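/- **Setting.** Let $a,b_0,b_1>0$ and let $\alpha(t,s)$, $a$-periodic in $t$, be a $C^3$ parametrization of a surface in $\mathbb R^3$ which is an immersion for $s\in[-b_0,b_1]$ and injective on $[0,a)\times[-b_0,b_1]$; let $\vec n$ be a continuous unit normal, $g$ the induced metric, $D$ its gradient and covariant derivative, $\mathrm{div}_g$ its divergence, $\nabla\vec n$ the map $v\mapsto\nabla_v\vec n$ on tangent vectors, $\Pi(v,w)=\langle\nabla_v\vec n,w\rangle$, $\kappa$ the Gauss curvature, and $Q$ the rotation of the tangent planes with $\langle u,Qv\rangle=\det(u,v,\vec n)$. Write $\Gamma_{c}=\{\alpha(t,c)\}$. Assume $\Pi(\alpha_t,\alpha_t)>0$ for $s\in[-b_0,0]$, $\kappa>0$ for $s\in(0,b_1]$, $\kappa<0$ for $s\in[-b_0,0)$, and $\kappa=0$, $D\kappa\neq0$ on $\Gamma_0$. For $0<\varepsilon<b_0$ let $\Omega_{-\varepsilon}=\{\alpha(t,s): -\varepsilon<s<b_1\}$, with outward unit normal $\nu$. On a neighbourhood $|s|<\delta\le\min(b_0,b_1)$ of $\Gamma_0$ let $X_1,X_2$ be a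 $C^1$ orthonormal tangent frame with $\nabla\vec n X_i=\lambda_iX_i$, $\lambda_1>0$, $\lambda_2$ of the same sign as $s$ (zero on $\Gamma_0$), $X_2(\lambda_2)>0$, $QX_2=X_1$, $QX_1=-X_2$. (Such frames exist for some $\delta>0$; this is part of the assertion.) For $\varepsilon>0$ with $2\varepsilon<\delta$ take * $\zeta\in C_0^\infty(\mathbb R)$ with $0\le\zeta\le1$, $\zeta=1$ on $(-\varepsilon,\varepsilon)$, $\zeta(s)=0$ for $s\ge2\varepsilon$; * $\eta_0\in C^\infty(\mathbb R)$ with $0\le\eta_0\le1$, $\eta_0(s)=0$ for $s\le\varepsilon/2$, $\eta_0=1$ on $[\varepsilon,b_1]$, and $\eta=m\,\eta_0(s)$ with a constant $m>0$; * a constant $\displaystyle\sigma_0\ge1+\sup_{\Gamma_0}\frac{|\Pi(\alpha_t,Q\alpha_t)|}{\Pi(\alpha_t,\alpha_t)}+\sup_{|s|\le2\varepsilon}\frac{|\langle Q\alpha_t,X_1\rangle|}{|\langle\alpha_t,X_1\rangle|}$, and $X_{\sigma_0}=\sigma_0\alpha_t\mp Q\alpha_t$ according as $\det(\alpha_t,\alpha_s,\vec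 n)\gtrless0$; * $X=\zeta\,[\varepsilon^{1/3}\,\mathrm{sign}\langle\alpha_t,X_1\rangle\,X_1+X_2]+(1-\zeta)X_{\sigma_0}$, and a continuous tangent field $Y$ on $\overline{\Omega}_{-\varepsilon}$. For a constant $\gamma>0$ put $$\mathcal L_YV=e^{-\gamma\kappa}\big[(\mathrm{div}_g(Q\nabla\vec n V)+\langle V,Y-\eta QX\rangle)QX+(\mathrm{div}_gV-\eta\langle V,\nabla\vec n X\rangle)\nabla\vec n X\big],$$ with domain $D(\mathcal L_Y)$ the tangent fields $V\in L^2(\Omega_{-\varepsilon},T)$ whose weak divergences $\mathrm{div}_gV$, $\mathrm{div}_g(Q\nabla\vec nV)$ are in $L^2(\Omega_{-\varepsilon})$, and $$\mathcal L_Y^*W=e^{-\gamma\kappa}\big[\nabla\vec nQD\langle W,QX\rangle-D\langle W,\nabla\vec nX\rangle-\gamma(\langle W,QX\rangle\nabla\vec nQD\kappa-\langle W,\nabla\vec nX\rangle D\kappa)+\langle W,QX\rangle(Y-\eta QX)-\eta\langle W,\nabla\vec nX\rangle\nabla\vec nX\big],$$ $$\pounds_1=\frac{e^{-\gamma\kappa}}{\langle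 X,\nu\rangle}\Pi(X,X),\qquad \pounds_2=\frac{e^{-\gamma\kappa}}{\langle X,\nu\rangle}\Pi(Q\nu,Q\nu).$$ A field $V\in D(\mathcal L_Y)$ has boundary values $V|_{\Gamma_{-\varepsilon}}\in L^2(\Gamma_{-\varepsilon},T)$, $V|_{\Gamma_{b_1}}\in L^2(\Gamma_{b_1},T)$ if the divergence theorem $\int_{\Omega_{-\varepsilon}}(\varphi\,\mathrm{div}_gU+\langle U,D\varphi\rangle)=\int_{\partial\Omega_{-\varepsilon}}\langle U,\nu\rangle\varphi\,d\Gamma$ holds with them for $U=V$ and $U=Q\nabla\vec nV$ and all $\varphi\in C^1(\overline\Omega_{-\varepsilon})$. Let $L^2_{-\varepsilon,b_1}(\Omega_{-\varepsilon},T)$ be the completion of the $C^1$ tangent fields on $\overline\Omega_{-\varepsilon}$ in the norm $\|W\|^2=\|W\|^2_{L^2(\Omega_{-\varepsilon})}+\|\langle W,QX\rangle\|^2_{L^2(\Gamma_{-\varepsilon})}+\|\langle W,\nu\rangle\|^2_{L^2(\Gamma_{b_1})}$. **Theorem.** For every frame as above and every $K$, if $\gamma$ is sufficiently large (depending on the surface,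 the frame and $K$), then $\varepsilon>0$ sufficiently small (depending also on $\gamma$), and, after $\sigma_0,\zeta,\eta_0$ and $Y$ with $|Y|\le K$ have been chosen, $m$ sufficiently large, then there is a constant $C$ such that for all $F\in L^2(\Omega_{-\varepsilon},T)$, $p\in L^2(\Gamma_{b_1})$, $q\in L^2(\Gamma_{-\varepsilon})$ the following holds. The problem $$\mathcal L_YV=F\ \text{ in }\Omega_{-\varepsilon},\qquad \langle V,QX\rangle=q\ \text{ on }\Gamma_{-\varepsilon},\qquad \langle V,\nu\rangle=p\ \text{ on }\Gamma_{b_1}$$ has a unique solution $V\in D(\mathcal L_Y)\cap L^2_{-\varepsilon,b_1}(\Omega_{-\varepsilon},T)$ with boundary values in $L^2$. It satisfies $$(V,\mathcal L_Y^*W)_{L^2(\Omega_{-\varepsilon},T)}=(W,F)_{L^2(\Omega_{-\varepsilon},T)}+\int_{\Gamma_{-\varepsilon}}\pounds_2\,q\,\langle W,QX\rangle\,d\Gamma-\int_{\Gamma_{b_1}}\pounds_1\,p\,\langle W,\nu\rangle\,d\Gamma$$ for all $C^1$ tangent fields $W$ on $\overline\Omega_{-\varepsilon}$ with $\langle W,QX\rangle|_{\Gamma_{b_1}}=0$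 and $\langle W,\nu\rangle|_{\Gamma_{-\varepsilon}}=0$, it is the only field in $L^2(\Omega_{-\varepsilon},T)$ satisfying this identity, and $$\|V\|^2_{L^2(\Omega_{-\varepsilon},T)}+\|V\|^2_{L^2(\Gamma_{-\varepsilon},T)}+\|V\|^2_{L^2(\Gamma_{b_1},T)}\le C\big(\|F\|^2_{L^2(\Omega_{-\varepsilon},T)}+\|q\|^2_{L^2(\Gamma_{-\varepsilon})}+\|p\|^2_{L^2(\Gamma_{b_1})}\big).$$ -/

import Mathlib

open MeasureTheory Set
open scoped ContDiff

noncomputable section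

/-- Euclidean three-space. -/
abbrev E3 := EuclideanSpace ℝ (Fin 3)

/-- The vector product of `ℝ³`. -/
def cross (u v : E3) : E3 :=
  !₂[u 1 * v 2 - u 2 * v 1, u 2 * v 0 - u 0 * v 2, u 0 * v 1 - u 1 * v 0]

/-- The determinant of three vectors of `ℝ³`. -/
def det3 (u v w : E3) : ℝ := Matrix.det (Matrix.of fun i j => (![u, v, w] i) j)

/-- Derivative with respect to the first parameter `t`. -/
def dT {G : Type*} [NormedAddCommGroup G] [NormedSpace ℝ G] (f : ℝ × ℝ → G) (x : ℝ × ℝ) : G :=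
  fderiv ℝ f x (1, 0)

/-- Derivative with respect to the second parameter `s`. -/
def dS {G : Type*} [NormedAddCommGroup G] [NormedSpace ℝ G] (f : ℝ × ℝ → G) (x : ℝ × ℝ) : G :=
  fderiv ℝ f x (0, 1)

/-- A closed strip of a surface in `ℝ³`, given by a parametrization `α (t, s)` with `t` running
through one period `[0, a)` and `s` through `[-b₀, b₁]`, together with a choice `τ = ± 1` of the
side to which the unit normal points.  The properties required of these data are stated in
`ParamSurface.IsMixedType`.  A function or vector field on the surface is described by a function
of the parameters `(t, s)`; tangent vectors are vectors of `ℝ³`. -/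
structure ParamSurface where
  a : ℝ
  b₀ : ℝ
  b₁ : ℝ
  α : ℝ × ℝ → E3
  τ : ℝ

namespace ParamSurface

variable (S : ParamSurface)

/-! ### First and second fundamental forms -/

/-- The coordinate tangent vector `α_t`. -/
def αt (x : ℝ × ℝ) : E3 := dT S.α x

/-- The coordinate tangent vector `α_s`. -/
def αs (x : ℝ × ℝ) : E3 := dS S.α x

/-- The unit normal field. -/
def n (x : ℝ × ℝ) : E3 := (S.τ / ‖cross (S.αt x) (S.αs x)‖) • cross (S.αt x) (S.αs x)

/-- `v` is a tangent vector of the surface at the point with parameters `x`. -/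
def IsTangent (x : ℝ × ℝ) (v : E3) : Prop := inner ℝ v (S.n x) = 0

/-- The determinant `|α_t|² |α_s|² - ⟨α_t, α_s⟩²` of the induced metric. -/
def gdet (x : ℝ × ℝ) : ℝ :=
  inner ℝ (S.αt x) (S.αt x) * inner ℝ (S.αs x) (S.αs x) - inner ℝ (S.αt x) (S.αs x) ^ 2

/-- The `α_t`-component of a tangent vector `v` in the basis `α_t, α_s`. -/
def coordT (x : ℝ × ℝ) (v : E3) : ℝ :=
  (inner ℝ (S.αs x) (S.αs x) * inner ℝ v (S.αt x)
    - inner ℝ (S.αt x) (S.αs x) * inner ℝ v (S.αs x)) / S.gdet x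

/-- The `α_s`-component of a tangent vector `v` in the basis `α_t, α_s`. -/
def coordS (x : ℝ × ℝ) (v : E3) : ℝ :=
  (inner ℝ (S.αt x) (S.αt x) * inner ℝ v (S.αs x)
    - inner ℝ (S.αt x) (S.αs x) * inner ℝ v (S.αt x)) / S.gdet x

/-- The derivative `∇_v f` of a function `f` on the surface in the direction of a tangent
vector `v`. -/
def dirDeriv {G : Type*} [NormedAddCommGroup G] [NormedSpace ℝ G] (f : ℝ × ℝ → G) (x : ℝ × ℝ)
    (v : E3) : G :=
  S.coordT x v • dT f x + S.coordS x v • dS f x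

/-- The gradient `D f` of a real function on the surface with respect to the induced metric. -/
def grad (f : ℝ × ℝ → ℝ) (x : ℝ × ℝ) : E3 :=
  ((inner ℝ (S.αs x) (S.αs x) * dT f x - inner ℝ (S.αt x) (S.αs x) * dS f x) / S.gdet x) • S.αt x
  + ((inner ℝ (S.αt x) (S.αt x) * dS f x - inner ℝ (S.αt x) (S.αs x) * dT f x) / S.gdet x) • S.αs x

/-- The second fundamental form operator `v ↦ ∇_v n`. -/
def shape (x : ℝ × ℝ) (v : E3) : E3 := S.dirDeriv S.n x v

/-- The second fundamental form `Π(v, w) = ⟨∇_v n, w⟩`. -/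
def sff (x : ℝ × ℝ) (v w : E3) : ℝ := inner ℝ (S.shape x v) w

/-- The Gaussian curvature. -/
def curv (x : ℝ × ℝ) : ℝ :=
  (S.sff x (S.αt x) (S.αt x) * S.sff x (S.αs x) (S.αs x)
    - S.sff x (S.αt x) (S.αs x) * S.sff x (S.αs x) (S.αt x)) / S.gdet x

/-- The rotation `Q` of the tangent planes: `⟨u, Q v⟩ = det (u, v, n)`; see `inner_rot`. -/
def rot (x : ℝ × ℝ) (v : E3) : E3 := cross v (S.n x)

theorem inner_rot (x : ℝ × ℝ) (u v : E3) : inner ℝ u (S.rot x v) = det3 u v (S.n x) := by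
  simp [rot, cross, det3, Matrix.det_fin_three, PiLp.inner_apply, Fin.sum_univ_three]
  ring

theorem inner_grad_αt (f : ℝ × ℝ → ℝ) (x : ℝ × ℝ) (h : S.gdet x ≠ 0) :
    inner ℝ (S.grad f x) (S.αt x) = dT f x := by
  rw [grad, inner_add_left, real_inner_smul_left, real_inner_smul_left,
    real_inner_comm (S.αt x) (S.αs x)]
  field_simp
  simp only [gdet]
  ring

theorem inner_grad_αs (f : ℝ × ℝ → ℝ) (x : ℝ × ℝ) (h : S.gdet x ≠ 0) :
    inner ℝ (S.grad f x) (S.αs x) = dS f x := by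
  rw [grad, inner_add_left, real_inner_smul_left, real_inner_smul_left]
  field_simp
  simp only [gdet]
  ring

/-! ### The mixed-type surface -/

/-- The surface is of class `C³`, `α` is an embedding of the closed strip, `a`-periodic in `t`,
`Π(α_t, α_t) > 0` for `s ∈ [-b₀, 0]`, and the Gaussian curvature is positive for `s ∈ (0, b₁]`,
negative for `s ∈ [-b₀, 0)`, and vanishes with nonzero gradient for `s = 0`.  (Every `C³`
parametrization of the closed strip extends to a `C³` map on the plane; no other property is
required of `α` outside the strip.) -/
structure IsMixedType : Prop where
  a_pos : 0 < S.a
  b₀_pos : 0 < S.b₀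
  b₁_pos : 0 < S.b₁
  τ_sign : S.τ = 1 ∨ S.τ = -1
  smooth : ContDiff ℝ 3 S.α
  periodic : ∀ t s, S.α (t + S.a, s) = S.α (t, s)
  injOn : InjOn S.α (Ico 0 S.a ×ˢ Icc (-S.b₀) S.b₁)
  immersion : ∀ t, ∀ s ∈ Icc (-S.b₀) S.b₁, LinearIndependent ℝ ![S.αt (t, s), S.αs (t, s)]
  sff_pos : ∀ t, ∀ s ∈ Icc (-S.b₀) 0, 0 < S.sff (t, s) (S.αt (t, s)) (S.αt (t, s))
  curv_pos : ∀ t, ∀ s ∈ Ioc 0 S.b₁, 0 < S.curv (t, s)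
  curv_zero : ∀ t, S.curv (t, 0) = 0
  grad_curv_ne : ∀ t, S.grad S.curv (t, 0) ≠ 0
  curv_neg : ∀ t, ∀ s ∈ Ico (-S.b₀) 0, S.curv (t, s) < 0

/-- A `C¹` orthonormal frame of principal directions on the neighbourhood `|s| < δ` of the curve
`s = 0`, with principal curvatures `lam₁ > 0` and `lam₂`, where `lam₂` has the sign of `s`; it is
normalized by `X₂(lam₂) > 0` and `Q X₂ = X₁`. -/
structure IsPrincipalFrame (δ : ℝ) (X₁ X₂ : ℝ × ℝ → E3) (lam₁ lam₂ : ℝ × ℝ → ℝ) : Prop where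
  δ_pos : 0 < δ
  δ_le₀ : δ ≤ S.b₀
  δ_le₁ : δ ≤ S.b₁
  smooth₁ : ContDiffOn ℝ 1 X₁ (univ ×ˢ Ioo (-δ) δ)
  smooth₂ : ContDiffOn ℝ 1 X₂ (univ ×ˢ Ioo (-δ) δ)
  periodic₁ : ∀ t, ∀ s ∈ Ioo (-δ) δ, X₁ (t + S.a, s) = X₁ (t, s)
  periodic₂ : ∀ t, ∀ s ∈ Ioo (-δ) δ, X₂ (t + S.a, s) = X₂ (t, s)
  tangent₁ : ∀ t, ∀ s ∈ Ioo (-δ) δ, S.IsTangent (t, s) (X₁ (t, s))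
  tangent₂ : ∀ t, ∀ s ∈ Ioo (-δ) δ, S.IsTangent (t, s) (X₂ (t, s))
  norm₁ : ∀ t, ∀ s ∈ Ioo (-δ) δ, ‖X₁ (t, s)‖ = 1
  norm₂ : ∀ t, ∀ s ∈ Ioo (-δ) δ, ‖X₂ (t, s)‖ = 1
  orthogonal : ∀ t, ∀ s ∈ Ioo (-δ) δ, inner ℝ (X₁ (t, s)) (X₂ (t, s)) = 0
  shape₁ : ∀ t, ∀ s ∈ Ioo (-δ) δ, S.shape (t, s) (X₁ (t, s)) = lam₁ (t, s) • X₁ (t, s)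
  shape₂ : ∀ t, ∀ s ∈ Ioo (-δ) δ, S.shape (t, s) (X₂ (t, s)) = lam₂ (t, s) • X₂ (t, s)
  lam₁_pos : ∀ t, ∀ s ∈ Ioo (-δ) δ, 0 < lam₁ (t, s)
  lam₂_pos : ∀ t, ∀ s ∈ Ioo 0 δ, 0 < lam₂ (t, s)
  lam₂_zero : ∀ t, lam₂ (t, 0) = 0
  lam₂_neg : ∀ t, ∀ s ∈ Ioo (-δ) 0, lam₂ (t, s) < 0
  deriv_pos : ∀ t, ∀ s ∈ Ioo (-δ) δ, 0 < S.dirDeriv lam₂ (t, s) (X₂ (t, s))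
  rot₂ : ∀ t, ∀ s ∈ Ioo (-δ) δ, S.rot (t, s) (X₂ (t, s)) = X₁ (t, s)
  rot₁ : ∀ t, ∀ s ∈ Ioo (-δ) δ, S.rot (t, s) (X₁ (t, s)) = -X₂ (t, s)

/-! ### The multiplier field `X` and the function `η` -/

/-- Admissible cut-off function `ζ` of the parameter `s`. -/
structure IsCutoffζ (ε : ℝ) (ζ : ℝ → ℝ) : Prop where
  smooth : ContDiff ℝ ∞ ζ
  compact : HasCompactSupport ζ
  nonneg : ∀ s, 0 ≤ ζ s
  le_one : ∀ s, ζ s ≤ 1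
  eq_one : ∀ s ∈ Ioo (-ε) ε, ζ s = 1
  eq_zero : ∀ s, 2 * ε ≤ s → ζ s = 0

/-- Admissible cut-off function `η₀` of the parameter `s`. -/
structure IsCutoffη (ε : ℝ) (η₀ : ℝ → ℝ) : Prop where
  smooth : ContDiff ℝ ∞ η₀
  nonneg : ∀ s, 0 ≤ η₀ s
  le_one : ∀ s, η₀ s ≤ 1
  eq_zero : ∀ s, s ≤ ε / 2 → η₀ s = 0
  eq_one : ∀ s ∈ Icc ε S.b₁, η₀ s = 1

/-- `σ₀ ≥ 1 + sup |Π(α_t, Q α_t)| / Π(α_t, α_t) + sup |⟨Q α_t, X₁⟩| / |⟨α_t, X₁⟩|`, the first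
supremum over `s = 0`, the second over `|s| ≤ 2 ε`. -/
def IsAdmissibleσ (ε : ℝ) (X₁ : ℝ × ℝ → E3) (σ₀ : ℝ) : Prop :=
  ∀ t t', ∀ s ∈ Icc (-(2 * ε)) (2 * ε),
    1 + |S.sff (t, 0) (S.αt (t, 0)) (S.rot (t, 0) (S.αt (t, 0)))|
          / S.sff (t, 0) (S.αt (t, 0)) (S.αt (t, 0))
      + |inner ℝ (S.rot (t', s) (S.αt (t', s))) (X₁ (t', s))|
          / |inner ℝ (S.αt (t', s)) (X₁ (t', s))| ≤ σ₀

/-- The field `X_{σ₀} = σ₀ α_t ∓ Q α_t`, the sign depending on the sign of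
`det (α_t, α_s, n)`. -/
def Xσ (σ₀ : ℝ) (x : ℝ × ℝ) : E3 :=
  if 0 < det3 (S.αt x) (S.αs x) (S.n x) then σ₀ • S.αt x - S.rot x (S.αt x)
  else σ₀ • S.αt x + S.rot x (S.αt x)

/-- `X = ζ [ε^{1/3} sign ⟨α_t, X₁⟩ X₁ + X₂] + (1 - ζ) X_{σ₀}`. -/
def fieldX (ε σ₀ : ℝ) (ζ : ℝ → ℝ) (X₁ X₂ : ℝ × ℝ → E3) (x : ℝ × ℝ) : E3 :=
  ζ x.2 • ((ε ^ (1 / 3 : ℝ) * Real.sign (inner ℝ (S.αt x) (X₁ x))) • X₁ x + X₂ x)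
    + (1 - ζ x.2) • S.Xσ σ₀ x

/-! ### The region `Ω_{-ε}`, its boundary curves, and their measures -/

/-- Surface measure of `Ω_{-ε}`, on the parameter domain `[0, a) × (-ε, b₁)`. -/
def area (ε : ℝ) : Measure (ℝ × ℝ) :=
  (volume.restrict (Ico 0 S.a ×ˢ Ioo (-ε) S.b₁)).withDensity
    fun x => ENNReal.ofReal (Real.sqrt (S.gdet x))

/-- Arc length on the closed curve `α (·, s)`, on the parameter interval `[0, a)`. -/
def arc (s : ℝ) : Measure ℝ :=
  (volume.restrict (Ico 0 S.a)).withDensity fun t => ENNReal.ofReal ‖S.αt (t, s)‖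

/-- The unit tangent vector of the surface orthogonal to `α_t`, pointing towards growing `s`. -/
def conormal (x : ℝ × ℝ) : E3 :=
  let w := S.αs x - (inner ℝ (S.αt x) (S.αs x) / inner ℝ (S.αt x) (S.αt x)) • S.αt x
  ‖w‖⁻¹ • w

/-- Outward unit normal `ν` of `Ω_{-ε}` along the curve `s = -ε`. -/
def νBot (ε t : ℝ) : E3 := -S.conormal (t, -ε)

/-- Outward unit normal `ν` of `Ω_{-ε}` along the curve `s = b₁`. -/
def νTop (t : ℝ) : E3 := S.conormal (t, S.b₁)

/-- `L²(Ω_{-ε}, T)`: square integrable tangent fields. -/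
def MemL2T (ε : ℝ) (V : ℝ × ℝ → E3) : Prop :=
  MemLp V 2 (S.area ε) ∧ ∀ᵐ x ∂S.area ε, S.IsTangent x (V x)

/-- Square integrable fields, tangent to the surface, along the curve `α (·, s)`. -/
def MemL2Γ (s : ℝ) (Z : ℝ → E3) : Prop :=
  MemLp Z 2 (S.arc s) ∧ ∀ᵐ t ∂S.arc s, S.IsTangent (t, s) (Z t)

/-- Real functions of class `C¹` up to the boundary. -/
def IsC1Fun (φ : ℝ × ℝ → ℝ) : Prop :=
  ContDiff ℝ 1 φ ∧ ∀ t s, φ (t + S.a, s) = φ (t, s)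

/-- Tangent fields on `Ω_{-ε}` of class `C¹` up to the boundary. -/
def IsC1Field (ε : ℝ) (W : ℝ × ℝ → E3) : Prop :=
  ContDiff ℝ 1 W ∧ (∀ t s, W (t + S.a, s) = W (t, s)) ∧
    ∀ t, ∀ s ∈ Icc (-ε) S.b₁, S.IsTangent (t, s) (W (t, s))

/-- Tangent fields of class `C⁰` on the closure of `Ω_{-ε}`. -/
def IsC0Field (ε : ℝ) (Y : ℝ × ℝ → E3) : Prop :=
  ContinuousOn Y (univ ×ˢ Icc (-ε) S.b₁) ∧
    ∀ t, ∀ s ∈ Icc (-ε) S.b₁, Y (t + S.a, s) = Y (t, s) ∧ S.IsTangent (t, s) (Y (t, s))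

/-- `div_g V = f` on `Ω_{-ε}` in the sense of distributions. -/
def HasWeakDiv (ε : ℝ) (V : ℝ × ℝ → E3) (f : ℝ × ℝ → ℝ) : Prop :=
  ∀ φ, S.IsC1Fun φ →
    (∃ c d, -ε < c ∧ d < S.b₁ ∧ ∀ t s, s ∉ Icc c d → φ (t, s) = 0) →
    ∫ x, f x * φ x ∂S.area ε = -∫ x, inner ℝ (V x) (S.grad φ x) ∂S.area ε

/-- Divergence theorem: the field `V`, with divergence `f`, has the normal components of `Zb` and
`Zt` as normal boundary values along `s = -ε` and `s = b₁`. -/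
def HasNormalTrace (ε : ℝ) (V : ℝ × ℝ → E3) (f : ℝ × ℝ → ℝ) (Zb Zt : ℝ → E3) : Prop :=
  ∀ φ, S.IsC1Fun φ →
    ∫ x, f x * φ x ∂S.area ε + ∫ x, inner ℝ (V x) (S.grad φ x) ∂S.area ε
      = ∫ t, inner ℝ (Zb t) (S.νBot ε t) * φ (t, -ε) ∂S.arc (-ε)
        + ∫ t, inner ℝ (Zt t) (S.νTop t) * φ (t, S.b₁) ∂S.arc S.b₁

/-- The field `Q ∇n V`. -/
def rotShape (V : ℝ × ℝ → E3) (x : ℝ × ℝ) : E3 := S.rot x (S.shape x (V x))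

/-! ### The operator, its formal adjoint, and the boundary value problem -/

/-- `L_Y V`, where `f₁ = div_g (Q ∇n V)` and `f₂ = div_g V`. -/
def opL (γ : ℝ) (η : ℝ × ℝ → ℝ) (X Y V : ℝ × ℝ → E3) (f₁ f₂ : ℝ × ℝ → ℝ) (x : ℝ × ℝ) : E3 :=
  Real.exp (-γ * S.curv x) •
    ((f₁ x + inner ℝ (V x) (Y x - η x • S.rot x (X x))) • S.rot x (X x)
      + (f₂ x - η x * inner ℝ (V x) (S.shape x (X x))) • S.shape x (X x))

/-- The formal adjoint `L_Y^* W`. -/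
def opLstar (γ : ℝ) (η : ℝ × ℝ → ℝ) (X Y W : ℝ × ℝ → E3) (x : ℝ × ℝ) : E3 :=
  Real.exp (-γ * S.curv x) •
    (S.shape x (S.rot x (S.grad (fun y => inner ℝ (W y) (S.rot y (X y))) x))
      - S.grad (fun y => inner ℝ (W y) (S.shape y (X y))) x
      - γ • (inner ℝ (W x) (S.rot x (X x)) • S.shape x (S.rot x (S.grad S.curv x))
          - inner ℝ (W x) (S.shape x (X x)) • S.grad S.curv x)
      + inner ℝ (W x) (S.rot x (X x)) • (Y x - η x • S.rot x (X x))
      - (η x * inner ℝ (W x) (S.shape x (X x))) • S.shape x (X x))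

/-- The boundary weight `e^{-γκ} Π(X, X) / ⟨X, ν⟩`. -/
def weight₁ (γ : ℝ) (X : ℝ × ℝ → E3) (x : ℝ × ℝ) (ν : E3) : ℝ :=
  Real.exp (-γ * S.curv x) / inner ℝ (X x) ν * S.sff x (X x) (X x)

/-- The boundary weight `e^{-γκ} Π(Qν, Qν) / ⟨X, ν⟩`. -/
def weight₂ (γ : ℝ) (X : ℝ × ℝ → E3) (x : ℝ × ℝ) (ν : E3) : ℝ :=
  Real.exp (-γ * S.curv x) / inner ℝ (X x) ν * S.sff x (S.rot x ν) (S.rot x ν)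

/-- `V` belongs to the domain of `L_Y` on `Ω_{-ε}` (`V`, `div_g V`, `div_g (Q ∇n V)` are square
integrable), has the square integrable boundary values `Zb` along `s = -ε` and `Zt` along
`s = b₁`, and solves `L_Y V = F` in `Ω_{-ε}`, `⟨V, QX⟩ = q` on `s = -ε`, `⟨V, ν⟩ = p` on
`s = b₁`. -/
def Solves (ε γ : ℝ) (η : ℝ × ℝ → ℝ) (X Y F : ℝ × ℝ → E3) (p q : ℝ → ℝ)
    (V : ℝ × ℝ → E3) (Zb Zt : ℝ → E3) : Prop :=
  S.MemL2T ε V ∧ S.MemL2Γ (-ε) Zb ∧ S.MemL2Γ S.b₁ Zt ∧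
  (∃ f₁ f₂ : ℝ × ℝ → ℝ,
    MemLp f₁ 2 (S.area ε) ∧ MemLp f₂ 2 (S.area ε) ∧
    S.HasWeakDiv ε (S.rotShape V) f₁ ∧ S.HasWeakDiv ε V f₂ ∧
    S.HasNormalTrace ε (S.rotShape V) f₁
      (fun t => S.rot (t, -ε) (S.shape (t, -ε) (Zb t)))
      (fun t => S.rot (t, S.b₁) (S.shape (t, S.b₁) (Zt t))) ∧
    S.HasNormalTrace ε V f₂ Zb Zt ∧
    ∀ᵐ x ∂S.area ε, S.opL γ η X Y V f₁ f₂ x = F x) ∧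
  (∀ᵐ t ∂S.arc (-ε), inner ℝ (Zb t) (S.rot (t, -ε) (X (t, -ε))) = q t) ∧
  (∀ᵐ t ∂S.arc S.b₁, inner ℝ (Zt t) (S.νTop t) = p t)

/-- Test fields of class `C¹` with `⟨W, QX⟩ = 0` on `s = b₁` and `⟨W, ν⟩ = 0` on `s = -ε`. -/
def IsTestField (ε : ℝ) (X W : ℝ × ℝ → E3) : Prop :=
  S.IsC1Field ε W ∧
  (∀ t, inner ℝ (W (t, S.b₁)) (S.rot (t, S.b₁) (X (t, S.b₁))) = 0) ∧
  (∀ t, inner ℝ (W (t, -ε)) (S.νBot ε t) = 0)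

/-- The weak form of the boundary value problem. -/
def WeaklySolves (ε γ : ℝ) (η : ℝ × ℝ → ℝ) (X Y F : ℝ × ℝ → E3) (p q : ℝ → ℝ)
    (V : ℝ × ℝ → E3) : Prop :=
  S.MemL2T ε V ∧
  ∀ W, S.IsTestField ε X W →
    ∫ x, inner ℝ (V x) (S.opLstar γ η X Y W x) ∂S.area ε
      = ∫ x, inner ℝ (W x) (F x) ∂S.area ε
        + ∫ t, S.weight₂ γ X (t, -ε) (S.νBot ε t) * q t
            * inner ℝ (W (t, -ε)) (S.rot (t, -ε) (X (t, -ε))) ∂S.arc (-ε)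
        - ∫ t, S.weight₁ γ X (t, S.b₁) (S.νTop t) * p t
            * inner ℝ (W (t, S.b₁)) (S.νTop t) ∂S.arc S.b₁

/-- `V`, with boundary components `u` (for `⟨V, QX⟩` on `s = -ε`) and `w` (for `⟨V, ν⟩` on
`s = b₁`), belongs to the completion of the `C¹` tangent fields in the norm
`‖W‖² = ‖W‖²_{L²(Ω)} + ‖⟨W, QX⟩‖²_{L²(s = -ε)} + ‖⟨W, ν⟩‖²_{L²(s = b₁)}`. -/
def MemCompletion (ε : ℝ) (X V : ℝ × ℝ → E3) (u w : ℝ → ℝ) : Prop :=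
  S.MemL2T ε V ∧ MemLp u 2 (S.arc (-ε)) ∧ MemLp w 2 (S.arc S.b₁) ∧
  ∀ r > 0, ∃ W, S.IsC1Field ε W ∧
    ∫ x, ‖V x - W x‖ ^ 2 ∂S.area ε
      + ∫ t, (u t - inner ℝ (W (t, -ε)) (S.rot (t, -ε) (X (t, -ε)))) ^ 2 ∂S.arc (-ε)
      + ∫ t, (w t - inner ℝ (W (t, S.b₁)) (S.νTop t)) ^ 2 ∂S.arc S.b₁ < r

end ParamSurface

end

/-!
In the parameters `(t, s)` the problem is a first order system on a strip for the pair of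
coordinates of `V` in a basis of the tangent plane. The symmetry of the second fundamental form
makes the system symmetric: multiplying the two equations by `e^{-γκ} ⟨W, QX⟩` and
`e^{-γκ} ⟨W, ∇n X⟩` gives a flux that is bilinear and symmetric in `V` and `W`
(`ParamSurface.fluxT_comm`, `ParamSurface.fluxS_comm`). Since `Π(X, X)`, `Π(α_t, α_t)` and the
`s`-component of `X` are positive, a multiple `S.e γ X` of the basis `X, α_t` turns the flux through
the curves `s = const` into `diag (1, -1)` (`ParamSurface.IsMultiplier.fluxS_basis`). One boundary
value is therefore prescribed on each of the two curves, whatever the sign of `κ`.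

Such a system is well posed if its zero order part is definite (`SymmSystem.IsAccretive`). The
energy estimate `SymmSystem.adj_energy` for the adjoint gives weak solutions by duality
(`SymmSystem.exists_isWeak`). A weak solution is a strong one: its Steklov averages in the periodic
variable `t` satisfy the boundary conditions, and since the system can be solved for the
`s`-derivatives, which have constant coefficients `±1`, they are regular
(`SymmSystem.IsWeak.stek_isRegular`). Letting the averages converge gives boundary values, Green's
formula and the energy estimate (`SymmSystem.IsWeak.exists_traces`), and so uniqueness. The lemmas
`ParamSurface.IsMultiplier.weaklySolves_iff`, `solves_of_isGreenFun` and `isGreenFun_of_solves`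
carry this over to the surface, in `ParamSurface.IsMultiplier.wellPosed`.

It remains to see that the symmetric part `ParamSurface.accForm` of the adjoint operator is negative
definite. Near the curve `s = 0` the field is `X = θ X₁ + X₂` with `|θ| = ε^{1/3}`. There the
factor `e^{-γκ}` contributes a large negative multiple of `(v₁ - θ v₂)²`, because `X₂(κ) > 0`, and
`X₂(λ₂) > 0` provides a negative multiple of `v₂²`; all other terms are absorbed by these if `γ`
is large and then `ε` small (`frame_form_le`). Where `s ≥ ε` the function `η` is the constant `m`,
and its terms in `accForm` are `-m` times the sum of the squares of the two multipliers, which is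
definite; so `m` large suffices (`ParamSurface.IsMultiplier.exists_accForm_le`). Finally, near
`s = 0` the two principal curvatures are distinct, so that `∇n` has eigenvectors of class `C¹` and
principal frames exist (`ParamSurface.IsMixedType.exists_isPrincipalFrame`).
-/

noncomputable section

open Filter Topology

/-! ### Groups of isometries and Steklov averages -/

/-- The parameter plane. -/
notation "ℝ²" => ℝ × ℝ

/-- A strongly continuous one-parameter group of linear isometries. -/
structure IsIsometryGroup {H : Type*} [NormedAddCommGroup H] [NormedSpace ℝ H]
    (τ : ℝ → H →ₗᵢ[ℝ] H) : Prop where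
  zero : ∀ x, τ 0 x = x
  add : ∀ r s x, τ (r + s) x = τ r (τ s x)
  cont : ∀ x, Continuous fun r => τ r x

/-- The Steklov average `h⁻¹ ∫₀ʰ τ_r x dr`. -/
def stek {H : Type*} [NormedAddCommGroup H] [NormedSpace ℝ H] (τ : ℝ → H →ₗᵢ[ℝ] H) (h : ℝ)
    (x : H) : H := h⁻¹ • ∫ r in (0 : ℝ)..h, τ r x

/-- The difference quotient `h⁻¹ (τ_h x - x)`. -/
def diffQuot {H : Type*} [NormedAddCommGroup H] [NormedSpace ℝ H] (τ : ℝ → H →ₗᵢ[ℝ] H) (h : ℝ)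
    (x : H) : H := h⁻¹ • (τ h x - x)

namespace IsIsometryGroup

variable {H : Type*} [NormedAddCommGroup H] [InnerProductSpace ℝ H] {τ : ℝ → H →ₗᵢ[ℝ] H}

variable (hτ : IsIsometryGroup τ)
include hτ

theorem neg_apply (r : ℝ) (x : H) : τ (-r) (τ r x) = x := by rw [← hτ.add, neg_add_cancel, hτ.zero]

theorem apply_neg (r : ℝ) (x : H) : τ r (τ (-r) x) = x := by rw [← hτ.add, add_neg_cancel, hτ.zero]

theorem inner_neg (r : ℝ) (x y : H) : inner ℝ x (τ (-r) y) = inner ℝ (τ r x) y := by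
  rw [← (τ r).inner_map_map x, hτ.apply_neg]

theorem commutator_tendsto {M Mt : H →L[ℝ] H}
    (hM : ∀ z, HasDerivAt (fun r => τ (-r) (M (τ r z))) (-(Mt z)) 0) (y : H) :
    Tendsto (fun h => diffQuot τ h (M y) - M (diffQuot τ h y)) (𝓝[>] 0) (𝓝 (Mt y)) := by
  have h1 := (hM y).tendsto_slope_zero_right
  simp only [zero_add, neg_zero, hτ.zero] at h1
  have h2 : Tendsto (fun h => τ h (Mt y)) (𝓝[>] 0) (𝓝 (Mt y)) := by
    have := ((hτ.cont (Mt y)).tendsto 0).mono_left (nhdsWithin_le_nhds (s := Ioi 0))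
    rwa [hτ.zero] at this
  have h3 : Tendsto (fun h => ‖h⁻¹ • (τ (-h) (M (τ h y)) - M y) - -(Mt y)‖) (𝓝[>] 0) (𝓝 0) := by
    simpa using (h1.sub_const (-(Mt y))).norm
  have h4 : Tendsto (fun h => diffQuot τ h (M y) - M (diffQuot τ h y) - τ h (Mt y)) (𝓝[>] 0)
      (𝓝 0) := by
    rw [tendsto_zero_iff_norm_tendsto_zero]
    refine h3.congr fun h => ?_
    rw [← (τ h).norm_map, ← norm_neg]
    congr 1
    simp only [map_sub, map_smul, map_neg, hτ.apply_neg, diffQuot, smul_sub]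
    abel
  simpa using h4.add h2

/-- Differentiation of `r ↦ ⟨M τ_r z, τ_r w⟩`, once by the product rule and once with the
translation moved to `M`. -/
theorem product_rule {M Mt : H →L[ℝ] H}
    (hM : ∀ z, HasDerivAt (fun r => τ (-r) (M (τ r z))) (-(Mt z)) 0) {z z' w w' : H}
    (hz : HasDerivAt (fun r => τ r z) z' 0) (hw : HasDerivAt (fun r => τ r w) w' 0) :
    inner ℝ (M z') w + inner ℝ (M z) w' = -inner ℝ (Mt z) w := by
  have h1 := (M.hasFDerivAt.comp_hasDerivAt (0 : ℝ) hz).inner ℝ hw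
  have h2 := (hM z).inner ℝ (hasDerivAt_const (0 : ℝ) w)
  have h3 : (fun r => inner ℝ (τ (-r) (M (τ r z))) w)
      = fun r => inner ℝ ((M ∘ fun r => τ r z) r) (τ r w) := by
    ext r
    rw [real_inner_comm, hτ.inner_neg, real_inner_comm]; rfl
  rw [h3] at h2
  have := h1.unique h2
  simp only [Function.comp_apply, hτ.zero, inner_zero_right, zero_add, inner_neg_left] at this
  linarith

variable [CompleteSpace H]

theorem stek_tendsto (x : H) : Tendsto (fun h => stek τ h x) (𝓝[>] 0) (𝓝 x) := by
  have h1 : HasDerivAt (fun h => ∫ r in (0 : ℝ)..h, τ r x) (τ 0 x) 0 :=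
    intervalIntegral.integral_hasDerivAt_right (by simp)
      (hτ.cont x).stronglyMeasurable.stronglyMeasurableAtFilter (hτ.cont x).continuousAt
  have h2 := h1.tendsto_slope_zero_right
  simpa [stek, hτ.zero] using h2

theorem apply_stek (h r : ℝ) (x : H) : τ r (stek τ h x) = h⁻¹ • ∫ s in r..(r + h), τ s x := by
  have h1 : τ r (∫ s in (0 : ℝ)..h, τ s x) = ∫ s in (0 : ℝ)..h, τ r (τ s x) :=
    ((τ r).toContinuousLinearMap.intervalIntegral_comp_comm
      ((hτ.cont x).intervalIntegrable 0 h)).symm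
  rw [stek, map_smul, h1]
  simp_rw [← hτ.add]
  rw [intervalIntegral.integral_comp_add_left (fun s => τ s x)]
  simp

theorem stek_hasDerivAt (h : ℝ) (x : H) :
    HasDerivAt (fun r => τ r (stek τ h x)) (diffQuot τ h x) 0 := by
  simp_rw [hτ.apply_stek]
  have key : ∀ b, HasDerivAt (fun h => ∫ r in (0 : ℝ)..h, τ r x) (τ b x) b := fun b =>
    intervalIntegral.integral_hasDerivAt_right ((hτ.cont x).intervalIntegrable 0 b)
      (hτ.cont x).stronglyMeasurable.stronglyMeasurableAtFilter (hτ.cont x).continuousAt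
  have h1 : HasDerivAt (fun r => ∫ s in (0 : ℝ)..(r + h), τ s x) (τ h x) 0 := by
    have := (key (0 + h)).scomp (0 : ℝ) ((hasDerivAt_id (0 : ℝ)).add_const h)
    simpa using! this
  have h2 := (h1.sub (key 0)).const_smul h⁻¹
  rw [hτ.zero] at h2
  refine h2.congr_of_eventuallyEq (.of_forall fun r => ?_)
  simp only [Pi.smul_apply, Pi.sub_apply]
  rw [intervalIntegral.integral_interval_sub_left ((hτ.cont x).intervalIntegrable _ _)
    ((hτ.cont x).intervalIntegrable _ _)]

theorem inner_stek {h : ℝ} {x w w' : H} (hw : HasDerivAt (fun r => τ r w) w' 0) :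
    inner ℝ (stek τ h x) w' = -inner ℝ (diffQuot τ h x) w := by
  have := hτ.product_rule (M := ContinuousLinearMap.id ℝ H) (Mt := 0)
    (fun z => by simpa [hτ.neg_apply] using hasDerivAt_const (0 : ℝ) z)
    (hτ.stek_hasDerivAt h x) hw
  simp at this
  linarith

theorem integral_inner (h : ℝ) (x w : H) :
    inner ℝ (stek τ h x) w = h⁻¹ * ∫ r in (0 : ℝ)..h, inner ℝ x (τ (-r) w) := by
  have := (innerSL ℝ w).intervalIntegral_comp_comm ((hτ.cont x).intervalIntegrable (μ := volume) 0 h)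
  simp only [innerSL_apply_apply] at this
  simp_rw [hτ.inner_neg, real_inner_comm w]
  rw [this, stek, real_inner_smul_right]

end IsIsometryGroup

/-! ### Translations of periodic functions -/

/-- The group obtained by transporting a continuous measure preserving flow `φ` on `Y` to `X`
along maps `π : X → Y` and `σ : Y → X` that are inverse to each other up to null sets. -/
def flowGroup {X Y : Type*} [MeasurableSpace X] [MeasurableSpace Y] [TopologicalSpace Y]
    {μ : Measure X} {m : Measure Y} {π : X → Y} {σ : Y → X} (hπ : MeasurePreserving π μ m)
    (hσ : MeasurePreserving σ m μ) (φ : ℝ → C(Y, Y)) (hφ : ∀ r, MeasurePreserving (φ r) m m)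
    (r : ℝ) : Lp ℝ 2 μ →ₗᵢ[ℝ] Lp ℝ 2 μ :=
  ((Lp.compMeasurePreservingₗᵢ ℝ π hπ).comp (Lp.compMeasurePreservingₗᵢ ℝ (φ r) (hφ r))).comp
    (Lp.compMeasurePreservingₗᵢ ℝ σ hσ)

section flow

variable {X Y : Type*} [MeasurableSpace X] [MeasurableSpace Y] [TopologicalSpace Y]
    {μ : Measure X} {m : Measure Y} {π : X → Y} {σ : Y → X} (hπ : MeasurePreserving π μ m)
    (hσ : MeasurePreserving σ m μ) (φ : ℝ → C(Y, Y)) (hφ : ∀ r, MeasurePreserving (φ r) m m)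

theorem flowGroup_toLp (r : ℝ) {f : X → ℝ} (hf : MemLp f 2 μ) : flowGroup hπ hσ φ hφ r (hf.toLp f)
      = (hf.comp_measurePreserving ((hσ.comp (hφ r)).comp hπ)).toLp _ := rfl

theorem isIsometryGroup_flowGroup [R1Space Y] [BorelSpace Y] [m.InnerRegularCompactLTTop]
    [IsLocallyFiniteMeasure m] (h₁ : ∀ y, π (σ y) = y) (h₂ : ∀ᵐ x ∂μ, σ (π x) = x)
    (hφ₀ : ∀ y, φ 0 y = y) (hφa : ∀ r s y, φ (r + s) y = φ s (φ r y)) (hφc : Continuous φ) :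
    IsIsometryGroup (flowGroup hπ hσ φ hφ) where
  zero x := by
    obtain ⟨f, hf, rfl⟩ : ∃ (f : X → ℝ) (hf : MemLp f 2 μ), hf.toLp f = x :=
      ⟨x, Lp.memLp x, Lp.toLp_coeFn x _⟩
    rw [flowGroup_toLp, MemLp.toLp_eq_toLp_iff]
    filter_upwards [h₂] with x hx
    simp [hφ₀, hx]
  add r s x := by
    obtain ⟨f, hf, rfl⟩ : ∃ (f : X → ℝ) (hf : MemLp f 2 μ), hf.toLp f = x :=
      ⟨x, Lp.memLp x, Lp.toLp_coeFn x _⟩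
    rw [flowGroup_toLp, flowGroup_toLp, flowGroup_toLp, MemLp.toLp_eq_toLp_iff]
    refine .of_forall fun x => ?_
    simp [hφa, h₁]
  cont x := by
    refine (Lp.compMeasurePreservingₗᵢ ℝ π hπ).continuous.comp ?_
    exact (continuous_const (y := Lp.compMeasurePreserving σ hσ x)).compMeasurePreservingLp
      hφc hφ (by simp)

end flow

/-- Lebesgue measure on one period of the strip `c < s < d`. -/
def stripVol (a c d : ℝ) : Measure ℝ² := volume.restrict (Ico 0 a ×ˢ Ioo c d)

/-- Lebesgue measure on one period. -/
def perVol (a : ℝ) : Measure ℝ := volume.restrict (Ico 0 a)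

/-- The square integrable functions on the strip. -/
abbrev StripL2 (a c d : ℝ) := Lp ℝ 2 (stripVol a c d)

/-- The square integrable functions on one period. -/
abbrev PerL2 (a : ℝ) := Lp ℝ 2 (perVol a)

/-- Lebesgue measure in the parameters of `Ω_{-ε}`. -/
abbrev ParamSurface.vol (S : ParamSurface) (ε : ℝ) := stripVol S.a (-ε) S.b₁

theorem stripVol_eq_prod (a c d : ℝ) :
    stripVol a c d = (perVol a).prod (volume.restrict (Ioo c d)) := by
  rw [stripVol, perVol, Measure.prod_restrict]; rfl

instance (a : ℝ) : IsFiniteMeasure (perVol a) := by unfold perVol; infer_instance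

instance (a c d : ℝ) : IsFiniteMeasure (stripVol a c d) := by rw [stripVol_eq_prod]; infer_instance

section period

variable {a : ℝ}

/-- Rotation of the circle. -/
def circleShift (a r : ℝ) : C(AddCircle a, AddCircle a) :=
  ⟨fun u => u + (r : AddCircle a), by fun_prop⟩

theorem continuous_circleShift : Continuous (circleShift a) := by
  refine ContinuousMap.continuous_of_continuous_uncurry _ ?_
  have : Continuous fun p : ℝ × AddCircle a => p.2 + (p.1 : AddCircle a) :=
    continuous_snd.add ((AddCircle.continuous_mk' a).comp continuous_fst)
  exact this

variable [Fact (0 < a)]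

/-- The representative in `[0, a)` of a point of the circle. -/
def circleRep (u : AddCircle a) : ℝ := AddCircle.equivIco a 0 u

theorem coe_circleRep (u : AddCircle a) : (circleRep u : AddCircle a) = u := AddCircle.coe_equivIco

theorem circleRep_coe {t : ℝ} (ht : t ∈ Ico 0 a) : circleRep (t : AddCircle a) = t := by
  have ht' : t ∈ Ico 0 (0 + a) := by simpa using ht
  rw [circleRep, AddCircle.equivIco_coe_eq ht']

theorem measurePreserving_circleMk :
    MeasurePreserving (fun t : ℝ => (t : AddCircle a)) (perVol a) volume := by
  have := AddCircle.measurePreserving_mk a 0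
  rw [zero_add] at this
  rwa [perVol, restrict_Ico_eq_restrict_Ioc]

theorem measurePreserving_circleRep : MeasurePreserving (circleRep (a := a)) volume (perVol a) := by
  have hm : Measurable (circleRep (a := a)) :=
    measurable_subtype_coe.comp (AddCircle.measurableEquivIco a 0).measurable
  refine ⟨hm, ?_⟩
  rw [← measurePreserving_circleMk.map_eq, Measure.map_map hm measurePreserving_circleMk.measurable]
  have : circleRep (a := a) ∘ (fun t : ℝ => (t : AddCircle a)) =ᵐ[perVol a] id := by
    filter_upwards [ae_restrict_mem measurableSet_Ico] with t ht
    exact circleRep_coe ht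
  rw [Measure.map_congr this, Measure.map_id]

theorem Function.Periodic.circleRep_coe {α : Type*} {f : ℝ → α} (hf : Function.Periodic f a)
    (t : ℝ) : f (circleRep (t : AddCircle a)) = f t := by
  have h : ((circleRep (t : AddCircle a) : ℝ) : AddCircle a) = (t : AddCircle a) := coe_circleRep _
  have := congrArg hf.lift h
  simpa using this

theorem measurePreserving_circleShift (r : ℝ) : MeasurePreserving (circleShift a r) volume volume :=
  measurePreserving_add_right _ _

/-- Rotation of the first factor of the cylinder. -/
def cylinderShift (a r : ℝ) : C(AddCircle a × ℝ, AddCircle a × ℝ) :=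
  (circleShift a r).prodMap (.id ℝ)

theorem measurePreserving_cylinderShift (ρ : Measure ℝ) [SFinite ρ] (r : ℝ) :
    MeasurePreserving (cylinderShift a r) (volume.prod ρ) (volume.prod ρ) :=
  (measurePreserving_circleShift r).prod (.id _)

/-- Translation in `t` of square integrable functions on the period. -/
def transPeriod (a : ℝ) [Fact (0 < a)] : ℝ → PerL2 a →ₗᵢ[ℝ] PerL2 a :=
  flowGroup measurePreserving_circleMk measurePreserving_circleRep (circleShift a)
    measurePreserving_circleShift

theorem measurePreserving_stripMk (c d : ℝ) :
    MeasurePreserving (Prod.map (fun t : ℝ => (t : AddCircle a)) id) (stripVol a c d)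
      (volume.prod (volume.restrict (Ioo c d))) := by
  rw [stripVol_eq_prod]
  exact measurePreserving_circleMk.prod (.id _)

theorem measurePreserving_stripRep (c d : ℝ) :
    MeasurePreserving (Prod.map (circleRep (a := a)) id) (volume.prod (volume.restrict (Ioo c d)))
      (stripVol a c d) := by
  rw [stripVol_eq_prod]
  exact measurePreserving_circleRep.prod (.id _)

/-- Translation in `t` of square integrable functions on the strip. -/
def transStrip (a c d : ℝ) [Fact (0 < a)] : ℝ → StripL2 a c d →ₗᵢ[ℝ] StripL2 a c d :=
  flowGroup (m := (volume : Measure (AddCircle a)).prod (volume.restrict (Ioo c d)))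
    (π := Prod.map (fun t : ℝ => (t : AddCircle a)) id) (σ := Prod.map circleRep id)
    (measurePreserving_stripMk c d) (measurePreserving_stripRep c d)
    (cylinderShift a) (measurePreserving_cylinderShift _)

theorem isIsometryGroup_transPeriod : IsIsometryGroup (transPeriod a) := by
  refine isIsometryGroup_flowGroup _ _ _ _ coe_circleRep ?_ ?_ ?_ continuous_circleShift
  · filter_upwards [ae_restrict_mem measurableSet_Ico] with t ht
    exact circleRep_coe ht
  · intro y; simp [circleShift]
  · intro r s y; simp [circleShift, add_assoc]

theorem isIsometryGroup_transStrip (c d : ℝ) : IsIsometryGroup (transStrip a c d) := by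
  refine isIsometryGroup_flowGroup _ _ _ _ ?_ ?_ ?_ ?_ ?_
  · rintro ⟨u, s⟩; simp [coe_circleRep]
  · filter_upwards [ae_restrict_mem (measurableSet_Ico.prod measurableSet_Ioo)] with ⟨t, s⟩ hx
    simp [circleRep_coe hx.1]
  · rintro ⟨u, s⟩; simp [cylinderShift, circleShift]
  · rintro r r' ⟨u, s⟩; simp [cylinderShift, circleShift, add_assoc]
  · refine ContinuousMap.continuous_of_continuous_uncurry _ ?_
    have : Continuous fun p : ℝ × (AddCircle a × ℝ) => (p.2.1 + (p.1 : AddCircle a), p.2.2) :=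
      ((continuous_fst.comp continuous_snd).add
        ((AddCircle.continuous_mk' a).comp continuous_fst)).prodMk
        (continuous_snd.comp continuous_snd)
    exact this

theorem transPeriod_toLp (r : ℝ) {f f' : ℝ → ℝ} (hf : MemLp f 2 (perVol a))
    (hf' : MemLp f' 2 (perVol a)) (hp : ∀ t, f (t + a) = f t) (h : ∀ t, f' t = f (t + r)) :
    transPeriod a r (hf.toLp f) = hf'.toLp f' := by
  rw [transPeriod, flowGroup_toLp, MemLp.toLp_eq_toLp_iff]
  refine .of_forall fun t => ?_
  have := Function.Periodic.circleRep_coe (f := f) hp (t + r)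
  simp [circleShift, h, ← this]

theorem transStrip_toLp (r : ℝ) {c d : ℝ} {f f' : ℝ² → ℝ} (hf : MemLp f 2 (stripVol a c d))
    (hf' : MemLp f' 2 (stripVol a c d)) (hp : ∀ t s, f (t + a, s) = f (t, s))
    (h : ∀ t s, f' (t, s) = f (t + r, s)) :
    transStrip a c d r (hf.toLp f) = hf'.toLp f' := by
  rw [transStrip, flowGroup_toLp, MemLp.toLp_eq_toLp_iff]
  refine .of_forall fun ⟨t, s⟩ => ?_
  have := Function.Periodic.circleRep_coe (f := fun t => f (t, s)) (fun t => hp t s) (t + r)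
  simp [cylinderShift, circleShift, h, ← this]

end period

/-! ### Classes of square integrable functions -/

/-- The class in `L²(μ)` of a square integrable function; the class is `0` for any other
function. -/
def cls {X : Type*} [MeasurableSpace X] (μ : Measure X) (f : X → ℝ) : Lp ℝ 2 μ :=
  open Classical in if h : MemLp f 2 μ then h.toLp f else 0

/-- Multiplication by an essentially bounded function, as an operator on `L²(μ)`; it is `0` for any
other function. -/
def mulOp {X : Type*} [MeasurableSpace X] (μ : Measure X) (M : X → ℝ) : Lp ℝ 2 μ →L[ℝ] Lp ℝ 2 μ :=
  open Classical in
  if h : MemLp M ⊤ μ then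
    LinearMap.mkContinuous
      { toFun := fun y => (h.toLp M : Lp ℝ ⊤ μ) • y
        map_add' := fun y z => Lp.add_smul _ y z
        map_smul' := fun k y => (Lp.smul_comm k (h.toLp M) y).symm }
      ‖h.toLp M‖ fun y => Lp.norm_smul_le _ y
  else 0

section classes

variable {X : Type*} [MeasurableSpace X] {μ : Measure X}

theorem cls_of {f : X → ℝ} (h : MemLp f 2 μ) : cls μ f = h.toLp f := by simp [cls, h]

theorem coeFn_cls {f : X → ℝ} (h : MemLp f 2 μ) : cls μ f =ᵐ[μ] f := by
  rw [cls_of h]; exact h.coeFn_toLp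

theorem cls_coeFn (y : Lp ℝ 2 μ) : cls μ y = y := by rw [cls_of (Lp.memLp y), Lp.toLp_coeFn]

theorem cls_congr {f g : X → ℝ} (h : f =ᵐ[μ] g) : cls μ f = cls μ g := by
  by_cases hf : MemLp f 2 μ
  · rw [cls_of hf, cls_of (hf.ae_eq h), MemLp.toLp_eq_toLp_iff]; exact h
  · have hg : ¬ MemLp g 2 μ := fun hg => hf (hg.ae_eq h.symm)
    simp [cls, hf, hg]

theorem cls_add {f g : X → ℝ} (hf : MemLp f 2 μ) (hg : MemLp g 2 μ) :
    cls μ (fun x => f x + g x) = cls μ f + cls μ g := by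
  rw [cls_of hf, cls_of hg, ← MemLp.toLp_add, ← cls_of]; rfl

theorem cls_sub {f g : X → ℝ} (hf : MemLp f 2 μ) (hg : MemLp g 2 μ) :
    cls μ (fun x => f x - g x) = cls μ f - cls μ g := by
  rw [cls_of hf, cls_of hg, ← MemLp.toLp_sub, ← cls_of]; rfl

theorem cls_smul {f : X → ℝ} (hf : MemLp f 2 μ) (k : ℝ) :
    cls μ (fun x => k * f x) = k • cls μ f := by
  rw [cls_of hf, ← MemLp.toLp_const_smul, ← cls_of]; rfl

theorem cls_eq_iff {f g : X → ℝ} (hf : MemLp f 2 μ) (hg : MemLp g 2 μ) :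
    cls μ f = cls μ g ↔ f =ᵐ[μ] g := by
  rw [cls_of hf, cls_of hg, MemLp.toLp_eq_toLp_iff]

theorem inner_cls (y : Lp ℝ 2 μ) {f : X → ℝ} (hf : MemLp f 2 μ) :
    inner ℝ y (cls μ f) = ∫ x, y x * f x ∂μ := by
  rw [L2.inner_def]
  refine integral_congr_ae ?_
  filter_upwards [coeFn_cls hf] with x hx
  simp [hx, mul_comm]

theorem inner_cls_cls {f g : X → ℝ} (hf : MemLp f 2 μ) (hg : MemLp g 2 μ) :
    inner ℝ (cls μ f) (cls μ g) = ∫ x, f x * g x ∂μ := by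
  rw [inner_cls _ hg]
  refine integral_congr_ae ?_
  filter_upwards [coeFn_cls hf] with x hx
  simp [hx]

theorem norm_cls_sq {f : X → ℝ} (hf : MemLp f 2 μ) : ‖cls μ f‖ ^ 2 = ∫ x, f x ^ 2 ∂μ := by
  rw [← real_inner_self_eq_norm_sq, inner_cls_cls hf hf]
  simp_rw [pow_two]

theorem coeFn_mulOp {M : X → ℝ} (hM : MemLp M ⊤ μ) (y : Lp ℝ 2 μ) :
    mulOp μ M y =ᵐ[μ] fun x => M x * y x := by
  have : mulOp μ M y = (hM.toLp M : Lp ℝ ⊤ μ) • y := by simp [mulOp, hM]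
  rw [this]
  filter_upwards [Lp.coeFn_lpSMul (r := 2) (hM.toLp M) y, hM.coeFn_toLp] with x h1 h2
  rw [h1]; simp [h2]

theorem mulOp_cls {M f : X → ℝ} (hM : MemLp M ⊤ μ) (hf : MemLp f 2 μ) :
    mulOp μ M (cls μ f) = cls μ (fun x => M x * f x) := by
  rw [← cls_coeFn (mulOp μ M (cls μ f))]
  refine cls_congr ?_
  filter_upwards [coeFn_mulOp hM (cls μ f), coeFn_cls hf] with x h1 h2
  rw [h1, h2]

theorem exists_cls (y : Lp ℝ 2 μ) : ∃ f, MemLp f 2 μ ∧ cls μ f = y := ⟨y, Lp.memLp y, cls_coeFn y⟩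

theorem memLp_mul {M f : X → ℝ} (hM : MemLp M ⊤ μ) (hf : MemLp f 2 μ) :
    MemLp (fun x => M x * f x) 2 μ := by
  simpa using! hf.mul (r := 2) hM

theorem norm_mulOp_le {M : X → ℝ} (hM : MemLp M ⊤ μ) {C : ℝ} (hC : ∀ᵐ x ∂μ, |M x| ≤ C)
    (y : Lp ℝ 2 μ) : ‖mulOp μ M y‖ ≤ C * ‖y‖ := by
  refine Lp.norm_le_mul_norm_of_ae_le_mul ?_
  filter_upwards [hC, coeFn_mulOp hM y] with x h1 h2
  rw [h2, norm_mul]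
  exact mul_le_mul_of_nonneg_right h1 (norm_nonneg _)

theorem mulOp_symm {M : X → ℝ} (hM : MemLp M ⊤ μ) (y z : Lp ℝ 2 μ) :
    inner ℝ (mulOp μ M y) z = inner ℝ y (mulOp μ M z) := by
  obtain ⟨f, hf, rfl⟩ := exists_cls y
  obtain ⟨g, hg, rfl⟩ := exists_cls z
  rw [mulOp_cls hM hf, mulOp_cls hM hg, inner_cls_cls (memLp_mul hM hf) hg,
    inner_cls_cls hf (memLp_mul hM hg)]
  congr 1; ext x; ring

end classes

section continuous

theorem memLp_strip {E : Type*} [NormedAddCommGroup E] [SecondCountableTopology E] {a c d : ℝ}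
    {f : ℝ² → E} (hf : Continuous f) (p : ENNReal) : MemLp f p (stripVol a c d) := by
  borelize E
  obtain ⟨C, hC⟩ := ((isCompact_Icc (a := (0 : ℝ)) (b := a)).prod
    (isCompact_Icc (a := c) (b := d))).exists_bound_of_continuousOn hf.continuousOn
  refine MemLp.of_bound hf.aestronglyMeasurable C ?_
  filter_upwards [ae_restrict_mem (measurableSet_Ico.prod measurableSet_Ioo)] with x hx
  exact hC x ⟨⟨hx.1.1, hx.1.2.le⟩, ⟨hx.2.1.le, hx.2.2.le⟩⟩

theorem memLp_period {E : Type*} [NormedAddCommGroup E] [SecondCountableTopology E] {a : ℝ}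
    {f : ℝ → E} (hf : Continuous f) (p : ENNReal) : MemLp f p (perVol a) := by
  borelize E
  obtain ⟨C, hC⟩ := (isCompact_Icc (a := (0 : ℝ)) (b := a)).exists_bound_of_continuousOn
    hf.continuousOn
  refine MemLp.of_bound hf.aestronglyMeasurable C ?_
  filter_upwards [ae_restrict_mem measurableSet_Ico] with x hx
  exact hC x ⟨hx.1, hx.2.le⟩

/-- The fundamental theorem of calculus in `s`, integrated over the period. -/
theorem integral_strip_deriv {a c d : ℝ} (hcd : c ≤ d) {F F' : ℝ² → ℝ} (hF : Continuous F)
    (hF' : Continuous F') (h : ∀ t s, HasDerivAt (fun s => F (t, s)) (F' (t, s)) s) :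
    ∫ x, F' x ∂stripVol a c d = (∫ t, F (t, d) ∂perVol a) - ∫ t, F (t, c) ∂perVol a := by
  have hi : Integrable F' (stripVol a c d) := memLp_one_iff_integrable.mp (memLp_strip hF' 1)
  rw [stripVol_eq_prod] at hi ⊢
  rw [integral_prod _ hi, ← integral_sub]
  · refine integral_congr_ae (.of_forall fun t => ?_)
    simp only
    rw [← integral_Ioc_eq_integral_Ioo, ← intervalIntegral.integral_of_le hcd,
      intervalIntegral.integral_eq_sub_of_hasDerivAt (fun s _ => h t s)]
    exact (hF'.comp (by fun_prop : Continuous fun s : ℝ => (t, s))).intervalIntegrable _ _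
  · exact memLp_one_iff_integrable.mp (memLp_period (hF.comp (by fun_prop)) 1)
  · exact memLp_one_iff_integrable.mp (memLp_period (hF.comp (by fun_prop)) 1)

/-- A function with continuous `t`-derivative has difference quotients converging uniformly on the
strip. -/
theorem exists_uniform_diffQuot {a c d : ℝ} {M Mt : ℝ² → ℝ} (hMt : Continuous Mt)
    (h : ∀ t s, HasDerivAt (fun t => M (t, s)) (Mt (t, s)) t) {ε : ℝ} (hε : 0 < ε) :
    ∃ δ > 0, ∀ r, |r| < δ → ∀ t ∈ Ico 0 a, ∀ s ∈ Ioo c d,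
      |M (t + r, s) - M (t, s) - r * Mt (t, s)| ≤ ε * |r| := by
  have hu := ((isCompact_Icc (a := (-1 : ℝ)) (b := a + 1)).prod
    (isCompact_Icc (a := c) (b := d))).uniformContinuousOn_of_continuous hMt.continuousOn
  rw [Metric.uniformContinuousOn_iff] at hu
  obtain ⟨δ, hδ, H⟩ := hu ε hε
  refine ⟨min δ 1, by positivity, fun r hr t ht s hs => ?_⟩
  have hr1 : |r| < δ := hr.trans_le (min_le_left _ _)
  have hr2 : |r| < 1 := hr.trans_le (min_le_right _ _)
  have hder : ∀ x ∈ uIcc 0 r, HasDerivWithinAt (fun ρ => M (t + ρ, s) - ρ * Mt (t, s))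
      (Mt (t + x, s) - Mt (t, s)) (uIcc 0 r) x := fun x _ => by
    have h1 := (h (t + x) s).comp_const_add t x
    have h2 := (hasDerivAt_id x).mul_const (Mt (t, s))
    simpa using! (h1.sub h2).hasDerivWithinAt
  have hb : ∀ x ∈ uIcc 0 r, ‖Mt (t + x, s) - Mt (t, s)‖ ≤ ε := fun x hx => by
    have hx' : |x| ≤ |r| := by simpa using abs_sub_left_of_mem_uIcc hx
    have hx1 := abs_lt.mp (hx'.trans_lt hr2)
    rw [← dist_eq_norm]
    refine (H _ ⟨⟨by linarith [ht.1], by linarith [ht.2]⟩, hs.1.le, hs.2.le⟩ _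
      ⟨⟨by linarith [ht.1], by linarith [ht.2]⟩, hs.1.le, hs.2.le⟩ ?_).le
    simp [Prod.dist_eq, hx'.trans_lt hr1]
  have := (convex_uIcc 0 r).norm_image_sub_le_of_norm_hasDerivWithin_le hder hb
    left_mem_uIcc right_mem_uIcc
  simpa [Real.norm_eq_abs, sub_right_comm] using this

theorem mulOp_hasDerivAt {a c d : ℝ} {M Mt : ℝ² → ℝ} (hM : Continuous M) (hMt : Continuous Mt)
    (h : ∀ t s, HasDerivAt (fun t => M (t, s)) (Mt (t, s)) t)
    (y : StripL2 a c d) :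
    HasDerivAt (fun r => mulOp (stripVol a c d) (fun x => M (x.1 + r, x.2)) y)
      (mulOp _ Mt y) 0 := by
  rw [hasDerivAt_iff_isLittleO_nhds_zero, Asymptotics.isLittleO_iff]
  intro ε hε
  obtain ⟨δ, hδ, H⟩ := exists_uniform_diffQuot (a := a) (c := c) (d := d) hMt h
    (ε := ε / (‖y‖ + 1)) (by positivity)
  have : ∀ᶠ r in 𝓝 (0 : ℝ), |r| < δ := by
    filter_upwards [Metric.ball_mem_nhds (0 : ℝ) hδ] with r hr
    simpa using hr
  filter_upwards [this] with r hr
  have hMr : Continuous fun x : ℝ² => M (x.1 + r, x.2) := hM.comp (by fun_prop)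
  have hD : Continuous fun x : ℝ² => M (x.1 + r, x.2) - M x - r * Mt x := by fun_prop
  have e : mulOp (stripVol a c d) (fun x => M (x.1 + (0 + r), x.2)) y
      - mulOp (stripVol a c d) (fun x => M (x.1 + 0, x.2)) y - r • mulOp _ Mt y
      = mulOp _ (fun x => M (x.1 + r, x.2) - M x - r * Mt x) y := by
    obtain ⟨f, hf, rfl⟩ := exists_cls y
    simp only [zero_add, add_zero, Prod.mk.eta]
    have m1 := memLp_mul (memLp_strip hMr ⊤) hf
    have m2 := memLp_mul (memLp_strip hM ⊤) hf
    have m3 := memLp_mul (memLp_strip hMt ⊤) hf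
    have m12 : MemLp (fun x => M (x.1 + r, x.2) * f x - M x * f x) 2 (stripVol a c d) := m1.sub m2
    rw [mulOp_cls (memLp_strip hMr _) hf, mulOp_cls (memLp_strip hM _) hf,
      mulOp_cls (memLp_strip hMt _) hf, mulOp_cls (memLp_strip hD _) hf, ← cls_smul m3,
      ← cls_sub m1 m2, ← cls_sub m12 (m3.const_mul r)]
    congr 1; ext x; ring
  rw [e]
  have hy : 0 ≤ ‖y‖ := norm_nonneg y
  refine (norm_mulOp_le (memLp_strip hD _) (C := ε / (‖y‖ + 1) * |r|) ?_ y).trans ?_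
  · filter_upwards [ae_restrict_mem (measurableSet_Ico.prod measurableSet_Ioo)] with x hx
    exact H r hr x.1 hx.1 x.2 hx.2
  · rw [Real.norm_eq_abs, div_mul_eq_mul_div, div_mul_eq_mul_div, div_le_iff₀ (by positivity)]
    nlinarith [mul_nonneg hε.le (abs_nonneg r)]

end continuous

section translation

variable {a c d : ℝ} [Fact (0 < a)]

theorem transStrip_cls (r : ℝ) {f : ℝ² → ℝ} (hf : Continuous f)
    (hp : ∀ t s, f (t + a, s) = f (t, s)) :
    transStrip a c d r (cls _ f) = cls _ (fun x => f (x.1 + r, x.2)) := by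
  have h1 : Continuous fun x : ℝ² => f (x.1 + r, x.2) := hf.comp (by fun_prop)
  rw [cls_of (memLp_strip hf 2), cls_of (memLp_strip h1 2)]
  exact transStrip_toLp r _ _ hp fun _ _ => rfl

theorem transPeriod_cls (r : ℝ) {f : ℝ → ℝ} (hf : Continuous f) (hp : ∀ t, f (t + a) = f t) :
    transPeriod a r (cls _ f) = cls _ (fun t => f (t + r)) := by
  have h1 : Continuous fun t => f (t + r) := hf.comp (by fun_prop)
  rw [cls_of (memLp_period hf 2), cls_of (memLp_period h1 2)]
  exact transPeriod_toLp r _ _ hp fun _ => rfl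

theorem transStrip_mulOp (r : ℝ) {M : ℝ² → ℝ} (hM : Continuous M)
    (hp : ∀ t s, M (t + a, s) = M (t, s)) (y : StripL2 a c d) :
    transStrip a c d r (mulOp _ M y)
      = mulOp _ (fun x => M (x.1 + r, x.2)) (transStrip a c d r y) := by
  have h1 : Continuous fun x : ℝ² => M (x.1 + r, x.2) := hM.comp (by fun_prop)
  obtain ⟨f, hf, rfl⟩ := exists_cls y
  let T : ℝ² → ℝ² := (Prod.map circleRep id ∘ cylinderShift a r) ∘
    Prod.map (fun t : ℝ => (t : AddCircle a)) id
  have e (g : ℝ² → ℝ) (hg : MemLp g 2 (stripVol a c d)) : MemLp (g ∘ T) 2 (stripVol a c d) ∧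
      transStrip a c d r (cls _ g) = cls _ (g ∘ T) := by
    have hT : MeasurePreserving T (stripVol a c d) (stripVol a c d) :=
      ((measurePreserving_stripRep c d).comp (measurePreserving_cylinderShift _ r)).comp
        (measurePreserving_stripMk c d)
    have h' := hg.comp_measurePreserving hT
    exact ⟨h', by rw [cls_of hg, cls_of h']; rfl⟩
  obtain ⟨_, e1⟩ := e _ (memLp_mul (memLp_strip hM _) hf)
  obtain ⟨h2, e2⟩ := e _ hf
  rw [mulOp_cls (memLp_strip hM _) hf, e1, e2, mulOp_cls (memLp_strip h1 _) h2]
  congr 1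
  ext ⟨t, s⟩
  have := Function.Periodic.circleRep_coe (f := fun t => M (t, s)) (fun t => hp t s) (t + r)
  simp [T, cylinderShift, circleShift, ← this]

theorem conj_mulOp_hasDerivAt {M Mt : ℝ² → ℝ} (hM : Continuous M) (hMt : Continuous Mt)
    (hp : ∀ t s, M (t + a, s) = M (t, s))
    (h : ∀ t s, HasDerivAt (fun t => M (t, s)) (Mt (t, s)) t)
    (y : StripL2 a c d) :
    HasDerivAt (fun r => transStrip a c d (-r) (mulOp _ M (transStrip a c d r y)))
      (-(mulOp _ Mt y)) 0 := by
  have h1 := mulOp_hasDerivAt hM hMt h y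
  have h2 := HasDerivAt.scomp (h := fun r : ℝ => -r) (0 : ℝ) (by simpa using h1)
    (hasDerivAt_neg (0 : ℝ))
  have e : (fun r => transStrip a c d (-r) (mulOp _ M (transStrip a c d r y)))
      = (fun r => mulOp (stripVol a c d) (fun x => M (x.1 + r, x.2)) y) ∘ (fun r => -r) := by
    ext1 r
    rw [transStrip_mulOp _ hM hp, (isIsometryGroup_transStrip c d).neg_apply]; rfl
  rw [e]
  simpa using h2

theorem transStrip_cls_hasDerivAt {f ft : ℝ² → ℝ} (hf : Continuous f) (hft : Continuous ft)
    (hp : ∀ t s, f (t + a, s) = f (t, s))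
    (h : ∀ t s, HasDerivAt (fun t => f (t, s)) (ft (t, s)) t) :
    HasDerivAt (fun r => transStrip a c d r (cls _ f)) (cls _ ft) 0 := by
  have h1 : MemLp (fun _ : ℝ² => (1 : ℝ)) 2 (stripVol a c d) := memLp_strip continuous_const 2
  have := mulOp_hasDerivAt hf hft h (cls (stripVol a c d) fun _ => 1)
  rw [mulOp_cls (memLp_strip hft _) h1] at this
  simp only [mul_one] at this
  refine this.congr_of_eventuallyEq (.of_forall fun r => ?_)
  have hr : Continuous fun x : ℝ² => f (x.1 + r, x.2) := hf.comp (by fun_prop)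
  simp only
  rw [transStrip_cls r hf hp, mulOp_cls (memLp_strip hr _) h1]
  simp

end translation

/-! ### Periodic test functions -/

/-- Functions of class `C¹` on the plane, `a`-periodic in the first variable. -/
structure IsTestFun (a : ℝ) (χ : ℝ² → ℝ) : Prop where
  contDiff : ContDiff ℝ 1 χ
  periodic : ∀ t s, χ (t + a, s) = χ (t, s)

section partial_derivatives

variable {G : Type*} [NormedAddCommGroup G] [NormedSpace ℝ G] {f : ℝ² → G}

theorem hasDerivAt_dT {t s : ℝ} (h : DifferentiableAt ℝ f (t, s)) :
    HasDerivAt (fun t => f (t, s)) (dT f (t, s)) t := by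
  have := h.hasFDerivAt.comp_hasDerivAt t ((hasDerivAt_id t).prodMk (hasDerivAt_const t s))
  exact this

theorem hasDerivAt_dS {t s : ℝ} (h : DifferentiableAt ℝ f (t, s)) :
    HasDerivAt (fun s => f (t, s)) (dS f (t, s)) s := by
  have := h.hasFDerivAt.comp_hasDerivAt s ((hasDerivAt_const s t).prodMk (hasDerivAt_id s))
  exact this

theorem continuous_dT (h : ContDiff ℝ 1 f) : Continuous (dT f) :=
  (h.continuous_fderiv one_ne_zero).clm_apply continuous_const

theorem continuous_dS (h : ContDiff ℝ 1 f) : Continuous (dS f) :=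
  (h.continuous_fderiv one_ne_zero).clm_apply continuous_const

theorem fderiv_shift (r : ℝ) (x : ℝ²) :
    fderiv ℝ (fun y : ℝ² => f (y.1 + r, y.2)) x = fderiv ℝ f (x.1 + r, x.2) := by
  have : (fun y : ℝ² => f (y.1 + r, y.2)) = fun y => f (y + (r, 0)) := by ext y; simp [Prod.add_def]
  rw [this, fderiv_comp_add_right]; simp [Prod.add_def]

/-- A function with continuous partial derivatives is of class `C¹`. -/
theorem contDiff_one_of_partial {f f₁ f₂ : ℝ² → ℝ} (h₁ : Continuous f₁) (h₂ : Continuous f₂)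
    (d₁ : ∀ t s, HasDerivAt (fun t => f (t, s)) (f₁ (t, s)) t)
    (d₂ : ∀ t s, HasDerivAt (fun s => f (t, s)) (f₂ (t, s)) s) : ContDiff ℝ 1 f := by
  have hc (φ : ℝ² → ℝ) (hφ : Continuous φ) : Continuous fun x : ℝ² =>
      ContinuousLinearMap.toSpanSingleton ℝ (φ x) :=
    (ContinuousLinearMap.toSpanSingletonCLE (𝕜 := ℝ) (E := ℝ)).continuous.comp hφ
  have key : ∀ x : ℝ², HasFDerivAt f ((ContinuousLinearMap.toSpanSingleton ℝ (f₁ x)).coprod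
      (ContinuousLinearMap.toSpanSingleton ℝ (f₂ x))) x := fun x =>
    (hasStrictFDerivAt_uncurry_coprod (f := fun t s => f (t, s))
      (f₁ := fun t s => ContinuousLinearMap.toSpanSingleton ℝ (f₁ (t, s)))
      (f₂ := fun t s => ContinuousLinearMap.toSpanSingleton ℝ (f₂ (t, s)))
      (.of_forall fun v => (d₁ v.1 v.2).hasFDerivAt)
      (.of_forall fun v => (d₂ v.1 v.2).hasFDerivAt)
      (hc f₁ h₁).continuousAt (hc f₂ h₂).continuousAt).hasFDerivAt
  rw [contDiff_one_iff_fderiv]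
  refine ⟨fun x => (key x).differentiableAt, ?_⟩
  have : fderiv ℝ f = fun x => (ContinuousLinearMap.toSpanSingleton ℝ (f₁ x)).coprod
      (ContinuousLinearMap.toSpanSingleton ℝ (f₂ x)) := funext fun x => (key x).fderiv
  rw [this]
  have e : (fun x => (ContinuousLinearMap.toSpanSingleton ℝ (f₁ x)).coprod
      (ContinuousLinearMap.toSpanSingleton ℝ (f₂ x))) = fun x =>
      (ContinuousLinearMap.toSpanSingleton ℝ (f₁ x)).comp (ContinuousLinearMap.fst ℝ ℝ ℝ)
      + (ContinuousLinearMap.toSpanSingleton ℝ (f₂ x)).comp (ContinuousLinearMap.snd ℝ ℝ ℝ) := by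
    ext x <;> simp
  rw [e]
  exact ((hc f₁ h₁).clm_comp continuous_const).add ((hc f₂ h₂).clm_comp continuous_const)

theorem contDiff_primitive {g : ℝ² → ℝ} (hg : ContDiff ℝ 1 g) (c : ℝ) :
    ContDiff ℝ 1 fun x : ℝ² => ∫ σ in c..x.2, g (x.1, σ) := by
  have hg0 := hg.continuous
  have hgt := continuous_dT hg
  have hc : ∀ t, Continuous fun σ : ℝ => g (t, σ) := fun t => hg0.comp (by fun_prop)
  have hct : ∀ t, Continuous fun σ : ℝ => dT g (t, σ) := fun t => hgt.comp (by fun_prop)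
  refine contDiff_one_of_partial (f₁ := fun x => ∫ σ in c..x.2, dT g (x.1, σ)) (f₂ := g) ?_ hg0 ?_ ?_
  · exact intervalIntegral.continuous_parametric_primitive_of_continuous
      (f := fun t σ => dT g (t, σ)) hgt
  · intro t s
    obtain ⟨C, hC⟩ := ((isCompact_Icc (a := t - 1) (b := t + 1)).prod
      (isCompact_uIcc (a := c) (b := s))).exists_bound_of_continuousOn hgt.continuousOn
    refine (intervalIntegral.hasDerivAt_integral_of_dominated_loc_of_deriv_le
      (F := fun t σ => g (t, σ)) (F' := fun t σ => dT g (t, σ)) (bound := fun _ => C)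
      (Icc_mem_nhds (by linarith : t - 1 < t) (by linarith : t < t + 1))
      (.of_forall fun t => (hc t).aestronglyMeasurable)
      ((hc t).intervalIntegrable _ _) (hct t).aestronglyMeasurable
      (.of_forall fun σ hσ x hx => hC _ ⟨hx, uIoc_subset_uIcc hσ⟩) (by simp)
      (.of_forall fun σ _ x _ => hasDerivAt_dT (hg.differentiable one_ne_zero _))).2
  · intro t s
    exact intervalIntegral.integral_hasDerivAt_right ((hc t).intervalIntegrable _ _)
      (hc t).stronglyMeasurable.stronglyMeasurableAtFilter (hc t).continuousAt

end partial_derivatives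

namespace IsTestFun

variable {a : ℝ} {χ ψ : ℝ² → ℝ}

theorem const (a k : ℝ) : IsTestFun a fun _ => k := ⟨contDiff_const, fun _ _ => rfl⟩

theorem dT_shift (χ : ℝ² → ℝ) (r : ℝ) :
    dT (fun x : ℝ² => χ (x.1 + r, x.2)) = fun x => dT χ (x.1 + r, x.2) := by
  ext x; rw [dT, fderiv_shift]; rfl

theorem dS_shift (χ : ℝ² → ℝ) (r : ℝ) :
    dS (fun x : ℝ² => χ (x.1 + r, x.2)) = fun x => dS χ (x.1 + r, x.2) := by
  ext x; rw [dS, fderiv_shift]; rfl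

variable (h : IsTestFun a χ)
include h

theorem continuous : Continuous χ := h.contDiff.continuous

theorem differentiableAt (x : ℝ²) : DifferentiableAt ℝ χ x :=
  h.contDiff.differentiable one_ne_zero x

theorem slice (s : ℝ) : Continuous fun t => χ (t, s) := h.continuous.comp (by fun_prop)

theorem add (h' : IsTestFun a ψ) : IsTestFun a fun x => χ x + ψ x :=
  ⟨h.contDiff.add h'.contDiff, fun t s => by simp [h.periodic, h'.periodic]⟩

theorem mul (h' : IsTestFun a ψ) : IsTestFun a fun x => χ x * ψ x :=
  ⟨h.contDiff.mul h'.contDiff, fun t s => by simp [h.periodic, h'.periodic]⟩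

theorem shift (r : ℝ) : IsTestFun a fun x => χ (x.1 + r, x.2) :=
  ⟨h.contDiff.comp (by fun_prop), fun t s => by simpa [add_right_comm] using h.periodic (t + r) s⟩

theorem eq_shift : (fun x : ℝ² => χ (x.1 + a, x.2)) = χ := by ext x; exact h.periodic x.1 x.2

theorem dT_periodic (t s : ℝ) : dT χ (t + a, s) = dT χ (t, s) := by
  have := congrFun (dT_shift χ a) (t, s)
  rw [h.eq_shift] at this; exact this.symm

theorem dS_periodic (t s : ℝ) : dS χ (t + a, s) = dS χ (t, s) := by
  have := congrFun (dS_shift χ a) (t, s)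
  rw [h.eq_shift] at this; exact this.symm

theorem hasDerivAt_dT (t s : ℝ) :
    HasDerivAt (fun t => χ (t, s)) (dT χ (t, s)) t := _root_.hasDerivAt_dT (h.differentiableAt _)

theorem hasDerivAt_dS (t s : ℝ) :
    HasDerivAt (fun s => χ (t, s)) (dS χ (t, s)) s := _root_.hasDerivAt_dS (h.differentiableAt _)

theorem memLp {c d : ℝ} : MemLp χ 2 (stripVol a c d) := memLp_strip h.continuous 2

theorem memLp_dT {c d : ℝ} : MemLp (dT χ) 2 (stripVol a c d) :=
  memLp_strip (continuous_dT h.contDiff) 2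

theorem memLp_dS {c d : ℝ} : MemLp (dS χ) 2 (stripVol a c d) :=
  memLp_strip (continuous_dS h.contDiff) 2

theorem primitive (c : ℝ) : IsTestFun a fun x => ∫ σ in c..x.2, χ (x.1, σ) :=
  ⟨contDiff_primitive h.contDiff c, fun t s => by simp [h.periodic]⟩

theorem dS_primitive (c : ℝ) : dS (fun x : ℝ² => ∫ σ in c..x.2, χ (x.1, σ)) = χ := by
  ext ⟨t, s⟩
  refine (((h.primitive c).hasDerivAt_dS t s)).unique ?_
  have hc : Continuous fun σ : ℝ => χ (t, σ) := h.continuous.comp (by fun_prop)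
  exact intervalIntegral.integral_hasDerivAt_right (hc.intervalIntegrable _ _)
    hc.stronglyMeasurable.stronglyMeasurableAtFilter hc.continuousAt

omit h in
/-- The periodic extension of a function of class `C¹` that vanishes near the end points of the
period. -/
theorem exists_periodization (ha : 0 < a) {g : ℝ² → ℝ} (hg : ContDiff ℝ 1 g) {η : ℝ}
    (hη : 0 < η) (h0 : ∀ t s, t < η ∨ a - η < t → g (t, s) = 0) :
    ∃ χ, IsTestFun a χ ∧ (∀ t ∈ Ico 0 a, ∀ s, χ (t, s) = g (t, s)) ∧
      ∀ s, (∀ t, g (t, s) = 0) → ∀ t, χ (t, s) = 0 := by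
  set χ : ℝ² → ℝ := fun x => g (toIcoMod ha 0 x.1, x.2) with hχ
  have hper : ∀ t s, χ (t + a, s) = χ (t, s) := fun t s => by simp [hχ]
  have hI : ∀ t ∈ Ico 0 a, ∀ s, χ (t, s) = g (t, s) := fun t ht s => by
    have : toIcoMod ha 0 t = t := (toIcoMod_eq_self ha).2 (by simpa using ht)
    simp [hχ, this]
  have hint : ∀ (n : ℤ) (t s : ℝ), χ (t + n * a, s) = χ (t, s) := fun n t s => by
    have : toIcoMod ha 0 (t + n * a) = toIcoMod ha 0 t := by simp
    simp [hχ, this]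
  refine ⟨χ, ⟨contDiff_iff_contDiffAt.mpr ?_, hper⟩, hI, fun s hs t => hs _⟩
  -- near a point of `[0, a)` the extension is `g` or `0`
  have key : ∀ t ∈ Ico 0 a, ∀ s, ContDiffAt ℝ 1 χ (t, s) := by
    intro t ht s
    rcases eq_or_lt_of_le ht.1 with h | h
    · subst h
      have : χ =ᶠ[𝓝 ((0 : ℝ), s)] fun _ => 0 := by
        have hm : Ioo (-(min η a)) (min η a) ×ˢ univ ∈ 𝓝 ((0 : ℝ), s) :=
          prod_mem_nhds (Ioo_mem_nhds (by simp [hη, ha]) (by simp [hη, ha])) univ_mem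
        filter_upwards [hm] with x hx
        obtain ⟨t, s⟩ := x
        obtain ⟨⟨h1, h2⟩, -⟩ := hx
        simp only at h1 h2
        have h3 := min_le_left η a
        have h4 := min_le_right η a
        rcases le_or_gt 0 t with h | h
        · rw [hI t ⟨h, by linarith⟩, h0 _ _ (Or.inl (by linarith))]
        · rw [← hper, hI (t + a) ⟨by linarith, by linarith⟩, h0 _ _ (Or.inr (by linarith))]
      exact contDiffAt_const.congr_of_eventuallyEq this
    · have : χ =ᶠ[𝓝 (t, s)] g := by
        have hm : Ioo 0 a ×ˢ univ ∈ 𝓝 (t, s) := prod_mem_nhds (Ioo_mem_nhds h ht.2) univ_mem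
        filter_upwards [hm] with x hx
        exact hI x.1 ⟨hx.1.1.le, hx.1.2⟩ x.2
      exact hg.contDiffAt.congr_of_eventuallyEq this
  rintro ⟨t, s⟩
  set n : ℤ := toIcoDiv ha 0 t
  have ht : t - n * a ∈ Ico 0 a := by
    have h1 := toIcoMod_mem_Ico ha 0 t
    have h2 : toIcoMod ha 0 t = t - n * a := by rw [toIcoMod, zsmul_eq_mul]
    rwa [h2, zero_add] at h1
  have e : χ = fun x => χ (x.1 - n * a, x.2) := by
    ext x
    have := hint (-n) x.1 x.2
    rw [Int.cast_neg, neg_mul, ← sub_eq_add_neg] at this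
    exact this.symm
  rw [e]
  exact ContDiffAt.comp (t, s) (key _ ht s) (f := fun x : ℝ² => (x.1 - n * a, x.2)) (by fun_prop)

end IsTestFun

section density

variable {a c d : ℝ}

/-- An integrable function on the strip vanishes if it is orthogonal to all test functions supported
away from the boundary curves. -/
theorem ae_eq_zero_of_forall_test (ha : 0 < a) {f : ℝ² → ℝ} (hf : Integrable f (stripVol a c d))
    (h : ∀ χ, IsTestFun a χ → (∃ c' d', c < c' ∧ d' < d ∧ ∀ t s, s ∉ Icc c' d' → χ (t, s) = 0) →
      ∫ x, f x * χ x ∂stripVol a c d = 0) : f =ᵐ[stripVol a c d] 0 := by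
  have hU : IsOpen (Ioo 0 a ×ˢ Ioo c d) := isOpen_Ioo.prod isOpen_Ioo
  have hμ : stripVol a c d = volume.restrict (Ioo 0 a ×ˢ Ioo c d) := by
    rw [stripVol]
    refine Measure.restrict_congr_set ?_
    exact Measure.set_prod_ae_eq Ioo_ae_eq_Ico.symm (ae_eq_refl _)
  rw [hμ] at hf h ⊢
  rw [EventuallyEq, ae_restrict_iff' hU.measurableSet]
  refine hU.ae_eq_zero_of_integral_contDiff_smul_eq_zero
    (IntegrableOn.locallyIntegrableOn hf) fun g hg hgc hgs => ?_
  -- the support of `g` stays away from the boundary of the rectangle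
  obtain ⟨η, hη, hthick⟩ := hgc.isCompact.exists_cthickening_subset_open hU hgs
  have hsub : ∀ x ∈ tsupport g, x.1 - η ∈ Ioo 0 a ∧ x.1 + η ∈ Ioo 0 a ∧ x.2 - η ∈ Ioo c d ∧
      x.2 + η ∈ Ioo c d := by
    intro x hx
    have hm : ∀ y : ℝ², dist y x ≤ η → y ∈ Ioo 0 a ×ˢ Ioo c d := fun y hy =>
      hthick (Metric.mem_cthickening_of_dist_le y x η _ hx hy)
    have hη' : |η| ≤ η := by rw [abs_of_pos hη]
    have h1 := hm (x.1 - η, x.2) (by simpa [Prod.dist_eq, Real.dist_eq, hη.le] using hη')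
    have h2 := hm (x.1 + η, x.2) (by simpa [Prod.dist_eq, Real.dist_eq, hη.le] using hη')
    have h3 := hm (x.1, x.2 - η) (by simpa [Prod.dist_eq, Real.dist_eq, hη.le] using hη')
    have h4 := hm (x.1, x.2 + η) (by simpa [Prod.dist_eq, Real.dist_eq, hη.le] using hη')
    exact ⟨h1.1, h2.1, h3.2, h4.2⟩
  have hz : ∀ x, x ∉ tsupport g → g x = 0 := fun x hx => image_eq_zero_of_notMem_tsupport hx
  obtain ⟨χ, hχ, hI, hs0⟩ := IsTestFun.exists_periodization ha (hg.of_le (by norm_cast)) hη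
    (fun t s hts => hz _ fun hx => by
      obtain ⟨h1, h2, -⟩ := hsub _ hx
      simp only [mem_Ioo] at h1 h2
      rcases hts with h | h <;> linarith [h1.1, h2.2])
  have := h χ hχ ⟨c + η, d - η, by linarith, by linarith, fun t s hs => hs0 s (fun t => hz _ fun hx => by
      obtain ⟨-, -, h1, h2⟩ := hsub _ hx
      exact hs ⟨by linarith [h1.1], by linarith [h2.2]⟩) t⟩
  have e2 : ∫ x in Ioo 0 a ×ˢ Ioo c d, f x * χ x = ∫ x in Ioo 0 a ×ˢ Ioo c d, g x • f x := by
    refine setIntegral_congr_fun hU.measurableSet fun x hx => ?_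
    have : χ x = g x := hI x.1 ⟨hx.1.1.le, hx.1.2⟩ x.2
    simp [this, mul_comm]
  rw [e2] at this
  rw [← this]
  refine (setIntegral_eq_integral_of_forall_compl_eq_zero fun x hx => ?_).symm
  rw [hz x fun h => hx (hgs h), zero_smul]

/-- The analogue on the period. -/
theorem ae_eq_zero_of_forall_periodic (ha : 0 < a) {f : ℝ → ℝ} (hf : Integrable f (perVol a))
    (h : ∀ φ : ℝ → ℝ, ContDiff ℝ 1 φ → (∀ t, φ (t + a) = φ t) →
      ∫ t, f t * φ t ∂perVol a = 0) : f =ᵐ[perVol a] 0 := by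
  have hd := stripVol_eq_prod a 0 1
  have hf' : Integrable (fun x : ℝ² => f x.1) (stripVol a 0 1) := by rw [hd]; exact hf.comp_fst _
  have := ae_eq_zero_of_forall_test ha hf' fun χ hχ _ => by
    rw [hd, integral_prod_symm _ (by rw [← hd]; exact hf'.mul_of_top_left (memLp_strip hχ.continuous ⊤))]
    exact (integral_congr_ae (.of_forall fun s =>
      h (fun t => χ (t, s)) (hχ.contDiff.comp (by fun_prop)) fun t => hχ.periodic t s)).trans (integral_zero _ _)
  rw [hd] at this
  filter_upwards [Measure.ae_ae_of_ae_prod this] with t ht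
  have : (ae (volume.restrict (Ioo (0 : ℝ) 1))).NeBot := by
    rw [ae_neBot]; intro h; simpa using Measure.restrict_eq_zero.mp h
  exact ht.exists.choose_spec

end density

/-! ### Square integrable `s`-derivatives and boundary values -/

variable {a c d : ℝ}

/-- The classes `(F, ∂ₛF, F|_{s = c}, F|_{s = d})` of the functions `F` that have a continuous
`s`-derivative. -/
def regularGraph (a c d : ℝ) : Submodule ℝ (StripL2 a c d × StripL2 a c d × PerL2 a × PerL2 a) where
  carrier := {z | ∃ F F' : ℝ² → ℝ, Continuous F ∧ Continuous F' ∧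
    (∀ t s, HasDerivAt (fun s => F (t, s)) (F' (t, s)) s) ∧
    z = (cls _ F, cls _ F', cls _ (fun t => F (t, c)), cls _ (fun t => F (t, d)))}
  add_mem' := by
    rintro _ _ ⟨F, F', hF, hF', h, rfl⟩ ⟨G, G', hG, hG', h', rfl⟩
    refine ⟨fun x => F x + G x, fun x => F' x + G' x, hF.add hG, hF'.add hG',
      fun t s => (h t s).add (h' t s), ?_⟩
    have hc (s : ℝ) (F : ℝ² → ℝ) (hF : Continuous F) :
        MemLp (fun t => F (t, s)) 2 (perVol a) := memLp_period (hF.comp (by fun_prop)) 2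
    simp only [Prod.mk_add_mk]
    rw [cls_add (memLp_strip hF 2) (memLp_strip hG 2),
      cls_add (memLp_strip hF' 2) (memLp_strip hG' 2), cls_add (hc c F hF) (hc c G hG),
      cls_add (hc d F hF) (hc d G hG)]
  zero_mem' := by
    refine ⟨fun _ => 0, fun _ => 0, continuous_const, continuous_const,
      fun t s => hasDerivAt_const _ _, ?_⟩
    have h0 {X : Type} [MeasurableSpace X] (μ : Measure X) : cls μ (fun _ => (0 : ℝ)) = 0 := by
      rw [cls_of MemLp.zero']; rfl
    simp only [h0]; rfl
  smul_mem' := by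
    rintro k _ ⟨F, F', hF, hF', h, rfl⟩
    refine ⟨fun x => k * F x, fun x => k * F' x, hF.const_mul k, hF'.const_mul k,
      fun t s => (h t s).const_mul k, ?_⟩
    have hc (s : ℝ) : MemLp (fun t => F (t, s)) 2 (perVol a) :=
      memLp_period (hF.comp (by fun_prop)) 2
    simp only [Prod.smul_mk]
    rw [cls_smul (memLp_strip hF 2), cls_smul (memLp_strip hF' 2), cls_smul (hc c), cls_smul (hc d)]

/-- `y ∈ L²` has the `s`-derivative `k ∈ L²` and the boundary values `yc` and `yd` along `s = c` and
`s = d`: the closure of `regularGraph`. -/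
def sGraph (a c d : ℝ) : Submodule ℝ (StripL2 a c d × StripL2 a c d × PerL2 a × PerL2 a) :=
  (regularGraph a c d).topologicalClosure

theorem sGraph_induction {P : StripL2 a c d → StripL2 a c d → PerL2 a → PerL2 a → Prop}
    (hP : IsClosed {z : StripL2 a c d × StripL2 a c d ×
      PerL2 a × PerL2 a | P z.1 z.2.1 z.2.2.1 z.2.2.2})
    (h : ∀ F F' : ℝ² → ℝ, Continuous F → Continuous F' →
      (∀ t s, HasDerivAt (fun s => F (t, s)) (F' (t, s)) s) →
      P (cls _ F) (cls _ F') (cls _ fun t => F (t, c)) (cls _ fun t => F (t, d)))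
    {y k : StripL2 a c d} {yc yd : PerL2 a}
    (hz : (y, k, yc, yd) ∈ sGraph a c d) : P y k yc yd := by
  refine (closure_minimal ?_ hP : closure (regularGraph a c d).carrier ⊆ _) hz
  rintro _ ⟨F, F', hF, hF', hd, rfl⟩
  exact h F F' hF hF' hd

theorem test_mem_sGraph {χ : ℝ² → ℝ} (h : IsTestFun a χ) :
    (cls _ χ, cls _ (dS χ), cls _ (fun t => χ (t, c)), cls _ (fun t => χ (t, d))) ∈ sGraph a c d :=
  Submodule.le_topologicalClosure _ ⟨χ, dS χ, h.continuous, continuous_dS h.contDiff,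
    h.hasDerivAt_dS, rfl⟩

theorem slice_memLp {F : ℝ² → ℝ} (hF : Continuous F) (s : ℝ) :
    MemLp (fun t => F (t, s)) 2 (perVol a) := memLp_period (hF.comp (by fun_prop)) 2

/-- Integration by parts in `s`. -/
theorem sGraph_inner_test (hcd : c ≤ d) {y k : StripL2 a c d}
    {yc yd : PerL2 a} (hz : (y, k, yc, yd) ∈ sGraph a c d) {χ : ℝ² → ℝ}
    (hχ : IsTestFun a χ) :
    inner ℝ y (cls _ (dS χ)) + inner ℝ k (cls _ χ)
      = inner ℝ yd (cls _ fun t => χ (t, d)) - inner ℝ yc (cls _ fun t => χ (t, c)) := by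
  refine sGraph_induction (P := fun y k yc yd => inner ℝ y (cls _ (dS χ)) + inner ℝ k (cls _ χ)
      = inner ℝ yd (cls _ fun t => χ (t, d)) - inner ℝ yc (cls _ fun t => χ (t, c)))
    (isClosed_eq (by fun_prop) (by fun_prop)) ?_ hz
  intro F F' hF hF' hd
  have hs := continuous_dS hχ.contDiff
  rw [inner_cls_cls (memLp_strip hF 2) (memLp_strip hs 2),
    inner_cls_cls (memLp_strip hF' 2) (memLp_strip hχ.continuous 2),
    inner_cls_cls (slice_memLp hF d) (slice_memLp hχ.continuous d),
    inner_cls_cls (slice_memLp hF c) (slice_memLp hχ.continuous c), ← integral_add]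
  · exact integral_strip_deriv (F := fun x => F x * χ x) hcd (hF.mul hχ.continuous)
      ((hF.mul hs).add (hF'.mul hχ.continuous)) fun t s => by
        simpa [add_comm] using! (hd t s).mul (hχ.hasDerivAt_dS t s)
  · exact memLp_one_iff_integrable.mp (memLp_strip (hF.mul hs) 1)
  · exact memLp_one_iff_integrable.mp (memLp_strip (hF'.mul hχ.continuous) 1)

theorem sGraph_energy (hcd : c ≤ d) {y k : StripL2 a c d}
    {yc yd : PerL2 a} (hz : (y, k, yc, yd) ∈ sGraph a c d) :
    2 * inner ℝ y k = ‖yd‖ ^ 2 - ‖yc‖ ^ 2 := by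
  refine sGraph_induction (P := fun y k yc yd => 2 * inner ℝ y k = ‖yd‖ ^ 2 - ‖yc‖ ^ 2)
    (isClosed_eq (by fun_prop) (by fun_prop)) ?_ hz
  intro F F' hF hF' hd
  rw [inner_cls_cls (memLp_strip hF 2) (memLp_strip hF' 2), norm_cls_sq (slice_memLp hF d),
    norm_cls_sq (slice_memLp hF c), ← integral_const_mul]
  refine integral_strip_deriv (F := fun x => F x ^ 2) hcd (hF.pow 2) ?_ fun t s => ?_
  · fun_prop
  · simpa [mul_assoc] using! (hd t s).pow 2

/-- The a priori bound by the derivative and the boundary value at `s = d`. -/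
theorem sGraph_bound_top (hcd : c ≤ d) {y k : StripL2 a c d}
    {yc yd : PerL2 a} (hz : (y, k, yc, yd) ∈ sGraph a c d) :
    ‖y‖ ^ 2 ≤ (d - c) * ‖yd‖ ^ 2 + 2 * (d - c) * (‖y‖ * ‖k‖) := by
  refine sGraph_induction (P := fun y k yc yd =>
    ‖y‖ ^ 2 ≤ (d - c) * ‖yd‖ ^ 2 + 2 * (d - c) * (‖y‖ * ‖k‖))
    (isClosed_le (by fun_prop) (by fun_prop)) ?_ hz
  intro F F' hF hF' hd
  have key := integral_strip_deriv (a := a) (F := fun x => F x ^ 2 * (x.2 - c))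
    (F' := fun x => F x ^ 2 + (2 * (x.2 - c) * F x) * F' x) hcd (by fun_prop) (by fun_prop)
    fun t s => by
      have := ((hd t s).pow 2).mul ((hasDerivAt_id s).sub_const c)
      refine this.congr_deriv ?_
      simp; ring
  have hG : Continuous fun x : ℝ² => 2 * (x.2 - c) := by fun_prop
  rw [integral_add (memLp_one_iff_integrable.mp (memLp_strip (by fun_prop) 1))
    (memLp_one_iff_integrable.mp (memLp_strip (by fun_prop) 1))] at key
  have e2 : ∫ x, 2 * (x.2 - c) * F x * F' x ∂stripVol a c d
      = inner ℝ (mulOp (stripVol a c d) (fun x : ℝ² => 2 * (x.2 - c)) (cls _ F)) (cls _ F') := by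
    rw [mulOp_cls (memLp_strip hG _) (memLp_strip hF 2),
      inner_cls_cls (memLp_strip (by fun_prop) 2) (memLp_strip hF' 2)]
  have e3 : ‖mulOp (stripVol a c d) (fun x : ℝ² => 2 * (x.2 - c)) (cls _ F)‖
      ≤ 2 * (d - c) * ‖cls (stripVol a c d) F‖ := by
    refine norm_mulOp_le (memLp_strip hG _) ?_ _
    filter_upwards [ae_restrict_mem (measurableSet_Ico.prod measurableSet_Ioo)] with x hx
    rw [abs_of_nonneg (by linarith [hx.2.1])]
    linarith [hx.2.2]
  have e4 := abs_real_inner_le_norm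
    (mulOp (stripVol a c d) (fun x : ℝ² => 2 * (x.2 - c)) (cls _ F)) (cls _ F')
  rw [norm_cls_sq (memLp_strip hF 2), norm_cls_sq (slice_memLp hF d)]
  rw [e2] at key
  simp only [sub_self, mul_zero, integral_zero, sub_zero, integral_mul_const] at key
  have e5 := neg_abs_le (inner ℝ
    (mulOp (stripVol a c d) (fun x : ℝ² => 2 * (x.2 - c)) (cls _ F)) (cls _ F'))
  have e6 := mul_le_mul_of_nonneg_right e3 (norm_nonneg (cls (stripVol a c d) F'))
  linarith

theorem sGraph_bound_bottom (hcd : c ≤ d) {y k : StripL2 a c d}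
    {yc yd : PerL2 a} (hz : (y, k, yc, yd) ∈ sGraph a c d) :
    ‖y‖ ^ 2 ≤ (d - c) * ‖yc‖ ^ 2 + 4 * (d - c) * (‖y‖ * ‖k‖) := by
  have h1 := sGraph_bound_top hcd hz
  have h2 := sGraph_energy hcd hz
  have h3 := real_inner_le_norm y k
  nlinarith [sub_nonneg.mpr hcd, mul_le_mul_of_nonneg_left h3 (sub_nonneg.mpr hcd)]

theorem dense_cls {X : Type*} [TopologicalSpace X] [MeasurableSpace X] [BorelSpace X] [T4Space X]
    [WeaklyLocallyCompactSpace X] {μ : Measure X} [μ.Regular] (y : Lp ℝ 2 μ) {ε : ℝ}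
    (hε : 0 < ε) : ∃ f, Continuous f ∧ ‖y - cls μ f‖ ≤ ε := by
  obtain ⟨g, -, hg, hgc, hgm⟩ := (Lp.memLp y).exists_hasCompactSupport_eLpNorm_sub_le
    (by simp) (ε := ENNReal.ofReal ε) (by simpa using hε)
  refine ⟨g, hgc, ?_⟩
  have e : y - cls μ g = ((Lp.memLp y).sub hgm).toLp _ := by
    rw [MemLp.toLp_sub (Lp.memLp y) hgm, Lp.toLp_coeFn, cls_of hgm]
  rw [e, Lp.norm_toLp]
  exact ENNReal.toReal_le_of_le_ofReal hε.le hg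

instance : CompleteSpace (sGraph a c d) :=
  (regularGraph a c d).isClosed_topologicalClosure.completeSpace_coe

/-- An a priori bound on a projection of `sGraph` with dense range makes it surjective. -/
theorem sGraph_surjective {G : Type*} [NormedAddCommGroup G] [NormedSpace ℝ G]
    (L : (StripL2 a c d × StripL2 a c d × PerL2 a × PerL2 a) →L[ℝ] G) {C : ℝ}
    (hC : ∀ z ∈ sGraph a c d, ‖z‖ ≤ C * ‖L z‖)
    (hd : ∀ g : G, ∀ ε > 0, ∃ z ∈ regularGraph a c d, ‖g - L z‖ ≤ ε) (g : G) :
    ∃ z ∈ sGraph a c d, L z = g := by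
  let L' : sGraph a c d →L[ℝ] G := L.comp (sGraph a c d).subtypeL
  have hanti : AntilipschitzWith C.toNNReal L' := by
    refine AddMonoidHomClass.antilipschitz_of_bound L' fun z => (hC z z.2).trans ?_
    exact mul_le_mul_of_nonneg_right (Real.le_coe_toNNReal C) (norm_nonneg _)
  have hcl := hanti.isClosed_range L'.uniformContinuous
  have hmem : g ∈ closure (range L') := by
    refine Metric.mem_closure_iff.mpr fun ε hε => ?_
    obtain ⟨z, hz, h⟩ := hd g (ε / 2) (half_pos hε)
    exact ⟨L z, ⟨⟨z, Submodule.le_topologicalClosure _ hz⟩, rfl⟩, by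
      rw [dist_eq_norm]; exact h.trans_lt (half_lt_self hε)⟩
  rw [hcl.closure_eq] at hmem
  obtain ⟨z, hz⟩ := hmem
  exact ⟨z, z.2, hz⟩

theorem le_of_sq_le {D N y : ℝ} (hD : 0 ≤ D) (hN : 0 ≤ N)
    (h : y ^ 2 ≤ D * N ^ 2 + 4 * D * (y * N)) : y ≤ (4 * D + 1) * N := by
  by_contra! hlt
  have h1 : 0 ≤ (4 * D + 1) * N := by positivity
  nlinarith [mul_nonneg hD hN, mul_nonneg (mul_nonneg hD hN) hN, mul_nonneg hN hN]

theorem sGraph_norm_le (hcd : c ≤ d) {z : StripL2 a c d × StripL2 a c d × PerL2 a × PerL2 a}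
    (hz : z ∈ sGraph a c d) {N : ℝ} (hk : ‖z.2.1‖ ≤ N)
    (hb : ‖z.2.2.1‖ ≤ N ∨ ‖z.2.2.2‖ ≤ N) : ‖z‖ ≤ (8 * (d - c) + 3) * N := by
  obtain ⟨y, k, yc, yd⟩ := z
  simp only at hk hb
  have hD : 0 ≤ d - c := sub_nonneg.mpr hcd
  have hN : 0 ≤ N := (norm_nonneg _).trans hk
  have h1 := sGraph_bound_top hcd hz
  have h2 := sGraph_bound_bottom hcd hz
  have h3 := sGraph_energy hcd hz
  have hyk : ‖y‖ * ‖k‖ ≤ ‖y‖ * N := mul_le_mul_of_nonneg_left hk (norm_nonneg _)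
  have h0 : 0 ≤ ‖y‖ * ‖k‖ := by positivity
  have hy : ‖y‖ ≤ (4 * (d - c) + 1) * N := by
    refine le_of_sq_le hD hN ?_
    have e1 : (d - c) * (‖y‖ * ‖k‖) ≤ (d - c) * (‖y‖ * N) := mul_le_mul_of_nonneg_left hyk hD
    have e0 : 0 ≤ (d - c) * (‖y‖ * ‖k‖) := by positivity
    rcases hb with hb | hb
    · have := mul_le_mul_of_nonneg_left (pow_le_pow_left₀ (norm_nonneg _) hb 2) hD
      linarith
    · have := mul_le_mul_of_nonneg_left (pow_le_pow_left₀ (norm_nonneg _) hb 2) hD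
      linarith
  have hin := abs_le.mp (abs_real_inner_le_norm y k)
  have hyN : ‖y‖ * ‖k‖ ≤ (4 * (d - c) + 1) * N * N := hyk.trans (mul_le_mul_of_nonneg_right hy hN)
  have hDN : 0 ≤ (d - c) * N := by positivity
  have hDN2 : 0 ≤ (d - c) * N * N := by positivity
  have hDN3 : 0 ≤ (d - c) * N * ((d - c) * N) := by positivity
  have hc : ‖yc‖ ≤ (8 * (d - c) + 3) * N ∧ ‖yd‖ ≤ (8 * (d - c) + 3) * N := by
    have hN2 : 0 ≤ N * N := by positivity
    rcases hb with hb | hb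
    · refine ⟨hb.trans (by nlinarith), abs_le_of_sq_le_sq' ?_ (by positivity) |>.2⟩
      nlinarith [pow_le_pow_left₀ (norm_nonneg _) hb 2]
    · refine ⟨abs_le_of_sq_le_sq' ?_ (by positivity) |>.2, hb.trans (by nlinarith)⟩
      nlinarith [pow_le_pow_left₀ (norm_nonneg _) hb 2]
  simp only [Prod.norm_def, sup_le_iff]
  exact ⟨hy.trans (by nlinarith), hk.trans (by nlinarith), hc⟩

theorem exists_regularGraph_near (s₀ : ℝ) (g : StripL2 a c d × PerL2 a) {ε : ℝ} (hε : 0 < ε) :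
    ∃ F f : ℝ² → ℝ, (cls (stripVol a c d) F, cls (stripVol a c d) f,
      cls (perVol a) fun t => F (t, c), cls (perVol a) fun t => F (t, d)) ∈ regularGraph a c d ∧
      ‖g - ((cls _ f : StripL2 a c d), (cls _ fun t => F (t, s₀) : PerL2 a))‖ ≤ ε := by
  obtain ⟨f, hf, hfe⟩ := dense_cls g.1 hε
  obtain ⟨p, hp, hpe⟩ := dense_cls g.2 hε
  have hfs (t : ℝ) : Continuous fun σ : ℝ => f (t, σ) := hf.comp (by fun_prop)
  refine ⟨fun x => p x.1 + ∫ σ in s₀..x.2, f (x.1, σ), f, ⟨_, f, ?_, hf, fun t s => ?_, rfl⟩, ?_⟩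
  · exact (hp.comp continuous_fst).add
      (intervalIntegral.continuous_parametric_primitive_of_continuous (f := fun t σ => f (t, σ)) hf)
  · simp only
    exact (intervalIntegral.integral_hasDerivAt_right ((hfs t).intervalIntegrable _ _)
      (hfs t).stronglyMeasurable.stronglyMeasurableAtFilter (hfs t).continuousAt).const_add _
  · rw [Prod.norm_def]
    exact sup_le hfe (by simpa using hpe)

/-- Every `k ∈ L²` is the `s`-derivative of some `y` with a prescribed boundary value along
`s = d`. -/
theorem exists_sGraph_top (hcd : c ≤ d) (k : StripL2 a c d) (yd : PerL2 a) :
    ∃ y yc, (y, k, yc, yd) ∈ sGraph a c d := by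
  obtain ⟨⟨y, k', yc, yd'⟩, hz, h⟩ := sGraph_surjective (a := a) (c := c) (d := d)
    (((ContinuousLinearMap.fst ℝ _ _).comp (ContinuousLinearMap.snd ℝ _ _)).prod
      ((ContinuousLinearMap.snd ℝ _ _).comp ((ContinuousLinearMap.snd ℝ _ _).comp
        (ContinuousLinearMap.snd ℝ _ _))))
    (fun z hz => sGraph_norm_le hcd hz (le_max_left _ _) (.inr (le_max_right _ _)))
    (fun g ε hε => by
      obtain ⟨F, f, h, hn⟩ := exists_regularGraph_near d g hε
      exact ⟨_, h, hn⟩) (k, yd)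
  cases h
  exact ⟨y, yc, hz⟩

theorem exists_sGraph_bottom (hcd : c ≤ d) (k : StripL2 a c d) (yc : PerL2 a) :
    ∃ y yd, (y, k, yc, yd) ∈ sGraph a c d := by
  obtain ⟨⟨y, k', yc', yd⟩, hz, h⟩ := sGraph_surjective (a := a) (c := c) (d := d)
    (((ContinuousLinearMap.fst ℝ _ _).comp (ContinuousLinearMap.snd ℝ _ _)).prod
      ((ContinuousLinearMap.fst ℝ _ _).comp ((ContinuousLinearMap.snd ℝ _ _).comp
        (ContinuousLinearMap.snd ℝ _ _))))
    (fun z hz => sGraph_norm_le hcd hz (le_max_left _ _) (.inl (le_max_right _ _)))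
    (fun g ε hε => by
      obtain ⟨F, f, h, hn⟩ := exists_regularGraph_near c g hε
      exact ⟨_, h, hn⟩) (k, yc)
  cases h
  exact ⟨y, yd, hz⟩

theorem eq_zero_of_forall_test (ha : 0 < a) {y : StripL2 a c d}
    (h : ∀ χ, IsTestFun a χ → inner ℝ y (cls _ χ) = 0) : y = 0 := by
  rw [Lp.eq_zero_iff_ae_eq_zero]
  refine ae_eq_zero_of_forall_test ha ((Lp.memLp y).integrable (by norm_num)) fun χ hχ _ => ?_
  rw [← inner_cls _ (memLp_strip hχ.continuous 2)]
  exact h χ hχ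

/-- A weak `s`-derivative with a weak boundary value along `s = d` is a strong one. -/
theorem mem_sGraph_of_weak_top (ha : 0 < a) (hcd : c ≤ d) {y k : StripL2 a c d} {yd : PerL2 a}
    (h : ∀ χ, IsTestFun a χ → (∀ t, χ (t, c) = 0) →
      inner ℝ y (cls _ (dS χ)) + inner ℝ k (cls _ χ) = inner ℝ yd (cls _ fun t => χ (t, d))) :
    ∃ yc, (y, k, yc, yd) ∈ sGraph a c d := by
  obtain ⟨z, yc, hz⟩ := exists_sGraph_top hcd k yd
  suffices y = z by subst this; exact ⟨yc, hz⟩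
  rw [← sub_eq_zero]
  refine eq_zero_of_forall_test ha fun χ hχ => ?_
  have h1 := h _ (hχ.primitive c) (fun t => by simp)
  have h2 := sGraph_inner_test hcd hz (hχ.primitive c)
  rw [hχ.dS_primitive] at h1 h2
  have h3 : cls (perVol a) (fun t => ∫ σ in c..c, χ (t, σ)) = 0 := by
    simp only [intervalIntegral.integral_same]
    rw [cls_of MemLp.zero']; rfl
  simp only [h3, inner_zero_right] at h2
  rw [inner_sub_left]
  linarith

theorem mem_sGraph_of_weak_bottom (ha : 0 < a) (hcd : c ≤ d) {y k : StripL2 a c d} {yc : PerL2 a}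
    (h : ∀ χ, IsTestFun a χ → (∀ t, χ (t, d) = 0) →
      inner ℝ y (cls _ (dS χ)) + inner ℝ k (cls _ χ) = -inner ℝ yc (cls _ fun t => χ (t, c))) :
    ∃ yd, (y, k, yc, yd) ∈ sGraph a c d := by
  obtain ⟨z, yd, hz⟩ := exists_sGraph_bottom hcd k yc
  suffices y = z by subst this; exact ⟨yd, hz⟩
  rw [← sub_eq_zero]
  refine eq_zero_of_forall_test ha fun χ hχ => ?_
  have h1 := h _ (hχ.primitive d) (fun t => by simp)
  have h2 := sGraph_inner_test hcd hz (hχ.primitive d)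
  rw [hχ.dS_primitive] at h1 h2
  have h3 : cls (perVol a) (fun t => ∫ σ in d..d, χ (t, σ)) = 0 := by
    simp only [intervalIntegral.integral_same]
    rw [cls_of MemLp.zero']; rfl
  simp only [h3, inner_zero_right] at h2
  rw [inner_sub_left]
  linarith

/-! ### Symmetric systems on a strip -/

/-- Coefficients of a symmetric first order system `J ∂ₛy + ∂ₜ(M y) + Eᵀ y = g` for a pair `y` of
functions on the strip `c < s < d`, where `J = diag (1, -1)`; `Mt` is the `t`-derivative
of `M`. -/
structure SymmSystem where
  M : Fin 2 → Fin 2 → ℝ² → ℝ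
  Mt : Fin 2 → Fin 2 → ℝ² → ℝ
  E : Fin 2 → Fin 2 → ℝ² → ℝ

/-- The diagonal entries of `J`. -/
def sgnJ : Fin 2 → ℝ := ![1, -1]

namespace SymmSystem

/-- The system is periodic with symmetric `M`, and `E + Mt / 2` is negative definite. -/
structure IsAccretive (Q : SymmSystem) (a c d c₀ : ℝ) : Prop where
  pos : 0 < c₀
  continuous_M : ∀ i j, Continuous (Q.M i j)
  continuous_Mt : ∀ i j, Continuous (Q.Mt i j)
  continuous_E : ∀ i j, Continuous (Q.E i j)
  periodic : ∀ i j t s, Q.M i j (t + a, s) = Q.M i j (t, s)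
  hasDerivAt : ∀ i j t s, HasDerivAt (fun t => Q.M i j (t, s)) (Q.Mt i j (t, s)) t
  symm : ∀ i j, Q.M i j = Q.M j i
  le : ∀ t ∈ Ico 0 a, ∀ s ∈ Ioo c d, ∀ ξ : Fin 2 → ℝ,
    ∑ i, ∑ j, (Q.E i j (t, s) + Q.Mt i j (t, s) / 2) * (ξ i * ξ j) ≤ -c₀ * ∑ i, ξ i ^ 2

variable (Q : SymmSystem) (a c d : ℝ)

/-- The formal adjoint `T ψ = -J ∂ₛψ - M ∂ₜψ + E ψ` applied to test functions. -/
def adj (ψ : Fin 2 → ℝ² → ℝ) (i : Fin 2) : StripL2 a c d :=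
  -(sgnJ i • cls _ (dS (ψ i))) - ∑ j, mulOp _ (Q.M i j) (cls _ (dT (ψ j)))
    + ∑ j, mulOp _ (Q.E i j) (cls _ (ψ j))

/-- Weak solutions: `y₀ = p` along `s = d` and `y₁ = q` along `s = c`. -/
def IsWeak (y g : Fin 2 → StripL2 a c d) (p q : PerL2 a) : Prop :=
  ∀ ψ : Fin 2 → ℝ² → ℝ, (∀ i, IsTestFun a (ψ i)) → (∀ t, ψ 0 (t, c) = 0) → (∀ t, ψ 1 (t, d) = 0) →
    ∑ i, inner ℝ (y i) (Q.adj a c d ψ i) = ∑ i, inner ℝ (g i) (cls _ (ψ i))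
      - inner ℝ p (cls _ fun t => ψ 0 (t, d)) - inner ℝ q (cls _ fun t => ψ 1 (t, c))

/-- Green's formula for a solution with boundary values `yc` along `s = c` and `yd` along
`s = d`. -/
def Green (y g : Fin 2 → StripL2 a c d) (yc yd : Fin 2 → PerL2 a) : Prop :=
  ∀ ψ : Fin 2 → ℝ² → ℝ, (∀ i, IsTestFun a (ψ i)) →
    ∑ i, inner ℝ (y i) (Q.adj a c d ψ i) = ∑ i, inner ℝ (g i) (cls _ (ψ i))
      - ∑ i, sgnJ i * inner ℝ (yd i) (cls _ fun t => ψ i (t, d))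
      + ∑ i, sgnJ i * inner ℝ (yc i) (cls _ fun t => ψ i (t, c))

variable {Q a c d} {c₀ : ℝ}

namespace IsAccretive

theorem coercive (hQ : Q.IsAccretive a c d c₀) (z : Fin 2 → StripL2 a c d) :
    ∑ i, ∑ j, (inner ℝ (mulOp _ (Q.E i j) (z i)) (z j)
      + inner ℝ (mulOp _ (Q.Mt i j) (z i)) (z j) / 2) ≤ -c₀ * ∑ i, ‖z i‖ ^ 2 := by
  choose f hf hfz using fun i => exists_cls (z i)
  obtain rfl : (fun i => cls _ (f i)) = z := funext hfz
  have hterm (i j) : inner ℝ (mulOp (stripVol a c d) (Q.E i j) (cls _ (f i))) (cls _ (f j))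
        + inner ℝ (mulOp (stripVol a c d) (Q.Mt i j) (cls _ (f i))) (cls _ (f j)) / 2
      = ∫ x, (Q.E i j x + Q.Mt i j x / 2) * (f i x * f j x) ∂stripVol a c d := by
    have m1 := memLp_mul (memLp_strip (hQ.continuous_E i j) ⊤) (hf i)
    have m2 := memLp_mul (memLp_strip (hQ.continuous_Mt i j) ⊤) (hf i)
    rw [mulOp_cls (memLp_strip (hQ.continuous_E i j) _) (hf i),
      mulOp_cls (memLp_strip (hQ.continuous_Mt i j) _) (hf i), inner_cls_cls m1 (hf j),
      inner_cls_cls m2 (hf j), ← integral_div, ← integral_add]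
    · congr 1; ext x; ring
    · exact m1.integrable_mul (hf j)
    · exact (m2.integrable_mul (hf j)).div_const 2
  have hint2 (i j) : Integrable (fun x => (Q.E i j x + Q.Mt i j x / 2) * (f i x * f j x))
      (stripVol a c d) := by
    have hc : Continuous fun x => Q.E i j x + Q.Mt i j x / 2 :=
      (hQ.continuous_E i j).add ((hQ.continuous_Mt i j).div_const 2)
    have := (memLp_mul (memLp_strip hc ⊤) (hf i)).integrable_mul (hf j)
    refine this.congr (.of_forall fun x => ?_)
    simp [mul_assoc]
  simp only [hterm, norm_cls_sq (hf _)]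
  rw [← integral_finsetSum _ fun i _ => (hf i).integrable_sq, ← integral_const_mul]
  simp_rw [← integral_finsetSum _ fun j (_ : j ∈ Finset.univ) => hint2 _ j]
  rw [← integral_finsetSum _ fun i _ => integrable_finsetSum _ fun j _ => hint2 i j]
  refine integral_mono_ae
    (integrable_finsetSum _ fun i _ => integrable_finsetSum _ fun j _ => hint2 i j)
    ((integrable_finsetSum _ fun i _ => (hf i).integrable_sq).const_mul _) ?_
  filter_upwards [ae_restrict_mem (measurableSet_Ico.prod measurableSet_Ioo)] with x hx
  exact hQ.le x.1 hx.1 x.2 hx.2 fun i => f i x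

variable [Fact (0 < a)]

/-- Integration by parts in `t`: the first order term in `t` contributes only `-Mt / 2`. -/
theorem sum_inner_M (hQ : Q.IsAccretive a c d c₀) {z z' : Fin 2 → StripL2 a c d}
    (hz : ∀ i, HasDerivAt (fun r => transStrip a c d r (z i)) (z' i) 0) :
    ∑ i, ∑ j, inner ℝ (mulOp _ (Q.M i j) (z' i)) (z j)
      = -(∑ i, ∑ j, inner ℝ (mulOp _ (Q.Mt i j) (z i)) (z j)) / 2 := by
  have h (i j) := (isIsometryGroup_transStrip (a := a) c d).product_rule
    (conj_mulOp_hasDerivAt (hQ.continuous_M i j) (hQ.continuous_Mt i j) (hQ.periodic i j)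
      (hQ.hasDerivAt i j)) (hz i) (hz j)
  have hs (i j) (x y : StripL2 a c d) :
      inner ℝ (mulOp _ (Q.M i j) x) y = inner ℝ (mulOp _ (Q.M j i) y) x := by
    rw [mulOp_symm (memLp_strip (hQ.continuous_M i j) _), real_inner_comm, hQ.symm]
  have h00 := h 0 0
  have h01 := h 0 1
  have h10 := h 1 0
  have h11 := h 1 1
  have s1 := hs 0 0 (z 0) (z' 0)
  have s2 := hs 0 1 (z 0) (z' 1)
  have s3 := hs 1 0 (z 1) (z' 0)
  have s4 := hs 1 1 (z 1) (z' 1)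
  simp only [Fin.sum_univ_two]
  linarith

end IsAccretive

/-- Fields with square integrable first derivatives and `J ∂ₛz + ∂ₜ(M z) + Eᵀ z = f`. -/
def IsRegular (Q : SymmSystem) (a c d : ℝ) [Fact (0 < a)]
    (z f : Fin 2 → StripL2 a c d) (zc zd : Fin 2 → PerL2 a) : Prop :=
  ∃ z' k : Fin 2 → StripL2 a c d, (∀ i, HasDerivAt (fun r => transStrip a c d r (z i)) (z' i) 0) ∧
    (∀ i, (z i, k i, zc i, zd i) ∈ sGraph a c d) ∧
    ∀ j, f j = sgnJ j • k j + ∑ i, (mulOp _ (Q.M i j) (z' i) + mulOp _ (Q.Mt i j) (z i)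
      + mulOp _ (Q.E i j) (z i))

variable [Fact (0 < a)]

theorem IsRegular.sub {z f z₁ f₁ : Fin 2 → StripL2 a c d}
    {zc zd zc₁ zd₁ : Fin 2 → PerL2 a} (h : Q.IsRegular a c d z f zc zd)
    (h₁ : Q.IsRegular a c d z₁ f₁ zc₁ zd₁) :
    Q.IsRegular a c d (z - z₁) (f - f₁) (zc - zc₁) (zd - zd₁) := by
  obtain ⟨z', k, hz, hk, hf⟩ := h
  obtain ⟨z₁', k₁, hz₁, hk₁, hf₁⟩ := h₁
  refine ⟨z' - z₁', k - k₁, fun i => ?_, fun i => (sGraph a c d).sub_mem (hk i) (hk₁ i),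
    fun j => ?_⟩
  · simpa using! (hz i).sub (hz₁ i)
  · simp only [Pi.sub_apply, hf, hf₁, map_sub, smul_sub, Fin.sum_univ_two]
    abel

theorem energy_arith {c₀ z0 z1 f0 f1 c0 c1 d0 d1 I : ℝ} (hc : 0 < c₀) (hI : |I| ≤ f0 * z0 + f1 * z1)
    (h : I ≤ (d0 ^ 2 - c0 ^ 2 - d1 ^ 2 + c1 ^ 2) / 2 - c₀ * (z0 ^ 2 + z1 ^ 2)) :
    z0 ^ 2 + z1 ^ 2 + (c0 ^ 2 + c1 ^ 2) + (d0 ^ 2 + d1 ^ 2)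
      ≤ (2 + 2 / c₀ + 1 / c₀ ^ 2) * (f0 ^ 2 + f1 ^ 2 + d0 ^ 2 + c1 ^ 2) := by
  have h1 := (abs_le.mp hI).1
  set u := 1 / c₀ with hu
  have hu0 : 0 < u := by positivity
  have huc : u * c₀ = 1 := by rw [hu]; field_simp
  have e1 : f0 * z0 ≤ c₀ / 2 * z0 ^ 2 + u / 2 * f0 ^ 2 := by
    have : c₀ / 2 * z0 ^ 2 + u / 2 * f0 ^ 2 - f0 * z0 = u / 2 * (c₀ * z0 - f0) ^ 2 := by
      linear_combination (-(c₀ * z0 ^ 2) / 2 + z0 * f0) * huc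
    have : 0 ≤ u / 2 * (c₀ * z0 - f0) ^ 2 := by positivity
    linarith
  have e2 : f1 * z1 ≤ c₀ / 2 * z1 ^ 2 + u / 2 * f1 ^ 2 := by
    have : c₀ / 2 * z1 ^ 2 + u / 2 * f1 ^ 2 - f1 * z1 = u / 2 * (c₀ * z1 - f1) ^ 2 := by
      linear_combination (-(c₀ * z1 ^ 2) / 2 + z1 * f1) * huc
    have : 0 ≤ u / 2 * (c₀ * z1 - f1) ^ 2 := by positivity
    linarith
  have e3 : c₀ * (z0 ^ 2 + z1 ^ 2) + (c0 ^ 2 + d1 ^ 2) ≤ d0 ^ 2 + c1 ^ 2 + u * (f0 ^ 2 + f1 ^ 2) := by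
    nlinarith
  have e4 : z0 ^ 2 + z1 ^ 2 ≤ u * (d0 ^ 2 + c1 ^ 2 + u * (f0 ^ 2 + f1 ^ 2)) := by
    have : u * (c₀ * (z0 ^ 2 + z1 ^ 2)) ≤ u * (d0 ^ 2 + c1 ^ 2 + u * (f0 ^ 2 + f1 ^ 2)) := by
      apply mul_le_mul_of_nonneg_left _ hu0.le
      nlinarith [sq_nonneg c0, sq_nonneg d1]
    rwa [← mul_assoc, huc, one_mul] at this
  have e5 : c0 ^ 2 + d1 ^ 2 ≤ d0 ^ 2 + c1 ^ 2 + u * (f0 ^ 2 + f1 ^ 2) := by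
    have : 0 ≤ c₀ * (z0 ^ 2 + z1 ^ 2) := by positivity
    linarith
  have e6 : 2 / c₀ = 2 * u := by rw [hu]; ring
  have e7 : 1 / c₀ ^ 2 = u ^ 2 := by rw [hu]; ring
  rw [e6, e7]
  have p1 : 0 ≤ f0 ^ 2 + f1 ^ 2 := by positivity
  have p2 : 0 ≤ d0 ^ 2 + c1 ^ 2 := by positivity
  nlinarith [mul_nonneg hu0.le p1, mul_nonneg hu0.le p2, mul_nonneg (sq_nonneg u) p2]

/-- The energy estimate for regular fields. -/
theorem IsRegular.energy (hQ : Q.IsAccretive a c d c₀) (hcd : c ≤ d)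
    {z f : Fin 2 → StripL2 a c d} {zc zd : Fin 2 → PerL2 a}
    (h : Q.IsRegular a c d z f zc zd) :
    ∑ i, ‖z i‖ ^ 2 + ∑ i, ‖zc i‖ ^ 2 + ∑ i, ‖zd i‖ ^ 2
      ≤ (2 + 2 / c₀ + 1 / c₀ ^ 2) * (∑ i, ‖f i‖ ^ 2 + ‖zd 0‖ ^ 2 + ‖zc 1‖ ^ 2) := by
  obtain ⟨z', k, hz, hk, hf⟩ := h
  have h1 := hQ.coercive z
  have h2 := hQ.sum_inner_M hz
  have k0 := sGraph_energy hcd (hk 0)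
  have k1 := sGraph_energy hcd (hk 1)
  have hI : inner ℝ (f 0) (z 0) + inner ℝ (f 1) (z 1)
      ≤ (‖zd 0‖ ^ 2 - ‖zc 0‖ ^ 2 - ‖zd 1‖ ^ 2 + ‖zc 1‖ ^ 2) / 2 - c₀ * (‖z 0‖ ^ 2 + ‖z 1‖ ^ 2) := by
    rw [hf, hf]
    simp only [Fin.sum_univ_two, sgnJ, Matrix.cons_val_zero, Matrix.cons_val_one, inner_add_left,
      one_smul, neg_smul, inner_neg_left] at h1 h2 ⊢
    rw [real_inner_comm] at k0 k1
    linarith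
  have hI2 : |inner ℝ (f 0) (z 0) + inner ℝ (f 1) (z 1)| ≤ ‖f 0‖ * ‖z 0‖ + ‖f 1‖ * ‖z 1‖ :=
    (abs_add_le _ _).trans (add_le_add (abs_real_inner_le_norm _ _) (abs_real_inner_le_norm _ _))
  have := energy_arith hQ.pos hI2 hI
  simpa only [Fin.sum_univ_two] using this

/-- The energy estimate for the adjoint problem. -/
theorem adj_energy (hQ : Q.IsAccretive a c d c₀) (hcd : c ≤ d) {ψ : Fin 2 → ℝ² → ℝ}
    (hψ : ∀ i, IsTestFun a (ψ i)) (h0 : ∀ t, ψ 0 (t, c) = 0) (h1 : ∀ t, ψ 1 (t, d) = 0) :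
    ∑ i, ‖cls (stripVol a c d) (ψ i)‖ ^ 2 + ‖cls (perVol a) fun t => ψ 0 (t, d)‖ ^ 2
      + ‖cls (perVol a) fun t => ψ 1 (t, c)‖ ^ 2
      ≤ (2 + 2 / c₀ + 1 / c₀ ^ 2) * ∑ i, ‖Q.adj a c d ψ i‖ ^ 2 := by
  have hz (i) := transStrip_cls_hasDerivAt (c := c) (d := d) (hψ i).continuous
    (continuous_dT (hψ i).contDiff) (hψ i).periodic (hψ i).hasDerivAt_dT
  have e1 := hQ.coercive fun i => cls (stripVol a c d) (ψ i)
  have e2 := hQ.sum_inner_M hz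
  have k0 := sGraph_energy hcd (test_mem_sGraph (c := c) (d := d) (hψ 0))
  have k1 := sGraph_energy hcd (test_mem_sGraph (c := c) (d := d) (hψ 1))
  have z0 : ‖cls (perVol a) fun t => ψ 0 (t, c)‖ = 0 := by
    simp only [h0]; rw [cls_of MemLp.zero']; simp
  have z1 : ‖cls (perVol a) fun t => ψ 1 (t, d)‖ = 0 := by
    simp only [h1]; rw [cls_of MemLp.zero']; simp
  rw [z0] at k0
  rw [z1] at k1
  have hs (i j) (x y : StripL2 a c d) :
      inner ℝ (mulOp _ (Q.M i j) x) y = inner ℝ (mulOp _ (Q.M j i) x) y := by rw [hQ.symm]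
  have hE (i j) (x y : StripL2 a c d) :
      inner ℝ (mulOp _ (Q.E i j) x) y = inner ℝ (mulOp _ (Q.E i j) y) x := by
    rw [mulOp_symm (memLp_strip (hQ.continuous_E i j) _), real_inner_comm]
  have hI : inner ℝ (Q.adj a c d ψ 0) (cls _ (ψ 0)) + inner ℝ (Q.adj a c d ψ 1) (cls _ (ψ 1))
      ≤ ((0 : ℝ) ^ 2 - ‖cls (perVol a) fun t => ψ 0 (t, d)‖ ^ 2
        - ‖cls (perVol a) fun t => ψ 1 (t, c)‖ ^ 2 + (0 : ℝ) ^ 2) / 2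
        - c₀ * (‖cls (stripVol a c d) (ψ 0)‖ ^ 2
        + ‖cls (stripVol a c d) (ψ 1)‖ ^ 2) := by
    simp only [adj, Fin.sum_univ_two, sgnJ, Matrix.cons_val_zero, Matrix.cons_val_one,
      inner_add_left, inner_sub_left,
      one_smul, neg_smul, inner_neg_left, neg_neg] at e1 e2 ⊢
    rw [real_inner_comm] at k0 k1
    have s1 := hs 0 1 (cls _ (dT (ψ 0))) (cls _ (ψ 1))
    have s2 := hs 0 1 (cls _ (dT (ψ 1))) (cls _ (ψ 0))
    have s3 := hE 0 1 (cls _ (ψ 0)) (cls _ (ψ 1))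
    have s4 := hE 1 0 (cls _ (ψ 1)) (cls _ (ψ 0))
    linarith
  have hI2 : |inner ℝ (Q.adj a c d ψ 0) (cls _ (ψ 0)) + inner ℝ (Q.adj a c d ψ 1) (cls _ (ψ 1))|
      ≤ ‖Q.adj a c d ψ 0‖ * ‖cls (stripVol a c d) (ψ 0)‖
        + ‖Q.adj a c d ψ 1‖ * ‖cls (stripVol a c d) (ψ 1)‖ :=
    (abs_add_le _ _).trans (add_le_add (abs_real_inner_le_norm _ _) (abs_real_inner_le_norm _ _))
  have := energy_arith hQ.pos hI2 hI
  simp only [Fin.sum_univ_two]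
  linarith

/-- Green's formula for regular fields. -/
theorem IsRegular.green (hQ : Q.IsAccretive a c d c₀) (hcd : c ≤ d)
    {z f : Fin 2 → StripL2 a c d} {zc zd : Fin 2 → PerL2 a}
    (h : Q.IsRegular a c d z f zc zd) : Q.Green a c d z f zc zd := by
  intro ψ hψ
  obtain ⟨z', k, hz, hk, hf⟩ := h
  have hw (i) := transStrip_cls_hasDerivAt (c := c) (d := d) (hψ i).continuous
    (continuous_dT (hψ i).contDiff) (hψ i).periodic (hψ i).hasDerivAt_dT
  have hM (i j) := (isIsometryGroup_transStrip (a := a) c d).product_rule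
    (conj_mulOp_hasDerivAt (hQ.continuous_M i j) (hQ.continuous_Mt i j) (hQ.periodic i j)
      (hQ.hasDerivAt i j)) (hz i) (hw j)
  have hS (i) := sGraph_inner_test hcd (hk i) (hψ i)
  have sM (i j) (x y : StripL2 a c d) := mulOp_symm (memLp_strip (hQ.continuous_M i j) ⊤) x y
  have sE (i j) (x y : StripL2 a c d) := mulOp_symm (memLp_strip (hQ.continuous_E i j) ⊤) x y
  have h00 := hM 0 0
  have h01 := hM 0 1
  have h10 := hM 1 0
  have h11 := hM 1 1
  have s0 := hS 0
  have s1 := hS 1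
  simp only [adj, hf, Fin.sum_univ_two, sgnJ, Matrix.cons_val_zero, Matrix.cons_val_one,
      inner_add_left, inner_add_right, inner_sub_right,
      one_smul, neg_smul, inner_neg_left, inner_neg_right, neg_neg, ← sM, ← sE]
  linarith

end SymmSystem

/-! ### Weak solutions of symmetric systems are strong -/

namespace SymmSystem

variable {Q : SymmSystem} {a c d c₀ : ℝ} [Fact (0 < a)]

/-- The Steklov averages of a weak solution are regular; this is the step that uses that
translations in `t` preserve the boundary conditions. They satisfy the system up to commutators of
the averages with the coefficients. -/
theorem IsWeak.stek_isRegular (hQ : Q.IsAccretive a c d c₀) (hcd : c ≤ d)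
    {y g : Fin 2 → StripL2 a c d} {p q : PerL2 a}
    (hy : Q.IsWeak a c d y g p q) (h : ℝ) :
    ∃ zc zd, Q.IsRegular a c d (fun i => stek (transStrip a c d) h (y i))
      (fun j => stek (transStrip a c d) h (g j)
        - ∑ i, (stek (transStrip a c d) h (mulOp _ (Q.E i j) (y i))
          - mulOp _ (Q.E i j) (stek (transStrip a c d) h (y i)))
        - ∑ i, (diffQuot (transStrip a c d) h (mulOp _ (Q.M i j) (y i))
          - mulOp _ (Q.M i j) (diffQuot (transStrip a c d) h (y i)))
        + ∑ i, mulOp _ (Q.Mt i j) (stek (transStrip a c d) h (y i))) zc zd ∧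
      zd 0 = stek (transPeriod a) h p ∧ zc 1 = stek (transPeriod a) h q := by
  have hτ := isIsometryGroup_transStrip (a := a) c d
  have hσ := isIsometryGroup_transPeriod (a := a)
  set τ := transStrip a c d with hτdef
  set σ := transPeriod a with hσdef
  have ha : 0 < a := Fact.out
  -- translates of test functions are test functions
  have hpt (χ) (hχ : IsTestFun a χ) (r : ℝ) : τ r (cls _ χ) = cls _ (fun x => χ (x.1 + r, x.2)) :=
    transStrip_cls r hχ.continuous hχ.periodic
  have hptT (χ) (hχ : IsTestFun a χ) (r : ℝ) :
      τ r (cls _ (dT χ)) = cls _ (dT fun x => χ (x.1 + r, x.2)) := by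
    rw [IsTestFun.dT_shift]
    exact transStrip_cls r (continuous_dT hχ.contDiff) hχ.dT_periodic
  have hptS (χ) (hχ : IsTestFun a χ) (r : ℝ) :
      τ r (cls _ (dS χ)) = cls _ (dS fun x => χ (x.1 + r, x.2)) := by
    rw [IsTestFun.dS_shift]
    exact transStrip_cls r (continuous_dS hχ.contDiff) hχ.dS_periodic
  have hptb (χ) (hχ : IsTestFun a χ) (s r : ℝ) :
      σ r (cls _ fun t => χ (t, s)) = cls _ (fun t => χ (t + r, s)) :=
    transPeriod_cls r (hχ.slice s) fun t => hχ.periodic t s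
  have z2 : cls (stripVol a c d) (fun _ => (0 : ℝ)) = 0 := by rw [cls_of MemLp.zero']; rfl
  have z1 : cls (perVol a) (fun _ => (0 : ℝ)) = 0 := by rw [cls_of MemLp.zero']; rfl
  have zT : dT (fun _ : ℝ² => (0 : ℝ)) = fun _ => 0 := by ext x; simp [dT]
  have zS : dS (fun _ : ℝ² => (0 : ℝ)) = fun _ => 0 := by ext x; simp [dS]
  have sM (i j) (x y : StripL2 a c d) := mulOp_symm (memLp_strip (hQ.continuous_M i j) ⊤) x y
  have sE (i j) (x y : StripL2 a c d) := mulOp_symm (memLp_strip (hQ.continuous_E i j) ⊤) x y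
  have hw (χ) (hχ : IsTestFun a χ) := transStrip_cls_hasDerivAt (c := c) (d := d) hχ.continuous
    (continuous_dT hχ.contDiff) hχ.periodic hχ.hasDerivAt_dT
  have cc (x w : StripL2 a c d) : IntervalIntegrable (fun r => inner ℝ x (τ (-r) w)) volume 0 h :=
    (continuous_const.inner ((hτ.cont w).comp continuous_neg)).intervalIntegrable _ _
  have ccn (m : ℝ) (x w : StripL2 a c d) :
      IntervalIntegrable (fun r => -(m * inner ℝ x (τ (-r) w))) volume 0 h :=
    ((cc x w).const_mul m).neg
  have cb (x w : PerL2 a) : IntervalIntegrable (fun r => inner ℝ x (σ (-r) w)) volume 0 h :=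
    (continuous_const.inner ((hσ.cont w).comp continuous_neg)).intervalIntegrable _ _
  -- the `s`-derivatives of the averages, read off from the equation
  set k : Fin 2 → StripL2 a c d := fun j => sgnJ j • (stek τ h (g j)
    - ∑ i, stek τ h (mulOp _ (Q.E i j) (y i)) - ∑ i, diffQuot τ h (mulOp _ (Q.M i j) (y i))) with hk
  have hJ (j) : sgnJ j * sgnJ j = 1 := by fin_cases j <;> simp [sgnJ]
  -- the weak equation for one component, averaged over the translates of a test function
  have avg (j : Fin 2) (s : ℝ) (p : PerL2 a) (χ) (hχ : IsTestFun a χ)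
      (key : ∀ r, -(sgnJ j * inner ℝ (y j) (τ (-r) (cls _ (dS χ))))
        - inner ℝ (mulOp _ (Q.M 0 j) (y 0)) (τ (-r) (cls _ (dT χ)))
        - inner ℝ (mulOp _ (Q.M 1 j) (y 1)) (τ (-r) (cls _ (dT χ)))
        + inner ℝ (mulOp _ (Q.E 0 j) (y 0)) (τ (-r) (cls _ χ))
        + inner ℝ (mulOp _ (Q.E 1 j) (y 1)) (τ (-r) (cls _ χ))
        = inner ℝ (g j) (τ (-r) (cls _ χ)) - inner ℝ p (σ (-r) (cls _ fun t => χ (t, s)))) :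
      sgnJ j * inner ℝ (stek τ h (y j)) (cls _ (dS χ)) + sgnJ j * inner ℝ (k j) (cls _ χ)
        = inner ℝ (stek σ h p) (cls _ fun t => χ (t, s)) := by
    have I (x w) := hτ.integral_inner h x w
    have this := intervalIntegral.integral_congr (μ := volume) (a := 0) (b := h) fun r _ => key r
    rw [intervalIntegral.integral_add ((((ccn _ _ _).sub (cc _ _)).sub (cc _ _)).add (cc _ _))
      (cc _ _), intervalIntegral.integral_add (((ccn _ _ _).sub (cc _ _)).sub (cc _ _)) (cc _ _),
      intervalIntegral.integral_sub ((ccn _ _ _).sub (cc _ _)) (cc _ _),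
      intervalIntegral.integral_sub (ccn _ _ _) (cc _ _), intervalIntegral.integral_neg,
      intervalIntegral.integral_const_mul, intervalIntegral.integral_sub (cc _ _) (cb _ _)] at this
    simp only [hk, Fin.sum_univ_two, real_inner_smul_left, inner_sub_left, inner_add_left,
      ← mul_assoc, hJ, one_mul]
    have dq (x) := hτ.inner_stek (h := h) (x := x) (hw χ hχ)
    simp only [I] at dq
    simp only [I, hσ.integral_inner h]
    linear_combination -h⁻¹ * this - dq (mulOp _ (Q.M 0 j) (y 0)) - dq (mulOp _ (Q.M 1 j) (y 1))
  have w0 : ∃ zc, (stek τ h (y 0), k 0, zc, stek σ h p) ∈ sGraph a c d := by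
    refine mem_sGraph_of_weak_top ha hcd fun χ hχ h0 => ?_
    have := avg 0 d p χ hχ fun r => by
      have := hy ![fun x => χ (x.1 + -r, x.2), fun _ => 0] (Fin.forall_fin_two.mpr
        ⟨hχ.shift (-r), IsTestFun.const a 0⟩) (fun t => h0 _) (fun t => rfl)
      simp only [adj, Fin.sum_univ_two, Matrix.cons_val_zero, Matrix.cons_val_one, z1, z2, zT, zS,
        map_zero, add_zero, sub_zero, inner_zero_right, real_inner_smul_right,
        inner_add_right, inner_sub_right, inner_neg_right] at this
      rw [hptS χ hχ, hptT χ hχ, hpt χ hχ, hptb χ hχ, sM, sM, sE, sE]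
      linarith
    simpa [sgnJ] using this
  have w1 : ∃ zd, (stek τ h (y 1), k 1, stek σ h q, zd) ∈ sGraph a c d := by
    refine mem_sGraph_of_weak_bottom ha hcd fun χ hχ h0 => ?_
    have := avg 1 c q χ hχ fun r => by
      have := hy ![fun _ => 0, fun x => χ (x.1 + -r, x.2)] (Fin.forall_fin_two.mpr
        ⟨IsTestFun.const a 0, hχ.shift (-r)⟩) (fun t => rfl) (fun t => h0 _)
      simp only [adj, Fin.sum_univ_two, Matrix.cons_val_zero, Matrix.cons_val_one,
        Matrix.cons_val_fin_one, z1, z2, zT, zS, map_zero, zero_add, sub_zero,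
        inner_zero_right, real_inner_smul_right, inner_add_right, inner_sub_right, inner_neg_right] at this
      rw [hptS χ hχ, hptT χ hχ, hpt χ hχ, hptb χ hχ, sM, sM, sE, sE]
      linarith
    simp only [sgnJ, Matrix.cons_val_one, Matrix.cons_val_fin_one] at this
    linarith
  obtain ⟨zc, hzc⟩ := w0
  obtain ⟨zd, hzd⟩ := w1
  refine ⟨![zc, stek σ h q], ![stek σ h p, zd], ⟨fun i => diffQuot τ h (y i), k,
    fun i => hτ.stek_hasDerivAt h (y i), ?_, fun j => ?_⟩, rfl, rfl⟩
  · exact Fin.forall_fin_two.mpr ⟨hzc, hzd⟩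
  · simp only [hk, smul_smul, hJ, one_smul, Fin.sum_univ_two]
    abel

/-- Weak solutions are strong: they have boundary values, and satisfy Green's formula and the energy
estimate. -/
theorem IsWeak.exists_traces (hQ : Q.IsAccretive a c d c₀) (hcd : c ≤ d)
    {y g : Fin 2 → StripL2 a c d} {p q : PerL2 a}
    (hy : Q.IsWeak a c d y g p q) :
    ∃ yc yd : Fin 2 → PerL2 a, yd 0 = p ∧ yc 1 = q ∧ Q.Green a c d y g yc yd ∧
      ∑ i, ‖y i‖ ^ 2 + ∑ i, ‖yc i‖ ^ 2 + ∑ i, ‖yd i‖ ^ 2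
        ≤ (2 + 2 / c₀ + 1 / c₀ ^ 2) * (∑ i, ‖g i‖ ^ 2 + ‖p‖ ^ 2 + ‖q‖ ^ 2) := by
  have hτ := isIsometryGroup_transStrip (a := a) c d
  have hσ := isIsometryGroup_transPeriod (a := a)
  set τ := transStrip a c d
  choose zc zd hreg hp hq using hy.stek_isRegular hQ hcd
  set h : ℕ → ℝ := fun n => 1 / ((n : ℝ) + 1) with hh
  have hlim : Tendsto h atTop (𝓝[>] 0) := by
    refine tendsto_nhdsWithin_iff.mpr ⟨tendsto_one_div_add_atTop_nhds_zero_nat, ?_⟩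
    exact .of_forall fun n => by simp only [hh, mem_Ioi]; positivity
  set z : ℕ → Fin 2 → StripL2 a c d := fun n i => stek (τ) (h n) (y i) with hz
  set f : ℕ → Fin 2 → StripL2 a c d := fun n j =>
      (stek (τ) (h n) (g j) - ∑ i, (stek (τ) (h n) (mulOp _ (Q.E i j) (y i))
          - mulOp _ (Q.E i j) (stek (τ) (h n) (y i)))
        - ∑ i, (diffQuot (τ) (h n) (mulOp _ (Q.M i j) (y i))
          - mulOp _ (Q.M i j) (diffQuot (τ) (h n) (y i)))
        + ∑ i, mulOp _ (Q.Mt i j) (stek (τ) (h n) (y i))) with hf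
  have hR (n) : Q.IsRegular a c d (z n) (f n) (zc (h n)) (zd (h n)) := hreg (h n)
  have hzl (i) : Tendsto (fun n => z n i) atTop (𝓝 (y i)) := (hτ.stek_tendsto (y i)).comp hlim
  have hfl (j) : Tendsto (fun n => f n j) atTop (𝓝 (g j)) := by
    have t1 := (hτ.stek_tendsto (g j)).comp hlim
    have t2 : Tendsto (fun n => ∑ i, (stek (τ) (h n) (mulOp _ (Q.E i j) (y i))
          - mulOp _ (Q.E i j) (stek (τ) (h n) (y i)))) atTop (𝓝 (∑ _i : Fin 2, 0)) := by
      refine tendsto_finsetSum _ fun i _ => ?_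
      have := ((hτ.stek_tendsto (mulOp _ (Q.E i j) (y i))).comp hlim).sub
        (((mulOp (stripVol a c d) (Q.E i j)).continuous.tendsto _).comp (hzl i))
      rwa [sub_self] at this
    -- the commutators with `M` do not tend to `0`, but cancel against the last term
    have t3 : Tendsto (fun n => ∑ i, (diffQuot (τ) (h n) (mulOp _ (Q.M i j) (y i))
          - mulOp _ (Q.M i j) (diffQuot (τ) (h n) (y i)))) atTop
          (𝓝 (∑ i, mulOp _ (Q.Mt i j) (y i))) :=
      tendsto_finsetSum _ fun i _ => (hτ.commutator_tendsto
        (conj_mulOp_hasDerivAt (hQ.continuous_M i j) (hQ.continuous_Mt i j) (hQ.periodic i j)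
          (hQ.hasDerivAt i j)) (y i)).comp hlim
    have t4 : Tendsto (fun n => ∑ i, mulOp _ (Q.Mt i j) (stek (τ) (h n) (y i)))
        atTop (𝓝 (∑ i, mulOp _ (Q.Mt i j) (y i))) :=
      tendsto_finsetSum _ fun i _ =>
        ((mulOp (stripVol a c d) (Q.Mt i j)).continuous.tendsto _).comp (hzl i)
    have := ((t1.sub t2).sub t3).add t4
    simpa [hf] using this
  have hpl : Tendsto (fun n => zd (h n) 0) atTop (𝓝 p) := by
    simp only [hp]; exact (hσ.stek_tendsto p).comp hlim
  have hql : Tendsto (fun n => zc (h n) 1) atTop (𝓝 q) := by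
    simp only [hq]; exact (hσ.stek_tendsto q).comp hlim
  -- the energy estimate for differences makes the boundary values converge
  have hdiff {G : Type} [NormedAddCommGroup G] {u : ℕ → G} {v : G} (hu : Tendsto u atTop (𝓝 v)) :
      Tendsto (fun n : ℕ × ℕ => ‖u n.1 - u n.2‖ ^ 2) atTop (𝓝 0) := by
    have h1 : Tendsto (fun n : ℕ × ℕ => u n.1) atTop (𝓝 v) := by
      rw [← prod_atTop_atTop_eq]; exact hu.comp tendsto_fst
    have h2 : Tendsto (fun n : ℕ × ℕ => u n.2) atTop (𝓝 v) := by
      rw [← prod_atTop_atTop_eq]; exact hu.comp tendsto_snd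
    simpa using ((h1.sub h2).norm).pow 2
  have hbound : Tendsto (fun n : ℕ × ℕ => (2 + 2 / c₀ + 1 / c₀ ^ 2) *
      (∑ i, ‖f n.1 i - f n.2 i‖ ^ 2 + ‖zd (h n.1) 0 - zd (h n.2) 0‖ ^ 2
        + ‖zc (h n.1) 1 - zc (h n.2) 1‖ ^ 2)) atTop (𝓝 0) := by
    have := (((tendsto_finsetSum Finset.univ fun i _ => hdiff (hfl i)).add (hdiff hpl)).add
      (hdiff hql)).const_mul (2 + 2 / c₀ + 1 / c₀ ^ 2)
    simpa using this
  have hcauchy (u : ℕ → PerL2 a) (hu : ∀ n m, ‖u n - u m‖ ^ 2 ≤ (2 + 2 / c₀ + 1 / c₀ ^ 2) *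
      (∑ i, ‖f n i - f m i‖ ^ 2 + ‖zd (h n) 0 - zd (h m) 0‖ ^ 2
        + ‖zc (h n) 1 - zc (h m) 1‖ ^ 2)) : ∃ v, Tendsto u atTop (𝓝 v) := by
    refine cauchySeq_tendsto_of_complete (cauchySeq_iff_tendsto_dist_atTop_0.mpr ?_)
    have h1 : Tendsto (fun n : ℕ × ℕ => dist (u n.1) (u n.2) ^ 2) atTop (𝓝 0) :=
      squeeze_zero (fun n => by positivity) (fun n => by rw [dist_eq_norm]; exact hu n.1 n.2) hbound
    have h2 := (Real.continuous_sqrt.tendsto 0).comp h1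
    simpa [Function.comp_def, Real.sqrt_sq dist_nonneg] using h2
  have hE (n m) := ((hR n).sub (hR m)).energy hQ hcd
  simp only [Pi.sub_apply] at hE
  have hsq {G : Type} [NormedAddCommGroup G] (u : Fin 2 → G) : 0 ≤ ∑ i, ‖u i‖ ^ 2 :=
    Finset.sum_nonneg fun i _ => by positivity
  have hsq1 {G : Type} [NormedAddCommGroup G] (u : Fin 2 → G) (i) : ‖u i‖ ^ 2 ≤ ∑ i, ‖u i‖ ^ 2 :=
    Finset.single_le_sum (f := fun i => ‖u i‖ ^ 2) (fun i _ => by positivity) (Finset.mem_univ i)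
  choose yc hyc using fun i => hcauchy (fun n => zc (h n) i) fun n m => by
    have h1 := hE n m
    have h2 := hsq fun i => z n i - z m i
    have h3 := hsq fun i => zd (h n) i - zd (h m) i
    have h4 := hsq1 (fun i => zc (h n) i - zc (h m) i) i
    linarith
  choose yd hyd using fun i => hcauchy (fun n => zd (h n) i) fun n m => by
    have h1 := hE n m
    have h2 := hsq fun i => z n i - z m i
    have h3 := hsq fun i => zc (h n) i - zc (h m) i
    have h4 := hsq1 (fun i => zd (h n) i - zd (h m) i) i
    linarith
  have e0 : yd 0 = p := tendsto_nhds_unique (hyd 0) hpl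
  have e1 : yc 1 = q := tendsto_nhds_unique (hyc 1) hql
  refine ⟨yc, yd, e0, e1, fun ψ hψ => ?_, ?_⟩
  · have hG (n) := (hR n).green hQ hcd ψ hψ
    refine tendsto_nhds_unique (l := atTop)
      (f := fun n => ∑ i, inner ℝ (z n i) (Q.adj a c d ψ i)) ?_ ?_
    · exact tendsto_finsetSum _ fun i _ => (hzl i).inner tendsto_const_nhds
    · simp only [hG]
      refine ((tendsto_finsetSum _ fun i _ => (hfl i).inner tendsto_const_nhds).sub
        (tendsto_finsetSum _ fun i _ => ((hyd i).inner tendsto_const_nhds).const_mul _)).add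
        (tendsto_finsetSum _ fun i _ => ((hyc i).inner tendsto_const_nhds).const_mul _)
  · have hEn (n) := (hR n).energy hQ hcd
    refine le_of_tendsto_of_tendsto' (b := atTop) ?_ ?_ hEn
    · exact ((tendsto_finsetSum _ fun i _ => (hzl i).norm.pow 2).add
        (tendsto_finsetSum _ fun i _ => (hyc i).norm.pow 2)).add
        (tendsto_finsetSum _ fun i _ => (hyd i).norm.pow 2)
    · exact (((tendsto_finsetSum _ fun i _ => (hfl i).norm.pow 2).add (hpl.norm.pow 2)).add
        (hql.norm.pow 2)).const_mul _

/-- Weak solutions are unique. -/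
theorem IsWeak.unique (hQ : Q.IsAccretive a c d c₀) (hcd : c ≤ d)
    {y y' g : Fin 2 → StripL2 a c d} {p q : PerL2 a}
    (hy : Q.IsWeak a c d y g p q) (hy' : Q.IsWeak a c d y' g p q) : y' = y := by
  have hd : Q.IsWeak a c d (y' - y) 0 0 0 := fun ψ hψ h0 h1 => by
    have e1 := hy ψ hψ h0 h1
    have e2 := hy' ψ hψ h0 h1
    simp only [Pi.sub_apply, inner_sub_left, Finset.sum_sub_distrib, Pi.zero_apply,
      inner_zero_left, Finset.sum_const_zero, sub_zero]
    rw [e1, e2, sub_self]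
  obtain ⟨yc, yd, -, -, -, h⟩ := hd.exists_traces hQ hcd
  simp only [Pi.zero_apply, norm_zero] at h
  funext i
  have h1 : 0 ≤ ∑ i, ‖yc i‖ ^ 2 := Finset.sum_nonneg fun i _ => by positivity
  have h2 : 0 ≤ ∑ i, ‖yd i‖ ^ 2 := Finset.sum_nonneg fun i _ => by positivity
  have h3 := Finset.single_le_sum (f := fun i => ‖(y' - y) i‖ ^ 2) (fun i _ => by positivity)
    (Finset.mem_univ i)
  simp only [Fin.sum_univ_two] at h h1 h2 h3
  have h4 : ‖(y' - y) i‖ ^ 2 ≤ 0 := by linarith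
  have h5 : ‖(y' - y) i‖ = 0 := by nlinarith [norm_nonneg ((y' - y) i)]
  exact sub_eq_zero.mp (norm_eq_zero.mp h5)

end SymmSystem

/-- A linear functional that is bounded in terms of `‖T v‖` is represented by a vector paired
with `T v`. -/
theorem exists_inner_eq_of_bound {V H : Type*} [AddCommGroup V] [Module ℝ V] [NormedAddCommGroup H]
    [InnerProductSpace ℝ H] [CompleteSpace H] (T : V →ₗ[ℝ] H) (l : V →ₗ[ℝ] ℝ) {C : ℝ}
    (h : ∀ v, |l v| ≤ C * ‖T v‖) : ∃ y, ∀ v, inner ℝ y (T v) = l v := by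
  have hker : LinearMap.ker T ≤ LinearMap.ker l := fun v hv => by
    have h1 := h v
    rw [LinearMap.mem_ker.mp hv, norm_zero, mul_zero] at h1
    exact abs_nonpos_iff.mp h1
  let f : LinearMap.range T →ₗ[ℝ] ℝ :=
    ((LinearMap.ker T).liftQ l hker).comp T.quotKerEquivRange.symm.toLinearMap
  have hf (v : V) : f ⟨T v, v, rfl⟩ = l v := by
    have : T.quotKerEquivRange.symm ⟨T v, v, rfl⟩ = (LinearMap.ker T).mkQ v := by
      rw [LinearEquiv.symm_apply_eq]; ext; simp
    simp [f, this]
  let F : StrongDual ℝ (LinearMap.range T) := f.mkContinuous C (by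
    rintro ⟨_, v, rfl⟩
    rw [hf]; exact h v)
  obtain ⟨G, hG, -⟩ := exists_extension_norm_eq (LinearMap.range T) F
  refine ⟨(InnerProductSpace.toDual ℝ H).symm G, fun v => ?_⟩
  rw [InnerProductSpace.toDual_symm_apply, ← hf v]
  exact hG ⟨T v, v, rfl⟩

/-! ### Existence of weak solutions of symmetric systems -/

namespace SymmSystem

variable {Q : SymmSystem} {a c d c₀ : ℝ}

theorem cls_slice_add {f g : ℝ² → ℝ} (hf : IsTestFun a f) (hg : IsTestFun a g) (s : ℝ) :
    (cls (perVol a) fun t => (f + g) (t, s))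
      = (cls (perVol a) fun t => f (t, s)) + cls (perVol a) fun t => g (t, s) :=
  cls_add (slice_memLp hf.continuous s) (slice_memLp hg.continuous s)

theorem cls_slice_smul {f : ℝ² → ℝ} (hf : IsTestFun a f) (k s : ℝ) :
    (cls (perVol a) fun t => (k • f) (t, s)) = k • cls (perVol a) fun t => f (t, s) :=
  cls_smul (slice_memLp hf.continuous s) k

/-- The formal adjoint as a function. -/
def adjFun (Q : SymmSystem) (ψ : Fin 2 → ℝ² → ℝ) (i : Fin 2) (x : ℝ²) : ℝ :=
  -(sgnJ i * dS (ψ i) x) - ∑ j, Q.M i j x * dT (ψ j) x + ∑ j, Q.E i j x * ψ j x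

theorem continuous_adjFun (hQ : Q.IsAccretive a c d c₀) {ψ : Fin 2 → ℝ² → ℝ}
    (hψ : ∀ i, IsTestFun a (ψ i)) (i : Fin 2) : Continuous (Q.adjFun ψ i) := by
  refine ((continuous_const.mul (continuous_dS (hψ i).contDiff)).neg.sub
    (continuous_finsetSum _ fun j _ => ?_)).add (continuous_finsetSum _ fun j _ => ?_)
  · exact (hQ.continuous_M i j).mul (continuous_dT (hψ j).contDiff)
  · exact (hQ.continuous_E i j).mul (hψ j).continuous

theorem adj_eq_cls (hQ : Q.IsAccretive a c d c₀) {ψ : Fin 2 → ℝ² → ℝ}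
    (hψ : ∀ i, IsTestFun a (ψ i)) (i : Fin 2) :
    Q.adj a c d ψ i = cls _ (Q.adjFun ψ i) := by
  have mM (j) := memLp_mul (memLp_strip (a := a) (c := c) (d := d) (hQ.continuous_M i j) ⊤) (hψ j).memLp_dT
  have mE (j) := memLp_mul (memLp_strip (a := a) (c := c) (d := d) (hQ.continuous_E i j) ⊤) (hψ j).memLp
  have e : Q.adjFun ψ i = fun x => (-sgnJ i * dS (ψ i) x
      - (Q.M i 0 x * dT (ψ 0) x + Q.M i 1 x * dT (ψ 1) x))
      + (Q.E i 0 x * ψ 0 x + Q.E i 1 x * ψ 1 x) := by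
    ext x; simp only [adjFun, Fin.sum_univ_two]; ring
  have m1 : MemLp (fun x => -sgnJ i * dS (ψ i) x) 2 (stripVol a c d) := (hψ i).memLp_dS.const_mul _
  have m2 : MemLp (fun x => Q.M i 0 x * dT (ψ 0) x + Q.M i 1 x * dT (ψ 1) x) 2
    (stripVol a c d) := (mM 0).add (mM 1)
  have m3 : MemLp (fun x => Q.E i 0 x * ψ 0 x + Q.E i 1 x * ψ 1 x) 2
    (stripVol a c d) := (mE 0).add (mE 1)
  have m12 : MemLp (fun x => -sgnJ i * dS (ψ i) x
    - (Q.M i 0 x * dT (ψ 0) x + Q.M i 1 x * dT (ψ 1) x)) 2 (stripVol a c d) := m1.sub m2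
  rw [e, cls_add m12 m3, cls_sub m1 m2, cls_add (mM 0) (mM 1), cls_add (mE 0) (mE 1),
    cls_smul (hψ i).memLp_dS, adj]
  simp only [Fin.sum_univ_two, mulOp_cls (memLp_strip (hQ.continuous_M i _) _) (hψ _).memLp_dT,
    mulOp_cls (memLp_strip (hQ.continuous_E i _) _) (hψ _).memLp, neg_smul]

theorem adj_add (hQ : Q.IsAccretive a c d c₀) {ψ φ : Fin 2 → ℝ² → ℝ} (hψ : ∀ i, IsTestFun a (ψ i))
    (hφ : ∀ i, IsTestFun a (φ i)) (i : Fin 2) :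
    Q.adj a c d (ψ + φ) i = Q.adj a c d ψ i + Q.adj a c d φ i := by
  rw [adj_eq_cls hQ hψ, adj_eq_cls hQ hφ, adj_eq_cls hQ (ψ := ψ + φ) fun i => (hψ i).add (hφ i),
    ← cls_add (memLp_strip (continuous_adjFun hQ hψ i) 2) (memLp_strip (continuous_adjFun hQ hφ i) 2)]
  congr 1; ext x
  have e (j) : fderiv ℝ (ψ j + φ j) x = fderiv ℝ (ψ j) x + fderiv ℝ (φ j) x :=
    fderiv_add ((hψ j).differentiableAt x) ((hφ j).differentiableAt x)
  simp only [adjFun, dT, dS, e, _root_.add_apply, Pi.add_apply, Fin.sum_univ_two]; ring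

theorem adj_smul (hQ : Q.IsAccretive a c d c₀) {ψ : Fin 2 → ℝ² → ℝ} (hψ : ∀ i, IsTestFun a (ψ i))
    (k : ℝ) (i : Fin 2) : Q.adj a c d (k • ψ) i = k • Q.adj a c d ψ i := by
  rw [adj_eq_cls hQ hψ, adj_eq_cls hQ (ψ := k • ψ) fun i => (IsTestFun.const a k).mul (hψ i),
    ← cls_smul (memLp_strip (continuous_adjFun hQ hψ i) 2)]
  congr 1; ext x
  have e (j) : fderiv ℝ (k • ψ j) x = k • fderiv ℝ (ψ j) x :=
    fderiv_const_mul ((hψ j).differentiableAt x) k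
  simp only [adjFun, dT, dS, e, _root_.smul_apply, Pi.smul_apply, Fin.sum_univ_two, smul_eq_mul]; ring

variable [Fact (0 < a)]

/-- Weak solutions exist, by duality with the energy estimate for the adjoint. -/
theorem exists_isWeak (hQ : Q.IsAccretive a c d c₀) (hcd : c ≤ d)
    (g : Fin 2 → StripL2 a c d) (p q : PerL2 a) :
    ∃ y, Q.IsWeak a c d y g p q := by
  let V : Submodule ℝ (Fin 2 → ℝ² → ℝ) :=
    { carrier := {ψ | (∀ i, IsTestFun a (ψ i)) ∧ (∀ t, ψ 0 (t, c) = 0) ∧ ∀ t, ψ 1 (t, d) = 0}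
      add_mem' := fun {ψ φ} hψ hφ => ⟨fun i => (hψ.1 i).add (hφ.1 i),
        fun t => by simp [hψ.2.1 t, hφ.2.1 t], fun t => by simp [hψ.2.2 t, hφ.2.2 t]⟩
      zero_mem' := ⟨fun i => IsTestFun.const a 0, fun t => rfl, fun t => rfl⟩
      smul_mem' := fun k ψ hψ => ⟨fun i => (IsTestFun.const a k).mul (hψ.1 i),
        fun t => by simp [hψ.2.1 t], fun t => by simp [hψ.2.2 t]⟩ }
  let T : V →ₗ[ℝ] PiLp 2 (fun _ : Fin 2 => StripL2 a c d) :=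
    { toFun := fun ψ => WithLp.toLp 2 (Q.adj a c d ψ.1)
      map_add' := fun ψ φ => by ext1 i; exact adj_add hQ ψ.2.1 φ.2.1 i
      map_smul' := fun k ψ => by ext1 i; exact adj_smul hQ ψ.2.1 k i }
  let l : V →ₗ[ℝ] ℝ :=
    { toFun := fun ψ => ∑ i, inner ℝ (g i) (cls _ (ψ.1 i))
        - inner ℝ p (cls _ fun t => ψ.1 0 (t, d)) - inner ℝ q (cls _ fun t => ψ.1 1 (t, c))
      map_add' := fun ψ φ => by
        have c0 (j) : cls (stripVol a c d) ((ψ.1 + φ.1) j) = cls _ (ψ.1 j) + cls _ (φ.1 j) :=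
          cls_add ((ψ.2.1 j).memLp) ((φ.2.1 j).memLp)
        have c1 := cls_slice_add (ψ.2.1 0) (φ.2.1 0) d
        have c2 := cls_slice_add (ψ.2.1 1) (φ.2.1 1) c
        simp only [Submodule.coe_add, c0]
        rw [show (ψ.1 + φ.1) 0 = ψ.1 0 + φ.1 0 from rfl, c1,
          show (ψ.1 + φ.1) 1 = ψ.1 1 + φ.1 1 from rfl, c2]
        simp only [inner_add_right, Fin.sum_univ_two]
        ring
      map_smul' := fun k ψ => by
        have c0 (j) : cls (stripVol a c d) ((k • ψ.1) j) = k • cls _ (ψ.1 j) :=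
          cls_smul ((ψ.2.1 j).memLp) k
        have c1 := cls_slice_smul (ψ.2.1 0) k d
        have c2 := cls_slice_smul (ψ.2.1 1) k c
        simp only [Submodule.coe_smul, c0]
        rw [show (k • ψ.1) 0 = k • ψ.1 0 from rfl, c1, show (k • ψ.1) 1 = k • ψ.1 1 from rfl, c2]
        simp only [inner_smul_right, Fin.sum_univ_two, RingHom.id_apply, smul_eq_mul]
        ring }
  set A := 2 + 2 / c₀ + 1 / c₀ ^ 2
  have hpos := hQ.pos
  have hA : 0 ≤ A := by positivity
  have hb : ∀ v, |l v| ≤ ((‖g 0‖ + ‖g 1‖ + ‖p‖ + ‖q‖) * √A) * ‖T v‖ := by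
    intro ψ
    have hen := adj_energy hQ hcd ψ.2.1 ψ.2.2.1 ψ.2.2.2
    have hT : ∑ i, ‖Q.adj a c d ψ.1 i‖ ^ 2 = ‖T ψ‖ ^ 2 := by rw [PiLp.norm_sq_eq_of_L2]; rfl
    rw [hT] at hen
    have hsq (x : ℝ) (hx : x ^ 2 ≤ A * ‖T ψ‖ ^ 2) : x ≤ √A * ‖T ψ‖ := by
      refine le_of_sq_le_sq ?_ (by positivity)
      rwa [mul_pow, Real.sq_sqrt hA]
    simp only [Fin.sum_univ_two] at hen
    have n0 := sq_nonneg ‖cls (stripVol a c d) (ψ.1 0)‖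
    have n1 := sq_nonneg ‖cls (stripVol a c d) (ψ.1 1)‖
    have n2 := sq_nonneg ‖cls (perVol a) fun t => ψ.1 0 (t, d)‖
    have n3 := sq_nonneg ‖cls (perVol a) fun t => ψ.1 1 (t, c)‖
    have b0 := hsq ‖cls (stripVol a c d) (ψ.1 0)‖ (by linarith)
    have b1 := hsq ‖cls (stripVol a c d) (ψ.1 1)‖ (by linarith)
    have b2 := hsq ‖cls (perVol a) fun t => ψ.1 0 (t, d)‖ (by linarith)
    have b3 := hsq ‖cls (perVol a) fun t => ψ.1 1 (t, c)‖ (by linarith)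
    have hl : l ψ = inner ℝ (g 0) (cls _ (ψ.1 0)) + inner ℝ (g 1) (cls _ (ψ.1 1))
        - inner ℝ p (cls _ fun t => ψ.1 0 (t, d)) - inner ℝ q (cls _ fun t => ψ.1 1 (t, c)) := by
      simp only [l, LinearMap.coe_mk, AddHom.coe_mk, Fin.sum_univ_two]
    have i0 := (abs_real_inner_le_norm (g 0) (cls _ (ψ.1 0))).trans
      (mul_le_mul_of_nonneg_left b0 (norm_nonneg _))
    have i1 := (abs_real_inner_le_norm (g 1) (cls _ (ψ.1 1))).trans
      (mul_le_mul_of_nonneg_left b1 (norm_nonneg _))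
    have i2 := (abs_real_inner_le_norm p (cls _ fun t => ψ.1 0 (t, d))).trans
      (mul_le_mul_of_nonneg_left b2 (norm_nonneg _))
    have i3 := (abs_real_inner_le_norm q (cls _ fun t => ψ.1 1 (t, c))).trans
      (mul_le_mul_of_nonneg_left b3 (norm_nonneg _))
    rw [hl]
    refine ((abs_sub _ _).trans (add_le_add ((abs_sub _ _).trans
      (add_le_add (abs_add_le _ _) le_rfl)) le_rfl)).trans ?_
    linarith
  obtain ⟨y, hy⟩ := exists_inner_eq_of_bound T l hb
  refine ⟨y, fun ψ hψ h0 h1 => ?_⟩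
  have := hy ⟨ψ, hψ, h0, h1⟩
  rw [PiLp.inner_apply] at this
  exact this

/-- The notion `SymmSystem.IsWeak` for functions instead of classes of functions. -/
def IsWeakFun (Q : SymmSystem) (a c d : ℝ) (y g : Fin 2 → ℝ² → ℝ) (p q : ℝ → ℝ) : Prop :=
  ∀ ψ : Fin 2 → ℝ² → ℝ, (∀ i, IsTestFun a (ψ i)) → (∀ t, ψ 0 (t, c) = 0) → (∀ t, ψ 1 (t, d) = 0) →
    ∫ x, ∑ i, y i x * Q.adjFun ψ i x ∂stripVol a c d = ∫ x, ∑ i, g i x * ψ i x ∂stripVol a c d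
        - ∫ t, p t * ψ 0 (t, d) ∂perVol a - ∫ t, q t * ψ 1 (t, c) ∂perVol a

theorem sum_inner_cls {μ : Measure ℝ²} {f h : Fin 2 → ℝ² → ℝ} (hf : ∀ i, MemLp (f i) 2 μ)
    (hh : ∀ i, MemLp (h i) 2 μ) :
    ∑ i, inner ℝ (cls μ (f i)) (cls μ (h i)) = ∫ x, ∑ i, f i x * h i x ∂μ := by
  simp only [inner_cls_cls (hf _) (hh _)]
  exact (integral_finsetSum _ fun i _ => (hf i).integrable_mul (hh i)).symm

omit [Fact (0 < a)] in
theorem isWeak_cls_iff (hQ : Q.IsAccretive a c d c₀) {y g : Fin 2 → ℝ² → ℝ} {p q : ℝ → ℝ}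
    (hy : ∀ i, MemLp (y i) 2 (stripVol a c d)) (hg : ∀ i, MemLp (g i) 2 (stripVol a c d))
    (hp : MemLp p 2 (perVol a)) (hq : MemLp q 2 (perVol a)) :
    Q.IsWeak a c d (fun i => cls _ (y i)) (fun i => cls _ (g i)) (cls _ p) (cls _ q)
      ↔ Q.IsWeakFun a c d y g p q := by
  refine forall_congr' fun ψ => forall_congr' fun hψ => forall_congr' fun h0 =>
    forall_congr' fun h1 => ?_
  simp only [adj_eq_cls hQ hψ]
  rw [sum_inner_cls hy fun i => memLp_strip (continuous_adjFun hQ hψ i) 2,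
    sum_inner_cls hg fun i => memLp_strip (hψ i).continuous 2,
    inner_cls_cls hp (slice_memLp (hψ 0).continuous d), inner_cls_cls hq (slice_memLp (hψ 1).continuous c)]

theorem exists_isWeakFun (hQ : Q.IsAccretive a c d c₀) (hcd : c ≤ d) {g : Fin 2 → ℝ² → ℝ}
    {p q : ℝ → ℝ} (hg : ∀ i, MemLp (g i) 2 (stripVol a c d))
    (hp : MemLp p 2 (perVol a)) (hq : MemLp q 2 (perVol a)) :
    ∃ y : Fin 2 → ℝ² → ℝ, (∀ i, MemLp (y i) 2 (stripVol a c d)) ∧ Q.IsWeakFun a c d y g p q := by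
  obtain ⟨y, hy⟩ := exists_isWeak hQ hcd (fun i => cls _ (g i)) (cls _ p) (cls _ q)
  choose f hf hfy using fun i => exists_cls (y i)
  obtain rfl : (fun i => cls _ (f i)) = y := funext hfy
  exact ⟨f, hf, (isWeak_cls_iff hQ hf hg hp hq).mp hy⟩

theorem IsWeakFun.unique (hQ : Q.IsAccretive a c d c₀) (hcd : c ≤ d)
    {y y' g : Fin 2 → ℝ² → ℝ} {p q : ℝ → ℝ} (hg : ∀ i, MemLp (g i) 2 (stripVol a c d))
    (hp : MemLp p 2 (perVol a)) (hq : MemLp q 2 (perVol a))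
    (hy : ∀ i, MemLp (y i) 2 (stripVol a c d)) (hy' : ∀ i, MemLp (y' i) 2 (stripVol a c d))
    (h : Q.IsWeakFun a c d y g p q) (h' : Q.IsWeakFun a c d y' g p q) (i : Fin 2) :
    y' i =ᵐ[stripVol a c d] y i :=
  (cls_eq_iff (hy' i) (hy i)).mp (congrFun (((isWeak_cls_iff hQ hy hg hp hq).mpr h).unique hQ hcd
    ((isWeak_cls_iff hQ hy' hg hp hq).mpr h')) i)

theorem IsWeakFun.exists_traces (hQ : Q.IsAccretive a c d c₀) (hcd : c ≤ d)
    {y g : Fin 2 → ℝ² → ℝ} {p q : ℝ → ℝ} (hg : ∀ i, MemLp (g i) 2 (stripVol a c d))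
    (hp : MemLp p 2 (perVol a)) (hq : MemLp q 2 (perVol a))
    (hy : ∀ i, MemLp (y i) 2 (stripVol a c d)) (h : Q.IsWeakFun a c d y g p q) :
    ∃ y₁ y₀ : ℝ → ℝ, MemLp y₁ 2 (perVol a) ∧ MemLp y₀ 2 (perVol a) ∧
      (∀ ψ : Fin 2 → ℝ² → ℝ, (∀ i, IsTestFun a (ψ i)) →
        ∫ x, ∑ i, y i x * Q.adjFun ψ i x ∂stripVol a c d = ∫ x, ∑ i, g i x * ψ i x ∂stripVol a c d
            - ∫ t, (p t * ψ 0 (t, d) - y₁ t * ψ 1 (t, d)) ∂perVol a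
            + ∫ t, (y₀ t * ψ 0 (t, c) - q t * ψ 1 (t, c)) ∂perVol a) ∧
      ∫ x, ∑ i, y i x ^ 2 ∂stripVol a c d + ∫ t, y₀ t ^ 2 ∂perVol a + ∫ t, y₁ t ^ 2 ∂perVol a
        ≤ (2 + 2 / c₀ + 1 / c₀ ^ 2) * (∫ x, ∑ i, g i x ^ 2 ∂stripVol a c d
          + ∫ t, p t ^ 2 ∂perVol a + ∫ t, q t ^ 2 ∂perVol a) := by
  obtain ⟨yc, yd, e0, e1, hG, hE⟩ := ((isWeak_cls_iff hQ hy hg hp hq).mpr h).exists_traces hQ hcd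
  obtain ⟨y₁, m1, f1⟩ := exists_cls (yd 1)
  obtain ⟨y₀, m0, f0⟩ := exists_cls (yc 0)
  refine ⟨y₁, y₀, m1, m0, fun ψ hψ => ?_, ?_⟩
  · have := hG ψ hψ
    simp only [adj_eq_cls hQ hψ] at this
    rw [sum_inner_cls hy fun i => memLp_strip (continuous_adjFun hQ hψ i) 2,
      sum_inner_cls hg fun i => memLp_strip (hψ i).continuous 2] at this
    rw [this]
    simp only [Fin.sum_univ_two, sgnJ, Matrix.cons_val_zero, Matrix.cons_val_one,
      Matrix.cons_val_fin_one, e0, e1, ← f1, ← f0]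
    have i1 {f ψ : ℝ → ℝ} (hf : MemLp f 2 (perVol a)) (hψ : MemLp ψ 2 (perVol a)) :
        Integrable (fun t => f t * ψ t) (perVol a) := hf.integrable_mul hψ
    have b0 (s) := slice_memLp (a := a) (hψ 0).continuous s
    have b1 (s) := slice_memLp (a := a) (hψ 1).continuous s
    rw [inner_cls_cls hp (b0 d), inner_cls_cls m1 (b1 d), inner_cls_cls m0 (b0 c),
      inner_cls_cls hq (b1 c), integral_sub (i1 hp (b0 d)) (i1 m1 (b1 d)),
      integral_sub (i1 m0 (b0 c)) (i1 hq (b1 c))]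
    ring
  · simp only [norm_cls_sq (hy _), norm_cls_sq (hg _), norm_cls_sq hp, norm_cls_sq hq,
      Fin.sum_univ_two, e0, e1, ← f0, ← f1, norm_cls_sq m0, norm_cls_sq m1] at hE
    simp only [Fin.sum_univ_two]
    rw [integral_add (hy 0).integrable_sq (hy 1).integrable_sq,
      integral_add (hg 0).integrable_sq (hg 1).integrable_sq]
    have hp0 : 0 ≤ ∫ t, p t ^ 2 ∂perVol a := integral_nonneg fun t => sq_nonneg _
    have hq0 : 0 ≤ ∫ t, q t ^ 2 ∂perVol a := integral_nonneg fun t => sq_nonneg _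
    linarith

end SymmSystem

/-! ### The first fundamental form -/

section cross_product

theorem inner_E3 (u v : E3) : inner ℝ u v = u 0 * v 0 + u 1 * v 1 + u 2 * v 2 := by
  simp [PiLp.inner_apply, Fin.sum_univ_three, mul_comm]

theorem inner_cross_self_left (u v : E3) : inner ℝ (cross u v) u = 0 := by
  rw [inner_E3]; simp [cross]; ring

theorem inner_cross_self_right (u v : E3) : inner ℝ (cross u v) v = 0 := by
  rw [inner_E3]; simp [cross]; ring

theorem norm_cross_sq (u v : E3) :
    ‖cross u v‖ ^ 2 = inner ℝ u u * inner ℝ v v - inner ℝ u v ^ 2 := by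
  rw [← real_inner_self_eq_norm_sq]
  simp only [inner_E3]; simp [cross]; ring

theorem cross_cross_E3 (w u v : E3) :
    cross w (cross u v) = (inner ℝ w v : ℝ) • u - (inner ℝ w u : ℝ) • v := by
  ext i
  fin_cases i <;> simp [inner_E3, cross] <;> ring

theorem cross_smul_right (w u : E3) (k : ℝ) : cross w (k • u) = k • cross w u := by
  ext i
  fin_cases i <;> simp [cross] <;> ring

/-- Expansion of a vector in the basis `u, w, u × w`. -/
theorem smul_eq_basis_cross (u w v : E3) : (inner ℝ u u * inner ℝ w w - inner ℝ u w ^ 2) • v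
      = (inner ℝ w w * inner ℝ v u - inner ℝ u w * inner ℝ v w) • u
        + (inner ℝ u u * inner ℝ v w - inner ℝ u w * inner ℝ v u) • w
        + (inner ℝ v (cross u w) : ℝ) • cross u w := by
  simp only [inner_E3]
  ext i
  fin_cases i <;> simp [cross] <;> ring

end cross_product

namespace ParamSurface

variable {S : ParamSurface} {x : ℝ²}

/-- The density `√(det g)` of the surface measure. -/
def rt (S : ParamSurface) (x : ℝ²) : ℝ := √(S.gdet x)

/-- The coefficient `Π(α_t, α_t)` of the second fundamental form. -/
def h11 (S : ParamSurface) (x : ℝ²) : ℝ := inner ℝ (dT S.n x) (S.αt x)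

/-- The coefficient `Π(α_t, α_s)` of the second fundamental form. -/
def h12 (S : ParamSurface) (x : ℝ²) : ℝ := inner ℝ (dT S.n x) (S.αs x)

/-- The coefficient `Π(α_s, α_s)` of the second fundamental form. -/
def h22 (S : ParamSurface) (x : ℝ²) : ℝ := inner ℝ (dS S.n x) (S.αs x)

theorem rt_pos (hg : 0 < S.gdet x) : 0 < S.rt x := Real.sqrt_pos.mpr hg

theorem rt_sq (hg : 0 < S.gdet x) : S.rt x ^ 2 = S.gdet x := Real.sq_sqrt hg.le

theorem norm_cross_eq_rt (x) : ‖cross (S.αt x) (S.αs x)‖ = S.rt x := by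
  rw [rt, gdet, ← norm_cross_sq, Real.sqrt_sq (norm_nonneg _)]

theorem inner_n_αt (x) : inner ℝ (S.n x) (S.αt x) = 0 := by
  rw [n, real_inner_smul_left, inner_cross_self_left, mul_zero]

theorem inner_n_αs (x) : inner ℝ (S.n x) (S.αs x) = 0 := by
  rw [n, real_inner_smul_left, inner_cross_self_right, mul_zero]

theorem isTangent_αt (x) : S.IsTangent x (S.αt x) := by rw [IsTangent, real_inner_comm, inner_n_αt]

theorem isTangent_αs (x) : S.IsTangent x (S.αs x) := by rw [IsTangent, real_inner_comm, inner_n_αs]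

theorem IsTangent.add {u v : E3} (hu : S.IsTangent x u) (hv : S.IsTangent x v) :
    S.IsTangent x (u + v) := by
  rw [IsTangent] at *; rw [inner_add_left, hu, hv, add_zero]

theorem IsTangent.sub {u v : E3} (hu : S.IsTangent x u) (hv : S.IsTangent x v) :
    S.IsTangent x (u - v) := by
  rw [IsTangent] at *; rw [inner_sub_left, hu, hv, sub_zero]

theorem IsTangent.smul {u : E3} (hu : S.IsTangent x u) (k : ℝ) : S.IsTangent x (k • u) := by
  rw [IsTangent] at *; rw [real_inner_smul_left, hu, mul_zero]

theorem inner_n_self (hτ : S.τ ^ 2 = 1) (hg : 0 < S.gdet x) : inner ℝ (S.n x) (S.n x) = 1 := by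
  have := (rt_pos hg).ne'
  rw [n, real_inner_smul_left, real_inner_smul_right, real_inner_self_eq_norm_sq, norm_cross_eq_rt]
  field_simp; exact hτ

theorem isTangent_rot (x v) : S.IsTangent x (S.rot x v) := by
  rw [IsTangent, rot, inner_cross_self_right]

theorem coordT_add (x u v) : S.coordT x (u + v) = S.coordT x u + S.coordT x v := by
  simp only [coordT, inner_add_left]; ring

theorem coordS_add (x u v) : S.coordS x (u + v) = S.coordS x u + S.coordS x v := by
  simp only [coordS, inner_add_left]; ring

theorem coordT_sub (x u v) : S.coordT x (u - v) = S.coordT x u - S.coordT x v := by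
  simp only [coordT, inner_sub_left]; ring

theorem coordS_sub (x u v) : S.coordS x (u - v) = S.coordS x u - S.coordS x v := by
  simp only [coordS, inner_sub_left]; ring

theorem coordT_neg (x u) : S.coordT x (-u) = -S.coordT x u := by
  simp only [coordT, inner_neg_left]; ring

theorem coordS_neg (x u) : S.coordS x (-u) = -S.coordS x u := by
  simp only [coordS, inner_neg_left]; ring

theorem coordT_smul (x) (k : ℝ) (u) : S.coordT x (k • u) = k * S.coordT x u := by
  simp only [coordT, real_inner_smul_left]; ring

theorem coordS_smul (x) (k : ℝ) (u) : S.coordS x (k • u) = k * S.coordS x u := by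
  simp only [coordS, real_inner_smul_left]; ring

theorem coordT_αt (hg : 0 < S.gdet x) : S.coordT x (S.αt x) = 1 := by
  rw [coordT, div_eq_one_iff_eq hg.ne', gdet]; ring

theorem coordS_αt (x) : S.coordS x (S.αt x) = 0 := by rw [coordS, div_eq_zero_iff]; left; ring

theorem coordT_αs (x) : S.coordT x (S.αs x) = 0 := by
  rw [coordT, div_eq_zero_iff]; left; rw [real_inner_comm (S.αt x)]; ring

theorem coordS_αs (hg : 0 < S.gdet x) : S.coordS x (S.αs x) = 1 := by
  have h := real_inner_comm (S.αt x) (S.αs x)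
  rw [coordS, div_eq_one_iff_eq hg.ne', gdet, h]; ring

theorem inner_αt_eq (hg : 0 < S.gdet x) (v : E3) : inner ℝ v (S.αt x)
    = inner ℝ (S.αt x) (S.αt x) * S.coordT x v + inner ℝ (S.αt x) (S.αs x) * S.coordS x v := by
  have := hg.ne'
  rw [coordT, coordS]; field_simp; rw [gdet]; ring

theorem inner_αs_eq (hg : 0 < S.gdet x) (v : E3) : inner ℝ v (S.αs x)
    = inner ℝ (S.αt x) (S.αs x) * S.coordT x v + inner ℝ (S.αs x) (S.αs x) * S.coordS x v := by
  have := hg.ne'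
  rw [coordT, coordS]; field_simp; rw [gdet]; ring

theorem IsTangent.eq_coord (hτ : S.τ ^ 2 = 1) (hg : 0 < S.gdet x) {v : E3}
    (hv : S.IsTangent x v) : v = S.coordT x v • S.αt x + S.coordS x v • S.αs x := by
  have h := smul_eq_basis_cross (S.αt x) (S.αs x) v
  have h0 : inner ℝ v (cross (S.αt x) (S.αs x)) = 0 := by
    rw [IsTangent, n, real_inner_smul_right, norm_cross_eq_rt] at hv
    have hτ0 : S.τ ≠ 0 := fun h => by simp [h] at hτ
    have := (rt_pos hg).ne'
    simpa [hτ0, this] using hv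
  rw [h0, zero_smul, add_zero, ← gdet] at h
  have h2 := congrArg (fun w => (S.gdet x)⁻¹ • w) h
  simp only [smul_smul, smul_add, inv_mul_cancel₀ hg.ne', one_smul] at h2
  rw [coordT, coordS, div_eq_inv_mul, div_eq_inv_mul]
  exact h2

theorem rot_eq (v : E3) : S.rot x v
    = (S.τ / S.rt x) • ((inner ℝ v (S.αs x) : ℝ) • S.αt x - (inner ℝ v (S.αt x) : ℝ) • S.αs x) := by
  rw [rot, n, cross_smul_right, cross_cross_E3, norm_cross_eq_rt]

theorem coordT_rot (hg : 0 < S.gdet x) (v : E3) :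
    S.rt x * S.coordT x (S.rot x v) = S.τ * inner ℝ v (S.αs x) := by
  have := (rt_pos hg).ne'
  rw [rot_eq, coordT_smul, coordT_sub, coordT_smul, coordT_smul, coordT_αt hg, coordT_αs]
  field_simp; ring

theorem coordS_rot (hg : 0 < S.gdet x) (v : E3) :
    S.rt x * S.coordS x (S.rot x v) = -(S.τ * inner ℝ v (S.αt x)) := by
  have := (rt_pos hg).ne'
  rw [rot_eq, coordS_smul, coordS_sub, coordS_smul, coordS_smul, coordS_αt, coordS_αs hg]
  field_simp; ring

theorem inner_rot_eq (hg : 0 < S.gdet x) (w v : E3) : inner ℝ w (S.rot x v)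
    = S.τ * S.rt x * (S.coordT x w * S.coordS x v - S.coordS x w * S.coordT x v) := by
  have := (rt_pos hg).ne'
  rw [rot_eq, real_inner_smul_right, inner_sub_right, real_inner_smul_right,
    real_inner_smul_right, inner_αt_eq hg w, inner_αs_eq hg w, inner_αt_eq hg v, inner_αs_eq hg v]
  field_simp
  rw [rt_sq hg, gdet]; ring

theorem inner_rot_comm (hg : 0 < S.gdet x) (w v : E3) :
    inner ℝ w (S.rot x v) = -inner ℝ (S.rot x w) v := by
  rw [real_inner_comm v, inner_rot_eq hg, inner_rot_eq hg]; ring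

theorem rot_rot (hτ : S.τ ^ 2 = 1) (hg : 0 < S.gdet x) {v : E3} (hv : S.IsTangent x v) :
    S.rot x (S.rot x v) = -v := by
  have h0 := (rt_pos hg).ne'
  have e1 := coordT_rot hg (S.rot x v)
  have e2 := coordS_rot hg (S.rot x v)
  have f1 := coordT_rot hg v
  have f2 := coordS_rot hg v
  rw [inner_αs_eq hg] at e1 f1
  rw [inner_αt_eq hg] at e2 f2
  have hr := rt_sq hg
  rw [(isTangent_rot x (S.rot x v)).eq_coord hτ hg]
  nth_rw 3 [hv.eq_coord hτ hg]
  have k1 : S.coordT x (S.rot x (S.rot x v)) = -S.coordT x v := by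
    have : S.rt x ^ 2 * S.coordT x (S.rot x (S.rot x v)) = S.rt x ^ 2 * -S.coordT x v := by
      have : S.rt x ^ 2 * S.coordT x (S.rot x (S.rot x v)) = S.τ * (inner ℝ (S.αt x) (S.αs x) *
        (S.rt x * S.coordT x (S.rot x v))
        + inner ℝ (S.αs x) (S.αs x) * (S.rt x * S.coordS x (S.rot x v))) := by
        linear_combination S.rt x * e1
      rw [this, f1, f2, hr, gdet]
      linear_combination (-(inner ℝ (S.αt x) (S.αt x) * inner ℝ (S.αs x) (S.αs x))
        + inner ℝ (S.αt x) (S.αs x) ^ 2) * S.coordT x v * hτ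
    exact mul_left_cancel₀ (pow_ne_zero 2 h0) this
  have k2 : S.coordS x (S.rot x (S.rot x v)) = -S.coordS x v := by
    have : S.rt x ^ 2 * S.coordS x (S.rot x (S.rot x v)) = S.rt x ^ 2 * -S.coordS x v := by
      have : S.rt x ^ 2 * S.coordS x (S.rot x (S.rot x v)) = -(S.τ * (inner ℝ (S.αt x) (S.αt x) *
        (S.rt x * S.coordT x (S.rot x v))
        + inner ℝ (S.αt x) (S.αs x) * (S.rt x * S.coordS x (S.rot x v)))) := by
        linear_combination S.rt x * e2
      rw [this, f1, f2, hr, gdet]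
      linear_combination (-(inner ℝ (S.αt x) (S.αt x) * inner ℝ (S.αs x) (S.αs x))
        + inner ℝ (S.αt x) (S.αs x) ^ 2) * S.coordS x v * hτ
    exact mul_left_cancel₀ (pow_ne_zero 2 h0) this
  rw [k1, k2]; simp only [neg_smul]; abel

theorem inner_grad_eq (hg : 0 < S.gdet x) (f : ℝ² → ℝ) (v : E3) :
    inner ℝ v (S.grad f x) = S.coordT x v * dT f x + S.coordS x v * dS f x := by
  have := hg.ne'
  rw [grad, inner_add_right, real_inner_smul_right, real_inner_smul_right, coordT, coordS]
  field_simp; ring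

theorem det3_eq (hg : 0 < S.gdet x) : det3 (S.αt x) (S.αs x) (S.n x) = S.τ * S.rt x := by
  rw [← inner_rot, inner_rot_eq hg, coordT_αt hg, coordS_αs hg, coordS_αt, coordT_αs]; ring

theorem αt_ne_zero (hg : 0 < S.gdet x) : S.αt x ≠ 0 := fun h => by simp [gdet, h] at hg

theorem norm_αt_pos (hg : 0 < S.gdet x) : 0 < ‖S.αt x‖ := norm_pos_iff.mpr (αt_ne_zero hg)

/-- The normal component of a field along a coordinate curve `s = const`, times the line
element `‖α_t‖`, is the flux `√(det g) · U^s`. -/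
theorem norm_mul_inner_conormal (hg : 0 < S.gdet x) (u : E3) :
    ‖S.αt x‖ * inner ℝ u (S.conormal x) = S.rt x * S.coordS x u := by
  have hN := norm_αt_pos hg
  have hr := rt_pos hg
  have h11 : inner ℝ (S.αt x) (S.αt x) = ‖S.αt x‖ ^ 2 := real_inner_self_eq_norm_sq _
  set w := S.αs x - (inner ℝ (S.αt x) (S.αs x) / inner ℝ (S.αt x) (S.αt x)) • S.αt x with hw
  have hu (u : E3) : inner ℝ u w * ‖S.αt x‖ ^ 2 = S.rt x ^ 2 * S.coordS x u := by
    rw [hw, inner_sub_right, real_inner_smul_right, rt_sq hg, coordS, h11]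
    field_simp
  have hs : ‖w‖ ^ 2 * ‖S.αt x‖ ^ 2 = S.rt x ^ 2 := by
    have := hu w
    rw [real_inner_self_eq_norm_sq] at this
    rw [this]
    rw [hw, coordS_sub, coordS_smul, coordS_αs hg, coordS_αt]; ring
  have hn : ‖w‖ * ‖S.αt x‖ = S.rt x := by
    rw [← mul_pow] at hs
    exact (sq_eq_sq₀ (by positivity) hr.le).mp hs
  have hw0 : 0 < ‖w‖ := by
    rcases (norm_nonneg w).eq_or_lt with h | h
    · rw [← h] at hn; simp at hn; linarith
    · exact h
  have hc : S.conormal x = ‖w‖⁻¹ • w := rfl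
  rw [hc, real_inner_smul_right]
  have := hu u
  field_simp
  refine mul_left_cancel₀ hN.ne' ?_
  calc ‖S.αt x‖ * (‖S.αt x‖ * inner ℝ u w) = S.rt x * (S.rt x * S.coordS x u) := by
        linear_combination this
    _ = ‖S.αt x‖ * (‖w‖ * (S.rt x * S.coordS x u)) := by
        linear_combination -(S.rt x * S.coordS x u) * hn
    _ = _ := by ring

theorem inner_conormal_αt (hg : 0 < S.gdet x) : inner ℝ (S.conormal x) (S.αt x) = 0 := by
  have h := norm_mul_inner_conormal hg (S.αt x)
  rw [coordS_αt, mul_zero] at h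
  rw [real_inner_comm]
  exact (mul_eq_zero.mp h).resolve_left (norm_αt_pos hg).ne'

/-- The rotated conormal is the unit tangent vector of the coordinate curve, up to sign. -/
theorem rot_conormal (hg : 0 < S.gdet x) : S.rot x (S.conormal x) = (S.τ / ‖S.αt x‖) • S.αt x := by
  have h := norm_mul_inner_conormal hg (S.αs x)
  rw [coordS_αs hg, mul_one] at h
  have hN := (norm_αt_pos hg).ne'
  have hr := (rt_pos hg).ne'
  rw [rot_eq, inner_conormal_αt hg, zero_smul, sub_zero, smul_smul, real_inner_comm, ← h]
  congr 1
  rw [← h] at hr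
  have := right_ne_zero_of_mul hr
  field_simp

end ParamSurface

/-! ### The second fundamental form -/

section periodic_derivative

variable {G : Type*} [NormedAddCommGroup G] [NormedSpace ℝ G] {f : ℝ² → G}

/-- The derivative of a function that is periodic in `t` for `s > r` is periodic there, too. -/
theorem fderiv_periodic {a r : ℝ} (h : ∀ t, ∀ s, r < s → f (t + a, s) = f (t, s)) (t : ℝ) {s : ℝ}
    (hs : r < s) : fderiv ℝ f (t + a, s) = fderiv ℝ f (t, s) := by
  have := fderiv_shift (f := f) a (t, s)
  rw [← this]
  refine Filter.EventuallyEq.fderiv_eq ?_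
  have : ∀ᶠ y : ℝ² in 𝓝 (t, s), r < y.2 := continuousAt_snd.eventually (lt_mem_nhds hs)
  filter_upwards [this] with y hy using h y.1 y.2 hy

theorem contDiffAt_dT {x : ℝ²} {n m : WithTop ℕ∞} (h : ContDiffAt ℝ n f x) (hmn : m + 1 ≤ n) :
    ContDiffAt ℝ m (dT f) x := (h.fderiv_right hmn).clm_apply contDiffAt_const

theorem contDiffAt_dS {x : ℝ²} {n m : WithTop ℕ∞} (h : ContDiffAt ℝ n f x) (hmn : m + 1 ≤ n) :
    ContDiffAt ℝ m (dS f) x := (h.fderiv_right hmn).clm_apply contDiffAt_const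

theorem dT_inner {f g : ℝ² → E3} {x : ℝ²} (hf : DifferentiableAt ℝ f x)
    (hg : DifferentiableAt ℝ g x) :
    dT (fun y => (inner ℝ (f y) (g y) : ℝ)) x = inner ℝ (f x) (dT g x) + inner ℝ (dT f x) (g x) := by
  rw [dT, fderiv_inner_apply ℝ hf hg]; rfl

theorem dS_inner {f g : ℝ² → E3} {x : ℝ²} (hf : DifferentiableAt ℝ f x)
    (hg : DifferentiableAt ℝ g x) :
    dS (fun y => (inner ℝ (f y) (g y) : ℝ)) x = inner ℝ (f x) (dS g x) + inner ℝ (dS f x) (g x) := by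
  rw [dS, fderiv_inner_apply ℝ hf hg]; rfl

theorem ContDiffAt.cross {f g : ℝ² → E3} {x : ℝ²} {n : WithTop ℕ∞}
    (hf : ContDiffAt ℝ n f x) (hg : ContDiffAt ℝ n g x) :
    ContDiffAt ℝ n (fun y => cross (f y) (g y)) x := by
  rw [contDiffAt_euclidean] at *
  intro i
  fin_cases i
  · exact ((hf 1).mul (hg 2)).sub ((hf 2).mul (hg 1))
  · exact ((hf 2).mul (hg 0)).sub ((hf 0).mul (hg 2))
  · exact ((hf 0).mul (hg 1)).sub ((hf 1).mul (hg 0))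

/-- The mixed second derivatives coincide. -/
theorem dT_dS_comm {x : ℝ²} (h : ContDiffAt ℝ 2 f x) : dT (dS f) x = dS (dT f) x := by
  have hs := h.isSymmSndFDerivAt (by simp)
  have hd : DifferentiableAt ℝ (fderiv ℝ f) x :=
    (h.fderiv_right (m := 1) le_rfl).differentiableAt one_ne_zero
  have key (v w : ℝ²) : fderiv ℝ (fun y => fderiv ℝ f y v) x w = fderiv ℝ (fderiv ℝ f) x w v := by
    rw [fderiv_clm_apply hd (differentiableAt_const v)]; simp
  change fderiv ℝ (fun y => fderiv ℝ f y (0, 1)) x (1, 0)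
    = fderiv ℝ (fun y => fderiv ℝ f y (1, 0)) x (0, 1)
  rw [key, key]; exact hs _ _

end periodic_derivative

namespace ParamSurface

variable {S : ParamSurface} {x : ℝ²}

section smoothness

theorem contDiffAt_αt (h : ContDiff ℝ 3 S.α) : ContDiffAt ℝ 2 S.αt x :=
  contDiffAt_dT h.contDiffAt le_rfl

theorem contDiffAt_αs (h : ContDiff ℝ 3 S.α) : ContDiffAt ℝ 2 S.αs x :=
  contDiffAt_dS h.contDiffAt le_rfl

theorem contDiffAt_gdet (h : ContDiff ℝ 3 S.α) : ContDiffAt ℝ 2 S.gdet x :=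
  (((contDiffAt_αt h).inner ℝ (contDiffAt_αt h)).mul
    ((contDiffAt_αs h).inner ℝ (contDiffAt_αs h))).sub
    (((contDiffAt_αt h).inner ℝ (contDiffAt_αs h)).pow 2)

variable (h : ContDiff ℝ 3 S.α) (hg : 0 < S.gdet x)
include h hg

theorem contDiffAt_rt : ContDiffAt ℝ 2 S.rt x := (contDiffAt_gdet h).sqrt hg.ne'

theorem contDiffAt_n : ContDiffAt ℝ 2 S.n x := by
  have e : S.n = fun x => (S.τ / S.rt x) • cross (S.αt x) (S.αs x) := by
    ext1 x; rw [n, norm_cross_eq_rt]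
  rw [e]
  exact (contDiffAt_const.div (contDiffAt_rt h hg) (rt_pos hg).ne').smul
    ((contDiffAt_αt h).cross (contDiffAt_αs h))

theorem contDiffAt_dT_n : ContDiffAt ℝ 1 (dT S.n) x := contDiffAt_dT (contDiffAt_n h hg) le_rfl

theorem contDiffAt_dS_n : ContDiffAt ℝ 1 (dS S.n) x := contDiffAt_dS (contDiffAt_n h hg) le_rfl

theorem contDiffAt_h11 : ContDiffAt ℝ 1 S.h11 x :=
  (contDiffAt_dT_n h hg).inner ℝ ((contDiffAt_αt h).of_le one_le_two)

theorem contDiffAt_h12 : ContDiffAt ℝ 1 S.h12 x :=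
  (contDiffAt_dT_n h hg).inner ℝ ((contDiffAt_αs h).of_le one_le_two)

theorem contDiffAt_h22 : ContDiffAt ℝ 1 S.h22 x :=
  (contDiffAt_dS_n h hg).inner ℝ ((contDiffAt_αs h).of_le one_le_two)

variable {V : ℝ² → E3}

theorem contDiffAt_coordT (hV : ContDiffAt ℝ 1 V x) :
    ContDiffAt ℝ 1 (fun y => S.coordT y (V y)) x := by
  have ht := (contDiffAt_αt (x := x) h).of_le one_le_two
  have hs := (contDiffAt_αs (x := x) h).of_le one_le_two
  exact (((hs.inner ℝ hs).mul (hV.inner ℝ ht)).sub ((ht.inner ℝ hs).mul (hV.inner ℝ hs))).div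
    ((contDiffAt_gdet h).of_le one_le_two) hg.ne'

theorem contDiffAt_coordS (hV : ContDiffAt ℝ 1 V x) :
    ContDiffAt ℝ 1 (fun y => S.coordS y (V y)) x := by
  have ht := (contDiffAt_αt (x := x) h).of_le one_le_two
  have hs := (contDiffAt_αs (x := x) h).of_le one_le_two
  exact (((ht.inner ℝ ht).mul (hV.inner ℝ hs)).sub ((ht.inner ℝ hs).mul (hV.inner ℝ ht))).div
    ((contDiffAt_gdet h).of_le one_le_two) hg.ne'

theorem contDiffAt_shape (hV : ContDiffAt ℝ 1 V x) : ContDiffAt ℝ 1 (fun y => S.shape y (V y)) x :=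
  ((contDiffAt_coordT h hg hV).smul (contDiffAt_dT_n h hg)).add
    ((contDiffAt_coordS h hg hV).smul (contDiffAt_dS_n h hg))

theorem contDiffAt_rot (hV : ContDiffAt ℝ 1 V x) : ContDiffAt ℝ 1 (fun y => S.rot y (V y)) x :=
  hV.cross ((contDiffAt_n h hg).of_le one_le_two)

theorem eventually_gdet_pos : ∀ᶠ y in 𝓝 x, 0 < S.gdet y :=
  (contDiffAt_gdet h).continuousAt.eventually (lt_mem_nhds hg)

end smoothness

section second_fundamental_form

theorem inner_dT_n_self (hτ : S.τ ^ 2 = 1) (h : ContDiff ℝ 3 S.α) (hg : 0 < S.gdet x) :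
    inner ℝ (dT S.n x) (S.n x) = 0 := by
  have hd := (contDiffAt_n h hg).differentiableAt two_ne_zero
  have h1 := dT_inner hd hd
  have h2 : (fun y => (inner ℝ (S.n y) (S.n y) : ℝ)) =ᶠ[𝓝 x] fun _ => 1 := by
    filter_upwards [eventually_gdet_pos h hg] with y hy using inner_n_self hτ hy
  rw [dT, h2.fderiv_eq, real_inner_comm] at h1
  simp at h1; linarith

theorem inner_dS_n_self (hτ : S.τ ^ 2 = 1) (h : ContDiff ℝ 3 S.α) (hg : 0 < S.gdet x) :
    inner ℝ (dS S.n x) (S.n x) = 0 := by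
  have hd := (contDiffAt_n h hg).differentiableAt two_ne_zero
  have h1 := dS_inner hd hd
  have h2 : (fun y => (inner ℝ (S.n y) (S.n y) : ℝ)) =ᶠ[𝓝 x] fun _ => 1 := by
    filter_upwards [eventually_gdet_pos h hg] with y hy using inner_n_self hτ hy
  rw [dS, h2.fderiv_eq, real_inner_comm] at h1
  simp at h1; linarith

/-- The second fundamental form is symmetric. -/
theorem inner_dS_n_αt (h : ContDiff ℝ 3 S.α) (hg : 0 < S.gdet x) :
    inner ℝ (dS S.n x) (S.αt x) = S.h12 x := by
  have hd := (contDiffAt_n h hg).differentiableAt two_ne_zero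
  have h1 := dT_inner hd ((contDiffAt_αs (x := x) h).differentiableAt two_ne_zero)
  have h2 := dS_inner hd ((contDiffAt_αt (x := x) h).differentiableAt two_ne_zero)
  have e1 : (fun y => (inner ℝ (S.n y) (S.αs y) : ℝ)) = fun _ => 0 := funext fun y => inner_n_αs y
  have e2 : (fun y => (inner ℝ (S.n y) (S.αt y) : ℝ)) = fun _ => 0 := funext fun y => inner_n_αt y
  have e3 : dT S.αs x = dS S.αt x := dT_dS_comm (h.contDiffAt.of_le (by norm_num))
  rw [e1, dT, e3] at h1
  rw [e2, dS] at h2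
  simp at h1 h2
  rw [h12]; linarith

theorem isTangent_shape (hτ : S.τ ^ 2 = 1) (h : ContDiff ℝ 3 S.α) (hg : 0 < S.gdet x) (v : E3) :
    S.IsTangent x (S.shape x v) := by
  rw [IsTangent, shape, dirDeriv, inner_add_left, real_inner_smul_left, real_inner_smul_left,
    inner_dT_n_self hτ h hg, inner_dS_n_self hτ h hg]; simp

theorem inner_shape_αt (h : ContDiff ℝ 3 S.α) (hg : 0 < S.gdet x) (v : E3) :
    inner ℝ (S.shape x v) (S.αt x) = S.h11 x * S.coordT x v + S.h12 x * S.coordS x v := by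
  rw [shape, dirDeriv, inner_add_left, real_inner_smul_left, real_inner_smul_left,
    inner_dS_n_αt h hg, h11]; ring

theorem inner_shape_αs (v : E3) :
    inner ℝ (S.shape x v) (S.αs x) = S.h12 x * S.coordT x v + S.h22 x * S.coordS x v := by
  rw [shape, dirDeriv, inner_add_left, real_inner_smul_left, real_inner_smul_left, h12, h22]; ring

theorem inner_shape_eq (hτ : S.τ ^ 2 = 1) (h : ContDiff ℝ 3 S.α) (hg : 0 < S.gdet x) {w : E3}
    (hw : S.IsTangent x w) (v : E3) : inner ℝ w (S.shape x v)
      = S.coordT x w * (S.h11 x * S.coordT x v + S.h12 x * S.coordS x v)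
        + S.coordS x w * (S.h12 x * S.coordT x v + S.h22 x * S.coordS x v) := by
  nth_rw 1 [hw.eq_coord hτ hg]
  rw [inner_add_left, real_inner_smul_left, real_inner_smul_left, real_inner_comm,
    inner_shape_αt h hg, real_inner_comm, inner_shape_αs]

theorem inner_shape_comm (hτ : S.τ ^ 2 = 1) (h : ContDiff ℝ 3 S.α) (hg : 0 < S.gdet x) {v w : E3}
    (hv : S.IsTangent x v) (hw : S.IsTangent x w) :
    inner ℝ w (S.shape x v) = inner ℝ (S.shape x w) v := by
  rw [real_inner_comm v, inner_shape_eq hτ h hg hw, inner_shape_eq hτ h hg hv]; ring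

theorem shape_add (u v) : S.shape x (u + v) = S.shape x u + S.shape x v := by
  simp only [shape, dirDeriv, coordT_add, coordS_add, add_smul]; abel

theorem shape_smul (k : ℝ) (v) : S.shape x (k • v) = k • S.shape x v := by
  simp only [shape, dirDeriv, coordT_smul, coordS_smul, mul_smul, smul_add]

theorem sff_αt_αt (hg : 0 < S.gdet x) : S.sff x (S.αt x) (S.αt x) = S.h11 x := by
  rw [sff, shape, dirDeriv, coordT_αt hg, coordS_αt]; simp [h11]

theorem curv_eq (h : ContDiff ℝ 3 S.α) (hg : 0 < S.gdet x) :
    S.curv x = (S.h11 x * S.h22 x - S.h12 x ^ 2) / S.gdet x := by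
  rw [curv, sff_αt_αt hg, sff, sff, sff, inner_shape_αt h hg, inner_shape_αs, inner_shape_αs,
    coordT_αt hg, coordS_αt, coordT_αs, coordS_αs hg]
  congr 1; ring

theorem contDiffAt_curv (h : ContDiff ℝ 3 S.α) (hg : 0 < S.gdet x) : ContDiffAt ℝ 1 S.curv x := by
  have : ContDiffAt ℝ 1 (fun x => (S.h11 x * S.h22 x - S.h12 x ^ 2) / S.gdet x) x :=
    (((contDiffAt_h11 h hg).mul (contDiffAt_h22 h hg)).sub ((contDiffAt_h12 h hg).pow 2)).div
      ((contDiffAt_gdet h).of_le one_le_two) hg.ne'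
  refine this.congr_of_eventuallyEq ?_
  filter_upwards [eventually_gdet_pos h hg] with y hy using curv_eq h hy

end second_fundamental_form


theorem gdet_pos_of_linearIndependent (h : LinearIndependent ℝ ![S.αt x, S.αs x]) :
    0 < S.gdet x := by
  have h0 : 0 ≤ S.gdet x := by rw [gdet, ← norm_cross_sq]; positivity
  refine lt_of_le_of_ne h0 fun hz => ?_
  set g11 : ℝ := inner ℝ (S.αt x) (S.αt x) with h11
  set g12 : ℝ := inner ℝ (S.αt x) (S.αs x) with h12
  have hv : (-g12) • S.αt x + g11 • S.αs x = 0 := by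
    rw [← norm_eq_zero, ← sq_eq_zero_iff, ← real_inner_self_eq_norm_sq]
    simp only [inner_add_left, inner_add_right, real_inner_smul_left, real_inner_smul_right,
      real_inner_comm (S.αt x) (S.αs x), ← h11]
    rw [← h12]
    rw [gdet] at hz
    linear_combination (-g11) * hz
  have := (LinearIndependent.pair_iff.mp h) _ _ hv
  have h1 : S.αt x = 0 := inner_self_eq_zero.mp (this.2 ▸ rfl : (inner ℝ (S.αt x) (S.αt x) : ℝ) = 0)
  have := LinearIndependent.ne_zero 0 h
  exact this h1

end ParamSurface

/-! ### Fields of class `C¹` near a closed strip -/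

/-- `f` is of class `C¹` near the closed strip `c ≤ s ≤ d`, and `a`-periodic in `t` for `s > r`. -/
structure IsC1Near (a c d r : ℝ) {G : Type*} [NormedAddCommGroup G] [NormedSpace ℝ G]
    (f : ℝ² → G) : Prop where
  contDiffAt : ∀ t, ∀ s ∈ Icc c d, ContDiffAt ℝ 1 f (t, s)
  periodic : ∀ t s, r < s → f (t + a, s) = f (t, s)

namespace IsC1Near

variable {a c d r : ℝ} {G : Type*} [NormedAddCommGroup G] [NormedSpace ℝ G]

theorem of_test {χ : ℝ² → ℝ} (h : IsTestFun a χ) : IsC1Near a c d r χ :=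
  ⟨fun _ _ _ => h.contDiff.contDiffAt, fun t s _ => h.periodic t s⟩

theorem const (k : G) : IsC1Near a c d r fun _ => k := ⟨fun _ _ _ => contDiffAt_const, fun _ _ _ => rfl⟩

theorem neg {f : ℝ² → G} (hf : IsC1Near a c d r f) : IsC1Near a c d r fun x => -f x :=
  ⟨fun t s hs => (hf.contDiffAt t s hs).neg, fun t s hs => by simp [hf.periodic t s hs]⟩

theorem add {f g : ℝ² → G} (hf : IsC1Near a c d r f) (hg : IsC1Near a c d r g) :
    IsC1Near a c d r fun x => f x + g x :=
  ⟨fun t s hs => (hf.contDiffAt t s hs).add (hg.contDiffAt t s hs),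
    fun t s hs => by simp [hf.periodic t s hs, hg.periodic t s hs]⟩

theorem sub {f g : ℝ² → G} (hf : IsC1Near a c d r f) (hg : IsC1Near a c d r g) :
    IsC1Near a c d r fun x => f x - g x :=
  ⟨fun t s hs => (hf.contDiffAt t s hs).sub (hg.contDiffAt t s hs),
    fun t s hs => by simp [hf.periodic t s hs, hg.periodic t s hs]⟩

theorem smul {k : ℝ² → ℝ} {g : ℝ² → G} (hf : IsC1Near a c d r k) (hg : IsC1Near a c d r g) :
    IsC1Near a c d r fun x => k x • g x :=
  ⟨fun t s hs => (hf.contDiffAt t s hs).smul (hg.contDiffAt t s hs),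
    fun t s hs => by simp [hf.periodic t s hs, hg.periodic t s hs]⟩

theorem mul {f g : ℝ² → ℝ} (hf : IsC1Near a c d r f) (hg : IsC1Near a c d r g) :
    IsC1Near a c d r fun x => f x * g x := hf.smul hg

theorem inner {f g : ℝ² → E3} (hf : IsC1Near a c d r f) (hg : IsC1Near a c d r g) :
    IsC1Near a c d r fun x => (inner ℝ (f x) (g x) : ℝ) :=
  ⟨fun t s hs => (hf.contDiffAt t s hs).inner ℝ (hg.contDiffAt t s hs),
    fun t s hs => by simp [hf.periodic t s hs, hg.periodic t s hs]⟩

theorem inv {f : ℝ² → ℝ} (hf : IsC1Near a c d r f) (h0 : ∀ t, ∀ s ∈ Icc c d, f (t, s) ≠ 0) :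
    IsC1Near a c d r fun x => (f x)⁻¹ :=
  ⟨fun t s hs => (hf.contDiffAt t s hs).inv (h0 t s hs), fun t s hs => by simp [hf.periodic t s hs]⟩

theorem div {f g : ℝ² → ℝ} (hf : IsC1Near a c d r f) (hg : IsC1Near a c d r g)
    (h0 : ∀ t, ∀ s ∈ Icc c d, g (t, s) ≠ 0) : IsC1Near a c d r fun x => f x / g x := by
  simpa only [div_eq_mul_inv] using hf.mul (hg.inv h0)

theorem sqrt {f : ℝ² → ℝ} (hf : IsC1Near a c d r f) (h0 : ∀ t, ∀ s ∈ Icc c d, f (t, s) ≠ 0) :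
    IsC1Near a c d r fun x => √(f x) :=
  ⟨fun t s hs => (hf.contDiffAt t s hs).sqrt (h0 t s hs),
    fun t s hs => by simp [hf.periodic t s hs]⟩

theorem exp {f : ℝ² → ℝ} (hf : IsC1Near a c d r f) : IsC1Near a c d r fun x => Real.exp (f x) :=
  ⟨fun t s hs => (hf.contDiffAt t s hs).exp, fun t s hs => by simp [hf.periodic t s hs]⟩

section

variable {f : ℝ² → G} (hf : IsC1Near a c d r f)
include hf

theorem differentiableAt {t s : ℝ} (hs : s ∈ Icc c d) :
    DifferentiableAt ℝ f (t, s) := (hf.contDiffAt t s hs).differentiableAt one_ne_zero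

theorem continuousOn : ContinuousOn f (univ ×ˢ Icc c d) := fun x hx =>
  (hf.contDiffAt x.1 x.2 hx.2).continuousAt.continuousWithinAt

theorem continuousOn_dT : ContinuousOn (dT f) (univ ×ˢ Icc c d) := fun x hx =>
  (contDiffAt_dT (m := 0) (hf.contDiffAt x.1 x.2 hx.2) (by simp)).continuousAt.continuousWithinAt

theorem continuousOn_dS : ContinuousOn (dS f) (univ ×ˢ Icc c d) := fun x hx =>
  (contDiffAt_dS (m := 0) (hf.contDiffAt x.1 x.2 hx.2) (by simp)).continuousAt.continuousWithinAt

theorem dT_periodic (t : ℝ) {s : ℝ} (hs : r < s) : dT f (t + a, s) = dT f (t, s) := by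
  rw [dT, fderiv_periodic hf.periodic t hs]; rfl

theorem dS_periodic (t : ℝ) {s : ℝ} (hs : r < s) : dS f (t + a, s) = dS f (t, s) := by
  rw [dS, fderiv_periodic hf.periodic t hs]; rfl

end

/-- A function of class `C¹` near the closed strip coincides there with a periodic function of
class `C¹` on the plane. -/
theorem exists_extension {f : ℝ² → G} (hf : IsC1Near a c d r f) (ha : 0 < a) (hcd : c < d)
    (hr : r < c) : ∃ F : ℝ² → G, ContDiff ℝ 1 F ∧ (∀ t s, F (t + a, s) = F (t, s)) ∧
      ∀ t, ∀ s ∈ Icc c d, F =ᶠ[𝓝 (t, s)] f := by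
  set U : Set ℝ² := {x | ContDiffAt ℝ 1 f x} with hU
  have hUo : IsOpen U := isOpen_iff_mem_nhds.mpr fun x hx => by
    have h1 : ContDiffAt ℝ 1 f x := hx
    exact h1.eventually (by simp)
  obtain ⟨u, v, hu, hv, hau, hcv, huv⟩ := generalized_tube_lemma (s := Icc 0 a) (t := Icc c d)
    isCompact_Icc isCompact_Icc hUo (fun x hx => hf.contDiffAt x.1 x.2 hx.2)
  obtain ⟨δ₁, hδ₁, hδv⟩ := (isCompact_Icc (a := c) (b := d)).exists_thickening_subset_open hv hcv
  set δ := min δ₁ (c - r) with hδ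
  have hδ0 : 0 < δ := lt_min hδ₁ (by linarith)
  have hδr : δ ≤ c - r := min_le_right _ _
  -- smoothness in the enlarged strip
  have hsm (s : ℝ) (hs : s ∈ Ioo (c - δ) (d + δ)) : ∀ t, ContDiffAt ℝ 1 f (t, s) := by
    have hsv : s ∈ v := by
      refine hδv (Metric.mem_thickening_iff.mpr ?_)
      have hle : δ ≤ δ₁ := min_le_left _ _
      rcases le_or_gt s c with h | h
      · refine ⟨c, ⟨le_rfl, hcd.le⟩, ?_⟩
        rw [Real.dist_eq, abs_lt]; constructor <;> linarith [hs.1]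
      · rcases le_or_gt s d with h' | h'
        · exact ⟨s, ⟨h.le, h'⟩, by simpa using hδ₁⟩
        · refine ⟨d, ⟨hcd.le, le_rfl⟩, ?_⟩
          rw [Real.dist_eq, abs_lt]; constructor <;> linarith [hs.2]
    have h0 (t) (ht : t ∈ Icc 0 a) : ContDiffAt ℝ 1 f (t, s) := huv ⟨hau ht, hsv⟩
    have hrs : r < s := by linarith [hs.1]
    have hper (t : ℝ) (k : ℤ) : ∀ᶠ y : ℝ² in 𝓝 (t, s), f (y.1 + k * a, y.2) = f y := by
      have : ∀ᶠ y : ℝ² in 𝓝 (t, s), r < y.2 := continuousAt_snd.eventually (lt_mem_nhds hrs)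
      filter_upwards [this] with y hy
      have hp : Function.Periodic (fun t => f (t, y.2)) a := fun t => hf.periodic t y.2 hy
      exact hp.int_mul k y.1
    intro t
    set k := toIcoDiv ha 0 t
    have hmem : t - k • a ∈ Icc 0 a := by
      have := sub_toIcoDiv_zsmul_mem_Ico ha 0 t
      rw [zero_add] at this; exact Ico_subset_Icc_self this
    have h1 : ContDiffAt ℝ 1 (fun y : ℝ² => f (y.1 + (-k : ℤ) * a, y.2)) (t, s) := by
      have h2 := h0 _ hmem
      refine ContDiffAt.comp (t, s) (g := f) (f := fun y : ℝ² => (y.1 + (-k : ℤ) * a, y.2)) ?_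
        (by fun_prop)
      convert h2 using 2
      simp [sub_eq_add_neg]
    exact h1.congr_of_eventuallyEq ((hper t (-k)).mono fun y hy => hy.symm)
  let χ : ContDiffBump ((c + d) / 2) :=
    ⟨(d - c) / 2 + δ / 3, (d - c) / 2 + 2 * δ / 3, by linarith, by linarith⟩
  have hχ1 (s : ℝ) (hs : s ∈ Ioo (c - δ / 3) (d + δ / 3)) : χ s = 1 := by
    refine χ.one_of_mem_closedBall ?_
    rw [Metric.mem_closedBall, Real.dist_eq, abs_le]
    constructor <;> [have := hs.1; have := hs.2] <;> change _ ≤ _ <;> simp only [χ] <;> linarith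
  have hχ0 (s : ℝ) (hs : s ≤ c - 2 * δ / 3 ∨ d + 2 * δ / 3 ≤ s) : χ s = 0 := by
    refine χ.zero_of_le_dist ?_
    rw [Real.dist_eq, le_abs]
    simp only [χ]
    rcases hs with hs | hs
    · right; linarith
    · left; linarith
  refine ⟨fun x => χ x.2 • f x, ?_, fun t s => ?_, fun t s hs => ?_⟩
  · rw [contDiff_iff_contDiffAt]
    rintro ⟨t, s⟩
    by_cases hs : s ∈ Ioo (c - δ) (d + δ)
    · exact (χ.contDiffAt.comp (t, s) contDiffAt_snd).smul (hsm s hs t)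
    · have : ∀ᶠ y : ℝ² in 𝓝 (t, s), χ y.2 • f y = 0 := by
        rw [mem_Ioo, not_and_or, not_lt, not_lt] at hs
        rcases hs with hs | hs
        · have : ∀ᶠ y : ℝ² in 𝓝 (t, s), y.2 < c - 2 * δ / 3 :=
            continuousAt_snd.eventually (gt_mem_nhds (by simp only; linarith))
          filter_upwards [this] with y hy
          rw [hχ0 _ (Or.inl hy.le), zero_smul]
        · have : ∀ᶠ y : ℝ² in 𝓝 (t, s), d + 2 * δ / 3 < y.2 :=
            continuousAt_snd.eventually (lt_mem_nhds (by simp only; linarith))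
          filter_upwards [this] with y hy
          rw [hχ0 _ (Or.inr hy.le), zero_smul]
      exact (contDiffAt_const (c := (0 : G))).congr_of_eventuallyEq this
  · rcases le_or_gt s r with h | h
    · simp only [hχ0 s (Or.inl (by linarith)), zero_smul]
    · simp only [hf.periodic t s h]
  · have : ∀ᶠ y : ℝ² in 𝓝 (t, s), y.2 ∈ Ioo (c - δ / 3) (d + δ / 3) :=
      continuousAt_snd.eventually (isOpen_Ioo.mem_nhds
        ⟨by simp only; linarith [hs.1], by simp only; linarith [hs.2]⟩)
    filter_upwards [this] with y hy
    rw [hχ1 _ hy, one_smul]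

end IsC1Near

namespace ParamSurface

variable {S : ParamSurface}

section

variable (hp : ∀ t s, S.α (t + S.a, s) = S.α (t, s)) (t s : ℝ)
include hp

theorem αt_periodic : S.αt (t + S.a, s) = S.αt (t, s) := by
  rw [αt, dT, fderiv_periodic (r := s - 1) (fun t s _ => hp t s) t (by linarith)]; rfl

theorem αs_periodic : S.αs (t + S.a, s) = S.αs (t, s) := by
  rw [αs, dS, fderiv_periodic (r := s - 1) (fun t s _ => hp t s) t (by linarith)]; rfl

theorem n_periodic : S.n (t + S.a, s) = S.n (t, s) := by rw [n, αt_periodic hp, αs_periodic hp]; rfl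

theorem dT_n_periodic : dT S.n (t + S.a, s) = dT S.n (t, s) := by
  rw [dT, fderiv_periodic (r := s - 1) (fun t s _ => n_periodic hp t s) t (by linarith)]; rfl

theorem dS_n_periodic : dS S.n (t + S.a, s) = dS S.n (t, s) := by
  rw [dS, fderiv_periodic (r := s - 1) (fun t s _ => n_periodic hp t s) t (by linarith)]; rfl

theorem gdet_periodic : S.gdet (t + S.a, s) = S.gdet (t, s) := by
  rw [gdet, αt_periodic hp, αs_periodic hp]; rfl

theorem coordT_periodic (v : E3) : S.coordT (t + S.a, s) v = S.coordT (t, s) v := by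
  rw [coordT, αt_periodic hp, αs_periodic hp, gdet_periodic hp]; rfl

theorem coordS_periodic (v : E3) : S.coordS (t + S.a, s) v = S.coordS (t, s) v := by
  rw [coordS, αt_periodic hp, αs_periodic hp, gdet_periodic hp]; rfl

theorem rot_periodic (v : E3) : S.rot (t + S.a, s) v = S.rot (t, s) v := by
  rw [rot, n_periodic hp]; rfl

theorem shape_periodic (v : E3) : S.shape (t + S.a, s) v = S.shape (t, s) v := by
  rw [shape, dirDeriv, coordT_periodic hp, coordS_periodic hp, dT_n_periodic hp, dS_n_periodic hp]
  rfl

theorem curv_periodic : S.curv (t + S.a, s) = S.curv (t, s) := by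
  simp only [curv, sff, shape_periodic hp, αt_periodic hp, αs_periodic hp, gdet_periodic hp]

end

variable {c d r : ℝ}

/-- The regularity and nondegeneracy of the parametrization on a closed strip. -/
structure IsRegularStrip (S : ParamSurface) (c d : ℝ) : Prop where
  a_pos : 0 < S.a
  τ_sq : S.τ ^ 2 = 1
  smooth : ContDiff ℝ 3 S.α
  periodic : ∀ t s, S.α (t + S.a, s) = S.α (t, s)
  gdet_pos : ∀ t, ∀ s ∈ Icc c d, 0 < S.gdet (t, s)

theorem IsMixedType.isRegularStrip (hS : S.IsMixedType) : S.IsRegularStrip (-S.b₀) S.b₁ where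
  a_pos := hS.a_pos
  τ_sq := by rcases hS.τ_sign with h | h <;> simp [h]
  smooth := hS.smooth
  periodic := hS.periodic
  gdet_pos t s hs := gdet_pos_of_linearIndependent (hS.immersion t s hs)

namespace IsRegularStrip

theorem mono {c' d' : ℝ} (h : S.IsRegularStrip c d) (hc : c ≤ c') (hd : d' ≤ d) :
    S.IsRegularStrip c' d' :=
  ⟨h.a_pos, h.τ_sq, h.smooth, h.periodic, fun t s hs =>
    h.gdet_pos t s ⟨hc.trans hs.1, hs.2.trans hd⟩⟩

variable (h : S.IsRegularStrip c d)
include h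


theorem αt : IsC1Near S.a c d r S.αt :=
  ⟨fun _ _ _ => (contDiffAt_αt h.smooth).of_le one_le_two, fun t s _ => αt_periodic h.periodic t s⟩

theorem αs : IsC1Near S.a c d r S.αs :=
  ⟨fun _ _ _ => (contDiffAt_αs h.smooth).of_le one_le_two, fun t s _ => αs_periodic h.periodic t s⟩

theorem rt : IsC1Near S.a c d r S.rt :=
  ⟨fun t s hs => (contDiffAt_rt h.smooth (h.gdet_pos t s hs)).of_le one_le_two,
    fun t s _ => by rw [ParamSurface.rt, gdet_periodic h.periodic]; rfl⟩

theorem h11 : IsC1Near S.a c d r S.h11 :=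
  ⟨fun t s hs => contDiffAt_h11 h.smooth (h.gdet_pos t s hs), fun t s _ => by
    rw [ParamSurface.h11, dT_n_periodic h.periodic, αt_periodic h.periodic]; rfl⟩

theorem h12 : IsC1Near S.a c d r S.h12 :=
  ⟨fun t s hs => contDiffAt_h12 h.smooth (h.gdet_pos t s hs), fun t s _ => by
    rw [ParamSurface.h12, dT_n_periodic h.periodic, αs_periodic h.periodic]; rfl⟩

theorem h22 : IsC1Near S.a c d r S.h22 :=
  ⟨fun t s hs => contDiffAt_h22 h.smooth (h.gdet_pos t s hs), fun t s _ => by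
    rw [ParamSurface.h22, dS_n_periodic h.periodic, αs_periodic h.periodic]; rfl⟩

theorem curv : IsC1Near S.a c d r S.curv :=
  ⟨fun t s hs => contDiffAt_curv h.smooth (h.gdet_pos t s hs),
    fun t s _ => curv_periodic h.periodic t s⟩

variable {V : ℝ² → E3}

theorem coordT (hV : IsC1Near S.a c d r V) : IsC1Near S.a c d r fun x => S.coordT x (V x) :=
  ⟨fun t s hs => contDiffAt_coordT h.smooth (h.gdet_pos t s hs) (hV.contDiffAt t s hs),
    fun t s hs => by simp only [coordT_periodic h.periodic, hV.periodic t s hs]⟩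

theorem coordS (hV : IsC1Near S.a c d r V) : IsC1Near S.a c d r fun x => S.coordS x (V x) :=
  ⟨fun t s hs => contDiffAt_coordS h.smooth (h.gdet_pos t s hs) (hV.contDiffAt t s hs),
    fun t s hs => by simp only [coordS_periodic h.periodic, hV.periodic t s hs]⟩

theorem rot (hV : IsC1Near S.a c d r V) : IsC1Near S.a c d r fun x => S.rot x (V x) :=
  ⟨fun t s hs => contDiffAt_rot h.smooth (h.gdet_pos t s hs) (hV.contDiffAt t s hs),
    fun t s hs => by simp only [rot_periodic h.periodic, hV.periodic t s hs]⟩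

theorem shape (hV : IsC1Near S.a c d r V) : IsC1Near S.a c d r fun x => S.shape x (V x) :=
  ⟨fun t s hs => contDiffAt_shape h.smooth (h.gdet_pos t s hs) (hV.contDiffAt t s hs),
    fun t s hs => by simp only [shape_periodic h.periodic, hV.periodic t s hs]⟩

end IsRegularStrip

end ParamSurface

/-! ### The symmetric flux and the normalized basis -/

section product_rules

variable {f g : ℝ² → ℝ} {x : ℝ²}

theorem dT_mul (hf : DifferentiableAt ℝ f x) (hg : DifferentiableAt ℝ g x) :
    dT (fun y => f y * g y) x = f x * dT g x + g x * dT f x := by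
  rw [dT, fderiv_fun_mul hf hg]; rfl

theorem dS_mul (hf : DifferentiableAt ℝ f x) (hg : DifferentiableAt ℝ g x) :
    dS (fun y => f y * g y) x = f x * dS g x + g x * dS f x := by
  rw [dS, fderiv_fun_mul hf hg]; rfl

theorem dT_add (hf : DifferentiableAt ℝ f x) (hg : DifferentiableAt ℝ g x) :
    dT (fun y => f y + g y) x = dT f x + dT g x := by
  rw [dT, fderiv_fun_add hf hg]; rfl

theorem dS_add (hf : DifferentiableAt ℝ f x) (hg : DifferentiableAt ℝ g x) :
    dS (fun y => f y + g y) x = dS f x + dS g x := by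
  rw [dS, fderiv_fun_add hf hg]; rfl

theorem dT_const_mul (k : ℝ) (hf : DifferentiableAt ℝ f x) :
    dT (fun y => k * f y) x = k * dT f x := by
  rw [dT, fderiv_const_mul hf]; rfl

theorem dS_const_mul (k : ℝ) (hf : DifferentiableAt ℝ f x) :
    dS (fun y => k * f y) x = k * dS f x := by
  rw [dS, fderiv_const_mul hf]; rfl

theorem Filter.EventuallyEq.dT_eq (h : f =ᶠ[𝓝 x] g) : dT f x = dT g x := by
  rw [dT, h.fderiv_eq]; rfl

theorem Filter.EventuallyEq.dS_eq (h : f =ᶠ[𝓝 x] g) : dS f x = dS g x := by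
  rw [dS, h.fderiv_eq]; rfl

end product_rules

namespace ParamSurface

/-- The weight `e^{-γκ}`. -/
def wt (S : ParamSurface) (γ : ℝ) (x : ℝ²) : ℝ := Real.exp (-γ * S.curv x)

/-- `e^{-γκ} ⟨w, QX⟩`, the function by which `div (Q ∇n V)` is multiplied. -/
def mulA (S : ParamSurface) (γ : ℝ) (X : ℝ² → E3) (x : ℝ²) (w : E3) : ℝ :=
  S.wt γ x * inner ℝ w (S.rot x (X x))

/-- `e^{-γκ} ⟨w, ∇n X⟩`, the function by which `div V` is multiplied. -/
def mulB (S : ParamSurface) (γ : ℝ) (X : ℝ² → E3) (x : ℝ²) (w : E3) : ℝ :=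
  S.wt γ x * inner ℝ w (S.shape x (X x))

/-- The `t`-component of `Q ∇n v`, times the density `√(det g)`. -/
def fluxPT (S : ParamSurface) (x : ℝ²) (v : E3) : ℝ := S.rt x * S.coordT x (S.rot x (S.shape x v))

/-- The `s`-component of `Q ∇n v`, times the density `√(det g)`. -/
def fluxPS (S : ParamSurface) (x : ℝ²) (v : E3) : ℝ := S.rt x * S.coordS x (S.rot x (S.shape x v))

/-- The `t`-component of `v`, times the density `√(det g)`. -/
def fluxRT (S : ParamSurface) (x : ℝ²) (v : E3) : ℝ := S.rt x * S.coordT x v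

/-- The `s`-component of `v`, times the density `√(det g)`. -/
def fluxRS (S : ParamSurface) (x : ℝ²) (v : E3) : ℝ := S.rt x * S.coordS x v

/-- The adjoint operator, in terms of `φ₁ = e^{-γκ} ⟨W, QX⟩` and `φ₂ = e^{-γκ} ⟨W, ∇n X⟩`, paired
with `v` and multiplied by the density `√(det g)`. -/
def adjPair (S : ParamSurface) (η : ℝ² → ℝ) (X Y : ℝ² → E3) (φ₁ φ₂ : ℝ² → ℝ) (x : ℝ²)
    (v : E3) : ℝ :=
  -(S.fluxPT x v * dT φ₁ x + S.fluxPS x v * dS φ₁ x + S.fluxRT x v * dT φ₂ x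
      + S.fluxRS x v * dS φ₂ x)
    + S.rt x * (φ₁ x * inner ℝ v (Y x - η x • S.rot x (X x))
      - η x * φ₂ x * inner ℝ v (S.shape x (X x)))

variable {S : ParamSurface} {x : ℝ²} {γ : ℝ} {X Y : ℝ² → E3} {η : ℝ² → ℝ}

theorem wt_pos (x) : 0 < S.wt γ x := Real.exp_pos _

theorem rot_add (u v) : S.rot x (u + v) = S.rot x u + S.rot x v := by
  rw [rot_eq, rot_eq, rot_eq, ← smul_add]
  simp only [inner_add_left, add_smul]; congr 1; abel

theorem rot_smul (k : ℝ) (v) : S.rot x (k • v) = k • S.rot x v := by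
  rw [rot_eq, rot_eq, smul_comm k]
  simp only [real_inner_smul_left, smul_sub, smul_smul]

section linearity

variable (x) (u v : E3) (k : ℝ)

theorem mulA_add : S.mulA γ X x (u + v) = S.mulA γ X x u + S.mulA γ X x v := by
  simp only [mulA, inner_add_left]; ring

theorem mulB_add : S.mulB γ X x (u + v) = S.mulB γ X x u + S.mulB γ X x v := by
  simp only [mulB, inner_add_left]; ring

theorem mulA_smul : S.mulA γ X x (k • v) = k * S.mulA γ X x v := by
  simp only [mulA, real_inner_smul_left]; ring

theorem mulB_smul : S.mulB γ X x (k • v) = k * S.mulB γ X x v := by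
  simp only [mulB, real_inner_smul_left]; ring

theorem fluxPT_add : S.fluxPT x (u + v) = S.fluxPT x u + S.fluxPT x v := by
  simp only [fluxPT, shape_add, rot_add, coordT_add]; ring

theorem fluxPS_add : S.fluxPS x (u + v) = S.fluxPS x u + S.fluxPS x v := by
  simp only [fluxPS, shape_add, rot_add, coordS_add]; ring

theorem fluxRT_add : S.fluxRT x (u + v) = S.fluxRT x u + S.fluxRT x v := by
  simp only [fluxRT, coordT_add]; ring

theorem fluxRS_add : S.fluxRS x (u + v) = S.fluxRS x u + S.fluxRS x v := by
  simp only [fluxRS, coordS_add]; ring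

theorem fluxPT_smul : S.fluxPT x (k • v) = k * S.fluxPT x v := by
  simp only [fluxPT, shape_smul, rot_smul, coordT_smul]; ring

theorem fluxPS_smul : S.fluxPS x (k • v) = k * S.fluxPS x v := by
  simp only [fluxPS, shape_smul, rot_smul, coordS_smul]; ring

theorem fluxRT_smul : S.fluxRT x (k • v) = k * S.fluxRT x v := by
  simp only [fluxRT, coordT_smul]; ring

theorem fluxRS_smul : S.fluxRS x (k • v) = k * S.fluxRS x v := by
  simp only [fluxRS, coordS_smul]; ring

theorem adjPair_add (φ₁ φ₂ : ℝ² → ℝ) : S.adjPair η X Y φ₁ φ₂ x (u + v)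
    = S.adjPair η X Y φ₁ φ₂ x u + S.adjPair η X Y φ₁ φ₂ x v := by
  simp only [adjPair, fluxPT_add, fluxPS_add, fluxRT_add, fluxRS_add, inner_add_left]; ring

theorem adjPair_smul (φ₁ φ₂ : ℝ² → ℝ) : S.adjPair η X Y φ₁ φ₂ x (k • v)
    = k * S.adjPair η X Y φ₁ φ₂ x v := by
  simp only [adjPair, fluxPT_smul, fluxPS_smul, fluxRT_smul, fluxRS_smul, real_inner_smul_left]; ring

end linearity

section coordinates

theorem fluxPT_eq (hg : 0 < S.gdet x) (v : E3) :
    S.fluxPT x v = S.τ * (S.h12 x * S.coordT x v + S.h22 x * S.coordS x v) := by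
  rw [fluxPT, coordT_rot hg, inner_shape_αs]

theorem fluxPS_eq (h : ContDiff ℝ 3 S.α) (hg : 0 < S.gdet x) (v : E3) :
    S.fluxPS x v = -(S.τ * (S.h11 x * S.coordT x v + S.h12 x * S.coordS x v)) := by
  rw [fluxPS, coordS_rot hg, inner_shape_αt h hg]

theorem mulA_eq (hg : 0 < S.gdet x) (w : E3) : S.mulA γ X x w = S.wt γ x *
    (S.τ * S.rt x * (S.coordT x w * S.coordS x (X x) - S.coordS x w * S.coordT x (X x))) := by
  rw [mulA, inner_rot_eq hg]

theorem mulB_eq (hτ : S.τ ^ 2 = 1) (h : ContDiff ℝ 3 S.α) (hg : 0 < S.gdet x) {w : E3}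
    (hw : S.IsTangent x w) : S.mulB γ X x w = S.wt γ x *
      (S.coordT x w * (S.h11 x * S.coordT x (X x) + S.h12 x * S.coordS x (X x))
        + S.coordS x w * (S.h12 x * S.coordT x (X x) + S.h22 x * S.coordS x (X x))) := by
  rw [mulB, inner_shape_eq hτ h hg hw]

variable (hτ : S.τ ^ 2 = 1) (h : ContDiff ℝ 3 S.α) (hg : 0 < S.gdet x) {v w : E3}
  (hv : S.IsTangent x v) (hw : S.IsTangent x w)
include hτ h hg hv hw

/-- The `t`-component of the bilinear flux is symmetric. -/
theorem fluxT_comm : S.fluxPT x v * S.mulA γ X x w + S.fluxRT x v * S.mulB γ X x w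
    = S.fluxPT x w * S.mulA γ X x v + S.fluxRT x w * S.mulB γ X x v := by
  rw [fluxPT_eq hg, fluxPT_eq hg, mulA_eq hg, mulA_eq hg, mulB_eq hτ h hg hv, mulB_eq hτ h hg hw,
    fluxRT, fluxRT]
  linear_combination S.wt γ x * S.rt x * (S.coordT x v * S.coordS x w - S.coordS x v * S.coordT x w)
    * (-S.h12 x * S.coordT x (X x) - S.h22 x * S.coordS x (X x)) * hτ

/-- The `s`-component of the bilinear flux is symmetric. -/
theorem fluxS_comm : S.fluxPS x v * S.mulA γ X x w + S.fluxRS x v * S.mulB γ X x w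
    = S.fluxPS x w * S.mulA γ X x v + S.fluxRS x w * S.mulB γ X x v := by
  rw [fluxPS_eq h hg, fluxPS_eq h hg, mulA_eq hg, mulA_eq hg, mulB_eq hτ h hg hv,
    mulB_eq hτ h hg hw, fluxRS, fluxRS]
  linear_combination S.wt γ x * S.rt x * (S.coordT x v * S.coordS x w - S.coordS x v * S.coordT x w)
    * (S.h11 x * S.coordT x (X x) + S.h12 x * S.coordS x (X x)) * hτ

end coordinates

/-- The properties of the multiplier field `X` on a closed strip which make the problem a symmetric
system. -/
structure IsMultiplier (S : ParamSurface) (c d r : ℝ) (X : ℝ² → E3) : Prop where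
  strip : S.IsRegularStrip c d
  lt : c < d
  r_lt : r < c
  smooth : IsC1Near S.a c d r X
  tangent : ∀ t, ∀ s ∈ Icc c d, S.IsTangent (t, s) (X (t, s))
  coordS_pos : ∀ t, ∀ s ∈ Icc c d, 0 < S.coordS (t, s) (X (t, s))
  sff_pos : ∀ t, ∀ s ∈ Icc c d, 0 < S.sff (t, s) (X (t, s)) (X (t, s))
  h11_pos : ∀ t, ∀ s ∈ Icc c d, 0 < S.h11 (t, s)

/-- The basis `X, α_t` of the tangent plane, normalized so that the `s`-component of the bilinear
flux has the matrix `diag (1, -1)`. -/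
def e (S : ParamSurface) (γ : ℝ) (X : ℝ² → E3) : Fin 2 → ℝ² → E3 :=
  ![fun x => (√(S.wt γ x * S.sff x (X x) (X x) * S.rt x * S.coordS x (X x)))⁻¹ • X x,
    fun x => (√(S.wt γ x * S.h11 x * S.rt x * S.coordS x (X x)))⁻¹ • S.αt x]

theorem basis_zero (x) : S.e γ X 0 x
    = (√(S.wt γ x * S.sff x (X x) (X x) * S.rt x * S.coordS x (X x)))⁻¹ • X x := rfl

theorem basis_one (x) : S.e γ X 1 x
    = (√(S.wt γ x * S.h11 x * S.rt x * S.coordS x (X x)))⁻¹ • S.αt x := rfl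

namespace IsMultiplier

variable {c d r : ℝ} {t s : ℝ}

variable (hX : S.IsMultiplier c d r X)
include hX

theorem wt_isC1Near : IsC1Near S.a c d r (S.wt γ) := ((IsC1Near.const (-γ)).mul hX.strip.curv).exp

theorem sff_isC1Near : IsC1Near S.a c d r fun x => S.sff x (X x) (X x) :=
  (hX.strip.shape hX.smooth).inner hX.smooth

theorem basis_isC1Near (i : Fin 2) : IsC1Near S.a c d r (S.e γ X i) := by
  have p0 (t s) (hs : s ∈ Icc c d) :
      0 < S.wt γ (t, s) * S.sff (t, s) (X (t, s)) (X (t, s)) * S.rt (t, s)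
        * S.coordS (t, s) (X (t, s)) :=
    mul_pos (mul_pos (mul_pos (wt_pos _) (hX.sff_pos t s hs)) (rt_pos (hX.strip.gdet_pos t s hs)))
      (hX.coordS_pos t s hs)
  have p1 (t s) (hs : s ∈ Icc c d) : 0 < S.wt γ (t, s) * S.h11 (t, s) * S.rt (t, s)
        * S.coordS (t, s) (X (t, s)) :=
    mul_pos (mul_pos (mul_pos (wt_pos _) (hX.h11_pos t s hs)) (rt_pos (hX.strip.gdet_pos t s hs)))
      (hX.coordS_pos t s hs)
  fin_cases i
  · exact (((((hX.wt_isC1Near.mul hX.sff_isC1Near).mul hX.strip.rt).mul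
      (hX.strip.coordS hX.smooth)).sqrt fun t s hs => (p0 t s hs).ne').inv
      fun t s hs => (Real.sqrt_pos.mpr (p0 t s hs)).ne').smul hX.smooth
  · exact (((((hX.wt_isC1Near.mul hX.strip.h11).mul hX.strip.rt).mul
      (hX.strip.coordS hX.smooth)).sqrt fun t s hs => (p1 t s hs).ne').inv
      fun t s hs => (Real.sqrt_pos.mpr (p1 t s hs)).ne').smul hX.strip.αt

theorem basis_isTangent (i : Fin 2) (hs : s ∈ Icc c d) : S.IsTangent (t, s) (S.e γ X i (t, s)) := by
  fin_cases i
  · exact (hX.tangent t s hs).smul _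
  · exact (isTangent_αt _).smul _

theorem sff_eq (hs : s ∈ Icc c d) : S.sff (t, s) (X (t, s)) (X (t, s)) = S.coordT (t, s) (X (t, s))
      * (S.h11 (t, s) * S.coordT (t, s) (X (t, s)) + S.h12 (t, s) * S.coordS (t, s) (X (t, s)))
      + S.coordS (t, s) (X (t, s)) * (S.h12 (t, s) * S.coordT (t, s) (X (t, s))
      + S.h22 (t, s) * S.coordS (t, s) (X (t, s))) := by
  rw [sff, real_inner_comm, inner_shape_eq hX.strip.τ_sq hX.strip.smooth
    (hX.strip.gdet_pos t s hs) (hX.tangent t s hs)]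

/-- The `s`-component of the bilinear flux is `diag (1, -1)` in the normalized basis. -/
theorem fluxS_basis (hs : s ∈ Icc c d) (i j : Fin 2) :
    S.fluxPS (t, s) (S.e γ X i (t, s)) * S.mulA γ X (t, s) (S.e γ X j (t, s))
      + S.fluxRS (t, s) (S.e γ X i (t, s)) * S.mulB γ X (t, s) (S.e γ X j (t, s))
      = if i = j then sgnJ i else 0 := by
  have hg := hX.strip.gdet_pos t s hs
  have hτ := hX.strip.τ_sq
  have hα := hX.strip.smooth
  have hw := wt_pos (S := S) (γ := γ) (t, s)
  have hr := rt_pos hg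
  have hXs := hX.coordS_pos t s hs
  have hPi := hX.sff_pos t s hs
  have hh := hX.h11_pos t s hs
  have hPe := hX.sff_eq (t := t) hs
  set P := S.sff (t, s) (X (t, s)) (X (t, s))
  have k0 := Real.sq_sqrt (mul_pos (mul_pos (mul_pos hw hPi) hr) hXs).le
  have k1 := Real.sq_sqrt (mul_pos (mul_pos (mul_pos hw hh) hr) hXs).le
  have s0 := Real.sqrt_pos.mpr (mul_pos (mul_pos (mul_pos hw hPi) hr) hXs)
  have s1 := Real.sqrt_pos.mpr (mul_pos (mul_pos (mul_pos hw hh) hr) hXs)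
  have b0 := basis_zero (S := S) (γ := γ) (X := X) (t, s)
  have b1 := basis_one (S := S) (γ := γ) (X := X) (t, s)
  set q0 := √(S.wt γ (t, s) * P * S.rt (t, s) * S.coordS (t, s) (X (t, s)))
  set q1 := √(S.wt γ (t, s) * S.h11 (t, s) * S.rt (t, s) * S.coordS (t, s) (X (t, s)))
  have hX0 : S.fluxPS (t, s) (X (t, s)) * S.mulA γ X (t, s) (X (t, s))
      + S.fluxRS (t, s) (X (t, s)) * S.mulB γ X (t, s) (X (t, s)) = q0 ^ 2 := by
    rw [fluxPS_eq hα hg, mulA_eq hg, mulB_eq hτ hα hg (hX.tangent t s hs), fluxRS, k0, hPe]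
    ring
  have hX1 : S.fluxPS (t, s) (S.αt (t, s)) * S.mulA γ X (t, s) (S.αt (t, s))
      + S.fluxRS (t, s) (S.αt (t, s)) * S.mulB γ X (t, s) (S.αt (t, s)) = -q1 ^ 2 := by
    rw [fluxPS_eq hα hg, mulA_eq hg, mulB_eq hτ hα hg (isTangent_αt _), fluxRS, k1, coordT_αt hg,
      coordS_αt]
    linear_combination -S.h11 (t, s) * S.wt γ (t, s) * S.rt (t, s) * S.coordS (t, s) (X (t, s)) * hτ
  have hX2 : S.fluxPS (t, s) (S.αt (t, s)) * S.mulA γ X (t, s) (X (t, s))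
      + S.fluxRS (t, s) (S.αt (t, s)) * S.mulB γ X (t, s) (X (t, s)) = 0 := by
    rw [fluxPS_eq hα hg, mulA_eq hg, fluxRS, coordT_αt hg, coordS_αt]
    ring
  have hX3 := fluxS_comm hτ hα hg (hX.tangent t s hs) (isTangent_αt (t, s)) (γ := γ) (X := X)
  rw [hX2] at hX3
  fin_cases i <;> fin_cases j <;>
    simp only [Fin.zero_eta, Fin.mk_one, b0, b1, fluxPS_smul, fluxRS_smul, mulA_smul, mulB_smul,
      if_true, sgnJ, Matrix.cons_val_zero, Matrix.cons_val_one, Fin.isValue, zero_ne_one,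
      one_ne_zero, if_false]
  · field_simp; linear_combination hX0
  · linear_combination q0⁻¹ * q1⁻¹ * hX3
  · linear_combination q0⁻¹ * q1⁻¹ * hX2
  · field_simp; linear_combination hX1

theorem mulA_isC1Near {W : ℝ² → E3} (hW : IsC1Near S.a c d r W) :
    IsC1Near S.a c d r fun x => S.mulA γ X x (W x) :=
  hX.wt_isC1Near.mul (hW.inner (hX.strip.rot hX.smooth))

theorem mulB_isC1Near {W : ℝ² → E3} (hW : IsC1Near S.a c d r W) :
    IsC1Near S.a c d r fun x => S.mulB γ X x (W x) :=
  hX.wt_isC1Near.mul (hW.inner (hX.strip.shape hX.smooth))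

end IsMultiplier

namespace IsRegularStrip

variable {c d r : ℝ} {V : ℝ² → E3}

variable (h : S.IsRegularStrip c d)
include h

theorem fluxPT (hV : IsC1Near S.a c d r V) :
    IsC1Near S.a c d r fun x => S.fluxPT x (V x) := h.rt.mul (h.coordT (h.rot (h.shape hV)))

theorem fluxPS (hV : IsC1Near S.a c d r V) :
    IsC1Near S.a c d r fun x => S.fluxPS x (V x) := h.rt.mul (h.coordS (h.rot (h.shape hV)))

theorem fluxRT (hV : IsC1Near S.a c d r V) :
    IsC1Near S.a c d r fun x => S.fluxRT x (V x) := h.rt.mul (h.coordT hV)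

theorem fluxRS (hV : IsC1Near S.a c d r V) :
    IsC1Near S.a c d r fun x => S.fluxRS x (V x) := h.rt.mul (h.coordS hV)

end IsRegularStrip

end ParamSurface

/-! ### The symmetric part of the adjoint operator -/

namespace ParamSurface

/-- The bilinear form of which `accForm` is the quadratic form. -/
def accBil (S : ParamSurface) (γ : ℝ) (η : ℝ² → ℝ) (X Y v w : ℝ² → E3) (x : ℝ²) : ℝ :=
  (S.mulA γ X x (w x) * (dT (fun y => S.fluxPT y (v y)) x + dS (fun y => S.fluxPS y (v y)) x)
    + S.mulB γ X x (w x) * (dT (fun y => S.fluxRT y (v y)) x + dS (fun y => S.fluxRS y (v y)) x)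
    - S.fluxPT x (v x) * dT (fun y => S.mulA γ X y (w y)) x
    - S.fluxPS x (v x) * dS (fun y => S.mulA γ X y (w y)) x
    - S.fluxRT x (v x) * dT (fun y => S.mulB γ X y (w y)) x
    - S.fluxRS x (v x) * dS (fun y => S.mulB γ X y (w y)) x) / 2
  + S.rt x * (S.mulA γ X x (w x) * inner ℝ (v x) (Y x - η x • S.rot x (X x))
    - η x * S.mulB γ X x (w x) * inner ℝ (v x) (S.shape x (X x)))

/-- The symmetric part of the adjoint operator at the field `w`, as a density in the parameters.
It depends only on the value of `w` at the point (`accForm_congr`). -/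
def accForm (S : ParamSurface) (γ : ℝ) (η : ℝ² → ℝ) (X Y w : ℝ² → E3) (x : ℝ²) : ℝ :=
  S.accBil γ η X Y w w x

variable {S : ParamSurface} {x : ℝ²} {γ : ℝ} {X Y : ℝ² → E3} {η : ℝ² → ℝ}

section differentiability

variable {w : ℝ² → E3}

variable (h : ContDiff ℝ 3 S.α) (hg : 0 < S.gdet x)
include h hg

theorem contDiffAt_wt :
    ContDiffAt ℝ 1 (S.wt γ) x := (contDiffAt_const.mul (contDiffAt_curv h hg)).exp

theorem dT_wt : dT (S.wt γ) x = -γ * S.wt γ x * dT S.curv x := by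
  have := (((contDiffAt_curv h hg).differentiableAt one_ne_zero).hasFDerivAt.const_mul (-γ)).exp
  rw [dT, show S.wt γ = fun y => Real.exp (-γ * S.curv y) from rfl, this.fderiv]
  simp [dT]; ring

theorem dS_wt : dS (S.wt γ) x = -γ * S.wt γ x * dS S.curv x := by
  have := (((contDiffAt_curv h hg).differentiableAt one_ne_zero).hasFDerivAt.const_mul (-γ)).exp
  rw [dS, show S.wt γ = fun y => Real.exp (-γ * S.curv y) from rfl, this.fderiv]
  simp [dS]; ring

theorem differentiableAt_mulA (hX : ContDiffAt ℝ 1 X x) (hw : ContDiffAt ℝ 1 w x) :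
    DifferentiableAt ℝ (fun y => S.mulA γ X y (w y)) x :=
  ((contDiffAt_wt h hg).mul (hw.inner ℝ (contDiffAt_rot h hg hX))).differentiableAt one_ne_zero

theorem differentiableAt_mulB (hX : ContDiffAt ℝ 1 X x) (hw : ContDiffAt ℝ 1 w x) :
    DifferentiableAt ℝ (fun y => S.mulB γ X y (w y)) x :=
  ((contDiffAt_wt h hg).mul (hw.inner ℝ (contDiffAt_shape h hg hX))).differentiableAt one_ne_zero

theorem contDiffAt_rt_one : ContDiffAt ℝ 1 S.rt x := (contDiffAt_rt h hg).of_le one_le_two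

theorem contDiffAt_fluxPT 
    (hw : ContDiffAt ℝ 1 w x) : ContDiffAt ℝ 1 (fun y => S.fluxPT y (w y)) x :=
  (contDiffAt_rt_one h hg).mul (contDiffAt_coordT h hg (contDiffAt_rot h hg
    (contDiffAt_shape h hg hw)))

theorem contDiffAt_fluxPS 
    (hw : ContDiffAt ℝ 1 w x) : ContDiffAt ℝ 1 (fun y => S.fluxPS y (w y)) x :=
  (contDiffAt_rt_one h hg).mul (contDiffAt_coordS h hg (contDiffAt_rot h hg
    (contDiffAt_shape h hg hw)))

theorem contDiffAt_fluxRT 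
    (hw : ContDiffAt ℝ 1 w x) : ContDiffAt ℝ 1 (fun y => S.fluxRT y (w y)) x :=
  (contDiffAt_rt_one h hg).mul (contDiffAt_coordT h hg hw)

theorem contDiffAt_fluxRS 
    (hw : ContDiffAt ℝ 1 w x) : ContDiffAt ℝ 1 (fun y => S.fluxRS y (w y)) x :=
  (contDiffAt_rt_one h hg).mul (contDiffAt_coordS h hg hw)

end differentiability

theorem dT_comb {u₀ u₁ f₀ f₁ : ℝ² → ℝ} (hu₀ : DifferentiableAt ℝ u₀ x)
    (hu₁ : DifferentiableAt ℝ u₁ x) (h₀ : DifferentiableAt ℝ f₀ x) (h₁ : DifferentiableAt ℝ f₁ x) :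
    dT (fun y => u₀ y * f₀ y + u₁ y * f₁ y) x
      = u₀ x * dT f₀ x + f₀ x * dT u₀ x + (u₁ x * dT f₁ x + f₁ x * dT u₁ x) := by
  rw [dT_add (hu₀.fun_mul h₀) (hu₁.fun_mul h₁), dT_mul hu₀ h₀, dT_mul hu₁ h₁]

theorem dS_comb {u₀ u₁ f₀ f₁ : ℝ² → ℝ} (hu₀ : DifferentiableAt ℝ u₀ x)
    (hu₁ : DifferentiableAt ℝ u₁ x) (h₀ : DifferentiableAt ℝ f₀ x) (h₁ : DifferentiableAt ℝ f₁ x) :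
    dS (fun y => u₀ y * f₀ y + u₁ y * f₁ y) x
      = u₀ x * dS f₀ x + f₀ x * dS u₀ x + (u₁ x * dS f₁ x + f₁ x * dS u₁ x) := by
  rw [dS_add (hu₀.fun_mul h₀) (hu₁.fun_mul h₁), dS_mul hu₀ h₀, dS_mul hu₁ h₁]

/-- By the symmetry of the bilinear flux the derivatives of the coefficients drop out. -/
theorem accForm_comb (hτ : S.τ ^ 2 = 1) (h : ContDiff ℝ 3 S.α) (hg : 0 < S.gdet x)
    (hX : ContDiffAt ℝ 1 X x) {g₀ g₁ w : ℝ² → E3} {u₀ u₁ : ℝ² → ℝ}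
    (hg₀ : ContDiffAt ℝ 1 g₀ x) (hg₁ : ContDiffAt ℝ 1 g₁ x)
    (ht₀ : S.IsTangent x (g₀ x)) (ht₁ : S.IsTangent x (g₁ x))
    (hu₀ : DifferentiableAt ℝ u₀ x) (hu₁ : DifferentiableAt ℝ u₁ x)
    (hw : w =ᶠ[𝓝 x] fun y => u₀ y • g₀ y + u₁ y • g₁ y) :
    S.accForm γ η X Y w x = u₀ x * (u₀ x * S.accBil γ η X Y g₀ g₀ x)
      + u₀ x * (u₁ x * S.accBil γ η X Y g₀ g₁ x) + u₁ x * (u₀ x * S.accBil γ η X Y g₁ g₀ x)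
      + u₁ x * (u₁ x * S.accBil γ η X Y g₁ g₁ x) := by
  have eA : (fun y => S.mulA γ X y (w y)) =ᶠ[𝓝 x]
      fun y => u₀ y * S.mulA γ X y (g₀ y) + u₁ y * S.mulA γ X y (g₁ y) := by
    filter_upwards [hw] with y hy; rw [hy, mulA_add, mulA_smul, mulA_smul]
  have eB : (fun y => S.mulB γ X y (w y)) =ᶠ[𝓝 x]
      fun y => u₀ y * S.mulB γ X y (g₀ y) + u₁ y * S.mulB γ X y (g₁ y) := by
    filter_upwards [hw] with y hy; rw [hy, mulB_add, mulB_smul, mulB_smul]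
  have ePT : (fun y => S.fluxPT y (w y)) =ᶠ[𝓝 x]
      fun y => u₀ y * S.fluxPT y (g₀ y) + u₁ y * S.fluxPT y (g₁ y) := by
    filter_upwards [hw] with y hy; rw [hy, fluxPT_add, fluxPT_smul, fluxPT_smul]
  have ePS : (fun y => S.fluxPS y (w y)) =ᶠ[𝓝 x]
      fun y => u₀ y * S.fluxPS y (g₀ y) + u₁ y * S.fluxPS y (g₁ y) := by
    filter_upwards [hw] with y hy; rw [hy, fluxPS_add, fluxPS_smul, fluxPS_smul]
  have eRT : (fun y => S.fluxRT y (w y)) =ᶠ[𝓝 x]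
      fun y => u₀ y * S.fluxRT y (g₀ y) + u₁ y * S.fluxRT y (g₁ y) := by
    filter_upwards [hw] with y hy; rw [hy, fluxRT_add, fluxRT_smul, fluxRT_smul]
  have eRS : (fun y => S.fluxRS y (w y)) =ᶠ[𝓝 x]
      fun y => u₀ y * S.fluxRS y (g₀ y) + u₁ y * S.fluxRS y (g₁ y) := by
    filter_upwards [hw] with y hy; rw [hy, fluxRS_add, fluxRS_smul, fluxRS_smul]
  have dA₀ := differentiableAt_mulA (γ := γ) h hg hX hg₀
  have dA₁ := differentiableAt_mulA (γ := γ) h hg hX hg₁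
  have dB₀ := differentiableAt_mulB (γ := γ) h hg hX hg₀
  have dB₁ := differentiableAt_mulB (γ := γ) h hg hX hg₁
  have dPT₀ := (contDiffAt_fluxPT h hg hg₀).differentiableAt one_ne_zero
  have dPT₁ := (contDiffAt_fluxPT h hg hg₁).differentiableAt one_ne_zero
  have dPS₀ := (contDiffAt_fluxPS h hg hg₀).differentiableAt one_ne_zero
  have dPS₁ := (contDiffAt_fluxPS h hg hg₁).differentiableAt one_ne_zero
  have dRT₀ := (contDiffAt_fluxRT h hg hg₀).differentiableAt one_ne_zero
  have dRT₁ := (contDiffAt_fluxRT h hg hg₁).differentiableAt one_ne_zero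
  have dRS₀ := (contDiffAt_fluxRS h hg hg₀).differentiableAt one_ne_zero
  have dRS₁ := (contDiffAt_fluxRS h hg hg₁).differentiableAt one_ne_zero
  have sT := fluxT_comm (γ := γ) (X := X) hτ h hg ht₀ ht₁
  have sS := fluxS_comm (γ := γ) (X := X) hτ h hg ht₀ ht₁
  have hwx : w x = u₀ x • g₀ x + u₁ x • g₁ x := hw.self_of_nhds
  rw [accForm, accBil, eA.dT_eq, eA.dS_eq, eB.dT_eq, eB.dS_eq, ePT.dT_eq, ePS.dS_eq, eRT.dT_eq,
    eRS.dS_eq, dT_comb hu₀ hu₁ dA₀ dA₁, dS_comb hu₀ hu₁ dA₀ dA₁, dT_comb hu₀ hu₁ dB₀ dB₁,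
    dS_comb hu₀ hu₁ dB₀ dB₁, dT_comb hu₀ hu₁ dPT₀ dPT₁, dS_comb hu₀ hu₁ dPS₀ dPS₁,
    dT_comb hu₀ hu₁ dRT₀ dRT₁, dS_comb hu₀ hu₁ dRS₀ dRS₁, hwx]
  simp only [mulA_add, mulA_smul, mulB_add, mulB_smul, fluxPT_add, fluxPT_smul, fluxPS_add,
    fluxPS_smul, fluxRT_add, fluxRT_smul, fluxRS_add, fluxRS_smul, inner_add_left,
    real_inner_smul_left, accBil]
  linear_combination (u₁ x * dT u₀ x - u₀ x * dT u₁ x) / 2 * sT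
    + (u₁ x * dS u₀ x - u₀ x * dS u₁ x) / 2 * sS

theorem accForm_congr (hτ : S.τ ^ 2 = 1) (h : ContDiff ℝ 3 S.α) (hg : 0 < S.gdet x)
    (hX : ContDiffAt ℝ 1 X x) {w w' : ℝ² → E3} (hw : ContDiffAt ℝ 1 w x)
    (hw' : ContDiffAt ℝ 1 w' x) (ht : ∀ᶠ y in 𝓝 x, S.IsTangent y (w y))
    (ht' : ∀ᶠ y in 𝓝 x, S.IsTangent y (w' y)) (he : w x = w' x) :
    S.accForm γ η X Y w x = S.accForm γ η X Y w' x := by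
  have hαt := (contDiffAt_αt (x := x) h).of_le one_le_two
  have hαs := (contDiffAt_αs (x := x) h).of_le one_le_two
  have key {w : ℝ² → E3} (hw : ContDiffAt ℝ 1 w x) (ht : ∀ᶠ y in 𝓝 x, S.IsTangent y (w y)) :=
    accForm_comb (γ := γ) (η := η) (Y := Y) hτ h hg hX hαt hαs (isTangent_αt x) (isTangent_αs x)
      ((contDiffAt_coordT h hg hw).differentiableAt one_ne_zero)
      ((contDiffAt_coordS h hg hw).differentiableAt one_ne_zero) (w := w) (by
        filter_upwards [ht, eventually_gdet_pos h hg] with y hy hgy using hy.eq_coord hτ hgy)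
  rw [key hw ht, key hw' ht', he]

/-- The point of the closed strip `c ≤ s ≤ d` nearest to `x` on the same line `t = const`. -/
def clamp (c d : ℝ) (x : ℝ²) : ℝ² := (x.1, max c (min x.2 d))

theorem clamp_of_mem {c d t s : ℝ} (hs : s ∈ Icc c d) : clamp c d (t, s) = (t, s) := by
  simp [clamp, hs.1, hs.2]

theorem clamp_mem {c d : ℝ} (h : c ≤ d) (s : ℝ) : max c (min s d) ∈ Icc c d :=
  ⟨le_max_left _ _, max_le h (min_le_right _ _)⟩

theorem continuous_comp_clamp {c d : ℝ} (h : c ≤ d) {f : ℝ² → ℝ}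
    (hf : ContinuousOn f (univ ×ˢ Icc c d)) : Continuous fun x => f (clamp c d x) :=
  hf.comp_continuous (f := clamp c d)
    (continuous_fst.prodMk (continuous_const.max (continuous_snd.min continuous_const)))
    fun x => ⟨mem_univ _, clamp_mem h x.2⟩

/-- The coefficient of `∂ₜ` in the normalized basis. -/
def coeffM (S : ParamSurface) (γ : ℝ) (X : ℝ² → E3) (i j : Fin 2) (x : ℝ²) : ℝ :=
  S.fluxPT x (S.e γ X i x) * S.mulA γ X x (S.e γ X j x)
    + S.fluxRT x (S.e γ X i x) * S.mulB γ X x (S.e γ X j x)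

/-- The zero order coefficient in the normalized basis. -/
def coeffE (S : ParamSurface) (γ : ℝ) (η : ℝ² → ℝ) (X Y : ℝ² → E3) (i j : Fin 2) (x : ℝ²) : ℝ :=
  S.adjPair η X Y (fun y => S.mulA γ X y (S.e γ X j y))
    (fun y => S.mulB γ X y (S.e γ X j y)) x (S.e γ X i x)

/-- The boundary value problem in the normalized basis.  The coefficients are extended from the
closed strip `c ≤ s ≤ d` to the plane as constants in the direction of `s`. -/
def system (S : ParamSurface) (γ : ℝ) (η : ℝ² → ℝ) (X Y : ℝ² → E3) (c d : ℝ) : SymmSystem where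
  M i j x := S.coeffM γ X i j (clamp c d x)
  Mt i j x := dT (S.coeffM γ X i j) (clamp c d x)
  E i j x := S.coeffE γ η X Y i j (clamp c d x)

namespace IsMultiplier

variable {c d r : ℝ} {t s : ℝ}

variable (hX : S.IsMultiplier c d r X)
include hX

theorem coeffM_isC1Near (i j : Fin 2) : IsC1Near S.a c d r (S.coeffM γ X i j) :=
  ((hX.strip.fluxPT (hX.basis_isC1Near i)).mul (hX.mulA_isC1Near (hX.basis_isC1Near j))).add
    ((hX.strip.fluxRT (hX.basis_isC1Near i)).mul (hX.mulB_isC1Near (hX.basis_isC1Near j)))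

theorem continuousOn_adjPair {φ₁ φ₂ : ℝ² → ℝ} {V : ℝ² → E3}
    (h₁ : IsC1Near S.a c d r φ₁) (h₂ : IsC1Near S.a c d r φ₂) (hV : IsC1Near S.a c d r V)
    (hη : Continuous η) (hY : ContinuousOn Y (univ ×ˢ Icc c d)) :
    ContinuousOn (fun x => S.adjPair η X Y φ₁ φ₂ x (V x)) (univ ×ˢ Icc c d) := by
  have hrot := (hX.strip.rot hX.smooth).continuousOn
  refine (((((hX.strip.fluxPT hV).continuousOn.mul h₁.continuousOn_dT).add
    ((hX.strip.fluxPS hV).continuousOn.mul h₁.continuousOn_dS)).add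
    ((hX.strip.fluxRT hV).continuousOn.mul h₂.continuousOn_dT)).add
    ((hX.strip.fluxRS hV).continuousOn.mul h₂.continuousOn_dS)).neg.add
    ((hX.strip.rt (r := r)).continuousOn.mul ?_)
  exact (h₁.continuousOn.mul (hV.continuousOn.inner (hY.sub (hη.continuousOn.smul hrot)))).sub
    ((hη.continuousOn.mul h₂.continuousOn).mul
      (hV.inner (hX.strip.shape hX.smooth)).continuousOn)

theorem accForm_eq_sum (hs : s ∈ Ioo c d) (ξ : Fin 2 → ℝ) :
    ∑ i, ∑ j, ((S.system γ η X Y c d).E i j (t, s) + (S.system γ η X Y c d).Mt i j (t, s) / 2)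
        * (ξ i * ξ j)
      = S.accForm γ η X Y (fun y => ξ 0 • S.e γ X 0 y + ξ 1 • S.e γ X 1 y) (t, s) := by
  have hsc := Ioo_subset_Icc_self hs
  have hg := hX.strip.gdet_pos t s hsc
  have h := hX.strip.smooth
  have hXc := hX.smooth.contDiffAt t s hsc
  have he (i) := (hX.basis_isC1Near (γ := γ) i).contDiffAt t s hsc
  rw [accForm_comb hX.strip.τ_sq h hg hXc (he 0) (he 1) (hX.basis_isTangent 0 hsc)
    (hX.basis_isTangent 1 hsc) (differentiableAt_const (ξ 0)) (differentiableAt_const (ξ 1))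
    Filter.EventuallyEq.rfl]
  have hS (i j) : dS (fun y => S.fluxPS y (S.e γ X i y) * S.mulA γ X y (S.e γ X j y)
      + S.fluxRS y (S.e γ X i y) * S.mulB γ X y (S.e γ X j y)) (t, s) = 0 := by
    have : (fun y => S.fluxPS y (S.e γ X i y) * S.mulA γ X y (S.e γ X j y)
        + S.fluxRS y (S.e γ X i y) * S.mulB γ X y (S.e γ X j y)) =ᶠ[𝓝 (t, s)]
        fun _ => if i = j then sgnJ i else 0 := by
      have : ∀ᶠ y : ℝ² in 𝓝 (t, s), y.2 ∈ Ioo c d :=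
        continuousAt_snd.eventually (isOpen_Ioo.mem_nhds hs)
      filter_upwards [this] with y hy using hX.fluxS_basis (Ioo_subset_Icc_self hy) i j
    rw [this.dS_eq, dS]; simp
  have dA (j) := differentiableAt_mulA (γ := γ) h hg hXc (he j)
  have dB (j) := differentiableAt_mulB (γ := γ) h hg hXc (he j)
  have dPT (i) := (contDiffAt_fluxPT h hg (he i)).differentiableAt one_ne_zero
  have dPS (i) := (contDiffAt_fluxPS h hg (he i)).differentiableAt one_ne_zero
  have dRT (i) := (contDiffAt_fluxRT h hg (he i)).differentiableAt one_ne_zero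
  have dRS (i) := (contDiffAt_fluxRS h hg (he i)).differentiableAt one_ne_zero
  have key (i j) : (S.system γ η X Y c d).E i j (t, s) + (S.system γ η X Y c d).Mt i j (t, s) / 2
      = S.accBil γ η X Y (S.e γ X i) (S.e γ X j) (t, s) := by
    have h1 := hS i j
    rw [dS_comb (dPS i) (dRS i) (dA j) (dB j)] at h1
    simp only [system, clamp_of_mem hsc, coeffE, adjPair]
    have h2 : dT (S.coeffM γ X i j) (t, s) = _ := dT_comb (dPT i) (dRT i) (dA j) (dB j)
    rw [h2, accBil]
    linear_combination (-1 / 2) * h1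
  simp only [key, Fin.sum_univ_two]
  ring

/-- The system is accretive if the symmetric part of the adjoint operator is negative definite. -/
theorem isAccretive (hη : Continuous η)
    (hY : ContinuousOn Y (univ ×ˢ Icc c d)) {c₀ : ℝ} (h₀ : 0 < c₀)
    (hacc : ∀ t ∈ Ico 0 S.a, ∀ s ∈ Ioo c d, ∀ ξ : Fin 2 → ℝ,
      S.accForm γ η X Y (fun y => ξ 0 • S.e γ X 0 y + ξ 1 • S.e γ X 1 y) (t, s)
        ≤ -c₀ * ∑ i, ξ i ^ 2) :
    (S.system γ η X Y c d).IsAccretive S.a c d c₀ where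
  pos := h₀
  continuous_M i j := continuous_comp_clamp hX.lt.le (hX.coeffM_isC1Near i j).continuousOn
  continuous_Mt i j := continuous_comp_clamp hX.lt.le (hX.coeffM_isC1Near i j).continuousOn_dT
  continuous_E i j := continuous_comp_clamp hX.lt.le
    (hX.continuousOn_adjPair (hX.mulA_isC1Near (hX.basis_isC1Near j))
      (hX.mulB_isC1Near (hX.basis_isC1Near j)) (hX.basis_isC1Near i) hη hY)
  periodic i j t s := (hX.coeffM_isC1Near i j).periodic t _
    (hX.r_lt.trans_le (clamp_mem hX.lt.le s).1)
  hasDerivAt i j t s := hasDerivAt_dT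
    ((hX.coeffM_isC1Near i j).differentiableAt (clamp_mem hX.lt.le s))
  symm i j := by
    ext x
    have hm := clamp_mem hX.lt.le x.2
    exact fluxT_comm hX.strip.τ_sq hX.strip.smooth (hX.strip.gdet_pos x.1 _ hm)
      (hX.basis_isTangent i hm) (hX.basis_isTangent j hm)
  le t ht s hs ξ := by rw [hX.accForm_eq_sum hs]; exact hacc t ht s hs ξ

/-- In the normalized basis, `SymmSystem.adjFun` is the adjoint operator. -/
theorem sum_mul_adjFun (hs : s ∈ Ioo c d)
    {ψ : Fin 2 → ℝ² → ℝ} (hψ : ∀ i, DifferentiableAt ℝ (ψ i) (t, s)) {φ₁ φ₂ : ℝ² → ℝ}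
    (h₁ : φ₁ =ᶠ[𝓝 (t, s)] fun y => ψ 0 y * S.mulA γ X y (S.e γ X 0 y)
      + ψ 1 y * S.mulA γ X y (S.e γ X 1 y))
    (h₂ : φ₂ =ᶠ[𝓝 (t, s)] fun y => ψ 0 y * S.mulB γ X y (S.e γ X 0 y)
      + ψ 1 y * S.mulB γ X y (S.e γ X 1 y)) (y : Fin 2 → ℝ) :
    ∑ i, y i * (S.system γ η X Y c d).adjFun ψ i (t, s) = S.adjPair η X Y φ₁ φ₂ (t, s)
        (y 0 • S.e γ X 0 (t, s) + y 1 • S.e γ X 1 (t, s)) := by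
  have hsc := Ioo_subset_Icc_self hs
  have hg := hX.strip.gdet_pos t s hsc
  have h := hX.strip.smooth
  have hXc := hX.smooth.contDiffAt t s hsc
  have he (i) := (hX.basis_isC1Near (γ := γ) i).contDiffAt t s hsc
  have dA (j) := differentiableAt_mulA (γ := γ) h hg hXc (he j)
  have dB (j) := differentiableAt_mulB (γ := γ) h hg hXc (he j)
  have hJ := hX.fluxS_basis (t := t) (γ := γ) hsc
  have key (i) : (S.system γ η X Y c d).adjFun ψ i (t, s)
      = S.adjPair η X Y φ₁ φ₂ (t, s) (S.e γ X i (t, s)) := by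
    rw [adjPair, h₁.dT_eq, h₁.dS_eq, h₂.dT_eq, h₂.dS_eq, h₁.self_of_nhds, h₂.self_of_nhds,
      dT_comb (hψ 0) (hψ 1) (dA 0) (dA 1), dS_comb (hψ 0) (hψ 1) (dA 0) (dA 1),
      dT_comb (hψ 0) (hψ 1) (dB 0) (dB 1), dS_comb (hψ 0) (hψ 1) (dB 0) (dB 1)]
    simp only [SymmSystem.adjFun, system, clamp_of_mem hsc, coeffM, coeffE, adjPair,
      Fin.sum_univ_two]
    have h0 := hJ i 0
    have h1 := hJ i 1
    have hsum : sgnJ i * dS (ψ i) (t, s) = (if i = 0 then sgnJ i else 0) * dS (ψ 0) (t, s)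
        + (if i = 1 then sgnJ i else 0) * dS (ψ 1) (t, s) := by
      fin_cases i <;> simp
    rw [hsum]
    linear_combination dS (ψ 0) (t, s) * h0 + dS (ψ 1) (t, s) * h1
  simp only [key, Fin.sum_univ_two]
  rw [adjPair_add, adjPair_smul, adjPair_smul]

end IsMultiplier

end ParamSurface

/-! ### Coordinates in the normalized basis -/

/-- A measurable density that is bounded above and below by positive constants. -/
structure IsDensity {Z : Type*} [MeasurableSpace Z] (μ : Measure Z) (ρ : Z → ℝ) : Prop where
  measurable : Measurable ρ
  bounds : ∃ k₁ > 0, ∃ k₂, ∀ᵐ x ∂μ, k₁ ≤ ρ x ∧ ρ x ≤ k₂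

namespace IsDensity

variable {Z : Type*} [MeasurableSpace Z] {μ : Measure Z} {ρ : Z → ℝ}

variable (h : IsDensity μ ρ)
include h

theorem ae_iff {P : Z → Prop} :
    (∀ᵐ x ∂μ.withDensity fun x => ENNReal.ofReal (ρ x), P x) ↔ ∀ᵐ x ∂μ, P x := by
  obtain ⟨k₁, hk, k₂, hb⟩ := h.bounds
  rw [ae_withDensity_iff h.measurable.ennreal_ofReal]
  refine ⟨fun H => ?_, fun H => H.mono fun x hx _ => hx⟩
  filter_upwards [H, hb] with x hx hbx
  exact hx (by simpa using hk.trans_le hbx.1)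

theorem le_smul : ∃ k : ENNReal, k ≠ ⊤ ∧ (μ.withDensity fun x => ENNReal.ofReal (ρ x)) ≤ k • μ := by
  obtain ⟨k₁, hk, k₂, hb⟩ := h.bounds
  refine ⟨ENNReal.ofReal k₂, ENNReal.ofReal_ne_top, ?_⟩
  rw [← withDensity_const]
  exact withDensity_mono (hb.mono fun x hx => ENNReal.ofReal_le_ofReal hx.2)

theorem ge_smul : ∃ k : ENNReal, k ≠ ⊤ ∧ μ ≤ k • (μ.withDensity fun x => ENNReal.ofReal (ρ x)) := by
  obtain ⟨k₁, hk, k₂, hb⟩ := h.bounds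
  refine ⟨ENNReal.ofReal k₁⁻¹, ENNReal.ofReal_ne_top, ?_⟩
  rw [← withDensity_smul _ h.measurable.ennreal_ofReal]
  calc μ = μ.withDensity 1 := withDensity_one.symm
    _ ≤ _ := withDensity_mono (hb.mono fun x hx => by
      simp only [Pi.one_apply, Pi.smul_apply, smul_eq_mul]
      rw [← ENNReal.ofReal_mul (by positivity), ← ENNReal.ofReal_one]
      refine ENNReal.ofReal_le_ofReal ?_
      rw [inv_mul_eq_div, le_div_iff₀ hk, one_mul]; exact hx.1)

theorem memLp_iff {G : Type*} [NormedAddCommGroup G] {f : Z → G} {p : ENNReal} :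
    MemLp f p (μ.withDensity fun x => ENNReal.ofReal (ρ x)) ↔ MemLp f p μ := by
  obtain ⟨k, hk, hle⟩ := h.le_smul
  obtain ⟨k', hk', hge⟩ := h.ge_smul
  exact ⟨fun hf => hf.of_measure_le_smul hk' hge, fun hf => hf.of_measure_le_smul hk hle⟩

theorem integral_eq (f : Z → ℝ) :
    ∫ x, f x ∂(μ.withDensity fun x => ENNReal.ofReal (ρ x)) = ∫ x, ρ x * f x ∂μ := by
  obtain ⟨k₁, hk, k₂, hb⟩ := h.bounds
  rw [integral_withDensity_eq_integral_toReal_smul h.measurable.ennreal_ofReal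
    (.of_forall fun _ => ENNReal.ofReal_lt_top)]
  refine integral_congr_ae ?_
  filter_upwards [hb] with x hx
  rw [ENNReal.toReal_ofReal (hk.le.trans hx.1), smul_eq_mul]

theorem exists_integral_le : ∃ k, 0 ≤ k ∧ ∀ f : Z → ℝ, (∀ x, 0 ≤ f x) → Integrable f μ →
      ∫ x, f x ∂(μ.withDensity fun x => ENNReal.ofReal (ρ x)) ≤ k * ∫ x, f x ∂μ := by
  obtain ⟨k₁, hk, k₂, hb⟩ := h.bounds
  refine ⟨max k₂ 0, le_max_right _ _, fun f hf hi => ?_⟩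
  rw [h.integral_eq, ← integral_const_mul]
  refine integral_mono_of_nonneg ?_ (hi.const_mul _) ?_
  · filter_upwards [hb] with x hx using mul_nonneg (hk.le.trans hx.1) (hf x)
  · filter_upwards [hb] with x hx
    exact mul_le_mul_of_nonneg_right (hx.2.trans (le_max_left _ _)) (hf x)

theorem exists_integral_ge : ∃ k, 0 ≤ k ∧ ∀ f : Z → ℝ, (∀ x, 0 ≤ f x) → Integrable f μ →
      ∫ x, f x ∂μ ≤ k * ∫ x, f x ∂(μ.withDensity fun x => ENNReal.ofReal (ρ x)) := by
  obtain ⟨k₁, hk, k₂, hb⟩ := h.bounds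
  refine ⟨k₁⁻¹, by positivity, fun f hf hi => ?_⟩
  rw [h.integral_eq, ← integral_const_mul]
  refine integral_mono_ae hi ?_ ?_
  · refine Integrable.const_mul ?_ _
    refine hi.bdd_mul (c := k₂) h.measurable.aestronglyMeasurable ?_
    filter_upwards [hb] with x hx
    rw [Real.norm_of_nonneg (hk.le.trans hx.1)]; exact hx.2
  · filter_upwards [hb] with x hx
    rw [← mul_assoc, inv_mul_eq_div]
    have : 1 ≤ ρ x / k₁ := by rw [le_div_iff₀ hk, one_mul]; exact hx.1
    nlinarith [hf x]

end IsDensity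

/-- A function with the values of `f` on the closed strip `c ≤ s ≤ d`, periodic and of class `C¹`
on the plane; it is `0` if there is none. -/
def c1Ext {G : Type*} [NormedAddCommGroup G] [NormedSpace ℝ G] (a c d : ℝ) (f : ℝ² → G) : ℝ² → G :=
  open Classical in
  if h : ∃ F : ℝ² → G, ContDiff ℝ 1 F ∧ (∀ t s, F (t + a, s) = F (t, s)) ∧
    ∀ t, ∀ s ∈ Icc c d, F =ᶠ[𝓝 (t, s)] f then h.choose else 0

theorem ae_strip_mem (a c d : ℝ) : ∀ᵐ x ∂stripVol a c d, x.1 ∈ Ico 0 a ∧ x.2 ∈ Ioo c d := by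
  filter_upwards [ae_restrict_mem (measurableSet_Ico.prod measurableSet_Ioo)] with x hx using hx

theorem ae_period_mem (a : ℝ) : ∀ᵐ t ∂perVol a, t ∈ Ico 0 a := ae_restrict_mem measurableSet_Ico

namespace ParamSurface

variable {S : ParamSurface} {γ : ℝ} {X Y : ℝ² → E3} {η : ℝ² → ℝ}

theorem continuous_gdet (h : ContDiff ℝ 3 S.α) : Continuous S.gdet :=
  continuous_iff_continuousAt.mpr fun _ => (contDiffAt_gdet h).continuousAt

theorem IsRegularStrip.isDensity_rt {c d : ℝ} (h : S.IsRegularStrip c d) :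
    IsDensity (stripVol S.a c d) S.rt := by
  have hc : Continuous S.rt := (continuous_gdet h.smooth).sqrt
  refine ⟨hc.measurable, ?_⟩
  set K := Icc 0 S.a ×ˢ Icc c d
  have hK : IsCompact K := isCompact_Icc.prod isCompact_Icc
  obtain ⟨k₂, hk₂⟩ := hK.exists_bound_of_continuousOn hc.continuousOn
  rcases K.eq_empty_or_nonempty with he | hne
  · refine ⟨1, one_pos, 0, ?_⟩
    filter_upwards [ae_strip_mem S.a c d] with x hx
    have : x ∈ K := ⟨Ico_subset_Icc_self hx.1, Ioo_subset_Icc_self hx.2⟩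
    rw [he] at this; exact this.elim
  · obtain ⟨x₀, hx₀, hmin⟩ := hK.exists_isMinOn hne hc.continuousOn
    refine ⟨S.rt x₀, rt_pos (h.gdet_pos x₀.1 x₀.2 hx₀.2), k₂, ?_⟩
    filter_upwards [ae_strip_mem S.a c d] with x hx
    have : x ∈ K := ⟨Ico_subset_Icc_self hx.1, Ioo_subset_Icc_self hx.2⟩
    exact ⟨hmin this, (le_abs_self _).trans (hk₂ x this)⟩

theorem IsRegularStrip.isDensity_αt {c d s : ℝ} (h : S.IsRegularStrip c d) (hs : s ∈ Icc c d) :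
    IsDensity (perVol S.a) fun t => ‖S.αt (t, s)‖ := by
  have hc : Continuous fun t => ‖S.αt (t, s)‖ := (continuous_iff_continuousAt.mpr fun x =>
      ((contDiffAt_αt (x := x) h.smooth).continuousAt)).norm.comp (by fun_prop)
  refine ⟨hc.measurable, ?_⟩
  obtain ⟨k₂, hk₂⟩ := (isCompact_Icc (a := 0) (b := S.a)).exists_bound_of_continuousOn
    hc.continuousOn
  obtain ⟨t₀, ht₀, hmin⟩ := (isCompact_Icc (a := 0) (b := S.a)).exists_isMinOn
    ⟨0, le_rfl, h.a_pos.le⟩ hc.continuousOn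
  refine ⟨‖S.αt (t₀, s)‖, norm_αt_pos (h.gdet_pos t₀ s hs), k₂, ?_⟩
  filter_upwards [ae_period_mem S.a] with t ht
  exact ⟨hmin (Ico_subset_Icc_self ht), (le_abs_self _).trans (hk₂ t (Ico_subset_Icc_self ht))⟩

/-- The coefficients of a tangent vector in the normalized basis. -/
def coeff (S : ParamSurface) (γ : ℝ) (X : ℝ² → E3) (i : Fin 2) (x : ℝ²) (v : E3) : ℝ :=
  sgnJ i * (S.fluxPS x v * S.mulA γ X x (S.e γ X i x) + S.fluxRS x v * S.mulB γ X x (S.e γ X i x))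

theorem coeff_add (i : Fin 2) (x : ℝ²) (u v : E3) :
    S.coeff γ X i x (u + v) = S.coeff γ X i x u + S.coeff γ X i x v := by
  simp only [coeff, fluxPS_add, fluxRS_add]; ring

theorem coeff_smul (i : Fin 2) (x : ℝ²) (k : ℝ) (v : E3) :
    S.coeff γ X i x (k • v) = k * S.coeff γ X i x v := by
  simp only [coeff, fluxPS_smul, fluxRS_smul]; ring

theorem mulA_self (x : ℝ²) : S.mulA γ X x (X x) = 0 := by
  rw [mulA, rot, real_inner_comm, show cross (X x) (S.n x) = cross (X x) (S.n x) from rfl,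
    inner_cross_self_left, mul_zero]

theorem mulA_basis_zero (x : ℝ²) : S.mulA γ X x (S.e γ X 0 x) = 0 := by
  rw [basis_zero, mulA_smul, mulA_self, mul_zero]

theorem fluxRS_basis_one (x : ℝ²) : S.fluxRS x (S.e γ X 1 x) = 0 := by
  rw [basis_one, fluxRS_smul, fluxRS, coordS_αt, mul_zero, mul_zero]

namespace IsMultiplier

variable {c d r : ℝ} {t s : ℝ}

variable (hX : S.IsMultiplier c d r X)
include hX

theorem c1Ext_spec {G : Type*} [NormedAddCommGroup G]
    [NormedSpace ℝ G] {f : ℝ² → G} (hf : IsC1Near S.a c d r f) :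
    ContDiff ℝ 1 (c1Ext S.a c d f) ∧
      (∀ t s, c1Ext S.a c d f (t + S.a, s) = c1Ext S.a c d f (t, s)) ∧
      ∀ t, ∀ s ∈ Icc c d, c1Ext S.a c d f =ᶠ[𝓝 (t, s)] f := by
  have h := hf.exists_extension hX.strip.a_pos hX.lt hX.r_lt
  simp only [c1Ext, h, dif_pos]
  exact h.choose_spec

theorem c1Ext_eq {G : Type*} [NormedAddCommGroup G]
    [NormedSpace ℝ G] {f : ℝ² → G} (hf : IsC1Near S.a c d r f) (hs : s ∈ Icc c d) :
    c1Ext S.a c d f (t, s) = f (t, s) := ((hX.c1Ext_spec hf).2.2 t s hs).self_of_nhds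

theorem isTestFun_c1Ext {f : ℝ² → ℝ}
    (hf : IsC1Near S.a c d r f) : IsTestFun S.a (c1Ext S.a c d f) :=
  ⟨(hX.c1Ext_spec hf).1, (hX.c1Ext_spec hf).2.1⟩

theorem coeff_isC1Near (i : Fin 2) {W : ℝ² → E3}
    (hW : IsC1Near S.a c d r W) : IsC1Near S.a c d r fun x => S.coeff γ X i x (W x) :=
  (IsC1Near.const (sgnJ i)).mul
    (((hX.strip.fluxPS hW).mul (hX.mulA_isC1Near (hX.basis_isC1Near i))).add
      ((hX.strip.fluxRS hW).mul (hX.mulB_isC1Near (hX.basis_isC1Near i))))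

theorem coeff_basis (hs : s ∈ Icc c d) (i j : Fin 2) :
    S.coeff γ X i (t, s) (S.e γ X j (t, s)) = if i = j then 1 else 0 := by
  rw [coeff, hX.fluxS_basis hs]
  fin_cases i <;> fin_cases j <;> simp [sgnJ]

theorem basis_zero_ne (hs : s ∈ Icc c d) :
    0 < √(S.wt γ (t, s) * S.sff (t, s) (X (t, s)) (X (t, s)) * S.rt (t, s)
      * S.coordS (t, s) (X (t, s))) :=
  Real.sqrt_pos.mpr (mul_pos (mul_pos (mul_pos (wt_pos _) (hX.sff_pos t s hs))
    (rt_pos (hX.strip.gdet_pos t s hs))) (hX.coordS_pos t s hs))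

theorem basis_one_ne (hs : s ∈ Icc c d) :
    0 < √(S.wt γ (t, s) * S.h11 (t, s) * S.rt (t, s) * S.coordS (t, s) (X (t, s))) :=
  Real.sqrt_pos.mpr (mul_pos (mul_pos (mul_pos (wt_pos _) (hX.h11_pos t s hs))
    (rt_pos (hX.strip.gdet_pos t s hs))) (hX.coordS_pos t s hs))

theorem eq_coeff (hs : s ∈ Icc c d) {v : E3}
    (hv : S.IsTangent (t, s) v) : v = S.coeff γ X 0 (t, s) v • S.e γ X 0 (t, s)
      + S.coeff γ X 1 (t, s) v • S.e γ X 1 (t, s) := by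
  have hg := hX.strip.gdet_pos t s hs
  have hτ := hX.strip.τ_sq
  have q0 := hX.basis_zero_ne (γ := γ) (t := t) hs
  have q1 := hX.basis_one_ne (γ := γ) (t := t) hs
  have hXs := hX.coordS_pos t s hs
  obtain ⟨p, q, hpq⟩ : ∃ p q : ℝ, v = p • S.e γ X 0 (t, s) + q • S.e γ X 1 (t, s) := by
    rw [basis_zero, basis_one]
    set k0 := √(S.wt γ (t, s) * S.sff (t, s) (X (t, s)) (X (t, s)) * S.rt (t, s)
      * S.coordS (t, s) (X (t, s)))
    set k1 := √(S.wt γ (t, s) * S.h11 (t, s) * S.rt (t, s) * S.coordS (t, s) (X (t, s)))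
    refine ⟨k0 * (S.coordS (t, s) v / S.coordS (t, s) (X (t, s))),
      k1 * (S.coordT (t, s) v - S.coordS (t, s) v / S.coordS (t, s) (X (t, s))
        * S.coordT (t, s) (X (t, s))), ?_⟩
    rw [smul_smul, smul_smul, mul_comm k0, mul_assoc, mul_inv_cancel₀ q0.ne', mul_one,
      mul_comm k1, mul_assoc, mul_inv_cancel₀ q1.ne', mul_one]
    nth_rw 1 [hv.eq_coord hτ hg]
    have hXe : (S.coordS (t, s) v / S.coordS (t, s) (X (t, s))) • X (t, s)
        = (S.coordS (t, s) v / S.coordS (t, s) (X (t, s)) * S.coordT (t, s) (X (t, s)))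
          • S.αt (t, s) + S.coordS (t, s) v • S.αs (t, s) := by
      have := congrArg (fun w => (S.coordS (t, s) v / S.coordS (t, s) (X (t, s))) • w)
        ((hX.tangent t s hs).eq_coord hτ hg)
      simpa only [smul_add, smul_smul, div_mul_cancel₀ _ hXs.ne'] using this
    rw [hXe, sub_smul]
    abel
  have h0 : S.coeff γ X 0 (t, s) v = p := by
    rw [hpq, coeff_add, coeff_smul, coeff_smul, hX.coeff_basis hs, hX.coeff_basis hs]; simp
  have h1 : S.coeff γ X 1 (t, s) v = q := by
    rw [hpq, coeff_add, coeff_smul, coeff_smul, hX.coeff_basis hs, hX.coeff_basis hs]; simp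
  rw [h0, h1]; exact hpq

theorem fluxRS_mul_mulB (hs : s ∈ Icc c d) :
    S.fluxRS (t, s) (S.e γ X 0 (t, s)) * S.mulB γ X (t, s) (S.e γ X 0 (t, s)) = 1 := by
  have h := hX.fluxS_basis (γ := γ) (t := t) hs 0 0
  rw [mulA_basis_zero, mul_zero, zero_add] at h
  simpa [sgnJ] using h

theorem fluxPS_mul_mulA (hs : s ∈ Icc c d) :
    S.fluxPS (t, s) (S.e γ X 1 (t, s)) * S.mulA γ X (t, s) (S.e γ X 1 (t, s)) = -1 := by
  have h := hX.fluxS_basis (γ := γ) (t := t) hs 1 1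
  rw [fluxRS_basis_one, zero_mul, add_zero] at h
  simpa [sgnJ] using h

theorem mulB_basis_zero_ne (hs : s ∈ Icc c d) :
    S.mulB γ X (t, s) (S.e γ X 0 (t, s)) ≠ 0 := fun h => by
  have := hX.fluxRS_mul_mulB (γ := γ) (t := t) hs
  rw [h, mul_zero] at this; exact zero_ne_one this

theorem mulA_basis_one_ne (hs : s ∈ Icc c d) :
    S.mulA γ X (t, s) (S.e γ X 1 (t, s)) ≠ 0 := fun h => by
  have := hX.fluxPS_mul_mulA (γ := γ) (t := t) hs
  rw [h, mul_zero] at this; norm_num at this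

/-- The bilinear flux through a curve `s = const` in the normalized basis. -/
theorem sum_flux (hs : s ∈ Icc c d) (y ψ : Fin 2 → ℝ) :
    S.fluxPS (t, s) (y 0 • S.e γ X 0 (t, s) + y 1 • S.e γ X 1 (t, s))
        * (ψ 0 * S.mulA γ X (t, s) (S.e γ X 0 (t, s)) + ψ 1 * S.mulA γ X (t, s) (S.e γ X 1 (t, s)))
      + S.fluxRS (t, s) (y 0 • S.e γ X 0 (t, s) + y 1 • S.e γ X 1 (t, s))
        * (ψ 0 * S.mulB γ X (t, s) (S.e γ X 0 (t, s)) + ψ 1 * S.mulB γ X (t, s) (S.e γ X 1 (t, s)))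
      = y 0 * ψ 0 - y 1 * ψ 1 := by
  have h := hX.fluxS_basis (γ := γ) (t := t) hs
  have h00 := h 0 0
  have h01 := h 0 1
  have h10 := h 1 0
  have h11 := h 1 1
  simp only [sgnJ, if_true, Fin.isValue, zero_ne_one, one_ne_zero, if_false,
    Matrix.cons_val_zero, Matrix.cons_val_one, Matrix.cons_val_fin_one] at h00 h01 h10 h11
  rw [fluxPS_add, fluxPS_smul, fluxPS_smul, fluxRS_add, fluxRS_smul, fluxRS_smul]
  linear_combination y 0 * ψ 0 * h00 + y 0 * ψ 1 * h01 + y 1 * ψ 0 * h10 + y 1 * ψ 1 * h11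

/-- A tangent field as a combination of `QX` and `∇n X`. -/
theorem eq_rot_shape (hs : s ∈ Icc c d) {v : E3} (hv : S.IsTangent (t, s) v) {k₁ k₂ : ℝ}
    (h₁ : inner ℝ (S.e γ X 0 (t, s)) v = k₁ * S.mulA γ X (t, s) (S.e γ X 0 (t, s))
      + k₂ * S.mulB γ X (t, s) (S.e γ X 0 (t, s)))
    (h₂ : inner ℝ (S.e γ X 1 (t, s)) v = k₁ * S.mulA γ X (t, s) (S.e γ X 1 (t, s))
      + k₂ * S.mulB γ X (t, s) (S.e γ X 1 (t, s))) :
    v = S.wt γ (t, s) • (k₁ • S.rot (t, s) (X (t, s)) + k₂ • S.shape (t, s) (X (t, s))) := by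
  have hg := hX.strip.gdet_pos t s hs
  set z := v - S.wt γ (t, s) • (k₁ • S.rot (t, s) (X (t, s)) + k₂ • S.shape (t, s) (X (t, s)))
    with hz
  have hzt : S.IsTangent (t, s) z := hv.sub ((((isTangent_rot _ _).smul _).add
    ((isTangent_shape hX.strip.τ_sq hX.strip.smooth hg _).smul _)).smul _)
  have z0 : inner ℝ (S.e γ X 0 (t, s)) z = 0 := by
    rw [hz, inner_sub_right, h₁, real_inner_smul_right, inner_add_right, real_inner_smul_right,
      real_inner_smul_right, mulA, mulB]; ring
  have z1 : inner ℝ (S.e γ X 1 (t, s)) z = 0 := by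
    rw [hz, inner_sub_right, h₂, real_inner_smul_right, inner_add_right, real_inner_smul_right,
      real_inner_smul_right, mulA, mulB]; ring
  have : z = 0 := by
    rw [← inner_self_eq_zero (𝕜 := ℝ)]
    nth_rw 1 [hX.eq_coeff (γ := γ) hs hzt]
    rw [inner_add_left, real_inner_smul_left, real_inner_smul_left, z0, z1]; simp
  exact sub_eq_zero.mp this

end IsMultiplier

end ParamSurface

/-! ### Fluxes and the divergence theorem in the parameters -/

section bounded_coefficients

variable {Z : Type*} [MeasurableSpace Z] {μ : Measure Z}

theorem exists_bound_of_top {e : Z → E3} (he : MemLp e ⊤ μ) : ∃ C, ∀ᵐ x ∂μ, ‖e x‖ ≤ C := by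
  have h := he.eLpNorm_lt_top
  rw [eLpNorm_exponent_top] at h
  exact ⟨_, (ae_le_eLpNormEssSup (f := e) (μ := μ)).mono fun x hx => by
    simpa using ENNReal.toReal_mono h.ne hx⟩

theorem memLp_inner_of_top {e V : Z → E3} (he : MemLp e ⊤ μ) (hV : MemLp V 2 μ) :
    MemLp (fun x => (inner ℝ (V x) (e x) : ℝ)) 2 μ := by
  obtain ⟨C, hC⟩ := exists_bound_of_top he
  refine hV.of_le_mul (c := C) (hV.1.inner he.1) ?_
  filter_upwards [hC] with x hx
  rw [mul_comm]
  exact (norm_inner_le_norm _ _).trans (mul_le_mul_of_nonneg_left hx (norm_nonneg _))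

theorem memLp_smul_of_top {e : Z → E3} {f : Z → ℝ} (he : MemLp e ⊤ μ) (hf : MemLp f 2 μ) :
    MemLp (fun x => f x • e x) 2 μ := by
  obtain ⟨C, hC⟩ := exists_bound_of_top he
  refine hf.of_le_mul (c := C) (hf.1.smul he.1) ?_
  filter_upwards [hC] with x hx
  rw [norm_smul, mul_comm]
  exact mul_le_mul_of_nonneg_right hx (norm_nonneg _)

theorem exists_bound_strip {a c d : ℝ} {G : Type*} [NormedAddCommGroup G] {f : ℝ² → G}
    (hf : ContinuousOn f (univ ×ˢ Icc c d)) :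
    ∃ N, 0 ≤ N ∧ ∀ t ∈ Ico 0 a, ∀ s ∈ Icc c d, ‖f (t, s)‖ ≤ N := by
  obtain ⟨C, hC⟩ := ((isCompact_Icc (a := (0 : ℝ)) (b := a)).prod
    (isCompact_Icc (a := c) (b := d))).exists_bound_of_continuousOn
    (hf.mono (prod_mono (subset_univ _) subset_rfl))
  exact ⟨max C 0, le_max_right _ _, fun t ht s hs =>
    (hC (t, s) ⟨Ico_subset_Icc_self ht, hs⟩).trans (le_max_left _ _)⟩

theorem memLp_top_strip {G : Type*} [NormedAddCommGroup G] [SecondCountableTopology G]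
    {a c d : ℝ} {f : ℝ² → G} (hf : ContinuousOn f (univ ×ˢ Icc c d)) :
    MemLp f ⊤ (stripVol a c d) := by
  borelize G
  obtain ⟨C, -, hC⟩ := exists_bound_strip (a := a) hf
  refine MemLp.of_bound ?_ C ?_
  · exact (hf.mono (prod_mono (subset_univ _) Ioo_subset_Icc_self)).aestronglyMeasurable
      (measurableSet_Ico.prod measurableSet_Ioo)
  · filter_upwards [ae_strip_mem a c d] with x hx
    exact hC _ hx.1 _ (Ioo_subset_Icc_self hx.2)

end bounded_coefficients

theorem IsC1Near.continuous_slice {a c d r s : ℝ} {G : Type*} [NormedAddCommGroup G]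
    [NormedSpace ℝ G] {f : ℝ² → G} (hf : IsC1Near a c d r f) (hs : s ∈ Icc c d) :
    Continuous fun t => f (t, s) :=
  hf.continuousOn.comp_continuous (by fun_prop) fun _ => ⟨mem_univ _, hs⟩

namespace ParamSurface

variable {S : ParamSurface} {γ ε r : ℝ} {X Y V W : ℝ² → E3} {η : ℝ² → ℝ} {t s : ℝ}

/-- The tangent vector that represents the `α_t`-component. -/
def covT (S : ParamSurface) (x : ℝ²) : E3 := (S.gdet x)⁻¹ • ((inner ℝ (S.αs x) (S.αs x) : ℝ) • S.αt x
  - (inner ℝ (S.αt x) (S.αs x) : ℝ) • S.αs x)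

/-- The tangent vector that represents the `α_s`-component. -/
def covS (S : ParamSurface) (x : ℝ²) : E3 := (S.gdet x)⁻¹ • ((inner ℝ (S.αt x) (S.αt x) : ℝ) • S.αs x
  - (inner ℝ (S.αt x) (S.αs x) : ℝ) • S.αt x)

theorem coordT_eq_inner (x : ℝ²) (v : E3) : S.coordT x v = inner ℝ v (S.covT x) := by
  simp only [coordT, covT, real_inner_smul_right, inner_sub_right]; field_simp

theorem coordS_eq_inner (x : ℝ²) (v : E3) : S.coordS x v = inner ℝ v (S.covS x) := by
  simp only [coordS, covS, real_inner_smul_right, inner_sub_right]; field_simp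

/-- The map `π` is the inclusion of the strip or of a curve `s = const`: functions that are
continuous on the closed strip are bounded along `π`. -/
structure IsSlice (S : ParamSurface) (ε : ℝ) {Z : Type*} [MeasurableSpace Z] (μ : Measure Z)
    (π : Z → ℝ²) : Prop where
  mem : ∀ᵐ z ∂μ, (π z).2 ∈ Icc (-ε) S.b₁
  real : ∀ f : ℝ² → ℝ, ContinuousOn f (univ ×ˢ Icc (-ε) S.b₁) → MemLp (fun z => f (π z)) ⊤ μ
  vec : ∀ f : ℝ² → E3, ContinuousOn f (univ ×ˢ Icc (-ε) S.b₁) → MemLp (fun z => f (π z)) ⊤ μ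

theorem isSlice_strip : S.IsSlice ε (S.vol ε) fun x => x where
  mem := (ae_strip_mem _ _ _).mono fun _ hx => Ioo_subset_Icc_self hx.2
  real _ := memLp_top_strip
  vec _ := memLp_top_strip

theorem isSlice_curve (hs : s ∈ Icc (-ε) S.b₁) : S.IsSlice ε (perVol S.a) fun t => (t, s) where
  mem := .of_forall fun _ => hs
  real _ hf := memLp_period (hf.comp_continuous (by fun_prop) fun _ => ⟨mem_univ _, hs⟩) ⊤
  vec _ hf := memLp_period (hf.comp_continuous (by fun_prop) fun _ => ⟨mem_univ _, hs⟩) ⊤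

/-- The adjoint operator in terms of `e^{-γκ} ⟨W, QX⟩` and `e^{-γκ} ⟨W, ∇n X⟩`. -/
theorem rt_mul_inner_opLstar {x : ℝ²} (hτ : S.τ ^ 2 = 1) (h : ContDiff ℝ 3 S.α)
    (hg : 0 < S.gdet x) (hX : ContDiffAt ℝ 1 X x) (hW : ContDiffAt ℝ 1 W x) {v : E3}
    (hv : S.IsTangent x v) :
    S.rt x * inner ℝ v (S.opLstar γ η X Y W x)
      = S.adjPair η X Y (fun y => S.mulA γ X y (W y)) (fun y => S.mulB γ X y (W y)) x v := by
  have hAQ (f : ℝ² → ℝ) : S.rt x * inner ℝ v (S.shape x (S.rot x (S.grad f x)))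
      = -(S.fluxPT x v * dT f x + S.fluxPS x v * dS f x) := by
    rw [inner_shape_comm hτ h hg (isTangent_rot _ _) hv, inner_rot_comm hg, inner_grad_eq hg,
      fluxPT, fluxPS]; ring
  have hD (f : ℝ² → ℝ) : S.rt x * inner ℝ v (S.grad f x)
      = S.fluxRT x v * dT f x + S.fluxRS x v * dS f x := by
    rw [inner_grad_eq hg, fluxRT, fluxRS]; ring
  have dw : DifferentiableAt ℝ (S.wt γ) x := (contDiffAt_wt h hg).differentiableAt one_ne_zero
  have da : DifferentiableAt ℝ (fun y => (inner ℝ (W y) (S.rot y (X y)) : ℝ)) x :=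
    (hW.inner ℝ (contDiffAt_rot h hg hX)).differentiableAt one_ne_zero
  have db : DifferentiableAt ℝ (fun y => (inner ℝ (W y) (S.shape y (X y)) : ℝ)) x :=
    (hW.inner ℝ (contDiffAt_shape h hg hX)).differentiableAt one_ne_zero
  rw [adjPair]
  simp only [mulA, mulB]
  rw [dT_mul dw da, dS_mul dw da, dT_mul dw db, dS_mul dw db, dT_wt h hg, dS_wt h hg]
  have e1 := hAQ fun y => inner ℝ (W y) (S.rot y (X y))
  have e2 := hD fun y => inner ℝ (W y) (S.shape y (X y))
  have e3 := hAQ S.curv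
  have e4 := hD S.curv
  simp only [opLstar, inner_sub_right, inner_add_right, real_inner_smul_right]
  rw [show Real.exp (-γ * S.curv x) = S.wt γ x from rfl]
  linear_combination S.wt γ x * e1 - S.wt γ x * e2
    - S.wt γ x * γ * inner ℝ (W x) (S.rot x (X x)) * e3
    + S.wt γ x * γ * inner ℝ (W x) (S.shape x (X x)) * e4

/-- A field that satisfies the divergence theorem has a weak divergence. -/
theorem HasNormalTrace.hasWeakDiv {f : ℝ² → ℝ} {Zb Zt : ℝ → E3}
    (h : S.HasNormalTrace ε V f Zb Zt) : S.HasWeakDiv ε V f := by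
  rintro φ hφ ⟨c, d, hc, hd, h0⟩
  have hb (t) : φ (t, -ε) = 0 := h0 t _ fun hm => absurd hm.1 (not_le.mpr hc)
  have ht (t) : φ (t, S.b₁) = 0 := h0 t _ fun hm => absurd hm.2 (not_le.mpr hd)
  have := h φ hφ
  simp only [hb, ht, mul_zero, integral_zero, add_zero] at this
  linarith

namespace IsMultiplier

theorem memLp_mul_strip (hf : ContinuousOn f (univ ×ˢ Icc (-ε) S.b₁)) {g : ℝ² → ℝ}
    (hg : MemLp g 2 (S.vol ε)) :
    MemLp (fun x => f x * g x) 2 (S.vol ε) :=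
  memLp_mul (memLp_top_strip hf) hg

variable (hX : S.IsMultiplier (-ε) S.b₁ r X)
include hX

theorem bot_mem : -ε ∈ Icc (-ε) S.b₁ := ⟨le_rfl, hX.lt.le⟩

theorem top_mem : S.b₁ ∈ Icc (-ε) S.b₁ := ⟨hX.lt.le, le_rfl⟩

theorem integral_area (f : ℝ² → ℝ) : ∫ x, f x ∂S.area ε = ∫ x, S.rt x * f x ∂S.vol ε :=
  hX.strip.isDensity_rt.integral_eq f

theorem integral_arc (hs : s ∈ Icc (-ε) S.b₁) (f : ℝ → ℝ) :
    ∫ t, f t ∂S.arc s = ∫ t, ‖S.αt (t, s)‖ * f t ∂perVol S.a :=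
  (hX.strip.isDensity_αt hs).integral_eq f

theorem ae_area {P : ℝ² → Prop} : (∀ᵐ x ∂S.area ε, P x) ↔ ∀ᵐ x ∂S.vol ε, P x :=
  hX.strip.isDensity_rt.ae_iff

theorem ae_arc (hs : s ∈ Icc (-ε) S.b₁) {P : ℝ → Prop} :
    (∀ᵐ t ∂S.arc s, P t) ↔ ∀ᵐ t ∂perVol S.a, P t :=
  (hX.strip.isDensity_αt hs).ae_iff

theorem memLp_area {G : Type*} [NormedAddCommGroup G] {f : ℝ² → G} {p : ENNReal} :
    MemLp f p (S.area ε) ↔ MemLp f p (S.vol ε) :=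
  hX.strip.isDensity_rt.memLp_iff

theorem memLp_arc (hs : s ∈ Icc (-ε) S.b₁) {G : Type*}
    [NormedAddCommGroup G] {f : ℝ → G} {p : ENNReal} :
    MemLp f p (S.arc s) ↔ MemLp f p (perVol S.a) :=
  (hX.strip.isDensity_αt hs).memLp_iff

theorem inner_νBot (t : ℝ) (v : E3) :
    ‖S.αt (t, -ε)‖ * inner ℝ v (S.νBot ε t) = -S.fluxRS (t, -ε) v := by
  rw [νBot, inner_neg_right, mul_neg, norm_mul_inner_conormal (hX.strip.gdet_pos t _ hX.bot_mem)]
  rfl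

theorem inner_νTop (t : ℝ) (v : E3) :
    ‖S.αt (t, S.b₁)‖ * inner ℝ v (S.νTop t) = S.fluxRS (t, S.b₁) v := by
  rw [νTop, norm_mul_inner_conormal (hX.strip.gdet_pos t _ hX.top_mem)]; rfl

/-- The divergence theorem in the parameter domain. -/
theorem hasNormalTrace_iff (f : ℝ² → ℝ) (Zb Zt : ℝ → E3) :
    S.HasNormalTrace ε V f Zb Zt ↔ ∀ φ, IsTestFun S.a φ → ∫ x, S.rt x * (f x * φ x) ∂S.vol ε
        + ∫ x, (S.fluxRT x (V x) * dT φ x + S.fluxRS x (V x) * dS φ x) ∂S.vol ε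
      = ∫ t, S.fluxRS (t, S.b₁) (Zt t) * φ (t, S.b₁) ∂perVol S.a
        - ∫ t, S.fluxRS (t, -ε) (Zb t) * φ (t, -ε) ∂perVol S.a := by
  have e (φ : ℝ² → ℝ) : S.IsC1Fun φ ↔ IsTestFun S.a φ := ⟨fun h => ⟨h.1, h.2⟩, fun h => ⟨h.1, h.2⟩⟩
  refine forall_congr' fun φ => ?_
  rw [e]
  refine forall_congr' fun hφ => ?_
  rw [hX.integral_area, hX.integral_area, hX.integral_arc hX.bot_mem, hX.integral_arc hX.top_mem]
  have e1 : ∫ x, S.rt x * inner ℝ (V x) (S.grad φ x) ∂S.vol ε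
      = ∫ x, (S.fluxRT x (V x) * dT φ x + S.fluxRS x (V x) * dS φ x) ∂S.vol ε := by
    refine integral_congr_ae ?_
    filter_upwards [ae_strip_mem S.a (-ε) S.b₁] with x hx
    rw [inner_grad_eq (hX.strip.gdet_pos x.1 x.2 (Ioo_subset_Icc_self hx.2)), fluxRT, fluxRS]; ring
  have e2 : ∫ t, ‖S.αt (t, -ε)‖ * (inner ℝ (Zb t) (S.νBot ε t) * φ (t, -ε)) ∂perVol S.a
      = -∫ t, S.fluxRS (t, -ε) (Zb t) * φ (t, -ε) ∂perVol S.a := by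
    rw [← integral_neg]
    congr 1; ext t; rw [← mul_assoc, hX.inner_νBot]; ring
  have e3 : ∫ t, ‖S.αt (t, S.b₁)‖ * (inner ℝ (Zt t) (S.νTop t) * φ (t, S.b₁)) ∂perVol S.a
      = ∫ t, S.fluxRS (t, S.b₁) (Zt t) * φ (t, S.b₁) ∂perVol S.a := by
    congr 1; ext t; rw [← mul_assoc, hX.inner_νTop]
  rw [e1, e2, e3, neg_add_eq_sub]

section integrability

variable {Z : Type*} [MeasurableSpace Z] {μ : Measure Z} {π : Z → ℝ²} {V : Z → E3}
  (hπ : S.IsSlice ε μ π) (hV : MemLp V 2 μ)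
include hπ hV

theorem memLp_coordT : MemLp (fun z => S.coordT (π z) (V z)) 2 μ := by
  have ht := hX.strip.αt (r := r)
  have hs := hX.strip.αs (r := r)
  simp only [coordT_eq_inner]
  exact memLp_inner_of_top (hπ.vec _ (((continuous_gdet hX.strip.smooth).continuousOn.inv₀ fun x hx =>
    (hX.strip.gdet_pos x.1 x.2 hx.2).ne').smul
      (((hs.inner hs).smul ht).sub ((ht.inner hs).smul hs)).continuousOn)) hV

theorem memLp_coordS : MemLp (fun z => S.coordS (π z) (V z)) 2 μ := by
  have ht := hX.strip.αt (r := r)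
  have hs := hX.strip.αs (r := r)
  simp only [coordS_eq_inner]
  exact memLp_inner_of_top (hπ.vec _ (((continuous_gdet hX.strip.smooth).continuousOn.inv₀ fun x hx =>
    (hX.strip.gdet_pos x.1 x.2 hx.2).ne').smul
      (((ht.inner ht).smul hs).sub ((ht.inner hs).smul ht)).continuousOn)) hV

theorem memLp_fluxRT : MemLp (fun z => S.fluxRT (π z) (V z)) 2 μ :=
  memLp_mul (hπ.real _ (hX.strip.rt (r := r)).continuousOn) (hX.memLp_coordT hπ hV)

theorem memLp_fluxRS : MemLp (fun z => S.fluxRS (π z) (V z)) 2 μ :=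
  memLp_mul (hπ.real _ (hX.strip.rt (r := r)).continuousOn) (hX.memLp_coordS hπ hV)

theorem memLp_fluxPT : MemLp (fun z => S.fluxPT (π z) (V z)) 2 μ :=
  (((memLp_mul (hπ.real _ (hX.strip.h12 (r := r)).continuousOn) (hX.memLp_coordT hπ hV)).add
    (memLp_mul (hπ.real _ (hX.strip.h22 (r := r)).continuousOn) (hX.memLp_coordS hπ hV))).const_mul
      S.τ).ae_eq (hπ.mem.mono fun _ hz => (fluxPT_eq (hX.strip.gdet_pos _ _ hz) _).symm)

theorem memLp_fluxPS : MemLp (fun z => S.fluxPS (π z) (V z)) 2 μ :=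
  (((memLp_mul (hπ.real _ (hX.strip.h11 (r := r)).continuousOn) (hX.memLp_coordT hπ hV)).add
    (memLp_mul (hπ.real _ (hX.strip.h12 (r := r)).continuousOn) (hX.memLp_coordS hπ hV))).const_mul
      S.τ).neg.ae_eq (hπ.mem.mono fun _ hz =>
        (fluxPS_eq hX.strip.smooth (hX.strip.gdet_pos _ _ hz) _).symm)

theorem memLp_coeff (i : Fin 2) : MemLp (fun z => S.coeff γ X i (π z) (V z)) 2 μ := by
  have hb := hX.basis_isC1Near (γ := γ) i
  refine (((memLp_mul (hπ.real _ (hX.mulA_isC1Near (γ := γ) hb).continuousOn)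
    (hX.memLp_fluxPS hπ hV)).add (memLp_mul (hπ.real _ (hX.mulB_isC1Near (γ := γ) hb).continuousOn)
      (hX.memLp_fluxRS hπ hV))).const_mul (sgnJ i)).ae_eq (.of_forall fun z => ?_)
  simp only [coeff, Pi.add_apply]; ring

omit hV in
theorem memLp_comb {y : Fin 2 → Z → ℝ} (hy : ∀ i, MemLp (y i) 2 μ) :
    MemLp (fun z => y 0 z • S.e γ X 0 (π z) + y 1 z • S.e γ X 1 (π z)) 2 μ :=
  (memLp_smul_of_top (hπ.vec _ (hX.basis_isC1Near 0).continuousOn) (hy 0)).add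
    (memLp_smul_of_top (hπ.vec _ (hX.basis_isC1Near 1).continuousOn) (hy 1))

end integrability

end IsMultiplier

end ParamSurface

/-! ### Density of test functions and uniqueness of boundary values -/

section density

variable {a c d s₀ : ℝ}

/-- Test functions approximate a function on the strip and, independently, one on a boundary
curve. -/
theorem exists_isTestFun_near (ha : 0 < a) (hs₀ : s₀ ∉ Ioo c d) {f : ℝ² → ℝ} {h : ℝ → ℝ}
    (hf : MemLp f 2 (stripVol a c d)) (hh : MemLp h 2 (perVol a)) {r : ℝ} (hr : 0 < r) :
    ∃ ψ, IsTestFun a ψ ∧ ∫ x, (f x - ψ x) ^ 2 ∂stripVol a c d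
      + ∫ t, (h t - ψ (t, s₀)) ^ 2 ∂perVol a < r := by
  let e (ψ : ℝ² → ℝ) : WithLp 2 (StripL2 a c d × PerL2 a) :=
    WithLp.toLp 2 (cls _ ψ, cls _ fun t => ψ (t, s₀))
  have m0 {χ} (h : IsTestFun a χ) : MemLp χ 2 (stripVol a c d) := memLp_strip h.continuous 2
  have m1 {χ} (h : IsTestFun a χ) : MemLp (fun t => χ (t, s₀)) 2 (perVol a) :=
    slice_memLp h.continuous s₀
  have hadd {χ ψ} (hχ : IsTestFun a χ) (hψ : IsTestFun a ψ) : e (χ + ψ) = e χ + e ψ := by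
    simp only [e, ← WithLp.toLp_add, Prod.mk_add_mk]
    rw [← cls_add (m0 hχ) (m0 hψ), ← cls_add (m1 hχ) (m1 hψ)]; rfl
  have hsmul {χ} (hχ : IsTestFun a χ) (k : ℝ) : e (k • χ) = k • e χ := by
    simp only [e, ← WithLp.toLp_smul, Prod.smul_mk]
    rw [← cls_smul (m0 hχ) k, ← cls_smul (m1 hχ) k]; rfl
  let K : Submodule ℝ (WithLp 2 (StripL2 a c d × PerL2 a)) :=
    { carrier := {z | ∃ ψ, IsTestFun a ψ ∧ e ψ = z}
      add_mem' := by rintro _ _ ⟨χ, hχ, rfl⟩ ⟨ψ, hψ, rfl⟩; exact ⟨χ + ψ, hχ.add hψ, hadd hχ hψ⟩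
      zero_mem' := ⟨(0 : ℝ) • fun _ => 0, by
        rw [zero_smul]; exact IsTestFun.const a 0, by
        rw [hsmul (IsTestFun.const a 0), zero_smul]⟩
      smul_mem' := by
        rintro k _ ⟨χ, hχ, rfl⟩; exact ⟨k • χ, (IsTestFun.const a k).mul hχ, hsmul hχ k⟩ }
  have hK : K.topologicalClosure = ⊤ := by
    rw [Submodule.topologicalClosure_eq_top_iff, Submodule.eq_bot_iff]
    intro z hz
    have hz' (ψ) (hψ : IsTestFun a ψ) : inner ℝ z.fst (cls _ ψ)
        + inner ℝ z.snd (cls _ fun t => ψ (t, s₀)) = 0 := by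
      have := (K.mem_orthogonal' z).mp hz (e ψ) ⟨ψ, hψ, rfl⟩
      rwa [WithLp.prod_inner_apply] at this
    -- test functions supported in the open strip do not see the boundary curve
    have h1 : z.fst = 0 := by
      rw [Lp.eq_zero_iff_ae_eq_zero]
      refine ae_eq_zero_of_forall_test ha ((Lp.memLp _).integrable (by norm_num)) ?_
      rintro χ hχ ⟨c', d', hc, hd, h0⟩
      have := hz' χ hχ
      have h00 : (fun t => χ (t, s₀)) = fun _ => (0 : ℝ) • 0 := funext fun t => by
        rw [smul_zero]
        exact h0 t s₀ fun hm => hs₀ ⟨hc.trans_le hm.1, hm.2.trans_lt hd⟩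
      have e0 : cls (perVol a) (fun t => χ (t, s₀)) = 0 := by
        rw [h00]
        exact (cls_smul (memLp_const 0) 0).trans (zero_smul _ _)
      rw [e0, inner_zero_right, add_zero, inner_cls _ (m0 hχ)] at this
      exact this
    have h2 : z.snd = 0 := by
      rw [Lp.eq_zero_iff_ae_eq_zero]
      refine ae_eq_zero_of_forall_periodic ha ((Lp.memLp _).integrable (by norm_num)) ?_
      intro φ hφ hp
      have hφ1 : IsTestFun a fun x => φ x.1 := ⟨hφ.comp contDiff_fst, fun t s => hp t⟩
      have := hz' (fun x => φ x.1) hφ1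
      rw [h1, inner_zero_left, zero_add, inner_cls _ (m1 hφ1)] at this
      exact this
    exact (WithLp.ofLp_injective 2) (Prod.ext h1 h2)
  have hmem : WithLp.toLp 2 (cls (stripVol a c d) f, cls (perVol a) h)
      ∈ closure (K : Set (WithLp 2 (StripL2 a c d × PerL2 a))) := by
    rw [← Submodule.topologicalClosure_coe, hK]; trivial
  obtain ⟨_, ⟨ψ, hψ, rfl⟩, hd⟩ := Metric.mem_closure_iff.mp hmem (√r) (Real.sqrt_pos.mpr hr)
  refine ⟨ψ, hψ, ?_⟩
  have h2 : dist (WithLp.toLp 2 (cls (stripVol a c d) f, cls (perVol a) h)) (e ψ) ^ 2 < r := by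
    rw [← Real.sq_sqrt hr.le]; exact pow_lt_pow_left₀ hd dist_nonneg two_ne_zero
  rw [dist_eq_norm, WithLp.prod_norm_sq_eq_of_L2] at h2
  have e1 : ‖cls (stripVol a c d) f - cls _ ψ‖ ^ 2 = ∫ x, (f x - ψ x) ^ 2 ∂stripVol a c d := by
    rw [← cls_sub hf (m0 hψ)]; exact norm_cls_sq (hf.sub (m0 hψ))
  have e2 : ‖cls (perVol a) h - cls _ fun t => ψ (t, s₀)‖ ^ 2
      = ∫ t, (h t - ψ (t, s₀)) ^ 2 ∂perVol a := by
    rw [← cls_sub hh (m1 hψ)]; exact norm_cls_sq (hh.sub (m1 hψ))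
  rw [← e1, ← e2]
  exact h2

end density

namespace SymmSystem

variable {Q : SymmSystem} {a c d c₀ : ℝ}

/-- Green's formula for a solution `y` with boundary values `zb` along `s = c` and `zt` along
`s = d`. -/
def IsGreenFun (Q : SymmSystem) (a c d : ℝ) (y g : Fin 2 → ℝ² → ℝ) (zb zt : Fin 2 → ℝ → ℝ) : Prop :=
  ∀ ψ : Fin 2 → ℝ² → ℝ, (∀ i, IsTestFun a (ψ i)) → ∫ x, ∑ i, y i x * Q.adjFun ψ i x ∂stripVol a c d
      = ∫ x, ∑ i, g i x * ψ i x ∂stripVol a c d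
        - ∫ t, (zt 0 t * ψ 0 (t, d) - zt 1 t * ψ 1 (t, d)) ∂perVol a
        + ∫ t, (zb 0 t * ψ 0 (t, c) - zb 1 t * ψ 1 (t, c)) ∂perVol a

variable {y y' g g' : Fin 2 → ℝ² → ℝ} {zb zt zb' zt' : Fin 2 → ℝ → ℝ}

theorem IsGreenFun.isWeakFun (h : Q.IsGreenFun a c d y g zb zt) :
    Q.IsWeakFun a c d y g (zt 0) (zb 1) := by
  intro ψ hψ h0 h1
  rw [h ψ hψ]
  simp only [h0, h1, mul_zero, sub_zero, zero_sub, integral_neg]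
  ring

/-- The boundary values of a solution are determined by the solution. -/
theorem IsGreenFun.traces_unique (ha : 0 < a) (hcd : c < d)
    (h : Q.IsGreenFun a c d y g zb zt) (h' : Q.IsGreenFun a c d y' g' zb' zt')
    (hy : ∀ i, y' i =ᵐ[stripVol a c d] y i) (hg : ∀ i, g' i =ᵐ[stripVol a c d] g i)
    (hb : ∀ i, MemLp (zb i) 2 (perVol a)) (ht : ∀ i, MemLp (zt i) 2 (perVol a))
    (hb' : ∀ i, MemLp (zb' i) 2 (perVol a)) (ht' : ∀ i, MemLp (zt' i) 2 (perVol a))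
    (i : Fin 2) : zb' i =ᵐ[perVol a] zb i ∧ zt' i =ᵐ[perVol a] zt i := by
  have key (ψ : Fin 2 → ℝ² → ℝ) (hψ : ∀ i, IsTestFun a (ψ i)) :
      - ∫ t, (zt 0 t * ψ 0 (t, d) - zt 1 t * ψ 1 (t, d)) ∂perVol a
        + ∫ t, (zb 0 t * ψ 0 (t, c) - zb 1 t * ψ 1 (t, c)) ∂perVol a
      = - ∫ t, (zt' 0 t * ψ 0 (t, d) - zt' 1 t * ψ 1 (t, d)) ∂perVol a
        + ∫ t, (zb' 0 t * ψ 0 (t, c) - zb' 1 t * ψ 1 (t, c)) ∂perVol a := by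
    have e1 : ∫ x, ∑ i, y' i x * Q.adjFun ψ i x ∂stripVol a c d
        = ∫ x, ∑ i, y i x * Q.adjFun ψ i x ∂stripVol a c d := by
      refine integral_congr_ae ?_
      filter_upwards [hy 0, hy 1] with x h0 h1
      rw [Fin.sum_univ_two, Fin.sum_univ_two, h0, h1]
    have e2 : ∫ x, ∑ i, g' i x * ψ i x ∂stripVol a c d
        = ∫ x, ∑ i, g i x * ψ i x ∂stripVol a c d := by
      refine integral_congr_ae ?_
      filter_upwards [hg 0, hg 1] with x h0 h1
      rw [Fin.sum_univ_two, Fin.sum_univ_two, h0, h1]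
    have := h ψ hψ
    have := h' ψ hψ
    linarith
  have fin {z z' : ℝ → ℝ} (hz : MemLp z 2 (perVol a)) (hz' : MemLp z' 2 (perVol a))
      (he : ∀ φ : ℝ → ℝ, ContDiff ℝ 1 φ → (∀ t, φ (t + a) = φ t) →
        ∫ t, z t * φ t ∂perVol a = ∫ t, z' t * φ t ∂perVol a) :
      z' =ᵐ[perVol a] z := by
    have h0 : (fun t => z' t - z t) =ᵐ[perVol a] 0 := by
      refine ae_eq_zero_of_forall_periodic ha ((hz'.sub hz).integrable (by norm_num)) ?_
      intro φ hφ hp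
      have mφ : MemLp φ 2 (perVol a) := memLp_period hφ.continuous 2
      simp only [sub_mul]
      have i1 : Integrable (fun t => z' t * φ t) (perVol a) := hz'.integrable_mul mφ
      have i2 : Integrable (fun t => z t * φ t) (perVol a) := hz.integrable_mul mφ
      rw [integral_sub i1 i2, he φ hφ hp, sub_self]
    filter_upwards [h0] with t ht0
    exact sub_eq_zero.mp ht0
  have hf (φ : ℝ → ℝ) (hφ : ContDiff ℝ 1 φ) (hp : ∀ t, φ (t + a) = φ t) (k : ℝ) :
      IsTestFun a fun x => φ x.1 * (x.2 - k) :=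
    ⟨(hφ.comp contDiff_fst).mul (contDiff_snd.sub contDiff_const), fun t s => by simp only [hp]⟩
  have hz := IsTestFun.const a 0
  have hdc : d - c ≠ 0 := (sub_pos.mpr hcd).ne'
  have hcd' : c - d ≠ 0 := (sub_neg.mpr hcd).ne
  have fin' {z z' : ℝ → ℝ} {k : ℝ} (hk : k ≠ 0) (hz : MemLp z 2 (perVol a))
      (hz' : MemLp z' 2 (perVol a))
      (he : ∀ φ : ℝ → ℝ, ContDiff ℝ 1 φ → (∀ t, φ (t + a) = φ t) →
        ∫ t, z t * (φ t * k) ∂perVol a = ∫ t, z' t * (φ t * k) ∂perVol a) :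
      z' =ᵐ[perVol a] z := by
    refine fin hz hz' fun φ hφ hp => ?_
    have := he φ hφ hp
    simp only [← mul_assoc] at this
    rw [integral_mul_const, integral_mul_const] at this
    exact mul_right_cancel₀ hk this
  fin_cases i
  · constructor
    · refine fin' hcd' (hb 0) (hb' 0) fun φ hφ hp => ?_
      simpa using key ![fun x => φ x.1 * (x.2 - d), fun _ => 0]
        (Fin.forall_fin_two.mpr ⟨hf φ hφ hp d, hz⟩)
    · refine fin' hdc (ht 0) (ht' 0) fun φ hφ hp => ?_
      simpa using key ![fun x => φ x.1 * (x.2 - c), fun _ => 0]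
        (Fin.forall_fin_two.mpr ⟨hf φ hφ hp c, hz⟩)
  · constructor
    · refine fin' hcd' (hb 1) (hb' 1) fun φ hφ hp => ?_
      simpa [integral_neg] using key ![fun _ => 0, fun x => φ x.1 * (x.2 - d)]
        (Fin.forall_fin_two.mpr ⟨hz, hf φ hφ hp d⟩)
    · refine fin' hdc (ht 1) (ht' 1) fun φ hφ hp => ?_
      simpa [integral_neg] using key ![fun _ => 0, fun x => φ x.1 * (x.2 - c)]
        (Fin.forall_fin_two.mpr ⟨hz, hf φ hφ hp c⟩)

end SymmSystem

/-! ### Green's formula for the two equations -/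

namespace ParamSurface

variable {S : ParamSurface} {γ ε r : ℝ} {X Y V W : ℝ² → E3} {η k₁ k₂ : ℝ² → ℝ} {t s : ℝ}
  {Zb Zt : ℝ → E3}

/-- Green's formula for the two equations `div (Q ∇n V) + ⟨V, Y - η QX⟩ = k₁` and
`div V - η ⟨V, ∇n X⟩ = k₂`, in the parameter domain. -/
def GreenPair (S : ParamSurface) (ε : ℝ) (η : ℝ² → ℝ) (X Y V : ℝ² → E3) (k₁ k₂ : ℝ² → ℝ)
    (Zb Zt : ℝ → E3) : Prop :=
  ∀ φ₁ φ₂, IsTestFun S.a φ₁ → IsTestFun S.a φ₂ → ∫ x, S.adjPair η X Y φ₁ φ₂ x (V x) ∂S.vol ε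
      = ∫ x, S.rt x * (k₁ x * φ₁ x + k₂ x * φ₂ x) ∂S.vol ε
        - ∫ t, (S.fluxPS (t, S.b₁) (Zt t) * φ₁ (t, S.b₁)
          + S.fluxRS (t, S.b₁) (Zt t) * φ₂ (t, S.b₁)) ∂perVol S.a
        + ∫ t, (S.fluxPS (t, -ε) (Zb t) * φ₁ (t, -ε)
          + S.fluxRS (t, -ε) (Zb t) * φ₂ (t, -ε)) ∂perVol S.a

namespace IsMultiplier

variable (hX : S.IsMultiplier (-ε) S.b₁ r X)
include hX

theorem memLp_inner_lower_order (hη : Continuous η)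
    (hY : ContinuousOn Y (univ ×ˢ Icc (-ε) S.b₁)) (hV : MemLp V 2 (S.vol ε)) :
    MemLp (fun x => (inner ℝ (V x) (Y x - η x • S.rot x (X x)) : ℝ)) 2 (S.vol ε) :=
  memLp_inner_of_top (memLp_top_strip (hY.sub
    (hη.continuousOn.smul (hX.strip.rot hX.smooth).continuousOn))) hV

theorem memLp_inner_shape (hη : Continuous η) (hV : MemLp V 2 (S.vol ε)) :
    MemLp (fun x => η x * inner ℝ (V x) (S.shape x (X x))) 2 (S.vol ε) :=
  memLp_mul_strip hη.continuousOn
    (memLp_inner_of_top (memLp_top_strip (hX.strip.shape hX.smooth).continuousOn) hV)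

/-- The divergence theorem for `Q ∇n V` and for `V` amounts to Green's formula for the pair. -/
theorem greenPair_iff (hη : Continuous η)
    (hY : ContinuousOn Y (univ ×ˢ Icc (-ε) S.b₁)) (hV : MemLp V 2 (S.vol ε))
    (hk₁ : MemLp k₁ 2 (S.vol ε)) (hk₂ : MemLp k₂ 2 (S.vol ε))
    (hPt : MemLp (fun t => S.fluxPS (t, S.b₁) (Zt t)) 2 (perVol S.a))
    (hRt : MemLp (fun t => S.fluxRS (t, S.b₁) (Zt t)) 2 (perVol S.a))
    (hPb : MemLp (fun t => S.fluxPS (t, -ε) (Zb t)) 2 (perVol S.a))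
    (hRb : MemLp (fun t => S.fluxRS (t, -ε) (Zb t)) 2 (perVol S.a)) :
    S.GreenPair ε η X Y V k₁ k₂ Zb Zt ↔ S.HasNormalTrace ε (S.rotShape V)
        (fun x => k₁ x - inner ℝ (V x) (Y x - η x • S.rot x (X x)))
        (fun t => S.rot (t, -ε) (S.shape (t, -ε) (Zb t)))
        (fun t => S.rot (t, S.b₁) (S.shape (t, S.b₁) (Zt t))) ∧
      S.HasNormalTrace ε V (fun x => k₂ x + η x * inner ℝ (V x) (S.shape x (X x))) Zb Zt := by
  rw [hX.hasNormalTrace_iff, hX.hasNormalTrace_iff]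
  set μ := S.vol ε
  have n1 := hX.memLp_inner_lower_order hη hY hV
  have n2 := hX.memLp_inner_shape hη hV
  have hrt := (hX.strip.rt (r := r)).continuousOn
  have i1 {φ} (h : IsTestFun S.a φ) :
      Integrable (fun x => S.fluxPT x (V x) * dT φ x + S.fluxPS x (V x) * dS φ x) μ :=
    ((hX.memLp_fluxPT isSlice_strip hV).integrable_mul h.memLp_dT).add
      ((hX.memLp_fluxPS isSlice_strip hV).integrable_mul h.memLp_dS)
  have i2 {φ} (h : IsTestFun S.a φ) :
      Integrable (fun x => S.fluxRT x (V x) * dT φ x + S.fluxRS x (V x) * dS φ x) μ :=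
    ((hX.memLp_fluxRT isSlice_strip hV).integrable_mul h.memLp_dT).add
      ((hX.memLp_fluxRS isSlice_strip hV).integrable_mul h.memLp_dS)
  have iz {f φ} (hf : MemLp f 2 μ) (h : IsTestFun S.a φ) :
      Integrable (fun x => S.rt x * (f x * φ x)) μ := by
    refine ((memLp_mul_strip hrt hf).integrable_mul h.memLp).congr (.of_forall fun x => ?_)
    simp only [Pi.mul_apply]; ring
  have ib {f : ℝ → ℝ} {φ} (hf : MemLp f 2 (perVol S.a)) (h : IsTestFun S.a φ) (s : ℝ) :
      Integrable (fun t => f t * φ (t, s)) (perVol S.a) :=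
    hf.integrable_mul (slice_memLp h.continuous s)
  have eadj {φ₁ φ₂} (h₁ : IsTestFun S.a φ₁) (h₂ : IsTestFun S.a φ₂) :
      ∫ x, S.adjPair η X Y φ₁ φ₂ x (V x) ∂μ
      = -(∫ x, (S.fluxPT x (V x) * dT φ₁ x + S.fluxPS x (V x) * dS φ₁ x) ∂μ)
        - ∫ x, (S.fluxRT x (V x) * dT φ₂ x + S.fluxRS x (V x) * dS φ₂ x) ∂μ
        + ∫ x, S.rt x * (inner ℝ (V x) (Y x - η x • S.rot x (X x)) * φ₁ x) ∂μ
        - ∫ x, S.rt x * ((η x * inner ℝ (V x) (S.shape x (X x))) * φ₂ x) ∂μ := by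
    have hJ : Integrable (fun x => S.rt x * (inner ℝ (V x) (Y x - η x • S.rot x (X x)) * φ₁ x)
        - S.rt x * ((η x * inner ℝ (V x) (S.shape x (X x))) * φ₂ x)) μ := (iz n1 h₁).sub (iz n2 h₂)
    have hI : Integrable (fun x => (S.fluxPT x (V x) * dT φ₁ x + S.fluxPS x (V x) * dS φ₁ x)
        + (S.fluxRT x (V x) * dT φ₂ x + S.fluxRS x (V x) * dS φ₂ x)) μ := (i1 h₁).add (i2 h₂)
    have e0 : ∫ x, S.adjPair η X Y φ₁ φ₂ x (V x) ∂μ = _ :=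
      (integral_congr_ae (.of_forall fun x => by simp only [adjPair]; ring)).trans
        (integral_sub hJ hI)
    rw [e0, integral_sub (iz n1 h₁) (iz n2 h₂), integral_add (i1 h₁) (i2 h₂)]
    ring
  have ek {φ₁ φ₂} (h₁ : IsTestFun S.a φ₁) (h₂ : IsTestFun S.a φ₂) :
      ∫ x, S.rt x * (k₁ x * φ₁ x + k₂ x * φ₂ x) ∂μ
      = ∫ x, S.rt x * (k₁ x * φ₁ x) ∂μ + ∫ x, S.rt x * (k₂ x * φ₂ x) ∂μ := by
    rw [← integral_add (iz hk₁ h₁) (iz hk₂ h₂)]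
    congr 1; ext x; ring
  have e1 {φ} (h : IsTestFun S.a φ) :
      ∫ x, S.rt x * ((k₁ x - inner ℝ (V x) (Y x - η x • S.rot x (X x))) * φ x) ∂μ
      = ∫ x, S.rt x * (k₁ x * φ x) ∂μ
        - ∫ x, S.rt x * (inner ℝ (V x) (Y x - η x • S.rot x (X x)) * φ x) ∂μ := by
    rw [← integral_sub (iz hk₁ h) (iz n1 h)]
    congr 1; ext x; ring
  have e2 {φ} (h : IsTestFun S.a φ) :
      ∫ x, S.rt x * ((k₂ x + η x * inner ℝ (V x) (S.shape x (X x))) * φ x) ∂μ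
      = ∫ x, S.rt x * (k₂ x * φ x) ∂μ
        + ∫ x, S.rt x * ((η x * inner ℝ (V x) (S.shape x (X x))) * φ x) ∂μ := by
    rw [← integral_add (iz hk₂ h) (iz n2 h)]
    congr 1; ext x; ring
  have z0 : IsTestFun S.a fun _ => (0 : ℝ) := IsTestFun.const _ 0
  have dT0 (x) : dT (fun _ : ℝ² => (0 : ℝ)) x = 0 := by simp [dT]
  have dS0 (x) : dS (fun _ : ℝ² => (0 : ℝ)) x = 0 := by simp [dS]
  change _ ↔ (∀ φ, IsTestFun S.a φ →
      ∫ x, S.rt x * ((k₁ x - inner ℝ (V x) (Y x - η x • S.rot x (X x))) * φ x) ∂μ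
        + ∫ x, (S.fluxPT x (V x) * dT φ x + S.fluxPS x (V x) * dS φ x) ∂μ
      = ∫ t, S.fluxPS (t, S.b₁) (Zt t) * φ (t, S.b₁) ∂perVol S.a
        - ∫ t, S.fluxPS (t, -ε) (Zb t) * φ (t, -ε) ∂perVol S.a) ∧ _
  constructor
  · intro H
    refine ⟨fun φ hφ => ?_, fun φ hφ => ?_⟩
    · have h1 := H φ _ hφ z0
      rw [eadj hφ z0] at h1
      simp only [mul_zero, dT0, dS0, add_zero, integral_zero, sub_zero] at h1
      rw [e1 hφ]; linarith
    · have h1 := H _ φ z0 hφ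
      rw [eadj z0 hφ] at h1
      simp only [mul_zero, dT0, dS0, add_zero, zero_add, integral_zero, neg_zero, zero_sub] at h1
      rw [e2 hφ]; linarith
  · rintro ⟨H1, H2⟩ φ₁ φ₂ h₁ h₂
    have h1 := H1 φ₁ h₁
    have h2 := H2 φ₂ h₂
    rw [e1 h₁] at h1
    rw [e2 h₂] at h2
    rw [eadj h₁ h₂, ek h₁ h₂, integral_add (ib hPt h₁ _) (ib hRt h₂ _),
      integral_add (ib hPb h₁ _) (ib hRb h₂ _)]
    linarith

section coordinates

variable {y : Fin 2 → ℝ² → ℝ} {zb zt : Fin 2 → ℝ → ℝ}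

/-- The test functions of the two equations and those of the system in the normalized basis
correspond to each other. -/
theorem greenPair_iff_isGreenFun 
    (hV : ∀ᵐ x ∂S.vol ε, V x = y 0 x • S.e γ X 0 x + y 1 x • S.e γ X 1 x)
    (hb : ∀ᵐ t ∂perVol S.a, Zb t = zb 0 t • S.e γ X 0 (t, -ε) + zb 1 t • S.e γ X 1 (t, -ε))
    (ht : ∀ᵐ t ∂perVol S.a, Zt t = zt 0 t • S.e γ X 0 (t, S.b₁) + zt 1 t • S.e γ X 1 (t, S.b₁)) :
    S.GreenPair ε η X Y V k₁ k₂ Zb Zt ↔ (S.system γ η X Y (-ε) S.b₁).IsGreenFun S.a (-ε) S.b₁ y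
        (fun i x => S.rt x * (k₁ x * S.mulA γ X x (S.e γ X i x)
          + k₂ x * S.mulB γ X x (S.e γ X i x))) zb zt := by
  set A := fun (i : Fin 2) x => S.mulA γ X x (S.e γ X i x) with hA
  set B := fun (i : Fin 2) x => S.mulB γ X x (S.e γ X i x) with hB
  have cA (i) : IsC1Near S.a (-ε) S.b₁ r (A i) := hX.mulA_isC1Near (hX.basis_isC1Near i)
  have cB (i) : IsC1Near S.a (-ε) S.b₁ r (B i) := hX.mulB_isC1Near (hX.basis_isC1Near i)
  have trans {φ₁ φ₂ : ℝ² → ℝ} {ψ : Fin 2 → ℝ² → ℝ} (hψ : ∀ i, IsTestFun S.a (ψ i))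
      (h₁ : ∀ t, ∀ s ∈ Icc (-ε) S.b₁, φ₁ (t, s) = ψ 0 (t, s) * A 0 (t, s) + ψ 1 (t, s) * A 1 (t, s))
      (h₂ : ∀ t, ∀ s ∈ Icc (-ε) S.b₁,
        φ₂ (t, s) = ψ 0 (t, s) * B 0 (t, s) + ψ 1 (t, s) * B 1 (t, s)) :
      ∫ x, S.adjPair η X Y φ₁ φ₂ x (V x) ∂S.vol ε
          = ∫ x, ∑ i, y i x * (S.system γ η X Y (-ε) S.b₁).adjFun ψ i x ∂S.vol ε ∧
      ∫ x, S.rt x * (k₁ x * φ₁ x + k₂ x * φ₂ x) ∂S.vol ε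
          = ∫ x, ∑ i, (S.rt x * (k₁ x * A i x + k₂ x * B i x)) * ψ i x ∂S.vol ε ∧
      ∫ t, (S.fluxPS (t, S.b₁) (Zt t) * φ₁ (t, S.b₁)
          + S.fluxRS (t, S.b₁) (Zt t) * φ₂ (t, S.b₁)) ∂perVol S.a
          = ∫ t, (zt 0 t * ψ 0 (t, S.b₁) - zt 1 t * ψ 1 (t, S.b₁)) ∂perVol S.a ∧
      ∫ t, (S.fluxPS (t, -ε) (Zb t) * φ₁ (t, -ε) + S.fluxRS (t, -ε) (Zb t) * φ₂ (t, -ε)) ∂perVol S.a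
          = ∫ t, (zb 0 t * ψ 0 (t, -ε) - zb 1 t * ψ 1 (t, -ε)) ∂perVol S.a := by
    refine ⟨integral_congr_ae ?_, integral_congr_ae ?_, integral_congr_ae ?_, integral_congr_ae ?_⟩
    · filter_upwards [hV, ae_strip_mem S.a (-ε) S.b₁] with x hx hm
      have hev : ∀ᶠ z : ℝ² in 𝓝 x, z.2 ∈ Ioo (-ε) S.b₁ :=
        continuousAt_snd.eventually (isOpen_Ioo.mem_nhds hm.2)
      rw [hx]
      refine (hX.sum_mul_adjFun (t := x.1) hm.2 (fun i => (hψ i).differentiableAt _) ?_ ?_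
        fun i => y i x).symm
      · filter_upwards [hev] with z hz using h₁ z.1 z.2 (Ioo_subset_Icc_self hz)
      · filter_upwards [hev] with z hz using h₂ z.1 z.2 (Ioo_subset_Icc_self hz)
    · filter_upwards [ae_strip_mem S.a (-ε) S.b₁] with x hm
      have a1 : φ₁ x = _ := h₁ x.1 x.2 (Ioo_subset_Icc_self hm.2)
      have a2 : φ₂ x = _ := h₂ x.1 x.2 (Ioo_subset_Icc_self hm.2)
      rw [a1, a2, Fin.sum_univ_two]; ring
    · filter_upwards [ht] with t h
      rw [h, h₁ t _ hX.top_mem, h₂ t _ hX.top_mem]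
      exact hX.sum_flux hX.top_mem (fun i => zt i t) fun i => ψ i (t, S.b₁)
    · filter_upwards [hb] with t h
      rw [h, h₁ t _ hX.bot_mem, h₂ t _ hX.bot_mem]
      exact hX.sum_flux hX.bot_mem (fun i => zb i t) fun i => ψ i (t, -ε)
  constructor
  · intro H ψ hψ
    have hc (i) := IsC1Near.of_test (c := -ε) (d := S.b₁) (r := r) (hψ i)
    have c1 := ((hc 0).mul (cA 0)).add ((hc 1).mul (cA 1))
    have c2 := ((hc 0).mul (cB 0)).add ((hc 1).mul (cB 1))
    obtain ⟨a1, a2, a3, a4⟩ := trans hψ (fun t s hs => hX.c1Ext_eq c1 hs)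
      fun t s hs => hX.c1Ext_eq c2 hs
    have := H _ _ (hX.isTestFun_c1Ext c1) (hX.isTestFun_c1Ext c2)
    rwa [a1, a2, a3, a4] at this
  · intro H φ₁ φ₂ h₁ h₂
    have d1 := IsC1Near.of_test (c := -ε) (d := S.b₁) (r := r) h₁
    have d2 := IsC1Near.of_test (c := -ε) (d := S.b₁) (r := r) h₂
    have c1 := d1.div (cA 1) fun t s hs => hX.mulA_basis_one_ne hs
    have c0 := (d2.sub (c1.mul (cB 1))).div (cB 0) fun t s hs => hX.mulB_basis_zero_ne hs
    set ψ : Fin 2 → ℝ² → ℝ := ![c1Ext S.a (-ε) S.b₁ _, c1Ext S.a (-ε) S.b₁ _]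
    have hψ (i) : IsTestFun S.a (ψ i) := by
      fin_cases i
      · exact hX.isTestFun_c1Ext c0
      · exact hX.isTestFun_c1Ext c1
    have v1 (t s) (hs : s ∈ Icc (-ε) S.b₁) : ψ 1 (t, s) = φ₁ (t, s) / A 1 (t, s) :=
      hX.c1Ext_eq c1 hs
    have v0 (t s) (hs : s ∈ Icc (-ε) S.b₁) : ψ 0 (t, s)
        = (φ₂ (t, s) - φ₁ (t, s) / A 1 (t, s) * B 1 (t, s)) / B 0 (t, s) := hX.c1Ext_eq c0 hs
    obtain ⟨a1, a2, a3, a4⟩ := trans (φ₁ := φ₁) (φ₂ := φ₂) hψ (fun t s hs => by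
        rw [v1 t s hs, show A 0 (t, s) = 0 from mulA_basis_zero _, mul_zero, zero_add,
          div_mul_cancel₀ _ (hX.mulA_basis_one_ne hs)])
      (fun t s hs => by
        rw [v1 t s hs, v0 t s hs, div_mul_cancel₀ _ (hX.mulB_basis_zero_ne hs)]; ring)
    rw [a1, a2, a3, a4]
    exact H ψ hψ

end coordinates

end IsMultiplier

end ParamSurface

/-! ### The weak form of the boundary value problem -/

namespace ParamSurface

variable {S : ParamSurface} {γ ε r : ℝ} {X Y V W F : ℝ² → E3} {η : ℝ² → ℝ} {t s : ℝ} {p q : ℝ → ℝ}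

theorem IsC1Field.isC1Near (h : S.IsC1Field ε W) : IsC1Near S.a (-ε) S.b₁ r W :=
  ⟨fun _ _ _ => h.1.contDiffAt, fun t s _ => h.2.1 t s⟩

namespace IsMultiplier

variable (hX : S.IsMultiplier (-ε) S.b₁ r X)
include hX

/-- The boundary weight along `s = b₁`, in terms of the normalized basis. -/
theorem weight₁_mul (t : ℝ) :
    S.weight₁ γ X (t, S.b₁) (S.νTop t) * inner ℝ (S.e γ X 0 (t, S.b₁)) (S.νTop t)
      = S.mulB γ X (t, S.b₁) (S.e γ X 0 (t, S.b₁)) := by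
  have hm := hX.top_mem
  have hne : (inner ℝ (X (t, S.b₁)) (S.νTop t) : ℝ) ≠ 0 := fun h0 => by
    have := hX.inner_νTop t (X (t, S.b₁))
    rw [h0, mul_zero] at this
    exact (mul_pos (rt_pos (hX.strip.gdet_pos t _ hm)) (hX.coordS_pos t _ hm)).ne this
  rw [weight₁, basis_zero, mulB_smul, mulB, real_inner_smul_left, sff, wt,
    real_inner_comm (X (t, S.b₁)) (S.shape _ _)]
  field_simp

/-- The boundary weight along `s = -ε`, in terms of the normalized basis. -/
theorem weight₂_mul (t : ℝ) : ‖S.αt (t, -ε)‖ * (S.weight₂ γ X (t, -ε) (S.νBot ε t)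
        * inner ℝ (S.e γ X 1 (t, -ε)) (S.rot (t, -ε) (X (t, -ε))))
      = -(S.wt γ (t, -ε) / S.mulA γ X (t, -ε) (S.e γ X 1 (t, -ε))) := by
  have hm := hX.bot_mem
  have hg := hX.strip.gdet_pos t _ hm
  have hN := norm_αt_pos hg
  have hr := rt_pos hg
  have hXs := hX.coordS_pos t _ hm
  have hh := hX.h11_pos t _ hm
  have hτ := hX.strip.τ_sq
  have hw := wt_pos (S := S) (γ := γ) (t, -ε)
  have hν : (inner ℝ (X (t, -ε)) (S.νBot ε t) : ℝ)
      = -(S.rt (t, -ε) * S.coordS (t, -ε) (X (t, -ε))) / ‖S.αt (t, -ε)‖ := by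
    rw [eq_div_iff hN.ne', mul_comm, hX.inner_νBot, fluxRS]
  have hrot : S.rot (t, -ε) (S.νBot ε t) = (-(S.τ / ‖S.αt (t, -ε)‖)) • S.αt (t, -ε) := by
    rw [νBot, ← neg_one_smul ℝ (S.conormal _), rot_smul, rot_conormal hg, smul_smul]; ring_nf
  have hsff : S.sff (t, -ε) (S.rot (t, -ε) (S.νBot ε t)) (S.rot (t, -ε) (S.νBot ε t))
      = S.h11 (t, -ε) / ‖S.αt (t, -ε)‖ ^ 2 := by
    rw [hrot, sff, shape_smul, real_inner_smul_left, real_inner_smul_right,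
      show inner ℝ (S.shape (t, -ε) (S.αt (t, -ε))) (S.αt (t, -ε)) = S.h11 (t, -ε) from
        sff_αt_αt hg]
    field_simp
    linear_combination hτ
  have k1 := Real.sq_sqrt (mul_pos (mul_pos (mul_pos hw hh) hr) hXs).le
  have s1 := Real.sqrt_pos.mpr (mul_pos (mul_pos (mul_pos hw hh) hr) hXs)
  have ha := hX.mulA_basis_one_ne (γ := γ) (t := t) hm
  have hA : (inner ℝ (S.e γ X 1 (t, -ε)) (S.rot (t, -ε) (X (t, -ε))) : ℝ)
      = S.mulA γ X (t, -ε) (S.e γ X 1 (t, -ε)) / S.wt γ (t, -ε) := by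
    rw [mulA, mul_div_cancel_left₀ _ hw.ne']
  have hA2 : S.mulA γ X (t, -ε) (S.e γ X 1 (t, -ε)) ^ 2 * S.h11 (t, -ε)
      = S.wt γ (t, -ε) * S.rt (t, -ε) * S.coordS (t, -ε) (X (t, -ε)) := by
    rw [basis_one, mulA_smul, mulA_eq hg, coordT_αt hg, coordS_αt]
    field_simp
    rw [k1, hτ]; ring
  rw [weight₂, hν, hsff, hA, show Real.exp (-γ * S.curv (t, -ε)) = S.wt γ (t, -ε) from rfl]
  field_simp
  linear_combination -hA2

section coordinates

variable {y : Fin 2 → ℝ² → ℝ}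

/-- The weak form of the boundary value problem in the normalized basis. -/
theorem weaklySolves_iff (hVm : S.MemL2T ε V) (hV : ∀ᵐ x ∂S.vol ε,
      V x = y 0 x • S.e γ X 0 x + y 1 x • S.e γ X 1 x) :
    S.WeaklySolves ε γ η X Y F p q V ↔ (S.system γ η X Y (-ε) S.b₁).IsWeakFun S.a (-ε) S.b₁ y
        (fun i x => S.rt x * inner ℝ (S.e γ X i x) (F x))
        (fun t => ‖S.αt (t, S.b₁)‖ * S.mulB γ X (t, S.b₁) (S.e γ X 0 (t, S.b₁)) * p t)
        (fun t => S.wt γ (t, -ε) / S.mulA γ X (t, -ε) (S.e γ X 1 (t, -ε)) * q t) := by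
  have trans {W : ℝ² → E3} {ψ : Fin 2 → ℝ² → ℝ} (hW : S.IsC1Field ε W)
      (hψ : ∀ i, IsTestFun S.a (ψ i)) (h : ∀ t, ∀ s ∈ Icc (-ε) S.b₁,
        W (t, s) = ψ 0 (t, s) • S.e γ X 0 (t, s) + ψ 1 (t, s) • S.e γ X 1 (t, s))
      (h0 : ∀ t, ψ 0 (t, -ε) = 0) (h1 : ∀ t, ψ 1 (t, S.b₁) = 0) :
      ∫ x, inner ℝ (V x) (S.opLstar γ η X Y W x) ∂S.area ε
          = ∫ x, ∑ i, y i x * (S.system γ η X Y (-ε) S.b₁).adjFun ψ i x ∂S.vol ε ∧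
      ∫ x, inner ℝ (W x) (F x) ∂S.area ε
          = ∫ x, ∑ i, S.rt x * inner ℝ (S.e γ X i x) (F x) * ψ i x ∂S.vol ε ∧
      ∫ t, S.weight₂ γ X (t, -ε) (S.νBot ε t) * q t
            * inner ℝ (W (t, -ε)) (S.rot (t, -ε) (X (t, -ε))) ∂S.arc (-ε)
          = -∫ t, S.wt γ (t, -ε) / S.mulA γ X (t, -ε) (S.e γ X 1 (t, -ε)) * q t * ψ 1 (t, -ε)
              ∂perVol S.a ∧
      ∫ t, S.weight₁ γ X (t, S.b₁) (S.νTop t) * p t * inner ℝ (W (t, S.b₁)) (S.νTop t) ∂S.arc S.b₁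
          = ∫ t, ‖S.αt (t, S.b₁)‖ * S.mulB γ X (t, S.b₁) (S.e γ X 0 (t, S.b₁)) * p t
              * ψ 0 (t, S.b₁) ∂perVol S.a := by
    rw [hX.integral_area, hX.integral_area, hX.integral_arc hX.bot_mem,
      hX.integral_arc hX.top_mem, ← integral_neg]
    refine ⟨integral_congr_ae ?_, integral_congr_ae ?_, integral_congr_ae (.of_forall fun t => ?_),
      integral_congr_ae (.of_forall fun t => ?_)⟩
    · filter_upwards [hV, ae_strip_mem S.a (-ε) S.b₁, hX.ae_area.mp hVm.2] with x hx hm hxt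
      have hsc := Ioo_subset_Icc_self hm.2
      have hev : ∀ᶠ z : ℝ² in 𝓝 x, z.2 ∈ Ioo (-ε) S.b₁ :=
        continuousAt_snd.eventually (isOpen_Ioo.mem_nhds hm.2)
      rw [rt_mul_inner_opLstar hX.strip.τ_sq hX.strip.smooth (hX.strip.gdet_pos x.1 x.2 hsc)
        (hX.smooth.contDiffAt x.1 x.2 hsc) hW.1.contDiffAt hxt, hx]
      refine (hX.sum_mul_adjFun (t := x.1) hm.2 (fun i => (hψ i).differentiableAt _) ?_ ?_
        fun i => y i x).symm
      · filter_upwards [hev] with z hz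
        have hWz : W z = _ := h z.1 z.2 (Ioo_subset_Icc_self hz)
        rw [hWz, mulA_add, mulA_smul, mulA_smul]
      · filter_upwards [hev] with z hz
        have hWz : W z = _ := h z.1 z.2 (Ioo_subset_Icc_self hz)
        rw [hWz, mulB_add, mulB_smul, mulB_smul]
    · filter_upwards [ae_strip_mem S.a (-ε) S.b₁] with x hm
      have hWz : W x = _ := h x.1 x.2 (Ioo_subset_Icc_self hm.2)
      rw [hWz, inner_add_left, real_inner_smul_left, real_inner_smul_left, Fin.sum_univ_two]; ring
    · have := hX.weight₂_mul (γ := γ) t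
      simp only
      rw [h t _ hX.bot_mem, h0, zero_smul, zero_add, real_inner_smul_left]
      linear_combination q t * ψ 1 (t, -ε) * this
    · have := hX.weight₁_mul (γ := γ) t
      simp only
      rw [h t _ hX.top_mem, h1, zero_smul, add_zero, real_inner_smul_left]
      linear_combination ‖S.αt (t, S.b₁)‖ * p t * ψ 0 (t, S.b₁) * this
  constructor
  · rintro ⟨-, H⟩ ψ hψ h0 h1
    have hc (i) := IsC1Near.of_test (c := -ε) (d := S.b₁) (r := r) (hψ i)
    have c1 := ((hc 0).smul (hX.basis_isC1Near (γ := γ) 0)).add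
      ((hc 1).smul (hX.basis_isC1Near (γ := γ) 1))
    have hWe (t s) (hs : s ∈ Icc (-ε) S.b₁) := hX.c1Ext_eq (t := t) c1 hs
    set W := c1Ext S.a (-ε) S.b₁ fun x => ψ 0 x • S.e γ X 0 x + ψ 1 x • S.e γ X 1 x
    have hW : S.IsC1Field ε W := ⟨(hX.c1Ext_spec c1).1, (hX.c1Ext_spec c1).2.1, fun t s hs => by
      rw [hWe t s hs]
      exact ((hX.basis_isTangent 0 hs).smul _).add ((hX.basis_isTangent 1 hs).smul _)⟩
    obtain ⟨a1, a2, a3, a4⟩ := trans hW hψ hWe h0 h1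
    have := H W ⟨hW, fun t => ?_, fun t => ?_⟩
    · rw [a1, a2, a3, a4] at this
      rw [this]; ring
    · rw [hWe t _ hX.top_mem, h1, zero_smul, add_zero, real_inner_smul_left]
      have h2 := mulA_basis_zero (S := S) (γ := γ) (X := X) (t, S.b₁)
      rw [mulA] at h2
      rw [(mul_eq_zero.mp h2).resolve_left (wt_pos _).ne', mul_zero]
    · have := hX.inner_νBot t (W (t, -ε))
      rw [hWe t _ hX.bot_mem, h0, zero_smul, zero_add, fluxRS_smul, fluxRS_basis_one, mul_zero,
        neg_zero] at this
      rw [hWe t _ hX.bot_mem, h0, zero_smul, zero_add]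
      exact (mul_eq_zero.mp this).resolve_left (norm_αt_pos (hX.strip.gdet_pos t _ hX.bot_mem)).ne'
  · refine fun H => ⟨hVm, fun W hW => ?_⟩
    have hc (i) := hX.coeff_isC1Near (γ := γ) i (hW.1.isC1Near (r := r))
    set ψ : Fin 2 → ℝ² → ℝ := fun i => c1Ext S.a (-ε) S.b₁ fun x => S.coeff γ X i x (W x)
    have hψe (i t s) (hs : s ∈ Icc (-ε) S.b₁) : ψ i (t, s) = S.coeff γ X i (t, s) (W (t, s)) :=
      hX.c1Ext_eq (hc i) hs
    have hψ (i) : IsTestFun S.a (ψ i) := hX.isTestFun_c1Ext (hc i)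
    have hWe (t s) (hs : s ∈ Icc (-ε) S.b₁) :
        W (t, s) = ψ 0 (t, s) • S.e γ X 0 (t, s) + ψ 1 (t, s) • S.e γ X 1 (t, s) := by
      rw [hψe 0 t s hs, hψe 1 t s hs]; exact hX.eq_coeff hs (hW.1.2.2 t s hs)
    have h0 (t) : ψ 0 (t, -ε) = 0 := by
      have h := hX.inner_νBot t (W (t, -ε))
      rw [hW.2.2 t, mul_zero, hWe t _ hX.bot_mem, fluxRS_add, fluxRS_smul, fluxRS_smul,
        fluxRS_basis_one, mul_zero, add_zero, zero_eq_neg] at h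
      refine (mul_eq_zero.mp h).resolve_right fun h' => ?_
      have := hX.fluxRS_mul_mulB (γ := γ) (t := t) hX.bot_mem
      rw [h', zero_mul] at this; exact zero_ne_one this
    have h1 (t) : ψ 1 (t, S.b₁) = 0 := by
      have h : S.mulA γ X (t, S.b₁) (W (t, S.b₁)) = 0 := by rw [mulA, hW.2.1 t, mul_zero]
      rw [hWe t _ hX.top_mem, mulA_add, mulA_smul, mulA_smul, mulA_basis_zero, mul_zero,
        zero_add] at h
      exact (mul_eq_zero.mp h).resolve_right (hX.mulA_basis_one_ne hX.top_mem)
    obtain ⟨a1, a2, a3, a4⟩ := trans hW.1 hψ hWe h0 h1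
    rw [a1, a2, a3, a4, H ψ hψ h0 h1]; ring

end coordinates

end IsMultiplier

end ParamSurface

/-! ### Solutions in the normalized basis -/

namespace ParamSurface

variable {S : ParamSurface} {γ ε r : ℝ} {X Y V W F : ℝ² → E3} {η : ℝ² → ℝ} {t s : ℝ}
  {p q : ℝ → ℝ} {Z Zb Zt : ℝ → E3}

namespace IsMultiplier

variable (hX : S.IsMultiplier (-ε) S.b₁ r X)
include hX

theorem memLp_data (hF : MemLp F 2 (S.vol ε)) (i : Fin 2) :
    MemLp (fun x => (inner ℝ (S.e γ X i x) (F x) : ℝ)) 2 (S.vol ε) := by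
  refine (memLp_inner_of_top (memLp_top_strip (hX.basis_isC1Near (γ := γ) i).continuousOn)
    hF).ae_eq (.of_forall fun x => real_inner_comm _ _)

/-- A solution of the system in the normalized basis gives a solution of the boundary value
problem. -/
theorem solves_of_isGreenFun (hη : Continuous η)
    (hY : ContinuousOn Y (univ ×ˢ Icc (-ε) S.b₁)) (hF : S.MemL2T ε F)
    {y : Fin 2 → ℝ² → ℝ} {zb zt : Fin 2 → ℝ → ℝ}
    (hy : ∀ i, MemLp (y i) 2 (S.vol ε))
    (hb : ∀ i, MemLp (zb i) 2 (perVol S.a)) (ht : ∀ i, MemLp (zt i) 2 (perVol S.a))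
    (hp : zt 0 = fun t => ‖S.αt (t, S.b₁)‖ * S.mulB γ X (t, S.b₁) (S.e γ X 0 (t, S.b₁)) * p t)
    (hq : zb 1 = fun t => S.wt γ (t, -ε) / S.mulA γ X (t, -ε) (S.e γ X 1 (t, -ε)) * q t)
    (h : (S.system γ η X Y (-ε) S.b₁).IsGreenFun S.a (-ε) S.b₁ y
        (fun i x => S.rt x * inner ℝ (S.e γ X i x) (F x)) zb zt) :
    S.Solves ε γ η X Y F p q (fun x => y 0 x • S.e γ X 0 x + y 1 x • S.e γ X 1 x)
      (fun t => zb 0 t • S.e γ X 0 (t, -ε) + zb 1 t • S.e γ X 1 (t, -ε))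
      (fun t => zt 0 t • S.e γ X 0 (t, S.b₁) + zt 1 t • S.e γ X 1 (t, S.b₁)) := by
  set V := fun x => y 0 x • S.e γ X 0 x + y 1 x • S.e γ X 1 x
  set Zb := fun t => zb 0 t • S.e γ X 0 (t, -ε) + zb 1 t • S.e γ X 1 (t, -ε)
  set Zt := fun t => zt 0 t • S.e γ X 0 (t, S.b₁) + zt 1 t • S.e γ X 1 (t, S.b₁)
  have hV : MemLp V 2 (S.vol ε) := hX.memLp_comb isSlice_strip hy
  have hZb : MemLp Zb 2 (perVol S.a) := hX.memLp_comb (isSlice_curve hX.bot_mem) hb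
  have hZt : MemLp Zt 2 (perVol S.a) := hX.memLp_comb (isSlice_curve hX.top_mem) ht
  have tan (u₀ u₁ t s) (hs : s ∈ Icc (-ε) S.b₁) :
      S.IsTangent (t, s) (u₀ • S.e γ X 0 (t, s) + u₁ • S.e γ X 1 (t, s)) :=
    ((hX.basis_isTangent 0 hs).smul _).add ((hX.basis_isTangent 1 hs).smul _)
  have hFm := hX.memLp_area.mp hF.1
  have cA := hX.mulA_isC1Near (γ := γ) (hX.basis_isC1Near (γ := γ) 1)
  have cB (i) := hX.mulB_isC1Near (γ := γ) (hX.basis_isC1Near (γ := γ) i)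
  let k₂ := fun x => (S.mulB γ X x (S.e γ X 0 x))⁻¹ * inner ℝ (S.e γ X 0 x) (F x)
  let k₁ := fun x => (S.mulA γ X x (S.e γ X 1 x))⁻¹ * (inner ℝ (S.e γ X 1 x) (F x)
    - S.mulB γ X x (S.e γ X 1 x) * k₂ x)
  have m2 : MemLp k₂ 2 (S.vol ε) := memLp_mul_strip
    ((cB 0).inv fun t s hs => hX.mulB_basis_zero_ne hs).continuousOn (hX.memLp_data hFm 0)
  have m1 : MemLp k₁ 2 (S.vol ε) := memLp_mul_strip
    (cA.inv fun t s hs => hX.mulA_basis_one_ne hs).continuousOn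
    ((hX.memLp_data hFm 1).sub (memLp_mul_strip (cB 1).continuousOn m2))
  have e0 (t s) (hs : s ∈ Icc (-ε) S.b₁) : inner ℝ (S.e γ X 0 (t, s)) (F (t, s))
      = k₁ (t, s) * S.mulA γ X (t, s) (S.e γ X 0 (t, s))
        + k₂ (t, s) * S.mulB γ X (t, s) (S.e γ X 0 (t, s)) := by
    have := hX.mulB_basis_zero_ne (γ := γ) (t := t) hs
    rw [mulA_basis_zero]; simp only [k₂]; field_simp; ring
  have e1 (t s) (hs : s ∈ Icc (-ε) S.b₁) : inner ℝ (S.e γ X 1 (t, s)) (F (t, s))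
      = k₁ (t, s) * S.mulA γ X (t, s) (S.e γ X 1 (t, s))
        + k₂ (t, s) * S.mulB γ X (t, s) (S.e γ X 1 (t, s)) := by
    have := hX.mulA_basis_one_ne (γ := γ) (t := t) hs
    simp only [k₁]; field_simp; ring
  have hG : S.GreenPair ε η X Y V k₁ k₂ Zb Zt := by
    rw [hX.greenPair_iff_isGreenFun (γ := γ) (zb := zb) (zt := zt) (y := y) (.of_forall fun _ => rfl)
      (.of_forall fun _ => rfl) (.of_forall fun _ => rfl)]
    intro ψ hψ
    rw [h ψ hψ]
    congr 2
    refine integral_congr_ae ?_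
    filter_upwards [ae_strip_mem S.a (-ε) S.b₁] with x hx
    have hsc := Ioo_subset_Icc_self hx.2
    have e0' := e0 x.1 x.2 hsc
    have e1' := e1 x.1 x.2 hsc
    simp only [Prod.mk.eta] at e0' e1'
    simp only [Fin.sum_univ_two, e0', e1']
  obtain ⟨t1, t2⟩ := (hX.greenPair_iff hη hY hV m1 m2 (hX.memLp_fluxPS (isSlice_curve hX.top_mem) hZt)
    (hX.memLp_fluxRS (isSlice_curve hX.top_mem) hZt) (hX.memLp_fluxPS (isSlice_curve hX.bot_mem) hZb)
    (hX.memLp_fluxRS (isSlice_curve hX.bot_mem) hZb)).mp hG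
  have n1 := hX.memLp_inner_lower_order hη hY hV
  have n2 := hX.memLp_inner_shape hη hV
  refine ⟨⟨hX.memLp_area.mpr hV, hX.ae_area.mpr ?_⟩,
    ⟨(hX.memLp_arc hX.bot_mem).mpr hZb, .of_forall fun t => tan _ _ t _ hX.bot_mem⟩,
    ⟨(hX.memLp_arc hX.top_mem).mpr hZt, .of_forall fun t => tan _ _ t _ hX.top_mem⟩,
    ⟨_, _, hX.memLp_area.mpr (m1.sub n1), hX.memLp_area.mpr (m2.add n2), t1.hasWeakDiv,
      t2.hasWeakDiv, t1, t2, hX.ae_area.mpr ?_⟩, .of_forall fun t => ?_, .of_forall fun t => ?_⟩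
  · filter_upwards [ae_strip_mem S.a (-ε) S.b₁] with x hx
    exact tan _ _ x.1 x.2 (Ioo_subset_Icc_self hx.2)
  · filter_upwards [ae_strip_mem S.a (-ε) S.b₁, hX.ae_area.mp hF.2] with x hx hFx
    have hsc := Ioo_subset_Icc_self hx.2
    simp only [opL, Pi.sub_apply, Pi.add_apply, sub_add_cancel, add_sub_cancel_right]
    exact (hX.eq_rot_shape (t := x.1) hsc hFx (e0 x.1 x.2 hsc) (e1 x.1 x.2 hsc)).symm
  · have h0 := mulA_basis_zero (S := S) (γ := γ) (X := X) (t, -ε)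
    have h1 := hX.mulA_basis_one_ne (γ := γ) (t := t) hX.bot_mem
    have hw := wt_pos (S := S) (γ := γ) (t, -ε)
    rw [mulA] at h0
    have : S.wt γ (t, -ε) * inner ℝ (Zb t) (S.rot (t, -ε) (X (t, -ε))) = S.wt γ (t, -ε) * q t := by
      simp only [Zb, inner_add_left, real_inner_smul_left, hq]
      have e : S.wt γ (t, -ε) * inner ℝ (S.e γ X 1 (t, -ε)) (S.rot (t, -ε) (X (t, -ε)))
        = S.mulA γ X (t, -ε) (S.e γ X 1 (t, -ε)) := rfl
      rw [mul_add, mul_left_comm, h0, mul_left_comm, e]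
      field_simp; ring
    exact mul_left_cancel₀ hw.ne' this
  · have h1 := hX.inner_νTop t (Zt t)
    have h2 := hX.fluxRS_mul_mulB (γ := γ) (t := t) hX.top_mem
    have hN := norm_αt_pos (hX.strip.gdet_pos t _ hX.top_mem)
    refine mul_left_cancel₀ hN.ne' ?_
    rw [h1]
    simp only [Zt, fluxRS_add, fluxRS_smul, fluxRS_basis_one, hp]
    linear_combination ‖S.αt (t, S.b₁)‖ * p t * h2

/-- The coordinates of a solution of the boundary value problem in the normalized basis. -/
theorem isGreenFun_of_solves (hη : Continuous η)
    (hY : ContinuousOn Y (univ ×ˢ Icc (-ε) S.b₁)) (h : S.Solves ε γ η X Y F p q V Zb Zt) :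
    (∃ g : Fin 2 → ℝ² → ℝ, (∀ i, g i =ᵐ[S.vol ε] fun x => S.rt x * inner ℝ (S.e γ X i x) (F x)) ∧
      (S.system γ η X Y (-ε) S.b₁).IsGreenFun S.a (-ε) S.b₁ (fun i x => S.coeff γ X i x (V x)) g
        (fun i t => S.coeff γ X i (t, -ε) (Zb t)) (fun i t => S.coeff γ X i (t, S.b₁) (Zt t))) ∧
    ((fun t => S.coeff γ X 0 (t, S.b₁) (Zt t)) =ᵐ[perVol S.a]
      fun t => ‖S.αt (t, S.b₁)‖ * S.mulB γ X (t, S.b₁) (S.e γ X 0 (t, S.b₁)) * p t) ∧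
    (fun t => S.coeff γ X 1 (t, -ε) (Zb t)) =ᵐ[perVol S.a]
      fun t => S.wt γ (t, -ε) / S.mulA γ X (t, -ε) (S.e γ X 1 (t, -ε)) * q t := by
  obtain ⟨hV, hZb, hZt, ⟨f₁, f₂, m1, m2, -, -, t1, t2, hF⟩, hq, hp⟩ := h
  have hVm := hX.memLp_area.mp hV.1
  have hbm := (hX.memLp_arc hX.bot_mem).mp hZb.1
  have htm := (hX.memLp_arc hX.top_mem).mp hZt.1
  have hVe : ∀ᵐ x ∂S.vol ε, V x = S.coeff γ X 0 x (V x) • S.e γ X 0 x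
      + S.coeff γ X 1 x (V x) • S.e γ X 1 x := by
    filter_upwards [ae_strip_mem S.a (-ε) S.b₁, hX.ae_area.mp hV.2] with x hx ht
    exact hX.eq_coeff (t := x.1) (Ioo_subset_Icc_self hx.2) ht
  have hbe : ∀ᵐ t ∂perVol S.a, Zb t = S.coeff γ X 0 (t, -ε) (Zb t) • S.e γ X 0 (t, -ε)
      + S.coeff γ X 1 (t, -ε) (Zb t) • S.e γ X 1 (t, -ε) := by
    filter_upwards [(hX.ae_arc hX.bot_mem).mp hZb.2] with t ht using hX.eq_coeff hX.bot_mem ht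
  have hte : ∀ᵐ t ∂perVol S.a, Zt t = S.coeff γ X 0 (t, S.b₁) (Zt t) • S.e γ X 0 (t, S.b₁)
      + S.coeff γ X 1 (t, S.b₁) (Zt t) • S.e γ X 1 (t, S.b₁) := by
    filter_upwards [(hX.ae_arc hX.top_mem).mp hZt.2] with t ht using hX.eq_coeff hX.top_mem ht
  let k₁ := fun x => f₁ x + inner ℝ (V x) (Y x - η x • S.rot x (X x))
  let k₂ := fun x => f₂ x - η x * inner ℝ (V x) (S.shape x (X x))
  have mk₁ : MemLp k₁ 2 (S.vol ε) :=
    (hX.memLp_area.mp m1).add (hX.memLp_inner_lower_order hη hY hVm)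
  have mk₂ : MemLp k₂ 2 (S.vol ε) := (hX.memLp_area.mp m2).sub (hX.memLp_inner_shape hη hVm)
  have hG : S.GreenPair ε η X Y V k₁ k₂ Zb Zt := by
    rw [hX.greenPair_iff hη hY hVm mk₁ mk₂ (hX.memLp_fluxPS (isSlice_curve hX.top_mem) htm)
      (hX.memLp_fluxRS (isSlice_curve hX.top_mem) htm) (hX.memLp_fluxPS (isSlice_curve hX.bot_mem) hbm)
      (hX.memLp_fluxRS (isSlice_curve hX.bot_mem) hbm)]
    simp only [k₁, k₂, add_sub_cancel_right, sub_add_cancel]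
    exact ⟨t1, t2⟩
  have hGr := (hX.greenPair_iff_isGreenFun (γ := γ) (y := fun i x => S.coeff γ X i x (V x))
    (zb := fun i t => S.coeff γ X i (t, -ε) (Zb t))
    (zt := fun i t => S.coeff γ X i (t, S.b₁) (Zt t)) hVe hbe hte).mp hG
  refine ⟨⟨_, fun i => ?_, hGr⟩, ?_, ?_⟩
  · filter_upwards [hX.ae_area.mp hF] with x hx
    rw [← hx, opL, real_inner_smul_right, inner_add_right, real_inner_smul_right,
      real_inner_smul_right, mulA, mulB, wt]
    ring
  · filter_upwards [(hX.ae_arc hX.top_mem).mp hp, hte] with t h0 h1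
    have h2 := hX.inner_νTop t (Zt t)
    have h3 := hX.fluxRS_mul_mulB (γ := γ) (t := t) hX.top_mem
    have h4 : S.fluxRS (t, S.b₁) (Zt t) = S.coeff γ X 0 (t, S.b₁) (Zt t)
        * S.fluxRS (t, S.b₁) (S.e γ X 0 (t, S.b₁)) := by
      conv_lhs => rw [h1]
      rw [fluxRS_add, fluxRS_smul, fluxRS_smul, fluxRS_basis_one, mul_zero, add_zero]
    rw [h0, h4] at h2
    linear_combination -S.coeff γ X 0 (t, S.b₁) (Zt t) * h3
      - S.mulB γ X (t, S.b₁) (S.e γ X 0 (t, S.b₁)) * h2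
  · filter_upwards [(hX.ae_arc hX.bot_mem).mp hq, hbe] with t h0 h1
    have h2 := hX.mulA_basis_one_ne (γ := γ) (t := t) hX.bot_mem
    have h3 : S.mulA γ X (t, -ε) (Zb t) = S.coeff γ X 1 (t, -ε) (Zb t)
        * S.mulA γ X (t, -ε) (S.e γ X 1 (t, -ε)) := by
      conv_lhs => rw [h1]
      rw [mulA_add, mulA_smul, mulA_smul, mulA_basis_zero, mul_zero, zero_add]
    have h4 : S.mulA γ X (t, -ε) (Zb t) = S.wt γ (t, -ε) * q t := by rw [mulA, h0]
    rw [h4] at h3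
    field_simp
    linear_combination -h3

end IsMultiplier

end ParamSurface

/-! ### Well-posedness for an accretive multiplier -/

/-- Multiplication by a bounded function in the square integrals. -/
theorem integral_sq_mul_le {Z : Type*} [MeasurableSpace Z] {μ : Measure Z} {f g : Z → ℝ} {N : ℝ}
    (hf : ∀ᵐ x ∂μ, |f x| ≤ N) (hg : MemLp g 2 μ) :
    ∫ x, (f x * g x) ^ 2 ∂μ ≤ N ^ 2 * ∫ x, g x ^ 2 ∂μ := by
  rw [← integral_const_mul]
  refine integral_mono_of_nonneg (.of_forall fun x => sq_nonneg _) (hg.integrable_sq.const_mul _) ?_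
  filter_upwards [hf] with x hx
  rw [mul_pow]
  exact mul_le_mul_of_nonneg_right (sq_le_sq' (neg_le_of_abs_le hx) (le_of_abs_le hx)) (sq_nonneg _)

theorem norm_comb_sq_le {N : ℝ} {u v : E3} (hu : ‖u‖ ≤ N) (hv : ‖v‖ ≤ N) (a b : ℝ) :
    ‖a • u + b • v‖ ^ 2 ≤ 2 * N ^ 2 * (a ^ 2 + b ^ 2) := by
  have hN : 0 ≤ N := (norm_nonneg _).trans hu
  have h1 : ‖a • u + b • v‖ ≤ |a| * N + |b| * N := by
    refine (norm_add_le _ _).trans (add_le_add ?_ ?_)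
    · rw [norm_smul, Real.norm_eq_abs]; exact mul_le_mul_of_nonneg_left hu (abs_nonneg _)
    · rw [norm_smul, Real.norm_eq_abs]; exact mul_le_mul_of_nonneg_left hv (abs_nonneg _)
  have h2 := pow_le_pow_left₀ (norm_nonneg _) h1 2
  have ha := sq_abs a
  have hb := sq_abs b
  nlinarith [sq_nonneg ((|a| - |b|) * N)]

namespace ParamSurface

variable {S : ParamSurface} {γ ε r : ℝ} {X Y V W F : ℝ² → E3} {η : ℝ² → ℝ} {t s : ℝ}
  {p q : ℝ → ℝ} {Z Zb Zt : ℝ → E3}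

namespace IsMultiplier

variable (hX : S.IsMultiplier (-ε) S.b₁ r X)
include hX

theorem exists_bound_basis (γ : ℝ) :
    ∃ N, 0 ≤ N ∧ ∀ i, ∀ t ∈ Ico 0 S.a, ∀ s ∈ Icc (-ε) S.b₁, ‖S.e γ X i (t, s)‖ ≤ N := by
  obtain ⟨N₀, h0, b0⟩ := exists_bound_strip (a := S.a) (hX.basis_isC1Near (γ := γ) 0).continuousOn
  obtain ⟨N₁, h1, b1⟩ := exists_bound_strip (a := S.a) (hX.basis_isC1Near (γ := γ) 1).continuousOn
  refine ⟨max N₀ N₁, h0.trans (le_max_left _ _), fun i t ht s hs => ?_⟩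
  fin_cases i
  · exact (b0 t ht s hs).trans (le_max_left _ _)
  · exact (b1 t ht s hs).trans (le_max_right _ _)

omit hX in
theorem integral_comb_le {Z : Type*} [MeasurableSpace Z] {μ : Measure Z} {ρ : Z → ℝ}
    (hρ : IsDensity μ ρ) {N : ℝ} {e : Fin 2 → Z → E3} (he : ∀ᵐ z ∂μ, ∀ i, ‖e i z‖ ≤ N) :
    ∃ D, 0 ≤ D ∧ ∀ y : Fin 2 → Z → ℝ, (∀ i, MemLp (y i) 2 μ) →
      ∀ V : Z → E3, MemLp V 2 μ → (∀ᵐ z ∂μ, V z = y 0 z • e 0 z + y 1 z • e 1 z) →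
      ∫ z, ‖V z‖ ^ 2 ∂(μ.withDensity fun z => ENNReal.ofReal (ρ z)) ≤ D * ∫ z, ∑ i, y i z ^ 2 ∂μ := by
  obtain ⟨k, hk, hle⟩ := hρ.exists_integral_le
  refine ⟨k * (2 * N ^ 2), by positivity, fun y hy V hm hV => ?_⟩
  refine (hle _ (fun x => sq_nonneg _) (hm.integrable_norm_pow two_ne_zero)).trans ?_
  rw [mul_assoc, ← integral_const_mul (2 * N ^ 2)]
  refine mul_le_mul_of_nonneg_left (integral_mono_of_nonneg (.of_forall fun x => sq_nonneg _) ?_ ?_)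
    hk
  · exact (integrable_finsetSum _ fun i _ => (hy i).integrable_sq).const_mul _
  · filter_upwards [hV, he] with x hx hm
    rw [hx, Fin.sum_univ_two]
    exact norm_comb_sq_le (hm 0) (hm 1) _ _

theorem exists_integral_comb_le (γ : ℝ) :
    ∃ D, 0 ≤ D ∧ ∀ y : Fin 2 → ℝ² → ℝ, (∀ i, MemLp (y i) 2 (S.vol ε)) →
      ∀ V : ℝ² → E3, (∀ᵐ x ∂S.vol ε, V x = y 0 x • S.e γ X 0 x + y 1 x • S.e γ X 1 x) →
      ∫ x, ‖V x‖ ^ 2 ∂S.area ε ≤ D * ∫ x, ∑ i, y i x ^ 2 ∂S.vol ε := by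
  obtain ⟨N, hN, hb⟩ := hX.exists_bound_basis γ
  obtain ⟨D, hD, h⟩ := integral_comb_le hX.strip.isDensity_rt (N := N) (e := S.e γ X)
    ((ae_strip_mem S.a (-ε) S.b₁).mono fun x hx i => hb i _ hx.1 _ (Ioo_subset_Icc_self hx.2))
  exact ⟨D, hD, fun y hy V hV =>
    h y hy V ((hX.memLp_comb isSlice_strip hy).ae_eq (hV.mono fun x hx => hx.symm)) hV⟩

theorem exists_integral_comb_slice_le (γ : ℝ) (hs : s ∈ Icc (-ε) S.b₁) :
    ∃ D, 0 ≤ D ∧ ∀ z : Fin 2 → ℝ → ℝ, (∀ i, MemLp (z i) 2 (perVol S.a)) →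
      ∫ t, ‖z 0 t • S.e γ X 0 (t, s) + z 1 t • S.e γ X 1 (t, s)‖ ^ 2 ∂S.arc s
        ≤ D * ∫ t, ∑ i, z i t ^ 2 ∂perVol S.a := by
  obtain ⟨N, hN, hb⟩ := hX.exists_bound_basis γ
  obtain ⟨D, hD, h⟩ := integral_comb_le (hX.strip.isDensity_αt hs) (N := N)
    (e := fun i t => S.e γ X i (t, s)) ((ae_period_mem S.a).mono fun t ht i => hb i t ht s hs)
  exact ⟨D, hD, fun z hz => h z hz _ (hX.memLp_comb (isSlice_curve hs) hz) (.of_forall fun _ => rfl)⟩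

theorem exists_integral_data_le (γ : ℝ) : ∃ D, 0 ≤ D ∧ ∀ F : ℝ² → E3, MemLp F 2 (S.vol ε) →
      ∫ x, ∑ i, (S.rt x * inner ℝ (S.e γ X i x) (F x)) ^ 2 ∂S.vol ε
        ≤ D * ∫ x, ‖F x‖ ^ 2 ∂S.area ε := by
  obtain ⟨N, hN, hb⟩ := hX.exists_bound_basis γ
  obtain ⟨R, hR, hr⟩ := exists_bound_strip (a := S.a) (hX.strip.rt (r := r)).continuousOn
  obtain ⟨k, hk, hge⟩ := hX.strip.isDensity_rt.exists_integral_ge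
  refine ⟨2 * (R * N) ^ 2 * k, by positivity, fun F hF => ?_⟩
  have hFi := hF.integrable_norm_pow two_ne_zero
  refine le_trans ?_ ((mul_le_mul_of_nonneg_left (hge _ (fun x => sq_nonneg _) hFi)
    (by positivity : 0 ≤ 2 * (R * N) ^ 2)).trans_eq (mul_assoc _ _ _).symm)
  rw [← integral_const_mul]
  refine integral_mono_of_nonneg (.of_forall fun x => Finset.sum_nonneg fun i _ => sq_nonneg _)
    (hFi.const_mul _) ?_
  filter_upwards [ae_strip_mem S.a (-ε) S.b₁] with x hm
  have hs := Ioo_subset_Icc_self hm.2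
  have key (i : Fin 2) : (S.rt x * inner ℝ (S.e γ X i x) (F x)) ^ 2 ≤ (R * N * ‖F x‖) ^ 2 := by
    refine sq_le_sq' (neg_le_of_abs_le ?_) (le_of_abs_le ?_) <;>
    · rw [abs_mul, mul_assoc]
      exact mul_le_mul (hr x.1 hm.1 x.2 hs) ((abs_real_inner_le_norm _ _).trans
        (mul_le_mul_of_nonneg_right (hb i x.1 hm.1 x.2 hs) (norm_nonneg _))) (abs_nonneg _) hR
  have k0 := key 0
  have k1 := key 1
  simp only [Fin.sum_univ_two]
  nlinarith

theorem exists_integral_mul_slice_le (hs : s ∈ Icc (-ε) S.b₁) {f : ℝ → ℝ} (hf : Continuous f) :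
    ∃ D, 0 ≤ D ∧ ∀ p : ℝ → ℝ, MemLp p 2 (S.arc s) →
      ∫ t, (f t * p t) ^ 2 ∂perVol S.a ≤ D * ∫ t, p t ^ 2 ∂S.arc s := by
  obtain ⟨N, hN⟩ := (isCompact_Icc (a := (0 : ℝ)) (b := S.a)).exists_bound_of_continuousOn
    hf.continuousOn
  obtain ⟨k, hk, hge⟩ := (hX.strip.isDensity_αt hs).exists_integral_ge
  refine ⟨N ^ 2 * k, by positivity, fun p hp => ?_⟩
  refine (integral_sq_mul_le (N := N) ?_ ((hX.memLp_arc hs).mp hp)).trans ?_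
  · filter_upwards [ae_period_mem S.a] with t ht using hN t (Ico_subset_Icc_self ht)
  · rw [mul_assoc]
    exact mul_le_mul_of_nonneg_left (hge _ (fun x => sq_nonneg _)
      ((hX.memLp_arc hs).mp hp).integrable_sq) (sq_nonneg _)

theorem exists_integral_slice_mul_le (hs : s ∈ Icc (-ε) S.b₁) {f : ℝ → ℝ} (hf : Continuous f) :
    ∃ D, 0 ≤ D ∧ ∀ p : ℝ → ℝ, MemLp p 2 (perVol S.a) →
      ∫ t, (f t * p t) ^ 2 ∂S.arc s ≤ D * ∫ t, p t ^ 2 ∂perVol S.a := by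
  obtain ⟨N, hN⟩ := (isCompact_Icc (a := (0 : ℝ)) (b := S.a)).exists_bound_of_continuousOn
    hf.continuousOn
  obtain ⟨k, hk, hle⟩ := (hX.strip.isDensity_αt hs).exists_integral_le
  refine ⟨k * N ^ 2, by positivity, fun p hp => ?_⟩
  refine (hle _ (fun x => sq_nonneg _) (memLp_mul (memLp_period hf ⊤) hp).integrable_sq).trans ?_
  rw [mul_assoc]
  refine mul_le_mul_of_nonneg_left (integral_sq_mul_le ?_ hp) hk
  filter_upwards [ae_period_mem S.a] with t ht using hN t (Ico_subset_Icc_self ht)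

/-- The boundary components `⟨V, QX⟩` along `s = -ε` and `⟨V, ν⟩` along `s = b₁` can be prescribed
independently of `V` in the completion of the `C¹` fields. -/
theorem memCompletion (γ : ℝ) {y : Fin 2 → ℝ² → ℝ}
    {zb zt : Fin 2 → ℝ → ℝ} (hy : ∀ i, MemLp (y i) 2 (S.vol ε))
    (hb : ∀ i, MemLp (zb i) 2 (perVol S.a)) (ht : ∀ i, MemLp (zt i) 2 (perVol S.a)) :
    S.MemCompletion ε X (fun x => y 0 x • S.e γ X 0 x + y 1 x • S.e γ X 1 x)
      (fun t => inner ℝ (zb 0 t • S.e γ X 0 (t, -ε) + zb 1 t • S.e γ X 1 (t, -ε))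
        (S.rot (t, -ε) (X (t, -ε))))
      (fun t => inner ℝ (zt 0 t • S.e γ X 0 (t, S.b₁) + zt 1 t • S.e γ X 1 (t, S.b₁))
        (S.νTop t)) := by
  have cb : Continuous fun t => (inner ℝ (S.e γ X 1 (t, -ε)) (S.rot (t, -ε) (X (t, -ε))) : ℝ) :=
    ((hX.basis_isC1Near 1).inner (hX.strip.rot hX.smooth)).continuous_slice hX.bot_mem
  have ct : Continuous fun t => (inner ℝ (S.e γ X 0 (t, S.b₁)) (S.νTop t) : ℝ) := by
    have h1 := (hX.strip.fluxRS (hX.basis_isC1Near (γ := γ) 0)).continuous_slice hX.top_mem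
    have h2 := (hX.strip.αt (r := r)).continuous_slice hX.top_mem
    refine (h1.div h2.norm fun t => (norm_αt_pos (hX.strip.gdet_pos t _ hX.top_mem)).ne').congr
      fun t => ?_
    rw [Pi.div_apply, ← hX.inner_νTop,
      mul_div_cancel_left₀ _ (norm_αt_pos (hX.strip.gdet_pos t _ hX.top_mem)).ne']
  have eb (u₀ u₁ t : ℝ) : (inner ℝ (u₀ • S.e γ X 0 (t, -ε) + u₁ • S.e γ X 1 (t, -ε))
      (S.rot (t, -ε) (X (t, -ε))) : ℝ)
      = inner ℝ (S.e γ X 1 (t, -ε)) (S.rot (t, -ε) (X (t, -ε))) * u₁ := by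
    have h0 := mulA_basis_zero (S := S) (γ := γ) (X := X) (t, -ε)
    rw [mulA] at h0
    rw [inner_add_left, real_inner_smul_left, real_inner_smul_left,
      (mul_eq_zero.mp h0).resolve_left (wt_pos _).ne', mul_zero, zero_add, mul_comm]
  have et (u₀ u₁ t : ℝ) : (inner ℝ (u₀ • S.e γ X 0 (t, S.b₁) + u₁ • S.e γ X 1 (t, S.b₁))
      (S.νTop t) : ℝ) = inner ℝ (S.e γ X 0 (t, S.b₁)) (S.νTop t) * u₀ := by
    have h0 := hX.inner_νTop t (S.e γ X 1 (t, S.b₁))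
    rw [fluxRS_basis_one] at h0
    rw [inner_add_left, real_inner_smul_left, real_inner_smul_left, (mul_eq_zero.mp h0).resolve_left
      (norm_αt_pos (hX.strip.gdet_pos t _ hX.top_mem)).ne', mul_zero, add_zero, mul_comm]
  refine ⟨⟨hX.memLp_area.mpr (hX.memLp_comb isSlice_strip hy), hX.ae_area.mpr ?_⟩, ?_, ?_, fun R hR => ?_⟩
  · filter_upwards [ae_strip_mem S.a (-ε) S.b₁] with x hx
    have hs := Ioo_subset_Icc_self hx.2
    exact ((hX.basis_isTangent (t := x.1) 0 hs).smul _).add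
      ((hX.basis_isTangent (t := x.1) 1 hs).smul _)
  · simp only [eb]
    exact (hX.memLp_arc hX.bot_mem).mpr (memLp_mul (memLp_period cb ⊤) (hb 1))
  · simp only [et]
    exact (hX.memLp_arc hX.top_mem).mpr (memLp_mul (memLp_period ct ⊤) (ht 0))
  obtain ⟨D, hD, hle⟩ := hX.exists_integral_comb_le γ
  obtain ⟨Db, hDb, hleb⟩ := hX.exists_integral_slice_mul_le hX.bot_mem cb
  obtain ⟨Dt, hDt, hlet⟩ := hX.exists_integral_slice_mul_le hX.top_mem ct
  set M := D + Db + Dt + 1 with hM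
  have hM0 : 0 < M := by positivity
  have ha := hX.strip.a_pos
  -- `⟨V, QX⟩` along `s = -ε` sees only the second coordinate and `⟨V, ν⟩` along `s = b₁` only the
  -- first, so each coordinate has to be approximated on one boundary curve
  obtain ⟨ψ₀, h0, k0⟩ := exists_isTestFun_near ha (c := -ε) (d := S.b₁) (s₀ := S.b₁) (by simp)
    (hy 0) (ht 0) (r := R / (2 * M)) (by positivity)
  obtain ⟨ψ₁, h1, k1⟩ := exists_isTestFun_near ha (c := -ε) (d := S.b₁) (s₀ := -ε) (by simp)
    (hy 1) (hb 1) (r := R / (2 * M)) (by positivity)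
  have c1 := ((IsC1Near.of_test (c := -ε) (d := S.b₁) (r := r) h0).smul
    (hX.basis_isC1Near (γ := γ) 0)).add
    ((IsC1Near.of_test (c := -ε) (d := S.b₁) (r := r) h1).smul (hX.basis_isC1Near (γ := γ) 1))
  have hWe (t s) (hs : s ∈ Icc (-ε) S.b₁) := hX.c1Ext_eq (t := t) c1 hs
  have sp := hX.c1Ext_spec c1
  set W := c1Ext S.a (-ε) S.b₁ fun x => ψ₀ x • S.e γ X 0 x + ψ₁ x • S.e γ X 1 x
  refine ⟨W, ⟨sp.1, sp.2.1, fun t s hs => ?_⟩, ?_⟩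
  · rw [hWe t s hs]
    exact ((hX.basis_isTangent 0 hs).smul _).add ((hX.basis_isTangent 1 hs).smul _)
  have m0 : MemLp (fun x => y 0 x - ψ₀ x) 2 (S.vol ε) := (hy 0).sub (memLp_strip h0.continuous 2)
  have m1 : MemLp (fun x => y 1 x - ψ₁ x) 2 (S.vol ε) := (hy 1).sub (memLp_strip h1.continuous 2)
  have l1 := hle ![fun x => y 0 x - ψ₀ x, fun x => y 1 x - ψ₁ x] (Fin.forall_fin_two.mpr ⟨m0, m1⟩)
    (fun x => (y 0 x • S.e γ X 0 x + y 1 x • S.e γ X 1 x) - W x) (by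
      filter_upwards [ae_strip_mem S.a (-ε) S.b₁] with x hx
      have := hWe x.1 x.2 (Ioo_subset_Icc_self hx.2)
      simp only [Prod.mk.eta] at this
      simp only [this, Matrix.cons_val_zero, Matrix.cons_val_one]
      module)
  have l2 := hleb (fun t => zb 1 t - ψ₁ (t, -ε)) ((hb 1).sub (slice_memLp h1.continuous _))
  have l3 := hlet (fun t => zt 0 t - ψ₀ (t, S.b₁)) ((ht 0).sub (slice_memLp h0.continuous _))
  simp only [hWe _ _ hX.bot_mem, hWe _ _ hX.top_mem, eb, et, ← mul_sub]
  simp only [Fin.sum_univ_two, Matrix.cons_val_zero, Matrix.cons_val_one] at l1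
  rw [integral_add (m0.integrable_sq) (m1.integrable_sq)] at l1
  have n0 : 0 ≤ ∫ x, (y 0 x - ψ₀ x) ^ 2 ∂S.vol ε := integral_nonneg fun x => sq_nonneg _
  have n1 : 0 ≤ ∫ x, (y 1 x - ψ₁ x) ^ 2 ∂S.vol ε := integral_nonneg fun x => sq_nonneg _
  have n2 : 0 ≤ ∫ t, (zb 1 t - ψ₁ (t, -ε)) ^ 2 ∂perVol S.a := integral_nonneg fun x => sq_nonneg _
  have n3 : 0 ≤ ∫ t, (zt 0 t - ψ₀ (t, S.b₁)) ^ 2 ∂perVol S.a := integral_nonneg fun x => sq_nonneg _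
  have hR2 : M * (R / (2 * M)) * 2 = R := by field_simp
  set A0 := ∫ x, (y 0 x - ψ₀ x) ^ 2 ∂S.vol ε
  set A1 := ∫ x, (y 1 x - ψ₁ x) ^ 2 ∂S.vol ε
  set B0 := ∫ t, (zb 1 t - ψ₁ (t, -ε)) ^ 2 ∂perVol S.a
  set B1 := ∫ t, (zt 0 t - ψ₀ (t, S.b₁)) ^ 2 ∂perVol S.a
  have k0' : M * (A0 + B1) < M * (R / (2 * M)) := mul_lt_mul_of_pos_left k0 hM0
  have k1' : M * (A1 + B0) < M * (R / (2 * M)) := mul_lt_mul_of_pos_left k1 hM0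
  have e1 : D * (A0 + A1) ≤ M * (A0 + A1) := mul_le_mul_of_nonneg_right (by linarith) (by linarith)
  have e2 : Db * B0 ≤ M * B0 := mul_le_mul_of_nonneg_right (by linarith) n2
  have e3 : Dt * B1 ≤ M * B1 := mul_le_mul_of_nonneg_right (by linarith) n3
  linarith

/-- If the system in the normalized basis is accretive, the boundary value problem is well posed. -/
theorem wellPosed (hη : Continuous η) (hY : ContinuousOn Y (univ ×ˢ Icc (-ε) S.b₁)) {c₀ : ℝ}
    (hQ : (S.system γ η X Y (-ε) S.b₁).IsAccretive S.a (-ε) S.b₁ c₀) :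
    ∃ C : ℝ, ∀ (F : ℝ² → E3) (p q : ℝ → ℝ),
      S.MemL2T ε F → MemLp p 2 (S.arc S.b₁) → MemLp q 2 (S.arc (-ε)) →
      ∃ (V : ℝ² → E3) (Zb Zt : ℝ → E3), S.Solves ε γ η X Y F p q V Zb Zt ∧
        S.MemCompletion ε X V (fun t => inner ℝ (Zb t) (S.rot (t, -ε) (X (t, -ε))))
          (fun t => inner ℝ (Zt t) (S.νTop t)) ∧
        S.WeaklySolves ε γ η X Y F p q V ∧
        (∫ x, ‖V x‖ ^ 2 ∂S.area ε + ∫ t, ‖Zb t‖ ^ 2 ∂S.arc (-ε) + ∫ t, ‖Zt t‖ ^ 2 ∂S.arc S.b₁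
          ≤ C * (∫ x, ‖F x‖ ^ 2 ∂S.area ε + ∫ t, q t ^ 2 ∂S.arc (-ε) + ∫ t, p t ^ 2 ∂S.arc S.b₁)) ∧
        (∀ V' Zb' Zt', S.Solves ε γ η X Y F p q V' Zb' Zt' →
          V' =ᵐ[S.area ε] V ∧ Zb' =ᵐ[S.arc (-ε)] Zb ∧ Zt' =ᵐ[S.arc S.b₁] Zt) ∧
        (∀ V', S.WeaklySolves ε γ η X Y F p q V' → V' =ᵐ[S.area ε] V) := by
  have : Fact (0 < S.a) := ⟨hX.strip.a_pos⟩
  have cp : Continuous fun t =>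
      ‖S.αt (t, S.b₁)‖ * S.mulB γ X (t, S.b₁) (S.e γ X 0 (t, S.b₁)) :=
    ((hX.strip.αt (r := r)).continuous_slice hX.top_mem).norm.mul
      ((hX.mulB_isC1Near (hX.basis_isC1Near 0)).continuous_slice hX.top_mem)
  have cq : Continuous fun t => S.wt γ (t, -ε) / S.mulA γ X (t, -ε) (S.e γ X 1 (t, -ε)) :=
    (hX.wt_isC1Near.continuous_slice hX.bot_mem).div
      ((hX.mulA_isC1Near (hX.basis_isC1Near 1)).continuous_slice hX.bot_mem)
      fun t => hX.mulA_basis_one_ne hX.bot_mem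
  obtain ⟨D, hD, hDle⟩ := hX.exists_integral_comb_le γ
  obtain ⟨Db, hDb, hDble⟩ := hX.exists_integral_comb_slice_le γ hX.bot_mem
  obtain ⟨Dt, hDt, hDtle⟩ := hX.exists_integral_comb_slice_le γ hX.top_mem
  obtain ⟨Dg, hDg, hDgle⟩ := hX.exists_integral_data_le γ
  obtain ⟨Dp, hDp, hDple⟩ := hX.exists_integral_mul_slice_le hX.top_mem cp
  obtain ⟨Dq, hDq, hDqle⟩ := hX.exists_integral_mul_slice_le hX.bot_mem cq
  set C₀ := 2 + 2 / c₀ + 1 / c₀ ^ 2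
  have hC₀ : 0 ≤ C₀ := by have := hQ.pos; positivity
  refine ⟨(D + Db + Dt) * ((C₀ + 1) * (Dg + Dp + Dq)), fun F p q hF hp hq => ?_⟩
  have hFm := hX.memLp_area.mp hF.1
  have hpm := (hX.memLp_arc hX.top_mem).mp hp
  have hqm := (hX.memLp_arc hX.bot_mem).mp hq
  set g : Fin 2 → ℝ² → ℝ := fun i x => S.rt x * inner ℝ (S.e γ X i x) (F x) with hg
  set p' : ℝ → ℝ := fun t => ‖S.αt (t, S.b₁)‖ * S.mulB γ X (t, S.b₁) (S.e γ X 0 (t, S.b₁)) * p t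
  set q' : ℝ → ℝ := fun t => S.wt γ (t, -ε) / S.mulA γ X (t, -ε) (S.e γ X 1 (t, -ε)) * q t
  have gm (i) : MemLp (g i) 2 (S.vol ε) :=
    memLp_mul_strip (hX.strip.rt (r := r)).continuousOn (hX.memLp_data hFm i)
  have pm : MemLp p' 2 (perVol S.a) := memLp_mul (memLp_period cp ⊤) hpm
  have qm : MemLp q' 2 (perVol S.a) := memLp_mul (memLp_period cq ⊤) hqm
  have hcd := hX.lt.le
  obtain ⟨y, hy, hw⟩ := SymmSystem.exists_isWeakFun hQ hcd gm pm qm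
  obtain ⟨y₁, y₀, m1, m0, hG, hE⟩ := hw.exists_traces hQ hcd gm pm qm hy
  set zb : Fin 2 → ℝ → ℝ := ![y₀, q'] with hzb
  set zt : Fin 2 → ℝ → ℝ := ![p', y₁] with hzt
  have bm (i) : MemLp (zb i) 2 (perVol S.a) := by fin_cases i <;> assumption
  have tm (i) : MemLp (zt i) 2 (perVol S.a) := by fin_cases i <;> assumption
  have hGr : (S.system γ η X Y (-ε) S.b₁).IsGreenFun S.a (-ε) S.b₁ y g zb zt := hG
  have hsol := hX.solves_of_isGreenFun hη hY hF hy bm tm rfl rfl hGr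
  have tangent_coord {V' : ℝ² → E3} (hV' : S.MemL2T ε V') :
      ∀ᵐ x ∂S.vol ε, V' x = S.coeff γ X 0 x (V' x) • S.e γ X 0 x
        + S.coeff γ X 1 x (V' x) • S.e γ X 1 x := by
    filter_upwards [ae_strip_mem S.a (-ε) S.b₁, hX.ae_area.mp hV'.2] with x hx ht
    exact hX.eq_coeff (t := x.1) (Ioo_subset_Icc_self hx.2) ht
  have huniq (V' : ℝ² → E3) (hV' : S.MemL2T ε V')
      (hwk : (S.system γ η X Y (-ε) S.b₁).IsWeakFun S.a (-ε) S.b₁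
        (fun i x => S.coeff γ X i x (V' x)) g p' q') :
      ∀ i, (fun x => S.coeff γ X i x (V' x)) =ᵐ[S.vol ε] y i := fun i =>
    hw.unique hQ hcd gm pm qm hy (fun i => hX.memLp_coeff isSlice_strip (hX.memLp_area.mp hV'.1) i) hwk i
  refine ⟨_, _, _, hsol, hX.memCompletion γ hy bm tm,
    (hX.weaklySolves_iff hsol.1 (.of_forall fun _ => rfl)).mpr hw, ?_, ?_, ?_⟩
  · have l1 := hDle y hy _ (.of_forall fun _ => rfl)
    have l2 := hDble zb bm
    have l3 := hDtle zt tm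
    have l4 := hDgle F hFm
    have l5 := hDple p hp
    have l6 := hDqle q hq
    have sb : ∫ t, ∑ i, zb i t ^ 2 ∂perVol S.a
        = ∫ t, y₀ t ^ 2 ∂perVol S.a + ∫ t, q' t ^ 2 ∂perVol S.a := by
      simp only [Fin.sum_univ_two]
      exact integral_add m0.integrable_sq qm.integrable_sq
    have st : ∫ t, ∑ i, zt i t ^ 2 ∂perVol S.a
        = ∫ t, p' t ^ 2 ∂perVol S.a + ∫ t, y₁ t ^ 2 ∂perVol S.a := by
      simp only [Fin.sum_univ_two]
      exact integral_add pm.integrable_sq m1.integrable_sq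
    rw [sb] at l2
    rw [st] at l3
    have nn {f : ℝ → ℝ} {s} : 0 ≤ ∫ t, f t ^ 2 ∂S.arc s := integral_nonneg fun t => sq_nonneg _
    have nπ {f : ℝ → ℝ} : 0 ≤ ∫ t, f t ^ 2 ∂perVol S.a := integral_nonneg fun t => sq_nonneg _
    have ny : 0 ≤ ∫ x, ∑ i, y i x ^ 2 ∂S.vol ε :=
      integral_nonneg fun x => Finset.sum_nonneg fun i _ => sq_nonneg _
    have nF : 0 ≤ ∫ x, ‖F x‖ ^ 2 ∂S.area ε := integral_nonneg fun x => sq_nonneg _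
    set T := ∫ x, ‖F x‖ ^ 2 ∂S.area ε + ∫ t, q t ^ 2 ∂S.arc (-ε) + ∫ t, p t ^ 2 ∂S.arc S.b₁
    have data : ∫ x, ∑ i, g i x ^ 2 ∂S.vol ε + ∫ t, p' t ^ 2 ∂perVol S.a + ∫ t, q' t ^ 2 ∂perVol S.a
        ≤ (Dg + Dp + Dq) * T := by
      have := nn (f := p) (s := S.b₁)
      have := nn (f := q) (s := -ε)
      have a1 : Dg * ∫ x, ‖F x‖ ^ 2 ∂S.area ε ≤ Dg * T :=
        mul_le_mul_of_nonneg_left (by linarith) hDg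
      have a2 : Dp * ∫ t, p t ^ 2 ∂S.arc S.b₁ ≤ Dp * T :=
        mul_le_mul_of_nonneg_left (by linarith) hDp
      have a3 : Dq * ∫ t, q t ^ 2 ∂S.arc (-ε) ≤ Dq * T :=
        mul_le_mul_of_nonneg_left (by linarith) hDq
      linarith
    set G := ∫ x, ∑ i, g i x ^ 2 ∂S.vol ε + ∫ t, p' t ^ 2 ∂perVol S.a + ∫ t, q' t ^ 2 ∂perVol S.a
    have nG : 0 ≤ ∫ x, ∑ i, g i x ^ 2 ∂S.vol ε :=
      integral_nonneg fun x => Finset.sum_nonneg fun i _ => sq_nonneg _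
    have np := nπ (f := p')
    have nq := nπ (f := q')
    have n0 := nπ (f := y₀)
    have n1 := nπ (f := y₁)
    have tot : D * ∫ x, ∑ i, y i x ^ 2 ∂S.vol ε
        + Db * (∫ t, y₀ t ^ 2 ∂perVol S.a + ∫ t, q' t ^ 2 ∂perVol S.a)
        + Dt * (∫ t, p' t ^ 2 ∂perVol S.a + ∫ t, y₁ t ^ 2 ∂perVol S.a)
        ≤ (D + Db + Dt) * ((C₀ + 1) * G) := by
      have b1 : D * ∫ x, ∑ i, y i x ^ 2 ∂S.vol ε ≤ D * ((C₀ + 1) * G) :=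
        mul_le_mul_of_nonneg_left (by linarith) hD
      have b2 : Db * (∫ t, y₀ t ^ 2 ∂perVol S.a + ∫ t, q' t ^ 2 ∂perVol S.a)
          ≤ Db * ((C₀ + 1) * G) := mul_le_mul_of_nonneg_left (by linarith) hDb
      have b3 : Dt * (∫ t, p' t ^ 2 ∂perVol S.a + ∫ t, y₁ t ^ 2 ∂perVol S.a)
          ≤ Dt * ((C₀ + 1) * G) := mul_le_mul_of_nonneg_left (by linarith) hDt
      linarith
    refine (add_le_add (add_le_add l1 l2) l3).trans (tot.trans ?_)
    rw [mul_assoc, mul_assoc]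
    exact mul_le_mul_of_nonneg_left (mul_le_mul_of_nonneg_left data (by linarith)) (by linarith)
  · intro V' Zb' Zt' h'
    obtain ⟨⟨g', hg', hGr'⟩, e0, e1⟩ := hX.isGreenFun_of_solves hη hY (γ := γ) h'
    have hbm := (hX.memLp_arc hX.bot_mem).mp h'.2.1.1
    have htm := (hX.memLp_arc hX.top_mem).mp h'.2.2.1.1
    have hwk : (S.system γ η X Y (-ε) S.b₁).IsWeakFun S.a (-ε) S.b₁
        (fun i x => S.coeff γ X i x (V' x)) g p' q' := by
      intro ψ hψ h0 h1
      rw [hGr'.isWeakFun ψ hψ h0 h1]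
      congr 1
      · congr 1
        · refine integral_congr_ae ?_
          filter_upwards [hg' 0, hg' 1] with x a0 a1
          simp only [Fin.sum_univ_two, a0, a1, hg]
        · refine integral_congr_ae ?_
          filter_upwards [e0] with t a0
          simp only [a0, p']
      · refine integral_congr_ae ?_
        filter_upwards [e1] with t a1
        simp only [a1, q']
    have hu := huniq V' h'.1 hwk
    have htr := hGr.traces_unique hX.strip.a_pos hX.lt hGr' hu hg' bm tm
      (fun i => hX.memLp_coeff (isSlice_curve hX.bot_mem) hbm i)
      (fun i => hX.memLp_coeff (isSlice_curve hX.top_mem) htm i)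
    refine ⟨hX.ae_area.mpr ?_, (hX.ae_arc hX.bot_mem).mpr ?_, (hX.ae_arc hX.top_mem).mpr ?_⟩
    · filter_upwards [tangent_coord h'.1, hu 0, hu 1] with x hx a0 a1
      rw [hx, a0, a1]
    · filter_upwards [(hX.ae_arc hX.bot_mem).mp h'.2.1.2, (htr 0).1, (htr 1).1] with t ht a0 a1
      rw [hX.eq_coeff (γ := γ) hX.bot_mem ht, a0, a1]
    · filter_upwards [(hX.ae_arc hX.top_mem).mp h'.2.2.1.2, (htr 0).2, (htr 1).2] with t ht a0 a1
      rw [hX.eq_coeff (γ := γ) hX.top_mem ht, a0, a1]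
  · intro V' h'
    have hu := huniq V' h'.1 ((hX.weaklySolves_iff h'.1 (tangent_coord h'.1)).mp h')
    refine hX.ae_area.mpr ?_
    filter_upwards [tangent_coord h'.1, hu 0, hu 1] with x hx a0 a1
    rw [hx, a0, a1]

end IsMultiplier

end ParamSurface

/-! ### A quadratic form in a principal frame -/

theorem mul_le_mul_of_abs_le {x y A B : ℝ} (hx : |x| ≤ A) (hy : |y| ≤ B) : x * y ≤ A * B :=
  (le_abs_self _).trans ((abs_mul x y).trans_le
    (mul_le_mul hx hy (abs_nonneg _) ((abs_nonneg _).trans hx)))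

theorem abs_mul_add_mul_le {p q x y N A B : ℝ} (hp : |p| ≤ N) (hq : |q| ≤ N) (hx : |x| ≤ A)
    (hy : |y| ≤ B) : |p * x + q * y| ≤ N * (A + B) := by
  have hN := (abs_nonneg _).trans hp
  calc |p * x + q * y| ≤ |p| * |x| + |q| * |y| := by
        rw [← abs_mul, ← abs_mul]; exact abs_add_le _ _
    _ ≤ N * A + N * B := by gcongr
    _ = _ := by ring

/-- The symmetric part of the adjoint operator in a principal frame, for `X = θ X₁ + X₂`.  The
term with `γ` controls `a = v₁ - θ v₂`, and `X₂(λ₂) > 0` controls `v₂`; all other terms are either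
dominated by the first of these or small with `θ`. -/
theorem frame_form_le {N c γ θ l₁ l₂ p₁ p₂ r₁ r₂ k₁ k₂ l₁₁ l₁₂ l₂₁ l₂₂ y₁ y₂ ρ : ℝ}
    (hN : 1 ≤ N) (hc : 0 < c) (hγ : 0 ≤ γ)
    (hγN : 3 / 2 * N + 49 / 4 * N ^ 2 / c + c / 4 ≤ γ * c / 2)
    (hθ : |θ| * (64 * N ^ 2 * (1 + γ)) ≤ c) (hθ₁ : |θ| ≤ 1)
    (hl₁ : |l₁| ≤ N) (hl₂ : |l₂| ≤ N * |θ|) (hp₁ : |p₁| ≤ N) (hp₂ : |p₂| ≤ N) (hr₁ : |r₁| ≤ N)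
    (hr₂ : |r₂| ≤ N) (hk₁ : |k₁| ≤ N) (hk₂ : |k₂| ≤ N) (h₁₁ : |l₁₁| ≤ N) (h₁₂ : |l₁₂| ≤ N)
    (h₂₁ : |l₂₁| ≤ N) (h₂₂ : c ≤ l₂₂) (hlk : c ≤ l₁ * k₂) (hy₁ : |y₁| ≤ N) (hy₂ : |y₂| ≤ N)
    (hρ : 0 ≤ ρ) (v₁ v₂ : ℝ) :
    ((v₁ - θ * v₂) * (p₁ * v₁ + p₂ * v₂) + (θ * l₁ * v₁ + l₂ * v₂) * (r₁ * v₁ + r₂ * v₂)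
        + γ * (v₁ - θ * v₂) * (-l₁ * v₁ * k₂ + l₂ * v₂ * k₁)
        + γ * (θ * l₁ * v₁ + l₂ * v₂) * (v₁ * k₁ + v₂ * k₂)
        - (θ * v₁ * (v₁ * l₁₁ + v₂ * l₂₁) + v₂ * (v₁ * l₁₂ + v₂ * l₂₂))) / 2
      + (v₁ - θ * v₂) * (v₁ * y₁ + v₂ * y₂)
      - ρ * ((v₁ - θ * v₂) ^ 2 + (θ * l₁ * v₁ + l₂ * v₂) ^ 2)
    ≤ -(c / 24) * (v₁ ^ 2 + v₂ ^ 2) := by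
  obtain ⟨a, rfl⟩ : ∃ a, v₁ = a + θ * v₂ := ⟨v₁ - θ * v₂, by ring⟩
  have e : a + θ * v₂ - θ * v₂ = a := by ring
  rw [e]
  set v := a + θ * v₂ with hv
  set b := θ * l₁ * v + l₂ * v₂ with hb
  have hN0 : 0 ≤ N := by linarith
  set u := |a|
  set w := |v₂|
  set q := |θ|
  have u0 : 0 ≤ u := abs_nonneg _
  have w0 : 0 ≤ w := abs_nonneg _
  have q0 : 0 ≤ q := abs_nonneg _
  have hu : |a| ≤ u := le_rfl
  have hw : |v₂| ≤ w := le_rfl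
  have hq : |θ| ≤ q := le_rfl
  have hu2 : u ^ 2 = a ^ 2 := sq_abs a
  have hw2 : w ^ 2 = v₂ ^ 2 := sq_abs v₂
  have hv1 : |v| ≤ u + w := by
    refine (abs_add_le _ _).trans ?_
    rw [abs_mul]
    have : |θ| * |v₂| ≤ 1 * w := mul_le_mul hθ₁ le_rfl w0 zero_le_one
    linarith
  have hb1 : |b| ≤ 2 * N * q * (u + w) := by
    have h1 : |θ * l₁| ≤ N * q := by rw [abs_mul, mul_comm]; exact mul_le_mul_of_nonneg_right hl₁ q0
    refine (abs_mul_add_mul_le h1 hl₂ hv1 hw).trans ?_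
    have : 0 ≤ N * q := mul_nonneg hN0 q0
    nlinarith only [this, u0, w0]
  have T1 := mul_le_mul_of_abs_le hu (abs_mul_add_mul_le hp₁ hp₂ hv1 hw)
  have T2 := mul_le_mul_of_abs_le hb1 (abs_mul_add_mul_le hr₁ hr₂ hv1 hw)
  have T4 := mul_le_mul_of_abs_le hb1 (abs_mul_add_mul_le hk₁ hk₂ hv1 hw)
  have T6 := mul_le_mul_of_abs_le hu (abs_mul_add_mul_le hy₁ hy₂ hv1 hw)
  have T5 : -(θ * v) * (l₁₁ * v + l₂₁ * v₂) ≤ q * (u + w) * (N * (u + w + w)) :=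
    mul_le_mul_of_abs_le (by rw [abs_neg, abs_mul]; exact mul_le_mul_of_nonneg_left hv1 q0)
      (abs_mul_add_mul_le h₁₁ h₂₁ hv1 hw)
  have T5' : -(a * v₂) * l₁₂ ≤ u * w * N := mul_le_mul_of_abs_le (by rw [abs_neg, abs_mul]) h₁₂
  have T5'' : -(θ * v₂ ^ 2) * l₁₂ ≤ q * w ^ 2 * N :=
    mul_le_mul_of_abs_le (by rw [abs_neg, abs_mul, ← hw2, abs_of_nonneg (sq_nonneg w)]) h₁₂
  have T3 : -(l₁ * k₂) * a ^ 2 ≤ -c * u ^ 2 := by rw [hu2]; nlinarith only [sq_nonneg a, hlk]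
  have T3' : (a * v₂) * (-θ * (l₁ * k₂) + l₂ * k₁) ≤ (u * w) * (2 * N ^ 2 * q) := by
    refine mul_le_mul_of_abs_le (by rw [abs_mul]) ((abs_add_le _ _).trans ?_)
    have h1 : |l₁| * |k₂| ≤ N * N := mul_le_mul hl₁ hk₂ (abs_nonneg _) hN0
    have h2 : |l₂| * |k₁| ≤ N * q * N := mul_le_mul hl₂ hk₁ (abs_nonneg _) (mul_nonneg hN0 q0)
    rw [abs_mul, abs_mul, abs_mul, abs_neg]
    nlinarith only [mul_le_mul_of_nonneg_left h1 q0, h2]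
  have T7 : -l₂₂ * v₂ ^ 2 ≤ -c * w ^ 2 := by rw [hw2]; nlinarith only [sq_nonneg v₂, h₂₂]
  have T8 : 0 ≤ ρ * (a ^ 2 + b ^ 2) := by positivity
  have G3 := mul_le_mul_of_nonneg_left T3 hγ
  have G3' := mul_le_mul_of_nonneg_left T3' hγ
  have G4 := mul_le_mul_of_nonneg_left T4 hγ
  -- the remainder that is small with `θ`
  have R1 : N * q * ((u + w) * (u + w + w)) ≤ N * q * (4 * (u ^ 2 + w ^ 2)) :=
    mul_le_mul_of_nonneg_left (by nlinarith only [sq_nonneg (u - w)]) (mul_nonneg hN0 q0)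
  have R2 : N * q ≤ N ^ 2 * q := mul_le_mul_of_nonneg_right (by nlinarith only [hN]) q0
  have R3 := mul_le_mul_of_nonneg_left R1 hN0
  have R4 := mul_le_mul_of_nonneg_left R3 hγ
  have s0 : 0 ≤ u ^ 2 + w ^ 2 := by positivity
  have R5 := mul_le_mul_of_nonneg_right R2 s0
  have R6 : u * w ≤ (u ^ 2 + w ^ 2) / 2 := by nlinarith only [sq_nonneg (u - w)]
  have R7 := mul_le_mul_of_nonneg_left R6 (mul_nonneg hγ (mul_nonneg (sq_nonneg N) q0))
  have R8 : N * q * w ^ 2 ≤ N * q * (u ^ 2 + w ^ 2) :=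
    mul_le_mul_of_nonneg_left (by nlinarith only [sq_nonneg u]) (mul_nonneg hN0 q0)
  have R9 : 8 * (q * N ^ 2 * (1 + γ)) * (u ^ 2 + w ^ 2) ≤ c / 8 * (u ^ 2 + w ^ 2) :=
    mul_le_mul_of_nonneg_right (by linarith) s0
  have R10 : 0 ≤ q * N ^ 2 * (u ^ 2 + w ^ 2) := by positivity
  have R11 : 0 ≤ γ * (q * N ^ 2 * (u ^ 2 + w ^ 2)) := by positivity
  -- the mixed term
  have M1 : 7 / 2 * N * (u * w) ≤ 49 / 4 * N ^ 2 / c * u ^ 2 + c / 4 * w ^ 2 := by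
    have : 49 / 4 * N ^ 2 / c * u ^ 2 + c / 4 * w ^ 2 - 7 / 2 * N * (u * w)
        = (7 / 2 * N * u - c / 2 * w) ^ 2 / c := by field_simp; ring
    have h2 : 0 ≤ (7 / 2 * N * u - c / 2 * w) ^ 2 / c := by positivity
    linarith
  have M2 := mul_le_mul_of_nonneg_right hγN (sq_nonneg u)
  have V : v ^ 2 ≤ 2 * u ^ 2 + 2 * w ^ 2 := by
    have := sq_le_sq' (by linarith [abs_nonneg v] : -(u + w) ≤ |v|) hv1
    rw [sq_abs] at this
    nlinarith only [sq_nonneg (u - w), this]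
  have V' : c / 24 * (v ^ 2 + v₂ ^ 2) ≤ c / 8 * (u ^ 2 + w ^ 2) := by
    rw [← hw2]; nlinarith only [mul_le_mul_of_nonneg_left V hc.le, mul_nonneg hc.le (sq_nonneg u)]
  have key : ∀ z, -l₁ * v * z = -(l₁ * z) * a + -θ * (l₁ * z) * v₂ := fun z => by rw [hv]; ring
  have key2 : v₂ * (v * l₁₂ + v₂ * l₂₂) = a * v₂ * l₁₂ + θ * v₂ ^ 2 * l₁₂ + l₂₂ * v₂ ^ 2 := by
    rw [hv]; ring
  rw [key, key2]
  clear_value v b u w q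
  linarith only [T1, T2, T5, T5', T5'', T6, T7, T8, G3, G3', G4, R1, R3, R4, R5, R7, R8, R9, R10, R11, M1,
    M2, V']

/-! ### Bounds for principal frames -/

/-- A function that is continuous near the segment `s = 0` and positive on it has a positive lower
bound on a neighbourhood of the segment. -/
theorem exists_lower_bound {a δ : ℝ} {f : ℝ² → ℝ} (hδ : 0 < δ)
    (hf : ∀ t, ∀ s ∈ Ioo (-δ) δ, ContinuousAt f (t, s)) (h0 : ∀ t, 0 < f (t, 0)) :
    ∃ s₁ c, 0 < s₁ ∧ s₁ < δ ∧ 0 < c ∧ ∀ t ∈ Icc 0 a, ∀ s ∈ Icc (-s₁) s₁, c ≤ f (t, s) := by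
  have hm : (0 : ℝ) ∈ Ioo (-δ) δ := ⟨by linarith, hδ⟩
  have hc0 : ContinuousOn (fun t : ℝ => f (t, 0)) (Icc 0 a) := fun t _ =>
    ((hf t 0 hm).comp (f := fun t : ℝ => (t, (0 : ℝ))) (by fun_prop)).continuousWithinAt
  obtain ⟨c, hc, hcf⟩ : ∃ c, 0 < c ∧ ∀ t ∈ Icc 0 a, c < f (t, 0) := by
    rcases (Icc (0 : ℝ) a).eq_empty_or_nonempty with he | hne
    · exact ⟨1, one_pos, fun t ht => by rw [he] at ht; exact ht.elim⟩
    · obtain ⟨t₀, -, h⟩ := isCompact_Icc.exists_isMinOn hne hc0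
      exact ⟨f (t₀, 0) / 2, half_pos (h0 t₀), fun t ht => by linarith [h0 t₀, isMinOn_iff.mp h t ht]⟩
  have hev : ∀ᶠ s in 𝓝 (0 : ℝ), ∀ t ∈ Icc 0 a, c < f (t, s) :=
    isCompact_Icc.eventually_forall_of_forall_eventually fun t ht =>
      ((hf t 0 hm).comp (f := Prod.swap) (x := (0, t)) continuous_swap.continuousAt).eventually
        (lt_mem_nhds (hcf t ht))
  obtain ⟨e, he, hball⟩ := Metric.eventually_nhds_iff.mp hev
  refine ⟨min (e / 2) (δ / 2), c, by positivity, by linarith [min_le_right (e / 2) (δ / 2)], hc,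
    fun t ht s hs => (hball ?_ t ht).le⟩
  rw [Real.dist_eq, sub_zero]
  linarith [abs_le.mpr hs, min_le_left (e / 2) (δ / 2)]

/-- A common bound for finitely many functions that are continuous on a closed strip. -/
theorem exists_bound_family {a c d : ℝ} {n : ℕ} {f : Fin n → ℝ² → ℝ}
    (hf : ∀ i, ContinuousOn (f i) (univ ×ˢ Icc c d)) :
    ∃ N, 1 ≤ N ∧ ∀ i, ∀ t ∈ Icc 0 a, ∀ s ∈ Icc c d, |f i (t, s)| ≤ N := by
  obtain ⟨N, h0, hN⟩ := exists_bound_strip (a := a + 1) (continuousOn_pi.mpr hf)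
  exact ⟨N + 1, by linarith, fun i t ht s hs => ((norm_le_pi_norm _ i).trans
    (hN t ⟨ht.1, ht.2.trans_lt (lt_add_one a)⟩ s hs)).trans (le_add_of_nonneg_right zero_le_one)⟩

theorem HasDerivAt.nonneg_of_pos_right {g : ℝ → ℝ} {d δ : ℝ} (h : HasDerivAt g d 0) (hδ : 0 < δ)
    (h0 : g 0 = 0) (hg : ∀ s ∈ Ioo 0 δ, 0 < g s) : 0 ≤ d := by
  have h1 := h.hasDerivWithinAt (s := Ioi 0)
  rw [hasDerivWithinAt_iff_tendsto_slope' (by simp)] at h1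
  refine ge_of_tendsto h1 ?_
  filter_upwards [Ioo_mem_nhdsGT hδ] with s hs
  rw [slope_def_field, h0]
  exact div_nonneg (by linarith [hg s hs]) (by linarith [hs.1])

namespace ParamSurface

variable {S : ParamSurface} {δ : ℝ} {X₁ X₂ : ℝ² → E3} {lam₁ lam₂ : ℝ² → ℝ} {t s : ℝ}

theorem IsMixedType.dS_curv_pos (hS : S.IsMixedType) (t : ℝ) :
    dT S.curv (t, 0) = 0 ∧ 0 < dS S.curv (t, 0) := by
  have hm : (0 : ℝ) ∈ Icc (-S.b₀) S.b₁ := ⟨by linarith [hS.b₀_pos], hS.b₁_pos.le⟩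
  have hg := hS.isRegularStrip.gdet_pos t 0 hm
  have hd := (contDiffAt_curv hS.smooth hg).differentiableAt one_ne_zero
  have hT : dT S.curv (t, 0) = 0 := by
    have := hasDerivAt_dT hd
    simp only [hS.curv_zero] at this
    exact this.unique (hasDerivAt_const _ _)
  refine ⟨hT, lt_of_le_of_ne ((hasDerivAt_dS hd).nonneg_of_pos_right hS.b₁_pos (hS.curv_zero t)
    fun s hs => hS.curv_pos t s ⟨hs.1, hs.2.le⟩) fun h0 => hS.grad_curv_ne t ?_⟩
  rw [grad, hT, ← h0]; simp

/-- `√(det g) ∇_v f`, the directional derivative used in the divergence formulas. -/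
def fluxD (S : ParamSurface) (f : ℝ² → ℝ) (x : ℝ²) (v : E3) : ℝ :=
  S.fluxRT x v * dT f x + S.fluxRS x v * dS f x

theorem eventually_snd_mem {c d : ℝ} (hs : s ∈ Ioo c d) : ∀ᶠ y : ℝ² in 𝓝 (t, s), y.2 ∈ Ioo c d :=
  continuousAt_snd.eventually (isOpen_Ioo.mem_nhds hs)

namespace IsPrincipalFrame

variable (hF : S.IsPrincipalFrame δ X₁ X₂ lam₁ lam₂)
include hF

theorem mem_strip (hs : s ∈ Ioo (-δ) δ) : s ∈ Icc (-S.b₀) S.b₁ :=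
  ⟨by linarith [hs.1, hF.δ_le₀], by linarith [hs.2, hF.δ_le₁]⟩

theorem contDiffAt₁ (hs : s ∈ Ioo (-δ) δ) : ContDiffAt ℝ 1 X₁ (t, s) :=
  hF.smooth₁.contDiffAt ((isOpen_univ.prod isOpen_Ioo).mem_nhds ⟨mem_univ _, hs⟩)

theorem contDiffAt₂ (hs : s ∈ Ioo (-δ) δ) : ContDiffAt ℝ 1 X₂ (t, s) :=
  hF.smooth₂.contDiffAt ((isOpen_univ.prod isOpen_Ioo).mem_nhds ⟨mem_univ _, hs⟩)

theorem inner₁ (hs : s ∈ Ioo (-δ) δ) : inner ℝ (X₁ (t, s)) (X₁ (t, s)) = (1 : ℝ) := by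
  rw [real_inner_self_eq_norm_sq, hF.norm₁ t s hs, one_pow]

theorem inner₂ (hs : s ∈ Ioo (-δ) δ) : inner ℝ (X₂ (t, s)) (X₂ (t, s)) = (1 : ℝ) := by
  rw [real_inner_self_eq_norm_sq, hF.norm₂ t s hs, one_pow]

theorem lam₁_eq (hs : s ∈ Ioo (-δ) δ) :
    lam₁ (t, s) = inner ℝ (S.shape (t, s) (X₁ (t, s))) (X₁ (t, s)) := by
  rw [hF.shape₁ t s hs, real_inner_smul_left, hF.inner₁ hs, mul_one]

theorem lam₂_eq (hs : s ∈ Ioo (-δ) δ) :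
    lam₂ (t, s) = inner ℝ (S.shape (t, s) (X₂ (t, s))) (X₂ (t, s)) := by
  rw [hF.shape₂ t s hs, real_inner_smul_left, hF.inner₂ hs, mul_one]

variable (hS : S.IsMixedType)
include hS

theorem gdet_pos (hs : s ∈ Ioo (-δ) δ) : 0 < S.gdet (t, s) :=
  hS.isRegularStrip.gdet_pos t s (hF.mem_strip hs)

theorem contDiffAt_lam₁ (hs : s ∈ Ioo (-δ) δ) : ContDiffAt ℝ 1 lam₁ (t, s) :=
  ((contDiffAt_shape hS.smooth (hF.gdet_pos hS hs) (hF.contDiffAt₁ hs)).inner ℝ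
    (hF.contDiffAt₁ hs)).congr_of_eventuallyEq <| by
      filter_upwards [eventually_snd_mem hs] with y hy using hF.lam₁_eq (t := y.1) hy

theorem contDiffAt_lam₂ (hs : s ∈ Ioo (-δ) δ) : ContDiffAt ℝ 1 lam₂ (t, s) :=
  ((contDiffAt_shape hS.smooth (hF.gdet_pos hS hs) (hF.contDiffAt₂ hs)).inner ℝ
    (hF.contDiffAt₂ hs)).congr_of_eventuallyEq <| by
      filter_upwards [eventually_snd_mem hs] with y hy using hF.lam₂_eq (t := y.1) hy

/-- The direction `X₂` points to the side `s > 0` on the curve `s = 0`, since `λ₂` increases in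
both directions. -/
theorem coordS_pos (t : ℝ) : 0 < S.coordS (t, 0) (X₂ (t, 0)) := by
  have hm : (0 : ℝ) ∈ Ioo (-δ) δ := ⟨by linarith [hF.δ_pos], hF.δ_pos⟩
  have hd := (hF.contDiffAt_lam₂ hS hm (t := t)).differentiableAt one_ne_zero
  have hT : dT lam₂ (t, 0) = 0 := by
    have := hasDerivAt_dT hd
    simp only [hF.lam₂_zero] at this
    exact this.unique (hasDerivAt_const _ _)
  have hs := (hasDerivAt_dS hd).nonneg_of_pos_right hF.δ_pos (hF.lam₂_zero t) (hF.lam₂_pos t)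
  have := hF.deriv_pos t 0 hm
  rw [dirDeriv, hT, smul_zero, zero_add, smul_eq_mul] at this
  exact pos_of_mul_pos_left this hs

theorem continuousAt_fluxD {f : ℝ² → ℝ} {W : ℝ² → E3} (hs : s ∈ Ioo (-δ) δ)
    (hW : ContDiffAt ℝ 1 W (t, s)) (hf : ContDiffAt ℝ 1 f (t, s)) :
    ContinuousAt (fun y => S.fluxD f y (W y)) (t, s) := by
  have hg := hF.gdet_pos hS hs (t := t)
  have h1 := contDiffAt_dT (m := 0) hf (by simp)
  have h2 := contDiffAt_dS (m := 0) hf (by simp)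
  exact ((contDiffAt_fluxRT hS.smooth hg hW).continuousAt.mul h1.continuousAt).add
    ((contDiffAt_fluxRS hS.smooth hg hW).continuousAt.mul h2.continuousAt)

end IsPrincipalFrame

/-- The divergence of `Q ∇n W`, as a density in the parameters. -/
def divP (S : ParamSurface) (W : ℝ² → E3) (x : ℝ²) : ℝ :=
  dT (fun y => S.fluxPT y (W y)) x + dS (fun y => S.fluxPS y (W y)) x

/-- The divergence of `W`, as a density in the parameters. -/
def divR (S : ParamSurface) (W : ℝ² → E3) (x : ℝ²) : ℝ :=
  dT (fun y => S.fluxRT y (W y)) x + dS (fun y => S.fluxRS y (W y)) x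

theorem continuousAt_divP {W : ℝ² → E3} {x : ℝ²} (h : ContDiff ℝ 3 S.α) (hg : 0 < S.gdet x)
    (hW : ContDiffAt ℝ 1 W x) : ContinuousAt (S.divP W) x :=
  (contDiffAt_dT (m := 0) (contDiffAt_fluxPT h hg hW) (by simp)).continuousAt.add
    (contDiffAt_dS (m := 0) (contDiffAt_fluxPS h hg hW) (by simp)).continuousAt

theorem continuousAt_divR {W : ℝ² → E3} {x : ℝ²} (h : ContDiff ℝ 3 S.α) (hg : 0 < S.gdet x)
    (hW : ContDiffAt ℝ 1 W x) : ContinuousAt (S.divR W) x :=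
  (contDiffAt_dT (m := 0) (contDiffAt_fluxRT h hg hW) (by simp)).continuousAt.add
    (contDiffAt_dS (m := 0) (contDiffAt_fluxRS h hg hW) (by simp)).continuousAt

/-- Bounds, uniform on a neighbourhood `|s| ≤ s₁` of the curve `s = 0`, for the quantities of a
principal frame which enter the symmetric part of the adjoint operator. -/
structure FrameBounds (S : ParamSurface) (X₁ X₂ : ℝ² → E3) (lam₁ lam₂ : ℝ² → ℝ)
    (N c : ℝ) (x : ℝ²) : Prop where
  coordS₂ : c ≤ S.coordS x (X₂ x)
  lam₁_ge : c ≤ lam₁ x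
  curv_ge : c ≤ lam₁ x * S.fluxD S.curv x (X₂ x)
  lam₂_ge : c ≤ S.fluxD lam₂ x (X₂ x)
  coordS₁ : |S.coordS x (X₁ x)| ≤ N
  rt_le : |S.rt x| ≤ N
  lam₁_le : |lam₁ x| ≤ N
  lam₂_le : |lam₂ x| ≤ N * |x.2|
  divP₁ : |S.divP X₁ x| ≤ N
  divP₂ : |S.divP X₂ x| ≤ N
  divR₁ : |S.divR X₁ x| ≤ N
  divR₂ : |S.divR X₂ x| ≤ N
  curv₁ : |S.fluxD S.curv x (X₁ x)| ≤ N
  curv₂ : |S.fluxD S.curv x (X₂ x)| ≤ N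
  lam₁₁ : |S.fluxD lam₁ x (X₁ x)| ≤ N
  lam₁₂ : |S.fluxD lam₂ x (X₁ x)| ≤ N
  lam₂₁ : |S.fluxD lam₁ x (X₂ x)| ≤ N

theorem IsPrincipalFrame.exists_frameBounds (hF : S.IsPrincipalFrame δ X₁ X₂ lam₁ lam₂)
    (hS : S.IsMixedType) : ∃ s₁ N c, 0 < s₁ ∧ s₁ < δ ∧ 1 ≤ N ∧ 0 < c ∧
      ∀ t ∈ Icc 0 S.a, ∀ s ∈ Icc (-s₁) s₁, S.FrameBounds X₁ X₂ lam₁ lam₂ N c (t, s) := by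
  have h := hS.smooth
  have hm : (0 : ℝ) ∈ Ioo (-δ) δ := ⟨by linarith [hF.δ_pos], hF.δ_pos⟩
  have g {t s} (hs : s ∈ Ioo (-δ) δ) := hF.gdet_pos hS hs (t := t)
  have k {t s} (hs : s ∈ Ioo (-δ) δ) := contDiffAt_curv h (g hs (t := t))
  have x1 {t s} (hs : s ∈ Ioo (-δ) δ) := hF.contDiffAt₁ hs (t := t)
  have x2 {t s} (hs : s ∈ Ioo (-δ) δ) := hF.contDiffAt₂ hs (t := t)
  have m1 {t s} (hs : s ∈ Ioo (-δ) δ) := hF.contDiffAt_lam₁ hS hs (t := t)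
  have m2 {t s} (hs : s ∈ Ioo (-δ) δ) := hF.contDiffAt_lam₂ hS hs (t := t)
  obtain ⟨s₁, c, s₁pos, s₁lt, cpos, hc⟩ := exists_lower_bound (a := S.a) (f := fun x =>
      S.coordS x (X₂ x) ⊓ lam₁ x ⊓ (lam₁ x * S.fluxD S.curv x (X₂ x)) ⊓ S.fluxD lam₂ x (X₂ x))
    hF.δ_pos (fun t s hs => (((contDiffAt_coordS h (g hs) (x2 hs)).continuousAt.min
      (m1 hs).continuousAt).min ((m1 hs).continuousAt.mul
      (hF.continuousAt_fluxD hS hs (x2 hs) (k hs)))).min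
      (hF.continuousAt_fluxD hS hs (x2 hs) (m2 hs))) (fun t => by
      have p0 := hF.coordS_pos hS t
      have p1 := hF.lam₁_pos t 0 hm
      have p2 := rt_pos (g hm (t := t))
      have p3 := hF.deriv_pos t 0 hm
      obtain ⟨c1, c2⟩ := hS.dS_curv_pos t
      refine lt_min (lt_min (lt_min p0 p1) (mul_pos p1 ?_)) ?_
      · rw [fluxD, c1, mul_zero, zero_add, fluxRS]; positivity
      · have : S.fluxD lam₂ (t, 0) (X₂ (t, 0))
            = S.rt (t, 0) * S.dirDeriv lam₂ (t, 0) (X₂ (t, 0)) := by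
          simp only [fluxD, fluxRT, fluxRS, dirDeriv, smul_eq_mul]; ring
        rw [this]; positivity)
  have hsub {s} (hs : s ∈ Icc (-s₁) s₁) : s ∈ Ioo (-δ) δ := ⟨by linarith [hs.1], by linarith [hs.2]⟩
  have cont {f : ℝ² → ℝ} (hf : ∀ t s, s ∈ Ioo (-δ) δ → ContinuousAt f (t, s)) :
      ContinuousOn f (univ ×ˢ Icc (-s₁) s₁) := fun x hx =>
    (hf x.1 x.2 (hsub hx.2)).continuousWithinAt
  obtain ⟨N, hN1, hN⟩ := exists_bound_family (a := S.a) (c := -s₁) (d := s₁)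
    (f := ![fun x => S.coordS x (X₁ x), S.rt, lam₁, dS lam₂, S.divP X₁, S.divP X₂, S.divR X₁,
      S.divR X₂, fun x => S.fluxD S.curv x (X₁ x), fun x => S.fluxD S.curv x (X₂ x),
      fun x => S.fluxD lam₁ x (X₁ x), fun x => S.fluxD lam₂ x (X₁ x),
      fun x => S.fluxD lam₁ x (X₂ x)]) (by
    simp only [Fin.forall_fin_succ, Matrix.cons_val_zero, Matrix.cons_val_succ]
    exact ⟨cont fun t s hs => (contDiffAt_coordS h (g hs) (x1 hs)).continuousAt,
      cont fun t s hs => (contDiffAt_rt h (g hs)).continuousAt,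
      cont fun t s hs => (m1 hs).continuousAt,
      cont fun t s hs => (contDiffAt_dS (m := 0) (m2 hs) (by simp)).continuousAt,
      cont fun t s hs => continuousAt_divP h (g hs) (x1 hs),
      cont fun t s hs => continuousAt_divP h (g hs) (x2 hs),
      cont fun t s hs => continuousAt_divR h (g hs) (x1 hs),
      cont fun t s hs => continuousAt_divR h (g hs) (x2 hs),
      cont fun t s hs => hF.continuousAt_fluxD hS hs (x1 hs) (k hs),
      cont fun t s hs => hF.continuousAt_fluxD hS hs (x2 hs) (k hs),
      cont fun t s hs => hF.continuousAt_fluxD hS hs (x1 hs) (m1 hs),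
      cont fun t s hs => hF.continuousAt_fluxD hS hs (x1 hs) (m2 hs),
      cont fun t s hs => hF.continuousAt_fluxD hS hs (x2 hs) (m1 hs), fun i => i.elim0⟩)
  simp only [Fin.forall_fin_succ, Matrix.cons_val_zero, Matrix.cons_val_succ] at hN
  obtain ⟨b0, b1, b2, b3, b4, b5, b6, b7, b8, b9, b10, b11, b12, -⟩ := hN
  refine ⟨s₁, N, c, s₁pos, s₁lt, hN1, cpos, fun t ht s hs => ?_⟩
  have := hc t ht s hs
  simp only [le_min_iff] at this
  obtain ⟨⟨⟨c0, c1⟩, c2⟩, c3⟩ := this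
  refine ⟨c0, c1, c2, c3, b0 t ht s hs, b1 t ht s hs, b2 t ht s hs, ?_, b4 t ht s hs, b5 t ht s hs,
    b6 t ht s hs, b7 t ht s hs, b8 t ht s hs, b9 t ht s hs, b10 t ht s hs, b11 t ht s hs,
    b12 t ht s hs⟩
  have := (convex_Icc (-s₁) s₁).norm_image_sub_le_of_norm_hasDerivWithin_le
    (f := fun s => lam₂ (t, s)) (f' := fun s => dS lam₂ (t, s)) (C := N)
    (fun z hz => (hasDerivAt_dS ((m2 (hsub hz)).differentiableAt one_ne_zero)).hasDerivWithinAt)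
    (fun z hz => b3 t ht z hz) (x := 0) (y := s) ⟨by linarith, s₁pos.le⟩ hs
  simpa [hF.lam₂_zero] using this

end ParamSurface

/-! ### The field `X` as a multiplier -/

namespace ParamSurface

variable {S : ParamSurface} {δ s₁ N c ε σ₀ : ℝ} {X₁ X₂ : ℝ² → E3} {lam₁ lam₂ : ℝ² → ℝ}
  {ζ : ℝ → ℝ} {t s : ℝ}

theorem h11_mul_sub (h : ContDiff ℝ 3 S.α) {x : ℝ²} (hg : 0 < S.gdet x) :
    S.h11 x * S.h22 x - S.h12 x ^ 2 = S.curv x * S.gdet x := by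
  rw [curv_eq h hg, div_mul_cancel₀ _ hg.ne']

theorem IsMixedType.h11_pos (hS : S.IsMixedType) (t : ℝ) {s : ℝ} (hs : s ∈ Icc (-S.b₀) S.b₁) :
    0 < S.h11 (t, s) := by
  have hR := hS.isRegularStrip
  have neg {s} (hs : s ∈ Icc (-S.b₀) 0) : 0 < S.h11 (t, s) := by
    rw [← sff_αt_αt (hR.gdet_pos t s ⟨hs.1, hs.2.trans hS.b₁_pos.le⟩)]
    exact hS.sff_pos t s hs
  rcases le_or_gt s 0 with h0 | h0
  · exact neg ⟨hs.1, h0⟩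
  by_contra! hle
  have hc : ContinuousOn (fun s => S.h11 (t, s)) (Icc 0 s) := fun z hz =>
    ((contDiffAt_h11 hS.smooth (hR.gdet_pos t z ⟨by linarith [hz.1, hS.b₀_pos],
      hz.2.trans hs.2⟩)).continuousAt.comp (f := fun z : ℝ => (t, z))
      (by fun_prop)).continuousWithinAt
  have h00 := neg ⟨by linarith [hS.b₀_pos], le_rfl⟩
  obtain ⟨z, hz, hz0 : S.h11 (t, z) = 0⟩ := intermediate_value_Icc' h0.le hc ⟨hle, h00.le⟩
  have hz0' : 0 < z := lt_of_le_of_ne hz.1 fun h => by rw [← h] at hz0; exact h00.ne' hz0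
  have hg := hR.gdet_pos t z ⟨by linarith [hS.b₀_pos], hz.2.trans hs.2⟩
  have h1 := h11_mul_sub hS.smooth hg
  have h2 := mul_pos (hS.curv_pos t z ⟨hz0', hz.2.trans hs.2⟩) hg
  rw [hz0] at h1
  nlinarith [sq_nonneg (S.h12 (t, z))]

/-- On the elliptic side the second fundamental form is positive definite. -/
theorem IsMixedType.sff_pos_of_pos (hS : S.IsMixedType) (hs : s ∈ Ioc 0 S.b₁) {v : E3}
    (hv : S.IsTangent (t, s) v) (h0 : S.coordS (t, s) v ≠ 0) : 0 < S.sff (t, s) v v := by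
  have hm : s ∈ Icc (-S.b₀) S.b₁ := ⟨by linarith [hs.1, hS.b₀_pos], hs.2⟩
  have hg := hS.isRegularStrip.gdet_pos t s hm
  have h1 := h11_mul_sub hS.smooth hg
  have h11 := hS.h11_pos t hm
  rw [sff, real_inner_comm, inner_shape_eq hS.isRegularStrip.τ_sq hS.smooth hg hv]
  set p := S.coordT (t, s) v
  set q := S.coordS (t, s) v
  refine pos_of_mul_pos_right (a := S.h11 (t, s)) ?_ h11.le
  have : S.h11 (t, s) * (p * (S.h11 (t, s) * p + S.h12 (t, s) * q)
      + q * (S.h12 (t, s) * p + S.h22 (t, s) * q))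
      = (S.h11 (t, s) * p + S.h12 (t, s) * q) ^ 2 + S.curv (t, s) * S.gdet (t, s) * q ^ 2 := by
    rw [← h1]; ring
  rw [this]
  have := hS.curv_pos t s hs
  positivity

theorem Xσ_eq (hS : S.IsMixedType) {x : ℝ²} (hg : 0 < S.gdet x) :
    S.Xσ σ₀ x = σ₀ • S.αt x - S.τ • S.rot x (S.αt x) := by
  have hr := rt_pos hg
  rw [Xσ, det3_eq hg]
  rcases hS.τ_sign with h | h <;> simp [h, hr, hr.le]

theorem coordS_Xσ_pos (hS : S.IsMixedType) {x : ℝ²} (hg : 0 < S.gdet x) :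
    0 < S.coordS x (S.Xσ σ₀ x) := by
  have hr := rt_pos hg
  have h1 := coordS_rot hg (S.αt x)
  have h2 := norm_αt_pos hg
  rw [Xσ_eq hS hg, coordS_sub, coordS_smul, coordS_smul, coordS_αt]
  refine pos_of_mul_pos_right (a := S.rt x) ?_ hr.le
  have : S.rt x * (σ₀ * 0 - S.τ * S.coordS x (S.rot x (S.αt x))) = ‖S.αt x‖ ^ 2 := by
    rw [← real_inner_self_eq_norm_sq]
    linear_combination (-S.τ) * h1 + inner ℝ (S.αt x) (S.αt x) * hS.isRegularStrip.τ_sq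
  rw [this]; positivity

namespace IsPrincipalFrame

variable (hF : S.IsPrincipalFrame δ X₁ X₂ lam₁ lam₂) (hS : S.IsMixedType)
include hF

theorem sff_comb (hs : s ∈ Ioo (-δ) δ) (k : ℝ) :
    S.sff (t, s) (k • X₁ (t, s) + X₂ (t, s)) (k • X₁ (t, s) + X₂ (t, s))
      = k ^ 2 * lam₁ (t, s) + lam₂ (t, s) := by
  have h21 := hF.orthogonal t s hs
  have h12 : inner ℝ (X₂ (t, s)) (X₁ (t, s)) = (0 : ℝ) := by rw [real_inner_comm, h21]
  rw [sff, shape_add, shape_smul, hF.shape₁ t s hs, hF.shape₂ t s hs]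
  simp only [inner_add_left, inner_add_right, real_inner_smul_left, real_inner_smul_right,
    hF.inner₁ hs, hF.inner₂ hs, h21, h12]
  ring

include hS

theorem sign_inner (hs : s ∈ Ioo (-δ) δ) (h0 : 0 < S.coordS (t, s) (X₂ (t, s))) :
    Real.sign (inner ℝ (S.αt (t, s)) (X₁ (t, s))) = S.τ := by
  have hg := hF.gdet_pos hS hs (t := t)
  have hr := rt_pos hg
  rw [← hF.rot₂ t s hs, inner_rot_eq hg, coordT_αt hg, coordS_αt]
  rcases hS.τ_sign with h | h
  · rw [h, Real.sign_of_pos]; simp; positivity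
  · rw [h, Real.sign_of_neg]; simp; positivity

variable (s₁lt : s₁ < δ) (cpos : 0 < c)
  (hb : ∀ t ∈ Icc 0 S.a, ∀ s ∈ Icc (-s₁) s₁, S.FrameBounds X₁ X₂ lam₁ lam₂ N c (t, s))
include s₁lt hb

theorem coordS_ge (t) (hs : s ∈ Icc (-s₁) s₁) :
    c ≤ S.coordS (t, s) (X₂ (t, s)) ∧ |S.coordS (t, s) (X₁ (t, s))| ≤ N := by
  have hsub : s ∈ Ioo (-δ) δ := ⟨by linarith [hs.1], by linarith [hs.2]⟩
  have hp : Function.Periodic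
      (fun t => (S.coordS (t, s) (X₂ (t, s)), S.coordS (t, s) (X₁ (t, s)))) S.a := fun t => by
    simp only [coordS_periodic hS.periodic, hF.periodic₁ t s hsub, hF.periodic₂ t s hsub]
  obtain ⟨t', ht', he⟩ := hp.exists_mem_Ico₀ hS.a_pos t
  rw [Prod.mk.injEq] at he
  have := hb t' (Ico_subset_Icc_self ht') s hs
  rw [he.1, he.2]
  exact ⟨this.coordS₂, this.coordS₁⟩

include cpos

theorem fieldX_eq (t) (hs : s ∈ Icc (-s₁) s₁) : S.fieldX ε σ₀ ζ X₁ X₂ (t, s)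
    = ζ s • ((S.τ * ε ^ (1 / 3 : ℝ)) • X₁ (t, s) + X₂ (t, s))
      + (1 - ζ s) • (σ₀ • S.αt (t, s) - S.τ • S.rot (t, s) (S.αt (t, s))) := by
  have hsub : s ∈ Ioo (-δ) δ := ⟨by linarith [hs.1], by linarith [hs.2]⟩
  rw [fieldX, hF.sign_inner hS hsub (cpos.trans_le (hF.coordS_ge hS s₁lt hb t hs).1),
    Xσ_eq hS (hF.gdet_pos hS hsub), mul_comm S.τ]

/-- For small `ε` the field `X` is an admissible multiplier. -/
theorem isMultiplier_fieldX (hε : 0 < ε) (hεs : 2 * ε < s₁) (hεN : ε ^ (1 / 3 : ℝ) * N < c)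
    (hζ : IsCutoffζ ε ζ) :
    S.IsMultiplier (-ε) S.b₁ (-s₁) (S.fieldX ε σ₀ ζ X₁ X₂) := by
  have hR : S.IsRegularStrip (-ε) S.b₁ := hS.isRegularStrip.mono (by linarith [hF.δ_le₀]) le_rfl
  have hsub {s} (hs : s ∈ Icc (-s₁) s₁) : s ∈ Ioo (-δ) δ := ⟨by linarith [hs.1], by linarith [hs.2]⟩
  have hζ0 {x : ℝ²} (hx : 2 * ε ≤ x.2) : S.fieldX ε σ₀ ζ X₁ X₂ x = S.Xσ σ₀ x := by
    rw [fieldX, hζ.eq_zero _ hx]; simp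
  have hζ1 {s} (hs : s ∈ Icc (-ε) 0) : ζ s = 1 := by
    have : EqOn ζ (fun _ => 1) (closure (Ioo (-ε) ε)) :=
      (show EqOn ζ (fun _ => 1) (Ioo (-ε) ε) from hζ.eq_one).closure hζ.smooth.continuous
        continuous_const
    rw [closure_Ioo (by linarith)] at this
    exact this ⟨hs.1, by linarith [hs.2]⟩
  have hσ {x : ℝ²} (hg : 0 < S.gdet x) : ContDiffAt ℝ 1 (S.Xσ σ₀) x := by
    have h1 := (contDiffAt_αt (x := x) hS.smooth).of_le one_le_two
    have h2 : ContDiffAt ℝ 1 (fun x => σ₀ • S.αt x - S.τ • S.rot x (S.αt x)) x :=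
      ((contDiffAt_const (c := σ₀)).smul h1).sub ((contDiffAt_const (c := S.τ)).smul
        (contDiffAt_rot hS.smooth hg h1))
    refine h2.congr_of_eventuallyEq ?_
    filter_upwards [eventually_gdet_pos hS.smooth hg] with y hy using Xσ_eq hS hy
  have hζc {x : ℝ²} : ContDiffAt ℝ 1 (fun y : ℝ² => ζ y.2) x :=
    ((hζ.smooth.of_le (by exact_mod_cast le_top)).comp contDiff_snd).contDiffAt
  have htan {t s} (hg : 0 < S.gdet (t, s)) : S.IsTangent (t, s) (S.Xσ σ₀ (t, s)) := by
    rw [Xσ_eq hS hg]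
    exact ((isTangent_αt _).smul _).sub ((isTangent_rot _ _).smul _)
  have hper : ∀ t s, -s₁ < s →
      S.fieldX ε σ₀ ζ X₁ X₂ (t + S.a, s) = S.fieldX ε σ₀ ζ X₁ X₂ (t, s) := by
    intro t s hs
    have hXσ : S.Xσ σ₀ (t + S.a, s) = S.Xσ σ₀ (t, s) := by
      simp only [Xσ, αt_periodic hS.periodic, αs_periodic hS.periodic, n_periodic hS.periodic,
        rot_periodic hS.periodic]
    rcases lt_or_ge s (2 * ε) with h | h
    · have := hsub ⟨hs.le, (h.trans hεs).le⟩
      simp only [fieldX, hXσ, αt_periodic hS.periodic, hF.periodic₁ t s this, hF.periodic₂ t s this]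
    · rw [hζ0 h, hζ0 h, hXσ]
  have htX : ∀ t, ∀ s ∈ Icc (-ε) S.b₁, S.IsTangent (t, s) (S.fieldX ε σ₀ ζ X₁ X₂ (t, s)) := by
    intro t s hs
    rcases lt_or_ge s (2 * ε) with h | h
    · have := hsub ⟨by linarith [hs.1], (h.trans hεs).le⟩
      exact ((((hF.tangent₁ t s this).smul _).add (hF.tangent₂ t s this)).smul _).add
        ((htan (hR.gdet_pos t s hs)).smul _)
    · rw [hζ0 h]; exact htan (hR.gdet_pos t s hs)
  have hpos : ∀ t, ∀ s ∈ Icc (-ε) S.b₁, 0 < S.coordS (t, s) (S.fieldX ε σ₀ ζ X₁ X₂ (t, s)) := by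
    intro t s hs
    have hg := hR.gdet_pos t s hs
    have p2 := coordS_Xσ_pos (σ₀ := σ₀) hS hg
    rcases lt_or_ge s (2 * ε) with h | h
    · have hs' : s ∈ Icc (-s₁) s₁ := ⟨by linarith [hs.1], (h.trans hεs).le⟩
      obtain ⟨c1, c2⟩ := hF.coordS_ge hS s₁lt hb t hs'
      rw [hF.fieldX_eq hS s₁lt cpos hb t hs', ← Xσ_eq hS hg, coordS_add, coordS_smul, coordS_smul,
        coordS_add, coordS_smul]
      have p1 : 0 < S.τ * ε ^ (1 / 3 : ℝ) * S.coordS (t, s) (X₁ (t, s))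
          + S.coordS (t, s) (X₂ (t, s)) := by
        have he := Real.rpow_nonneg hε.le (1 / 3)
        have h1 : |S.τ * ε ^ (1 / 3 : ℝ) * S.coordS (t, s) (X₁ (t, s))| ≤ ε ^ (1 / 3 : ℝ) * N := by
          have : |S.τ| = 1 := by rcases hS.τ_sign with h | h <;> simp [h]
          rw [abs_mul, abs_mul, this, one_mul, abs_of_nonneg he]
          gcongr
        linarith [neg_le_of_abs_le h1]
      rcases (hζ.nonneg s).eq_or_lt with h0 | h0
      · rw [← h0]; simpa using p2
      · have := mul_pos h0 p1
        have := mul_nonneg (sub_nonneg.mpr (hζ.le_one s)) p2.le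
        linarith
    · rw [hζ0 h]; exact p2
  refine ⟨hR, by linarith [hS.b₁_pos], by linarith, ⟨fun t s hs => ?_, hper⟩, htX, hpos,
    fun t s hs => ?_, fun t s hs => hS.h11_pos t ⟨by linarith [hs.1, hF.δ_le₀], hs.2⟩⟩
  · have hg := hR.gdet_pos t s hs
    rcases lt_or_ge s s₁ with h | h
    · have hs' : s ∈ Ioo (-s₁) s₁ := ⟨by linarith [hs.1], h⟩
      have hd := hsub (Ioo_subset_Icc_self hs')
      have h1 : ContDiffAt ℝ 1 (fun y : ℝ² => 1 - ζ y.2) (t, s) := contDiffAt_const.sub hζc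
      have h2 : ContDiffAt ℝ 1 (fun y => (S.τ * ε ^ (1 / 3 : ℝ)) • X₁ y + X₂ y) (t, s) :=
        ((contDiffAt_const (c := S.τ * ε ^ (1 / 3 : ℝ))).smul (hF.contDiffAt₁ hd)).add
          (hF.contDiffAt₂ hd)
      refine ((hζc.smul h2).add (h1.smul (hσ hg))).congr_of_eventuallyEq ?_
      filter_upwards [eventually_snd_mem hs', eventually_gdet_pos hS.smooth hg] with y hy hgy
      refine (hF.fieldX_eq hS s₁lt cpos hb y.1 (Ioo_subset_Icc_self hy)).trans ?_
      rw [← Xσ_eq hS hgy]; rfl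
    · refine (hσ hg).congr_of_eventuallyEq ?_
      filter_upwards [eventually_snd_mem (d := s + 1) ⟨hεs.trans_le h, lt_add_one s⟩] with y hy
        using hζ0 hy.1.le
  · rcases le_or_gt s 0 with h | h
    · obtain ⟨t', ht', he⟩ := (show Function.Periodic (fun t => S.sff (t, s)
          (S.fieldX ε σ₀ ζ X₁ X₂ (t, s)) (S.fieldX ε σ₀ ζ X₁ X₂ (t, s))) S.a from fun t => by
        simp only [sff, shape_periodic hS.periodic, hper t s (by linarith [hs.1])]).exists_mem_Ico₀
          hS.a_pos t
      have hs' : s ∈ Icc (-s₁) s₁ := ⟨by linarith [hs.1], by linarith⟩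
      have hB := hb t' (Ico_subset_Icc_self ht') s hs'
      rw [he, hF.fieldX_eq hS s₁lt cpos hb t' hs', hζ1 ⟨hs.1, h⟩, sub_self, zero_smul, add_zero,
        one_smul, hF.sff_comb (hsub hs'), mul_pow, hS.isRegularStrip.τ_sq, one_mul]
      set e := ε ^ (1 / 3 : ℝ) with hedef
      have he0 : 0 < e := Real.rpow_pos_of_pos hε _
      have he3 : e ^ 3 = ε := by rw [hedef, ← Real.rpow_natCast, ← Real.rpow_mul hε.le]; norm_num
      have h2 : |s| ≤ e ^ 3 := by rw [he3, abs_of_nonpos h]; linarith [hs.1]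
      have hN0 : 0 ≤ N := (abs_nonneg _).trans hB.lam₁_le
      have h3 := neg_le_of_abs_le (hB.lam₂_le.trans (mul_le_mul_of_nonneg_left h2 hN0))
      have h4 := mul_le_mul_of_nonneg_left hB.lam₁_ge (sq_nonneg e)
      have h5 := mul_pos (sq_pos_of_pos he0) (sub_pos.mpr hεN)
      linarith
    · exact hS.sff_pos_of_pos ⟨h, hs.2⟩ (htX t s hs) (hpos t s hs).ne'

end IsPrincipalFrame

end ParamSurface

/-! ### The symmetric part near and away from the degenerate curve -/

namespace ParamSurface

variable {S : ParamSurface} {δ γ : ℝ} {X₁ X₂ X Y : ℝ² → E3} {lam₁ lam₂ η : ℝ² → ℝ} {t s : ℝ}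

theorem dT_const_comb {f g : ℝ² → ℝ} {x : ℝ²} (k l : ℝ) (hf : DifferentiableAt ℝ f x)
    (hg : DifferentiableAt ℝ g x) : dT (fun y => k * f y + l * g y) x = k * dT f x + l * dT g x := by
  rw [dT_add (hf.const_mul k) (hg.const_mul l), dT_const_mul k hf, dT_const_mul l hg]

theorem dS_const_comb {f g : ℝ² → ℝ} {x : ℝ²} (k l : ℝ) (hf : DifferentiableAt ℝ f x)
    (hg : DifferentiableAt ℝ g x) : dS (fun y => k * f y + l * g y) x = k * dS f x + l * dS g x := by
  rw [dS_add (hf.const_mul k) (hg.const_mul l), dS_const_mul k hf, dS_const_mul l hg]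

namespace IsPrincipalFrame

variable (hF : S.IsPrincipalFrame δ X₁ X₂ lam₁ lam₂)
include hF

theorem mulA_comb (hs : s ∈ Ioo (-δ) δ) {θ : ℝ} (hX : X (t, s) = θ • X₁ (t, s) + X₂ (t, s))
    (v₁ v₂ : ℝ) : S.mulA γ X (t, s) (v₁ • X₁ (t, s) + v₂ • X₂ (t, s))
      = (v₁ - θ * v₂) * S.wt γ (t, s) := by
  have h := hF.orthogonal t s hs
  have h' : inner ℝ (X₂ (t, s)) (X₁ (t, s)) = (0 : ℝ) := by rw [real_inner_comm, h]
  rw [mulA, hX, rot_add, rot_smul, hF.rot₁ t s hs, hF.rot₂ t s hs]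
  simp only [inner_add_left, inner_add_right, real_inner_smul_left, real_inner_smul_right,
    inner_neg_right, hF.inner₁ hs, hF.inner₂ hs, h, h']
  ring

theorem mulB_comb (hs : s ∈ Ioo (-δ) δ) {θ : ℝ} (hX : X (t, s) = θ • X₁ (t, s) + X₂ (t, s))
    (v₁ v₂ : ℝ) : S.mulB γ X (t, s) (v₁ • X₁ (t, s) + v₂ • X₂ (t, s))
      = S.wt γ (t, s) * (θ * v₁ * lam₁ (t, s) + v₂ * lam₂ (t, s)) := by
  have h := hF.orthogonal t s hs
  have h' : inner ℝ (X₂ (t, s)) (X₁ (t, s)) = (0 : ℝ) := by rw [real_inner_comm, h]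
  rw [mulB, hX, shape_add, shape_smul, hF.shape₁ t s hs, hF.shape₂ t s hs]
  simp only [inner_add_left, inner_add_right, real_inner_smul_left, real_inner_smul_right,
    hF.inner₁ hs, hF.inner₂ hs, h, h']
  ring

/-- The symmetric part of the adjoint operator where `X = θ X₁ + X₂`, in the principal frame. -/
theorem accForm_eq (hS : S.IsMixedType) (hs : s ∈ Ioo (-δ) δ) {θ : ℝ}
    (hX : X =ᶠ[𝓝 (t, s)] fun y => θ • X₁ y + X₂ y) (v₁ v₂ : ℝ) :
    S.accForm γ η X Y (fun y => v₁ • X₁ y + v₂ • X₂ y) (t, s) = S.wt γ (t, s) *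
      (((v₁ - θ * v₂) * (S.divP X₁ (t, s) * v₁ + S.divP X₂ (t, s) * v₂)
        + (θ * lam₁ (t, s) * v₁ + lam₂ (t, s) * v₂)
          * (S.divR X₁ (t, s) * v₁ + S.divR X₂ (t, s) * v₂)
        + γ * (v₁ - θ * v₂) * (-lam₁ (t, s) * v₁ * S.fluxD S.curv (t, s) (X₂ (t, s))
          + lam₂ (t, s) * v₂ * S.fluxD S.curv (t, s) (X₁ (t, s)))
        + γ * (θ * lam₁ (t, s) * v₁ + lam₂ (t, s) * v₂)
          * (v₁ * S.fluxD S.curv (t, s) (X₁ (t, s)) + v₂ * S.fluxD S.curv (t, s) (X₂ (t, s)))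
        - (θ * v₁ * (v₁ * S.fluxD lam₁ (t, s) (X₁ (t, s)) + v₂ * S.fluxD lam₁ (t, s) (X₂ (t, s)))
          + v₂ * (v₁ * S.fluxD lam₂ (t, s) (X₁ (t, s)) + v₂ * S.fluxD lam₂ (t, s) (X₂ (t, s))))) / 2
      + (v₁ - θ * v₂) * (v₁ * (S.rt (t, s) * inner ℝ (X₁ (t, s)) (Y (t, s)))
        + v₂ * (S.rt (t, s) * inner ℝ (X₂ (t, s)) (Y (t, s))))
      - S.rt (t, s) * η (t, s) * ((v₁ - θ * v₂) ^ 2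
        + (θ * lam₁ (t, s) * v₁ + lam₂ (t, s) * v₂) ^ 2)) := by
  have h := hS.smooth
  have hg := hF.gdet_pos hS hs (t := t)
  have hw := (wt_pos (S := S) (γ := γ) (t, s)).ne'
  have hmem : ∀ᶠ y : ℝ² in 𝓝 (t, s), y.2 ∈ Ioo (-δ) δ := eventually_snd_mem hs
  have eA : (fun y => S.mulA γ X y (v₁ • X₁ y + v₂ • X₂ y)) =ᶠ[𝓝 (t, s)]
      fun y => (v₁ - θ * v₂) * S.wt γ y := by
    filter_upwards [hX, hmem] with y hy hm using hF.mulA_comb (t := y.1) hm hy v₁ v₂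
  have eB : (fun y => S.mulB γ X y (v₁ • X₁ y + v₂ • X₂ y)) =ᶠ[𝓝 (t, s)]
      fun y => S.wt γ y * (θ * v₁ * lam₁ y + v₂ * lam₂ y) := by
    filter_upwards [hX, hmem] with y hy hm using hF.mulB_comb (t := y.1) hm hy v₁ v₂
  have hA := eA.eq_of_nhds
  have hB := eB.eq_of_nhds
  have iA : inner ℝ (v₁ • X₁ (t, s) + v₂ • X₂ (t, s)) (S.rot (t, s) (X (t, s))) = v₁ - θ * v₂ := by
    refine mul_left_cancel₀ hw ?_
    rw [← mul_comm (v₁ - θ * v₂), ← hA]; rfl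
  have iB : inner ℝ (v₁ • X₁ (t, s) + v₂ • X₂ (t, s)) (S.shape (t, s) (X (t, s)))
      = θ * v₁ * lam₁ (t, s) + v₂ * lam₂ (t, s) := mul_left_cancel₀ hw (by rw [← hB]; rfl)
  have iY : inner ℝ (v₁ • X₁ (t, s) + v₂ • X₂ (t, s)) (Y (t, s))
      = v₁ * inner ℝ (X₁ (t, s)) (Y (t, s)) + v₂ * inner ℝ (X₂ (t, s)) (Y (t, s)) := by
    rw [inner_add_left, real_inner_smul_left, real_inner_smul_left]
  have x1 := hF.contDiffAt₁ hs (t := t)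
  have x2 := hF.contDiffAt₂ hs (t := t)
  have m1 := (hF.contDiffAt_lam₁ hS hs (t := t)).differentiableAt one_ne_zero
  have m2 := (hF.contDiffAt_lam₂ hS hs (t := t)).differentiableAt one_ne_zero
  have dw := (contDiffAt_wt (γ := γ) h hg).differentiableAt one_ne_zero
  have dl : DifferentiableAt ℝ (fun y => θ * v₁ * lam₁ y + v₂ * lam₂ y) (t, s) :=
    (m1.const_mul (θ * v₁)).add (m2.const_mul v₂)
  have o : (1 : WithTop ℕ∞) ≠ 0 := one_ne_zero
  have P1T : S.fluxPT (t, s) (X₁ (t, s)) = -lam₁ (t, s) * S.fluxRT (t, s) (X₂ (t, s)) := by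
    rw [fluxPT, hF.shape₁ t s hs, rot_smul, hF.rot₁ t s hs, coordT_smul, coordT_neg, fluxRT]; ring
  have P1S : S.fluxPS (t, s) (X₁ (t, s)) = -lam₁ (t, s) * S.fluxRS (t, s) (X₂ (t, s)) := by
    rw [fluxPS, hF.shape₁ t s hs, rot_smul, hF.rot₁ t s hs, coordS_smul, coordS_neg, fluxRS]; ring
  have P2T : S.fluxPT (t, s) (X₂ (t, s)) = lam₂ (t, s) * S.fluxRT (t, s) (X₁ (t, s)) := by
    rw [fluxPT, hF.shape₂ t s hs, rot_smul, hF.rot₂ t s hs, coordT_smul, fluxRT]; ring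
  have P2S : S.fluxPS (t, s) (X₂ (t, s)) = lam₂ (t, s) * S.fluxRS (t, s) (X₁ (t, s)) := by
    rw [fluxPS, hF.shape₂ t s hs, rot_smul, hF.rot₂ t s hs, coordS_smul, fluxRS]; ring
  rw [accForm, accBil, eA.dT_eq, eA.dS_eq, eB.dT_eq, eB.dS_eq, dT_const_mul _ dw,
    dS_const_mul _ dw, dT_mul dw dl, dS_mul dw dl, dT_const_comb _ _ m1 m2,
    dS_const_comb _ _ m1 m2, dT_wt h hg, dS_wt h hg, hA, hB, inner_sub_right,
    real_inner_smul_right, iA, iB, iY]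
  simp only [fluxPT_add, fluxPS_add, fluxRT_add, fluxRS_add, fluxPT_smul, fluxPS_smul,
    fluxRT_smul, fluxRS_smul]
  rw [dT_const_comb _ _ ((contDiffAt_fluxPT h hg x1).differentiableAt o)
      ((contDiffAt_fluxPT h hg x2).differentiableAt o),
    dT_const_comb _ _ ((contDiffAt_fluxRT h hg x1).differentiableAt o)
      ((contDiffAt_fluxRT h hg x2).differentiableAt o),
    dS_const_comb _ _ ((contDiffAt_fluxPS h hg x1).differentiableAt o)
      ((contDiffAt_fluxPS h hg x2).differentiableAt o),
    dS_const_comb _ _ ((contDiffAt_fluxRS h hg x1).differentiableAt o)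
      ((contDiffAt_fluxRS h hg x2).differentiableAt o), P1T, P1S, P2T, P2S]
  simp only [divP, divR, fluxD]
  ring

end IsPrincipalFrame

namespace IsMultiplier

variable {c d r : ℝ}

/-- The two functions multiplying `div (Q ∇n V)` and `div V` determine the coefficients of a
field in the normalized basis, uniformly on the strip. -/
theorem exists_coeff_le (hX : S.IsMultiplier c d r X) : ∃ k, 0 < k ∧ ∀ t ∈ Ico 0 S.a,
    ∀ s ∈ Icc c d, ∀ ξ : Fin 2 → ℝ, ∀ w, w = ξ 0 • S.e γ X 0 (t, s) + ξ 1 • S.e γ X 1 (t, s) →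
      k * ∑ i, ξ i ^ 2 ≤ (S.mulA γ X (t, s) w ^ 2 + S.mulB γ X (t, s) w ^ 2) / S.wt γ (t, s) ∧
      k * ∑ i, ξ i ^ 2 ≤ S.rt (t, s)
        * ((S.mulA γ X (t, s) w ^ 2 + S.mulB γ X (t, s) w ^ 2) / S.wt γ (t, s)) := by
  have e (i) := hX.basis_isC1Near (γ := γ) i
  have A1 := hX.mulA_isC1Near (γ := γ) (e 1)
  have B0 := hX.mulB_isC1Near (γ := γ) (e 0)
  have B1 := hX.mulB_isC1Near (γ := γ) (e 1)
  have a1 {t s} (hs : s ∈ Icc c d) := hX.mulA_basis_one_ne (γ := γ) hs (t := t)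
  have b0 {t s} (hs : s ∈ Icc c d) := hX.mulB_basis_zero_ne (γ := γ) hs (t := t)
  obtain ⟨N, hN1, hN⟩ := exists_bound_family (a := S.a) (c := c) (d := d)
    (f := ![S.wt γ, fun x => (S.rt x)⁻¹, fun x => (S.mulA γ X x (S.e γ X 1 x))⁻¹,
      fun x => (S.mulB γ X x (S.e γ X 0 x))⁻¹, fun x => S.mulB γ X x (S.e γ X 1 x)]) (by
    simp only [Fin.forall_fin_succ, Matrix.cons_val_zero, Matrix.cons_val_succ]
    exact ⟨hX.wt_isC1Near.continuousOn, (hX.strip.rt.inv (r := r) fun t s hs =>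
      (rt_pos (hX.strip.gdet_pos t s hs)).ne').continuousOn,
      (A1.inv fun t s hs => a1 hs).continuousOn, (B0.inv fun t s hs => b0 hs).continuousOn,
      B1.continuousOn, fun i => i.elim0⟩)
  simp only [Fin.forall_fin_succ, Matrix.cons_val_zero, Matrix.cons_val_succ] at hN
  obtain ⟨hN0, hNr, hNA, hNB0, hNB1, -⟩ := hN
  have N0 : 0 < N := by linarith
  have NN : 1 ≤ N ^ 6 := one_le_pow₀ hN1
  refine ⟨(4 * N ^ 6 * N * N)⁻¹, by positivity, fun t ht s hs ξ w hw => ?_⟩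
  have ht' := Ico_subset_Icc_self ht
  have hwt := wt_pos (S := S) (γ := γ) (t, s)
  have hrt := rt_pos (hX.strip.gdet_pos t s hs)
  have eA : S.mulA γ X (t, s) w = ξ 1 * S.mulA γ X (t, s) (S.e γ X 1 (t, s)) := by
    rw [hw, mulA_add, mulA_smul, mulA_smul, mulA_basis_zero]; ring
  have eB : S.mulB γ X (t, s) w = ξ 0 * S.mulB γ X (t, s) (S.e γ X 0 (t, s))
      + ξ 1 * S.mulB γ X (t, s) (S.e γ X 1 (t, s)) := by
    rw [hw, mulB_add, mulB_smul, mulB_smul]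
  have q1 := hNA t ht' s hs
  have q2 := hNB0 t ht' s hs
  have q3 := hNB1 t ht' s hs
  have a1' := a1 hs (t := t)
  have b0' := b0 hs (t := t)
  set A := S.mulA γ X (t, s) w
  set B := S.mulB γ X (t, s) w
  set α₁ := S.mulA γ X (t, s) (S.e γ X 1 (t, s))
  set β₀ := S.mulB γ X (t, s) (S.e γ X 0 (t, s))
  set β₁ := S.mulB γ X (t, s) (S.e γ X 1 (t, s))
  have x1 : ξ 1 = A * α₁⁻¹ := by rw [eA]; field_simp
  have x0 : ξ 0 = (B - ξ 1 * β₁) * β₀⁻¹ := by rw [eB]; field_simp; ring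
  have sq {z : ℝ} (h : |z| ≤ N) : z ^ 2 ≤ N ^ 2 := by rw [← sq_abs]; gcongr
  have y1 : ξ 1 ^ 2 ≤ A ^ 2 * N ^ 2 := by
    rw [x1, mul_pow]; exact mul_le_mul_of_nonneg_left (sq q1) (sq_nonneg _)
  have y0 : ξ 0 ^ 2 ≤ (2 * B ^ 2 + 2 * (A ^ 2 * N ^ 2 * N ^ 2)) * N ^ 2 := by
    rw [x0, mul_pow]
    have h1 : (B - ξ 1 * β₁) ^ 2 ≤ 2 * B ^ 2 + 2 * (A ^ 2 * N ^ 2 * N ^ 2) := by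
      have : ξ 1 ^ 2 * β₁ ^ 2 ≤ A ^ 2 * N ^ 2 * N ^ 2 :=
        mul_le_mul y1 (sq q3) (sq_nonneg _) (by positivity)
      nlinarith only [this, sq_nonneg (B + ξ 1 * β₁)]
    exact mul_le_mul h1 (sq q2) (sq_nonneg _) (by positivity)
  have N2 : N ^ 2 ≤ N ^ 6 := pow_le_pow_right₀ hN1 (by norm_num)
  have key : ∑ i, ξ i ^ 2 ≤ 4 * N ^ 6 * (A ^ 2 + B ^ 2) := by
    rw [Fin.sum_univ_two]
    have h1 := mul_le_mul_of_nonneg_left N2 (sq_nonneg A)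
    have h2 := mul_le_mul_of_nonneg_left N2 (sq_nonneg B)
    have h3 : 0 ≤ N ^ 6 * A ^ 2 := by positivity
    have h4 : 0 ≤ N ^ 6 * B ^ 2 := by positivity
    nlinarith only [y1, y0, h1, h2, h3, h4]
  have hwN : S.wt γ (t, s) ≤ N := (le_abs_self _).trans (hN0 t ht' s hs)
  have hrN : 1 ≤ S.rt (t, s) * N := by
    have := (le_abs_self _).trans (hNr t ht' s hs)
    rw [inv_le_iff_one_le_mul₀ hrt] at this; linarith
  have D0 : 0 ≤ A ^ 2 + B ^ 2 := by positivity
  have k1 : (4 * N ^ 6 * N * N)⁻¹ * ∑ i, ξ i ^ 2 ≤ (A ^ 2 + B ^ 2) / (N * N) := by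
    rw [inv_mul_le_iff₀ (by positivity)]
    refine key.trans_eq ?_
    field_simp
  have k2 : (A ^ 2 + B ^ 2) / N ≤ (A ^ 2 + B ^ 2) / S.wt γ (t, s) := by gcongr
  refine ⟨k1.trans (le_trans ?_ k2), k1.trans ?_⟩
  · gcongr; nlinarith only [hN1]
  · calc (A ^ 2 + B ^ 2) / (N * N) ≤ S.rt (t, s) * N * ((A ^ 2 + B ^ 2) / (N * N)) :=
        le_mul_of_one_le_left (by positivity) hrN
      _ = S.rt (t, s) * ((A ^ 2 + B ^ 2) / N) := by field_simp
      _ ≤ _ := mul_le_mul_of_nonneg_left k2 hrt.le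

theorem accForm_eta (w : ℝ² → E3) (x : ℝ²) : S.accForm γ η X Y w x = S.accForm γ 0 X Y w x
      - η x * (S.rt x * ((S.mulA γ X x (w x) ^ 2 + S.mulB γ X x (w x) ^ 2) / S.wt γ x)) := by
  have := (wt_pos (S := S) (γ := γ) x).ne'
  simp only [accForm, accBil, inner_sub_right, real_inner_smul_right, Pi.zero_apply]
  have e1 : inner ℝ (w x) (S.rot x (X x)) = S.mulA γ X x (w x) / S.wt γ x := by
    rw [mulA]; field_simp
  have e2 : inner ℝ (w x) (S.shape x (X x)) = S.mulB γ X x (w x) / S.wt γ x := by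
    rw [mulB]; field_simp
  rw [e1, e2]; ring

/-- A large multiple of `η` makes the symmetric part negative definite. -/
theorem exists_accForm_le (hX : S.IsMultiplier c d r X) (hY : ContinuousOn Y (univ ×ˢ Icc c d)) :
    ∃ m₀, 0 < m₀ ∧ ∀ η : ℝ² → ℝ, ∀ t ∈ Ico 0 S.a, ∀ s ∈ Ioo c d, m₀ ≤ η (t, s) → ∀ ξ : Fin 2 → ℝ,
      S.accForm γ η X Y (fun y => ξ 0 • S.e γ X 0 y + ξ 1 • S.e γ X 1 y) (t, s)
        ≤ -1 * ∑ i, ξ i ^ 2 := by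
  obtain ⟨k, k0, hk⟩ := hX.exists_coeff_le (γ := γ)
  have hE (i j) : ContinuousOn (fun x => S.coeffE γ 0 X Y i j x + dT (S.coeffM γ X i j) x / 2)
      (univ ×ˢ Icc c d) :=
    (hX.continuousOn_adjPair (hX.mulA_isC1Near (hX.basis_isC1Near j))
      (hX.mulB_isC1Near (hX.basis_isC1Near j)) (hX.basis_isC1Near i) continuous_zero hY).add
      ((hX.coeffM_isC1Near i j).continuousOn_dT.div_const 2)
  -- a bound for the form without `η`, to be dominated by the terms with `η`
  obtain ⟨N, hN0, hN⟩ := exists_bound_strip (a := S.a)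
    (continuousOn_pi.mpr fun i => continuousOn_pi.mpr fun j => hE i j)
  refine ⟨(2 * N + 1) / k, by positivity, fun η t ht s hs hη ξ => ?_⟩
  have hsc := Ioo_subset_Icc_self hs
  have h1 := (hk t ht s hsc ξ _ rfl).2
  rw [accForm_eta, ← hX.accForm_eq_sum hs]
  have h2 : ∑ i, ∑ j, ((S.system γ 0 X Y c d).E i j (t, s)
      + (S.system γ 0 X Y c d).Mt i j (t, s) / 2) * (ξ i * ξ j) ≤ 2 * N * ∑ i, ξ i ^ 2 := by
    have hb (i j) : ((S.system γ 0 X Y c d).E i j (t, s)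
        + (S.system γ 0 X Y c d).Mt i j (t, s) / 2) * (ξ i * ξ j)
        ≤ N * ((ξ i ^ 2 + ξ j ^ 2) / 2) := by
      refine mul_le_mul_of_abs_le ?_ ?_
      · simp only [system, clamp_of_mem hsc]
        exact ((norm_le_pi_norm (fun j => S.coeffE γ 0 X Y i j (t, s)
          + dT (S.coeffM γ X i j) (t, s) / 2) j).trans (norm_le_pi_norm (fun i j =>
            S.coeffE γ 0 X Y i j (t, s) + dT (S.coeffM γ X i j) (t, s) / 2) i)).trans
              (hN t ht s hsc)
      · rw [abs_le]; constructor <;> nlinarith only [sq_nonneg (ξ i + ξ j), sq_nonneg (ξ i - ξ j)]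
    refine (Finset.sum_le_sum fun i _ => Finset.sum_le_sum fun j _ => hb i j).trans_eq ?_
    simp only [Fin.sum_univ_two]; ring
  have h3 : 0 ≤ ∑ i, ξ i ^ 2 := Finset.sum_nonneg fun i _ => sq_nonneg _
  have h4 := mul_le_mul hη h1 (by positivity) ((by positivity : 0 ≤ (2 * N + 1) / k).trans hη)
  have h5 : (2 * N + 1) / k * (k * ∑ i, ξ i ^ 2) = (2 * N + 1) * ∑ i, ξ i ^ 2 := by field_simp
  linarith

end IsMultiplier

end ParamSurface

/-! ### Accretivity for the field `X` -/

namespace ParamSurface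

variable {S : ParamSurface} {δ s₁ N c ε σ₀ γ K : ℝ} {X₁ X₂ X Y : ℝ² → E3}
  {lam₁ lam₂ η : ℝ² → ℝ} {ζ η₀ : ℝ → ℝ} {t s : ℝ}

theorem IsTangent.eq_comb_of_orthonormal {x : ℝ²} (hτ : S.τ ^ 2 = 1) (hg : 0 < S.gdet x)
    {v e f : E3} (hv : S.IsTangent x v) (he : S.IsTangent x e) (hf : S.IsTangent x f)
    (hee : inner ℝ e e = (1 : ℝ)) (hff : inner ℝ f f = (1 : ℝ)) (h : inner ℝ e f = (0 : ℝ))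
    (hre : S.rot x e = -f) (hrf : S.rot x f = e) :
    v = (inner ℝ v e : ℝ) • e + (inner ℝ v f : ℝ) • f := by
  have h' : inner ℝ f e = (0 : ℝ) := by rw [real_inner_comm, h]
  rw [← sub_eq_zero]
  set u := v - ((inner ℝ v e : ℝ) • e + (inner ℝ v f : ℝ) • f) with hu
  have hut : S.IsTangent x u := hv.sub ((he.smul _).add (hf.smul _))
  have u1 : inner ℝ u (S.rot x f) = (0 : ℝ) := by
    rw [hrf, hu, inner_sub_left, inner_add_left, real_inner_smul_left, real_inner_smul_left, hee,
      h']
    ring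
  have u2 : inner ℝ u (S.rot x e) = (0 : ℝ) := by
    rw [hre, inner_neg_right, hu, inner_sub_left, inner_add_left, real_inner_smul_left,
      real_inner_smul_left, hff, h]
    ring
  have u3 : inner ℝ e (S.rot x f) = (1 : ℝ) := by rw [hrf, hee]
  rw [inner_rot_eq hg] at u1 u2 u3
  rw [hut.eq_coord hτ hg]
  have c1 : S.coordT x u = 0 := by
    linear_combination (-S.coordT x u) * u3 + S.coordT x e * u1 - S.coordT x f * u2
  have c2 : S.coordS x u = 0 := by
    linear_combination (-S.coordS x u) * u3 + S.coordS x e * u1 - S.coordS x f * u2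
  rw [c1, c2]; simp

namespace IsPrincipalFrame

variable (hF : S.IsPrincipalFrame δ X₁ X₂ lam₁ lam₂) (hS : S.IsMixedType)
include hF hS

theorem eq_comb (hs : s ∈ Ioo (-δ) δ) {v : E3} (hv : S.IsTangent (t, s) v) :
    v = (inner ℝ v (X₁ (t, s)) : ℝ) • X₁ (t, s) + (inner ℝ v (X₂ (t, s)) : ℝ) • X₂ (t, s) :=
  hv.eq_comb_of_orthonormal hS.isRegularStrip.τ_sq (hF.gdet_pos hS hs) (hF.tangent₁ t s hs)
    (hF.tangent₂ t s hs) (hF.inner₁ hs) (hF.inner₂ hs) (hF.orthogonal t s hs) (hF.rot₁ t s hs)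
    (hF.rot₂ t s hs)

/-- Near the curve `s = 0` the symmetric part of the adjoint operator is negative definite. -/
theorem accForm_le (hs : s ∈ Ioo (-δ) δ) (hb : S.FrameBounds X₁ X₂ lam₁ lam₂ N c (t, s))
    (hN : 1 ≤ N) (hc : 0 < c) (hγ : 0 ≤ γ) {M : ℝ} (hM : M = N * (1 + |K|))
    (hγM : 3 / 2 * M + 49 / 4 * M ^ 2 / c + c / 4 ≤ γ * c / 2) {θ : ℝ}
    (hθ : |θ| * (64 * M ^ 2 * (1 + γ)) ≤ c) (hθ₁ : |θ| ≤ 1) (hsθ : |s| ≤ |θ|)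
    (hX : X =ᶠ[𝓝 (t, s)] fun y => θ • X₁ y + X₂ y) (hY : ‖Y (t, s)‖ ≤ K) (hη : 0 ≤ η (t, s))
    {w : ℝ² → E3} (hw : ContDiffAt ℝ 1 w (t, s)) (ht : ∀ᶠ y in 𝓝 (t, s), S.IsTangent y (w y)) :
    S.accForm γ η X Y w (t, s) ≤ -(c / (144 * M ^ 2))
      * ((S.mulA γ X (t, s) (w (t, s)) ^ 2 + S.mulB γ X (t, s) (w (t, s)) ^ 2) / S.wt γ (t, s)) := by
  have hg := hF.gdet_pos hS hs (t := t)
  have hwt := wt_pos (S := S) (γ := γ) (t, s)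
  have x1 := hF.contDiffAt₁ hs (t := t)
  have x2 := hF.contDiffAt₂ hs (t := t)
  have he := hF.eq_comb hS hs ht.self_of_nhds
  set v₁ : ℝ := inner ℝ (w (t, s)) (X₁ (t, s))
  set v₂ : ℝ := inner ℝ (w (t, s)) (X₂ (t, s))
  have hK := abs_nonneg K
  have hNM : N ≤ M := by rw [hM]; nlinarith
  have hM1 : 1 ≤ M := hN.trans hNM
  have hXc : ContDiffAt ℝ 1 X (t, s) := by
    have : ContDiffAt ℝ 1 (fun y => θ • X₁ y + X₂ y) (t, s) :=
      ((contDiffAt_const (c := θ)).smul x1).add x2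
    exact this.congr_of_eventuallyEq hX
  have hw' : ContDiffAt ℝ 1 (fun y => v₁ • X₁ y + v₂ • X₂ y) (t, s) :=
    ((contDiffAt_const (c := v₁)).smul x1).add ((contDiffAt_const (c := v₂)).smul x2)
  have ht' : ∀ᶠ y in 𝓝 (t, s), S.IsTangent y (v₁ • X₁ y + v₂ • X₂ y) := by
    filter_upwards [eventually_snd_mem (t := t) hs] with y hy
    exact ((hF.tangent₁ y.1 y.2 hy).smul _).add ((hF.tangent₂ y.1 y.2 hy).smul _)
  have hYb (V : E3) (hV : ‖V‖ = 1) : |S.rt (t, s) * inner ℝ V (Y (t, s))| ≤ M := by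
    rw [abs_mul, hM]
    have h1 : |inner ℝ V (Y (t, s))| ≤ 1 + |K| := by
      refine (abs_real_inner_le_norm _ _).trans ?_
      rw [hV, one_mul]; linarith [le_abs_self K]
    exact mul_le_mul hb.rt_le h1 (abs_nonneg _) (by linarith)
  have hl₂ : |lam₂ (t, s)| ≤ M * |θ| :=
    hb.lam₂_le.trans (mul_le_mul hNM hsθ (abs_nonneg _) (by linarith))
  have key := frame_form_le hM1 hc hγ hγM hθ hθ₁ (hb.lam₁_le.trans hNM) hl₂
    (hb.divP₁.trans hNM) (hb.divP₂.trans hNM) (hb.divR₁.trans hNM) (hb.divR₂.trans hNM)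
    (hb.curv₁.trans hNM) (hb.curv₂.trans hNM) (hb.lam₁₁.trans hNM) (hb.lam₁₂.trans hNM)
    (hb.lam₂₁.trans hNM) hb.lam₂_ge hb.curv_ge (hYb _ (hF.norm₁ t s hs)) (hYb _ (hF.norm₂ t s hs))
    (mul_nonneg (rt_pos hg).le hη) v₁ v₂
  rw [accForm_congr hS.isRegularStrip.τ_sq hS.smooth hg hXc hw hw' ht ht' he,
    hF.accForm_eq hS hs hX]
  refine (mul_le_mul_of_nonneg_left key hwt.le).trans ?_
  have hX0 := hX.self_of_nhds
  rw [he, hF.mulA_comb hs hX0, hF.mulB_comb hs hX0]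
  set l₁ := lam₁ (t, s)
  set l₂ := lam₂ (t, s)
  set z := S.wt γ (t, s)
  have e1 : (((v₁ - θ * v₂) * z) ^ 2 + (z * (θ * v₁ * l₁ + v₂ * l₂)) ^ 2) / z
      = z * ((v₁ - θ * v₂) ^ 2 + (θ * l₁ * v₁ + l₂ * v₂) ^ 2) := by field_simp
  rw [e1]
  have b1 : |v₁ - θ * v₂| ≤ M * (|v₁| + |v₂|) := by
    have := abs_mul_add_mul_le (p := 1) (q := -θ) (N := M) (by simpa using hM1)
      (by rw [abs_neg]; linarith) (le_refl |v₁|) (le_refl |v₂|)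
    rwa [one_mul, neg_mul, ← sub_eq_add_neg] at this
  have b2 : |θ * l₁ * v₁ + l₂ * v₂| ≤ M * (|v₁| + |v₂|) := by
    refine abs_mul_add_mul_le ?_ (hl₂.trans (mul_le_of_le_one_right (by linarith) hθ₁)) le_rfl le_rfl
    rw [abs_mul]
    exact (mul_le_of_le_one_left (abs_nonneg _) hθ₁).trans (hb.lam₁_le.trans hNM)
  have b3 : (v₁ - θ * v₂) ^ 2 + (θ * l₁ * v₁ + l₂ * v₂) ^ 2 ≤ 6 * M ^ 2 * (v₁ ^ 2 + v₂ ^ 2) := by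
    have c1 := pow_le_pow_left₀ (abs_nonneg _) b1 2
    have c2 := pow_le_pow_left₀ (abs_nonneg _) b2 2
    rw [sq_abs] at c1 c2
    have c3 : (M * (|v₁| + |v₂|)) ^ 2 ≤ M ^ 2 * (2 * (v₁ ^ 2 + v₂ ^ 2)) := by
      rw [mul_pow, ← sq_abs v₁, ← sq_abs v₂]
      exact mul_le_mul_of_nonneg_left (by nlinarith only [sq_nonneg (|v₁| - |v₂|)]) (sq_nonneg M)
    have c4 : 0 ≤ M ^ 2 * (v₁ ^ 2 + v₂ ^ 2) := by positivity
    linarith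
  have b4 := mul_le_mul_of_nonneg_left b3 (by positivity : 0 ≤ z * (c / (144 * M ^ 2)))
  have e2 : z * (c / (144 * M ^ 2)) * (6 * M ^ 2 * (v₁ ^ 2 + v₂ ^ 2))
      = z * (c / 24) * (v₁ ^ 2 + v₂ ^ 2) := by field_simp; ring
  rw [e2] at b4
  linarith

variable (s₁lt : s₁ < δ) (cpos : 0 < c) (hN : 1 ≤ N)
  (hb : ∀ t ∈ Icc 0 S.a, ∀ s ∈ Icc (-s₁) s₁, S.FrameBounds X₁ X₂ lam₁ lam₂ N c (t, s))
include s₁lt cpos hN hb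

theorem exists_isAccretive (hγ : 0 ≤ γ) {M : ℝ} (hM : M = N * (1 + |K|))
    (hγM : 3 / 2 * M + 49 / 4 * M ^ 2 / c + c / 4 ≤ γ * c / 2) (hε : 0 < ε) (hεs : 2 * ε < s₁)
    (hε₁ : ε ^ (1 / 3 : ℝ) ≤ 1) (hεM : ε ^ (1 / 3 : ℝ) * (64 * M ^ 2 * (1 + γ)) ≤ c)
    (hζ : IsCutoffζ ε ζ) (hη₀ : S.IsCutoffη ε η₀)
    (hX : S.IsMultiplier (-ε) S.b₁ (-s₁) (S.fieldX ε σ₀ ζ X₁ X₂)) (hY : S.IsC0Field ε Y)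
    (hYK : ∀ t, ∀ s ∈ Icc (-ε) S.b₁, ‖Y (t, s)‖ ≤ K) :
    ∃ m₀ > 0, ∀ m ≥ m₀, ∃ c₀, (S.system γ (fun x => m * η₀ x.2) (S.fieldX ε σ₀ ζ X₁ X₂) Y
      (-ε) S.b₁).IsAccretive S.a (-ε) S.b₁ c₀ := by
  obtain ⟨m₀, m₀pos, hm₀⟩ := hX.exists_accForm_le (γ := γ) hY.1
  obtain ⟨k, kpos, hk⟩ := hX.exists_coeff_le (γ := γ)
  have hM1 : 1 ≤ M := by rw [hM]; nlinarith [abs_nonneg K]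
  have c₁pos : 0 < c / (144 * M ^ 2) * k := by positivity
  refine ⟨m₀, m₀pos, fun m hm => ⟨min 1 (c / (144 * M ^ 2) * k), hX.isAccretive
    (continuous_const.mul (hη₀.smooth.continuous.comp continuous_snd)) hY.1
    (lt_min one_pos c₁pos) fun t ht s hs ξ => ?_⟩⟩
  have hsum : 0 ≤ ∑ i, ξ i ^ 2 := Finset.sum_nonneg fun i _ => sq_nonneg _
  have hsc := Ioo_subset_Icc_self hs
  rcases lt_or_ge s ε with h | h
  · have hs' : s ∈ Icc (-s₁) s₁ := ⟨by linarith [hs.1], by linarith⟩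
    have hsδ : s ∈ Ioo (-δ) δ := ⟨by linarith [hs'.1], by linarith [hs'.2]⟩
    have he0 := Real.rpow_nonneg hε.le (1 / 3)
    have hθ : |S.τ * ε ^ (1 / 3 : ℝ)| = ε ^ (1 / 3 : ℝ) := by
      have : |S.τ| = 1 := by rcases hS.τ_sign with h | h <;> simp [h]
      rw [abs_mul, this, one_mul, abs_of_nonneg he0]
    -- `λ₂` vanishes for `s = 0`, so this makes it as small as `θ`
    have hsε : |s| ≤ |S.τ * ε ^ (1 / 3 : ℝ)| := by
      have h1 : ε ≤ ε ^ (1 / 3 : ℝ) := by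
        conv_lhs => rw [← Real.rpow_one ε]
        refine Real.rpow_le_rpow_of_exponent_ge hε ?_ (by norm_num)
        by_contra! h1
        exact absurd hε₁ (not_le.mpr (Real.one_lt_rpow h1 (by norm_num)))
      rw [hθ]
      exact (abs_le.mpr ⟨by linarith [hs.1], h.le⟩).trans h1
    have hXe : S.fieldX ε σ₀ ζ X₁ X₂ =ᶠ[𝓝 (t, s)]
        fun y => (S.τ * ε ^ (1 / 3 : ℝ)) • X₁ y + X₂ y := by
      filter_upwards [eventually_snd_mem (t := t) (⟨hs.1, h⟩ : s ∈ Ioo (-ε) ε)] with y hy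
      refine (hF.fieldX_eq hS s₁lt cpos hb y.1 ⟨by linarith [hy.1], by linarith [hy.2]⟩).trans ?_
      rw [hζ.eq_one y.2 hy]; simp
    have hbas (i) := (hX.basis_isC1Near (γ := γ) i).contDiffAt t s hsc
    have hw : ContDiffAt ℝ 1 (fun y => ξ 0 • S.e γ (S.fieldX ε σ₀ ζ X₁ X₂) 0 y
        + ξ 1 • S.e γ (S.fieldX ε σ₀ ζ X₁ X₂) 1 y) (t, s) :=
      ((contDiffAt_const (c := ξ 0)).smul (hbas 0)).add
        ((contDiffAt_const (c := ξ 1)).smul (hbas 1))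
    have htan : ∀ᶠ y in 𝓝 (t, s), S.IsTangent y (ξ 0 • S.e γ (S.fieldX ε σ₀ ζ X₁ X₂) 0 y
        + ξ 1 • S.e γ (S.fieldX ε σ₀ ζ X₁ X₂) 1 y) := by
      filter_upwards [eventually_snd_mem (t := t) hs] with y hy
      have hy' := Ioo_subset_Icc_self hy
      exact ((hX.basis_isTangent (t := y.1) 0 hy').smul _).add
        ((hX.basis_isTangent (t := y.1) 1 hy').smul _)
    have key := hF.accForm_le (η := fun x => m * η₀ x.2) hS hsδ
      (hb t (Ico_subset_Icc_self ht) s hs') hN cpos hγ hM hγM (by rwa [hθ]) (by rwa [hθ]) hsε hXe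
      (hYK t s hsc) (mul_nonneg (m₀pos.le.trans hm) (hη₀.nonneg _)) hw htan
    refine key.trans ?_
    have h1 := mul_le_mul_of_nonneg_left (hk t ht s hsc ξ _ rfl).1
      (by positivity : 0 ≤ c / (144 * M ^ 2))
    have h2 := mul_le_mul_of_nonneg_right (min_le_right 1 (c / (144 * M ^ 2) * k)) hsum
    linarith
  -- where `s ≥ ε` the function `η` is the constant `m`
  · have hη : m₀ ≤ m * η₀ s := by rw [hη₀.eq_one s ⟨h, hs.2.le⟩, mul_one]; exact hm
    refine (hm₀ (fun x => m * η₀ x.2) t ht s hs hη ξ).trans ?_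
    have h2 := mul_le_mul_of_nonneg_right (min_le_left 1 (c / (144 * M ^ 2) * k)) hsum
    linarith

end IsPrincipalFrame

end ParamSurface

/-! ### Principal curvatures -/

namespace ParamSurface

/-- The unit tangent vector of the curves `s = const`. -/
def eT (S : ParamSurface) (x : ℝ²) : E3 := (√(inner ℝ (S.αt x) (S.αt x)))⁻¹ • S.αt x

/-- The unit tangent vector of the surface obtained by rotating `eT`. -/
def eN (S : ParamSurface) (x : ℝ²) : E3 := S.rot x (S.eT x)

/-- The mean curvature. -/
def meanCurv (S : ParamSurface) (x : ℝ²) : ℝ :=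
  (inner ℝ (S.eT x) (S.shape x (S.eT x)) + inner ℝ (S.eN x) (S.shape x (S.eN x))) / 2

/-- The discriminant `H² - κ` of the characteristic polynomial of `∇n`. -/
def disc (S : ParamSurface) (x : ℝ²) : ℝ := S.meanCurv x ^ 2 - S.curv x

/-- The larger principal curvature. -/
def kMax (S : ParamSurface) (x : ℝ²) : ℝ := S.meanCurv x + √(S.disc x)

/-- The smaller principal curvature. -/
def kMin (S : ParamSurface) (x : ℝ²) : ℝ := S.meanCurv x - √(S.disc x)

/-- A principal vector for the larger principal curvature, by the theorem of Cayley and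
Hamilton. -/
def eigZ (S : ParamSurface) (x : ℝ²) : E3 := S.shape x (S.eT x) - S.kMin x • S.eT x

variable {S : ParamSurface} {x : ℝ²}

theorem inner_rot_rot (hτ : S.τ ^ 2 = 1) (hg : 0 < S.gdet x) {v : E3} (hv : S.IsTangent x v) :
    inner ℝ (S.rot x v) (S.rot x v) = (inner ℝ v v : ℝ) := by
  rw [inner_rot_comm hg, rot_rot hτ hg hv, inner_neg_left, neg_neg]

theorem inner_rot_self (hg : 0 < S.gdet x) (v : E3) : inner ℝ (S.rot x v) v = (0 : ℝ) := by
  rw [real_inner_comm, inner_rot_eq hg]; ring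

theorem isTangent_eT (x) : S.IsTangent x (S.eT x) := (isTangent_αt x).smul _

theorem isTangent_eN (x) : S.IsTangent x (S.eN x) := isTangent_rot x _

theorem inner_αt_self_pos (hg : 0 < S.gdet x) : 0 < inner ℝ (S.αt x) (S.αt x) := by
  rw [real_inner_self_eq_norm_sq]; have := norm_αt_pos hg; positivity

theorem inner_eT (hg : 0 < S.gdet x) : inner ℝ (S.eT x) (S.eT x) = (1 : ℝ) := by
  have h := inner_αt_self_pos hg
  have h2 := Real.sq_sqrt h.le
  have h3 := (Real.sqrt_pos.mpr h).ne'
  rw [eT, real_inner_smul_left, real_inner_smul_right]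
  field_simp
  linarith

theorem rot_eN (hτ : S.τ ^ 2 = 1) (hg : 0 < S.gdet x) : S.rot x (S.eN x) = -S.eT x :=
  rot_rot hτ hg (isTangent_eT x)

section algebra

theorem kMax_mul_kMin (hd : 0 ≤ S.disc x) : S.kMax x * S.kMin x = S.curv x := by
  have := Real.sq_sqrt hd
  rw [kMax, kMin]; rw [disc] at *; linear_combination -this

theorem kMax_eq : S.kMax x = inner ℝ (S.eT x) (S.shape x (S.eT x))
    + inner ℝ (S.eN x) (S.shape x (S.eN x)) - S.kMin x := by
  rw [kMax, kMin, meanCurv]; ring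

variable (hτ : S.τ ^ 2 = 1) (hg : 0 < S.gdet x)
include hτ hg

theorem eq_comb_eN_eT {v : E3} (hv : S.IsTangent x v) :
    v = (inner ℝ v (S.eN x) : ℝ) • S.eN x + (inner ℝ v (S.eT x) : ℝ) • S.eT x :=
  hv.eq_comb_of_orthonormal hτ hg (isTangent_eN x) (isTangent_eT x)
    ((inner_rot_rot hτ hg (isTangent_eT x)).trans (inner_eT hg)) (inner_eT hg)
    (inner_rot_self hg _) (rot_eN hτ hg) rfl

variable (h : ContDiff ℝ 3 S.α)
include h

theorem shape_eT : S.shape x (S.eT x) = (inner ℝ (S.eN x) (S.shape x (S.eT x)) : ℝ) • S.eN x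
    + (inner ℝ (S.eT x) (S.shape x (S.eT x)) : ℝ) • S.eT x := by
  conv_lhs => rw [eq_comb_eN_eT hτ hg (isTangent_shape hτ h hg (S.eT x))]
  rw [real_inner_comm (S.eN x), real_inner_comm (S.eT x)]

theorem shape_eN : S.shape x (S.eN x) = (inner ℝ (S.eN x) (S.shape x (S.eN x)) : ℝ) • S.eN x
    + (inner ℝ (S.eN x) (S.shape x (S.eT x)) : ℝ) • S.eT x := by
  conv_lhs => rw [eq_comb_eN_eT hτ hg (isTangent_shape hτ h hg (S.eN x))]
  rw [real_inner_comm (S.eN x), inner_shape_comm hτ h hg (isTangent_eT x) (isTangent_eN x)]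

theorem curv_eq_det : S.curv x = inner ℝ (S.eT x) (S.shape x (S.eT x))
    * inner ℝ (S.eN x) (S.shape x (S.eN x)) - (inner ℝ (S.eN x) (S.shape x (S.eT x)) : ℝ) ^ 2 := by
  have hN := inner_αt_self_pos hg
  have h2 := Real.sq_sqrt hN.le
  have h3 := (Real.sqrt_pos.mpr hN).ne'
  have hq := coordS_rot hg (S.eT x)
  have e1 : S.coordT x (S.eT x) = (√(inner ℝ (S.αt x) (S.αt x)))⁻¹ := by
    rw [eT, coordT_smul, coordT_αt hg, mul_one]
  have e2 : S.coordS x (S.eT x) = 0 := by rw [eT, coordS_smul, coordS_αt, mul_zero]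
  have e3 : inner ℝ (S.eT x) (S.αt x) = √(inner ℝ (S.αt x) (S.αt x)) := by
    rw [eT, real_inner_smul_left]; nth_rw 2 [← h2]; field_simp
  rw [e3] at hq
  rw [inner_shape_eq hτ h hg (isTangent_eT x), inner_shape_eq hτ h hg (isTangent_eN x),
    inner_shape_eq hτ h hg (isTangent_eN x), e1, e2, curv_eq h hg, div_eq_iff hg.ne', ← rt_sq hg]
  change S.rt x * S.coordS x (S.eN x) = _ at hq
  set N := √(inner ℝ (S.αt x) (S.αt x))
  set q := S.coordS x (S.eN x)
  have hq2 : S.rt x ^ 2 * q ^ 2 = N ^ 2 := by rw [← mul_pow, hq, neg_sq, mul_pow, hτ, one_mul]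
  field_simp
  linear_combination -(S.h11 x * S.h22 x - S.h12 x ^ 2) * hq2

theorem eigZ_eq : S.eigZ x = (inner ℝ (S.eN x) (S.shape x (S.eT x)) : ℝ) • S.eN x
    + (inner ℝ (S.eT x) (S.shape x (S.eT x)) - S.kMin x) • S.eT x := by
  rw [eigZ]
  nth_rw 1 [shape_eT hτ hg h]
  rw [sub_smul]; abel

theorem shape_eigZ (hd : 0 ≤ S.disc x) : S.shape x (S.eigZ x) = S.kMax x • S.eigZ x := by
  have h1 := kMax_mul_kMin hd
  have h2 := kMax_eq (S := S) (x := x)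
  have sT := shape_eT hτ hg h
  have sN := shape_eN hτ hg h
  rw [curv_eq_det hτ hg h] at h1
  rw [eigZ_eq hτ hg h, shape_add, shape_smul, shape_smul]
  generalize inner ℝ (S.eT x) (S.shape x (S.eT x)) = p at *
  generalize inner ℝ (S.eN x) (S.shape x (S.eT x)) = q at *
  generalize inner ℝ (S.eN x) (S.shape x (S.eN x)) = r at *
  rw [sT, sN]
  rw [h2] at h1 ⊢
  match_scalars
  · ring
  · linear_combination h1

theorem shape_rot_eigZ (hd : 0 ≤ S.disc x) :
    S.shape x (S.rot x (S.eigZ x)) = S.kMin x • S.rot x (S.eigZ x) := by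
  have h1 := kMax_mul_kMin hd
  have h2 := kMax_eq (S := S) (x := x)
  have sT := shape_eT hτ hg h
  have sN := shape_eN hτ hg h
  rw [curv_eq_det hτ hg h] at h1
  rw [eigZ_eq hτ hg h, rot_add, rot_smul, rot_smul, rot_eN hτ hg, ← eN, shape_add, smul_neg,
    ← neg_smul, shape_smul, shape_smul]
  generalize inner ℝ (S.eT x) (S.shape x (S.eT x)) = p at *
  generalize inner ℝ (S.eN x) (S.shape x (S.eT x)) = q at *
  generalize inner ℝ (S.eN x) (S.shape x (S.eN x)) = r at *
  rw [sT, sN]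
  rw [h2] at h1
  match_scalars
  · linear_combination -h1
  · ring

end algebra

end ParamSurface

/-! ### Existence of principal frames -/

namespace ParamSurface

variable {S : ParamSurface} {c d r t s : ℝ}

namespace IsRegularStrip

variable (h : S.IsRegularStrip c d)
include h

theorem eT : IsC1Near S.a c d r S.eT :=
  ((h.αt.inner h.αt).sqrt fun t s hs => (inner_αt_self_pos (h.gdet_pos t s hs)).ne').inv
    (fun t s hs => (Real.sqrt_pos.mpr (inner_αt_self_pos (h.gdet_pos t s hs))).ne') |>.smul h.αt

theorem meanCurv : IsC1Near S.a c d r S.meanCurv :=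
  ((h.eT.inner (h.shape h.eT)).add ((h.rot h.eT).inner (h.shape (h.rot h.eT)))).div
    (IsC1Near.const 2) fun _ _ _ => two_ne_zero

theorem disc : IsC1Near S.a c d r S.disc := by
  have := (h.meanCurv (r := r)).mul h.meanCurv |>.sub h.curv
  simp only [← sq] at this
  exact this

variable (h0 : ∀ t, ∀ s ∈ Icc c d, S.disc (t, s) ≠ 0)
include h0

theorem kMax : IsC1Near S.a c d r S.kMax := h.meanCurv.add (h.disc.sqrt h0)

theorem kMin : IsC1Near S.a c d r S.kMin := h.meanCurv.sub (h.disc.sqrt h0)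

theorem eigZ : IsC1Near S.a c d r S.eigZ := (h.shape h.eT).sub ((h.kMin h0).smul h.eT)

end IsRegularStrip

/-- A property that is periodic in `t` and holds near the curve `s = 0` on one period. -/
theorem exists_pos_strip {a δ : ℝ} {f : ℝ² → ℝ} (ha : 0 < a) (hδ : 0 < δ)
    (hf : ∀ t, ∀ s ∈ Ioo (-δ) δ, ContinuousAt f (t, s)) (hp : ∀ t s, f (t + a, s) = f (t, s))
    (h0 : ∀ t, 0 < f (t, 0)) :
    ∃ s₁, 0 < s₁ ∧ s₁ < δ ∧ ∀ t, ∀ s ∈ Icc (-s₁) s₁, 0 < f (t, s) := by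
  obtain ⟨s₁, k, h1, h2, h3, h4⟩ := exists_lower_bound (a := a) hδ hf h0
  refine ⟨s₁, h1, h2, fun t s hs => ?_⟩
  obtain ⟨t', ht', he⟩ :=
    (show Function.Periodic (fun t => f (t, s)) a from fun t => hp t s).exists_mem_Ico₀ ha t
  rw [he]
  exact h3.trans_le (h4 t' (Ico_subset_Icc_self ht') s hs)

namespace IsMixedType

variable (hS : S.IsMixedType)
include hS

/-- On the curve `s = 0` the shape operator is nonzero, positive semidefinite and singular. -/
theorem degenerate_facts (t : ℝ) : 0 < S.disc (t, 0) ∧ S.kMin (t, 0) = 0 ∧ 0 < S.kMax (t, 0) ∧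
    0 < inner ℝ (S.eT (t, 0)) (S.shape (t, 0) (S.eT (t, 0))) := by
  have hm : (0 : ℝ) ∈ Icc (-S.b₀) S.b₁ := ⟨by linarith [hS.b₀_pos], hS.b₁_pos.le⟩
  have hR := hS.isRegularStrip
  have hg := hR.gdet_pos t 0 hm
  have hA : 0 < inner ℝ (S.eT (t, 0)) (S.shape (t, 0) (S.eT (t, 0))) := by
    rw [inner_shape_eq hR.τ_sq hS.smooth hg (isTangent_eT _), eT, coordS_smul, coordS_αt,
      coordT_smul, coordT_αt hg]
    have h1 := hS.h11_pos t hm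
    have h2 := Real.sqrt_pos.mpr (inner_αt_self_pos hg)
    have h3 := inv_pos.mpr h2
    simp only [mul_zero, zero_mul, add_zero, mul_one]
    positivity
  have hc := curv_eq_det hR.τ_sq hg hS.smooth
  rw [hS.curv_zero t] at hc
  have hD : 0 ≤ inner ℝ (S.eN (t, 0)) (S.shape (t, 0) (S.eN (t, 0))) := by
    refine nonneg_of_mul_nonneg_right (a := inner ℝ (S.eT (t, 0)) (S.shape (t, 0) (S.eT (t, 0)))) ?_ hA
    nlinarith [sq_nonneg (inner ℝ (S.eN (t, 0)) (S.shape (t, 0) (S.eT (t, 0))) : ℝ)]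
  have hH : 0 < S.meanCurv (t, 0) := by rw [meanCurv]; linarith
  have hd : S.disc (t, 0) = S.meanCurv (t, 0) ^ 2 := by rw [disc, hS.curv_zero]; ring
  have hq : √(S.disc (t, 0)) = S.meanCurv (t, 0) := by rw [hd, Real.sqrt_sq hH.le]
  refine ⟨by rw [hd]; positivity, by rw [kMin, hq, sub_self], by rw [kMax, hq]; linarith, hA⟩

/-- Principal frames exist near the curve `s = 0`. -/
theorem exists_isPrincipalFrame : ∃ (δ : ℝ) (X₁ X₂ : ℝ² → E3) (lam₁ lam₂ : ℝ² → ℝ),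
    S.IsPrincipalFrame δ X₁ X₂ lam₁ lam₂ := by
  have hR := hS.isRegularStrip
  have hτ := hR.τ_sq
  have hα := hS.smooth
  have hδ₀ : 0 < min S.b₀ S.b₁ := lt_min hS.b₀_pos hS.b₁_pos
  have sub₀ {s : ℝ} (hs : s ∈ Ioo (-min S.b₀ S.b₁) (min S.b₀ S.b₁)) : s ∈ Icc (-S.b₀) S.b₁ :=
    ⟨by linarith [hs.1, min_le_left S.b₀ S.b₁], by linarith [hs.2, min_le_right S.b₀ S.b₁]⟩
  obtain ⟨δ₁, δ₁pos, δ₁lt, hdisc⟩ := exists_pos_strip hS.a_pos hδ₀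
    (fun t s hs => ((hR.disc (r := 0)).contDiffAt t s (sub₀ hs)).continuousAt)
    (fun t s => (hR.disc (r := s - 1)).periodic t s (by linarith))
    (fun t => (hS.degenerate_facts t).1)
  have hR₁ : S.IsRegularStrip (-δ₁) δ₁ := hR.mono (by linarith [min_le_left S.b₀ S.b₁])
    (by linarith [min_le_right S.b₀ S.b₁])
  have hne (t) (s) (hs : s ∈ Icc (-δ₁) δ₁) : S.disc (t, s) ≠ 0 := (hdisc t s hs).ne'
  -- the derivative of the smaller principal curvature along a multiple of `X₂`
  have hZ (r) := hR₁.rot ((hR₁.eigZ hne (r := r)))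
  have h00 : (0 : ℝ) ∈ Icc (-δ₁) δ₁ := ⟨by linarith, δ₁pos.le⟩
  obtain ⟨δ, δpos, δlt, hpos⟩ := exists_pos_strip (f := fun x => S.kMax x
      ⊓ (inner ℝ (S.eT x) (S.shape x (S.eT x)) - S.kMin x)
      ⊓ (-S.τ * S.dirDeriv S.kMin x (S.rot x (S.eigZ x)))) hS.a_pos δ₁pos
    (fun t s hs => by
      have hs' := Ioo_subset_Icc_self hs
      have hk := (hR₁.kMin hne (r := 0)).contDiffAt t s hs'
      have h1 := contDiffAt_dT (m := 0) hk (by simp)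
      have h2 := contDiffAt_dS (m := 0) hk (by simp)
      exact (((hR₁.kMax hne (r := 0)).contDiffAt t s hs').continuousAt.min
        (((hR₁.eT.inner (hR₁.shape hR₁.eT)).sub (hR₁.kMin hne (r := 0))).contDiffAt t s
          hs').continuousAt).min (continuousAt_const.mul
          ((((hR₁.coordT (hZ 0)).contDiffAt t s hs').continuousAt.smul h1.continuousAt).add
          (((hR₁.coordS (hZ 0)).contDiffAt t s hs').continuousAt.smul h2.continuousAt))))
    (fun t s => by
      have hr : s - 1 < s := by linarith
      have hk := hR₁.kMin hne (r := s - 1)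
      simp only [dirDeriv, (hR₁.kMax hne (r := s - 1)).periodic t s hr, hk.periodic t s hr,
        (hR₁.eT.inner (hR₁.shape hR₁.eT) (r := s - 1)).periodic t s hr, hk.dT_periodic t hr,
        hk.dS_periodic t hr, (hR₁.coordT (hZ (s - 1))).periodic t s hr,
        (hR₁.coordS (hZ (s - 1))).periodic t s hr])
    (fun t => by
      obtain ⟨-, k0, k1, k2⟩ := hS.degenerate_facts t
      obtain ⟨c1, c2⟩ := hS.dS_curv_pos t
      have hg := hR₁.gdet_pos t 0 h00
      have hd := (hR₁.kMin hne (r := 0)).differentiableAt h00 (t := t)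
      have hT : dT S.kMin (t, 0) = 0 := by
        have := hasDerivAt_dT hd
        simp only [fun t => (hS.degenerate_facts t).2.1] at this
        exact this.unique (hasDerivAt_const _ _)
      have hprod : S.curv =ᶠ[𝓝 (t, 0)] fun y => S.kMax y * S.kMin y := by
        filter_upwards [eventually_snd_mem (t := t) (⟨by linarith, δ₁pos⟩ : (0 : ℝ) ∈ Ioo (-δ₁) δ₁)]
          with y hy using (kMax_mul_kMin (hdisc y.1 y.2 (Ioo_subset_Icc_self hy)).le).symm
      rw [hprod.dS_eq, dS_mul ((hR₁.kMax hne (r := 0)).differentiableAt h00) hd, k0, zero_mul,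
        add_zero] at c2
      have hdS : 0 < dS S.kMin (t, 0) := pos_of_mul_pos_right c2 k1.le
      refine lt_min (lt_min k1 (by rwa [k0, sub_zero])) ?_
      have hr := rt_pos hg
      have hN := Real.sqrt_pos.mpr (inner_αt_self_pos hg)
      have hc := coordS_rot hg (S.eigZ (t, 0))
      rw [eigZ_eq hτ hg hα, k0, sub_zero, inner_add_left, real_inner_smul_left,
        real_inner_smul_left] at hc
      have e1 : inner ℝ (S.eN (t, 0)) (S.αt (t, 0)) = (0 : ℝ) := by
        have := inner_rot_self hg (S.eT (t, 0))
        nth_rw 2 [eT] at this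
        rw [real_inner_smul_right] at this
        exact (mul_eq_zero.mp this).resolve_left (inv_pos.mpr hN).ne'
      have e2 : 0 < inner ℝ (S.eT (t, 0)) (S.αt (t, 0)) := by
        have := inner_αt_self_pos hg
        rw [eT, real_inner_smul_left]; positivity
      rw [e1, mul_zero, zero_add] at hc
      rw [dirDeriv, hT, smul_zero, zero_add, smul_eq_mul]
      refine pos_of_mul_pos_right (a := S.rt (t, 0)) ?_ hr.le
      have : S.rt (t, 0) * (-S.τ * (S.coordS (t, 0) (S.rot (t, 0) (S.eigZ (t, 0)))
          * dS S.kMin (t, 0))) = inner ℝ (S.eT (t, 0)) (S.shape (t, 0) (S.eT (t, 0)))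
          * inner ℝ (S.eT (t, 0)) (S.αt (t, 0)) * dS S.kMin (t, 0) := by
        rw [eigZ_eq hτ hg hα, k0, sub_zero]
        linear_combination (-S.τ * dS S.kMin (t, 0)) * hc
          + inner ℝ (S.eT (t, 0)) (S.shape (t, 0) (S.eT (t, 0)))
          * inner ℝ (S.eT (t, 0)) (S.αt (t, 0)) * dS S.kMin (t, 0) * hτ
      rw [this]
      positivity)
  simp only [lt_min_iff] at hpos
  have hR₂ : S.IsRegularStrip (-δ) δ := hR₁.mono (by linarith) δlt.le
  have hd₂ (t) (s) (hs : s ∈ Icc (-δ) δ) := hdisc t s ⟨by linarith [hs.1], by linarith [hs.2]⟩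
  have hne₂ (t) (s) (hs : s ∈ Icc (-δ) δ) : S.disc (t, s) ≠ 0 := (hd₂ t s hs).ne'
  have tanZ {t s} (hs : s ∈ Icc (-δ) δ) : S.IsTangent (t, s) (S.eigZ (t, s)) :=
    (isTangent_shape hτ hα (hR₂.gdet_pos t s hs) _).sub ((isTangent_eT _).smul _)
  have hZZ (t) (s) (hs : s ∈ Icc (-δ) δ) : 0 < inner ℝ (S.eigZ (t, s)) (S.eigZ (t, s)) := by
    have hg := hR₂.gdet_pos t s hs
    rw [real_inner_self_eq_norm_sq]
    refine pow_pos (norm_pos_iff.mpr fun h0 => (hpos t s hs).1.2.ne' ?_) 2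
    have h1 : inner ℝ (S.eigZ (t, s)) (S.eT (t, s)) = (0 : ℝ) := by rw [h0, inner_zero_left]
    rwa [eigZ_eq hτ hg hα, inner_add_left, real_inner_smul_left, real_inner_smul_left, inner_eT hg,
      show inner ℝ (S.eN (t, s)) (S.eT (t, s)) = (0 : ℝ) from inner_rot_self hg _, mul_zero,
      zero_add, mul_one] at h1
  set k : ℝ² → ℝ := fun x => S.τ * (√(inner ℝ (S.eigZ x) (S.eigZ x)))⁻¹ with hk
  have kC : IsC1Near S.a (-δ) δ (-δ - 1) k := (IsC1Near.const S.τ).mul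
    ((((hR₂.eigZ hne₂).inner (hR₂.eigZ hne₂)).sqrt fun t s hs => (hZZ t s hs).ne').inv
      fun t s hs => (Real.sqrt_pos.mpr (hZZ t s hs)).ne')
  have x1C := kC.smul (hR₂.eigZ hne₂)
  have x2C := (kC.neg).smul (hR₂.rot (hR₂.eigZ hne₂))
  have k2 (t s) (hs : s ∈ Icc (-δ) δ) :
      k (t, s) * (k (t, s) * inner ℝ (S.eigZ (t, s)) (S.eigZ (t, s))) = 1 := by
    have h1 := Real.sq_sqrt (hZZ t s hs).le
    have h2 := (Real.sqrt_pos.mpr (hZZ t s hs)).ne'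
    simp only [hk]
    field_simp
    rw [hτ, h1, one_mul]
  have cd {f : ℝ² → E3} (hf : IsC1Near S.a (-δ) δ (-δ - 1) f) :
      ContDiffOn ℝ 1 f (univ ×ˢ Ioo (-δ) δ) := fun x hx =>
    (hf.contDiffAt x.1 x.2 (Ioo_subset_Icc_self hx.2)).contDiffWithinAt
  have i {s} (hs : s ∈ Ioo (-δ) δ) : s ∈ Icc (-δ) δ := Ioo_subset_Icc_self hs
  have cur (t) {s} (hs : s ∈ Ioo (-δ) δ) := kMax_mul_kMin (S := S) (hd₂ t s (i hs)).le
  have nrm {v : E3} (hv : inner ℝ v v = (1 : ℝ)) : ‖v‖ = 1 := by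
    rw [real_inner_self_eq_norm_sq] at hv
    exact (pow_eq_one_iff_of_nonneg (norm_nonneg _) two_ne_zero).mp hv
  refine ⟨δ, fun x => k x • S.eigZ x, fun x => -k x • S.rot x (S.eigZ x), S.kMax, S.kMin, δpos,
    by linarith [min_le_left S.b₀ S.b₁], by linarith [min_le_right S.b₀ S.b₁], cd x1C, cd x2C,
    fun t s hs => x1C.periodic t s (by linarith [hs.1]),
    fun t s hs => x2C.periodic t s (by linarith [hs.1]),
    fun t s hs => (tanZ (i hs)).smul _, fun t s hs => (isTangent_rot _ _).smul _,
    fun t s hs => nrm ?_, fun t s hs => nrm ?_, fun t s hs => ?_, fun t s hs => ?_,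
    fun t s hs => ?_, fun t s hs => (hpos t s (i hs)).1.1, fun t s hs => ?_,
    fun t => (hS.degenerate_facts t).2.1, fun t s hs => ?_, fun t s hs => ?_, fun t s hs => ?_,
    fun t s hs => ?_⟩
  · rw [real_inner_smul_left, real_inner_smul_right, k2 t s (i hs)]
  · rw [real_inner_smul_left, real_inner_smul_right,
      inner_rot_rot hτ (hR₂.gdet_pos t s (i hs)) (tanZ (i hs)), neg_mul, neg_mul, mul_neg, neg_neg,
      k2 t s (i hs)]
  · rw [real_inner_smul_left, real_inner_smul_right, real_inner_comm,
      inner_rot_self (hR₂.gdet_pos t s (i hs)), mul_zero, mul_zero]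
  · rw [shape_smul, shape_eigZ hτ (hR₂.gdet_pos t s (i hs)) hα (hd₂ t s (i hs)).le, smul_comm]
  · rw [shape_smul, shape_rot_eigZ hτ (hR₂.gdet_pos t s (i hs)) hα (hd₂ t s (i hs)).le, smul_comm]
  · have hs' : s ∈ Ioo (-δ) δ := ⟨by linarith [hs.1], hs.2⟩
    have := hS.curv_pos t s ⟨hs.1, by linarith [hs.2, min_le_right S.b₀ S.b₁]⟩
    rw [← cur t hs'] at this
    exact pos_of_mul_pos_right this (hpos t s (i hs')).1.1.le
  · have hs' : s ∈ Ioo (-δ) δ := ⟨hs.1, by linarith [hs.2]⟩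
    have := hS.curv_neg t s ⟨by linarith [hs.1, min_le_left S.b₀ S.b₁], hs.2⟩
    rw [← cur t hs'] at this
    exact neg_of_mul_neg_right this (hpos t s (i hs')).1.1.le
  · have h1 := (hpos t s (i hs)).2
    have h2 := inv_pos.mpr (Real.sqrt_pos.mpr (hZZ t s (i hs)))
    have h3 : S.dirDeriv S.kMin (t, s) (-k (t, s) • S.rot (t, s) (S.eigZ (t, s)))
        = (√(inner ℝ (S.eigZ (t, s)) (S.eigZ (t, s))))⁻¹
          * (-S.τ * S.dirDeriv S.kMin (t, s) (S.rot (t, s) (S.eigZ (t, s)))) := by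
      simp only [dirDeriv, coordT_smul, coordS_smul, smul_eq_mul, hk]; ring
    rw [h3]
    exact mul_pos h2 h1
  · rw [rot_smul, rot_rot hτ (hR₂.gdet_pos t s (i hs)) (tanZ (i hs)), neg_smul_neg]
  · rw [rot_smul, neg_smul, neg_neg]

end IsMixedType

end ParamSurface

end

/-! ### Choice of the parameters -/

theorem theorem2p1 (S : ParamSurface) (hS : S.IsMixedType) :
    -- principal frames near the curve of zero curvature exist
    (∃ (δ : ℝ) (X₁ X₂ : ℝ × ℝ → E3) (lam₁ lam₂ : ℝ × ℝ → ℝ),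
      S.IsPrincipalFrame δ X₁ X₂ lam₁ lam₂) ∧
    ∀ (δ : ℝ) (X₁ X₂ : ℝ × ℝ → E3) (lam₁ lam₂ : ℝ × ℝ → ℝ),
      S.IsPrincipalFrame δ X₁ X₂ lam₁ lam₂ →
    ∀ K : ℝ, ∃ γ₀ > 0, ∀ γ ≥ γ₀, ∃ ε₀ > 0, 2 * ε₀ ≤ δ ∧
    ∀ ε, 0 < ε → ε < ε₀ →
    ∀ (σ₀ : ℝ) (ζ η₀ : ℝ → ℝ), S.IsAdmissibleσ ε X₁ σ₀ → ParamSurface.IsCutoffζ ε ζ →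
      S.IsCutoffη ε η₀ →
    ∀ X : ℝ × ℝ → E3, X = S.fieldX ε σ₀ ζ X₁ X₂ →
    ∀ Y : ℝ × ℝ → E3, S.IsC0Field ε Y → (∀ t, ∀ s ∈ Set.Icc (-ε) S.b₁, ‖Y (t, s)‖ ≤ K) →
    ∃ m₀ > 0, ∀ m ≥ m₀,
    ∀ η : ℝ × ℝ → ℝ, (η = fun x => m * η₀ x.2) →
    ∃ C : ℝ, ∀ (F : ℝ × ℝ → E3) (p q : ℝ → ℝ),
      S.MemL2T ε F → MemLp p 2 (S.arc S.b₁) → MemLp q 2 (S.arc (-ε)) →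
      ∃ (V : ℝ × ℝ → E3) (Zb Zt : ℝ → E3),
        -- `V`, with boundary values `Zb` and `Zt`, solves the boundary value problem
        S.Solves ε γ η X Y F p q V Zb Zt ∧
        S.MemCompletion ε X V (fun t => inner ℝ (Zb t) (S.rot (t, -ε) (X (t, -ε))))
          (fun t => inner ℝ (Zt t) (S.νTop t)) ∧
        -- it satisfies the weak identity
        S.WeaklySolves ε γ η X Y F p q V ∧
        -- it is bounded by the data, together with its boundary values
        (∫ x, ‖V x‖ ^ 2 ∂S.area ε + ∫ t, ‖Zb t‖ ^ 2 ∂S.arc (-ε) + ∫ t, ‖Zt t‖ ^ 2 ∂S.arc S.b₁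
          ≤ C * (∫ x, ‖F x‖ ^ 2 ∂S.area ε + ∫ t, q t ^ 2 ∂S.arc (-ε)
              + ∫ t, p t ^ 2 ∂S.arc S.b₁)) ∧
        -- it is unique, as a solution with boundary values and even as a weak solution
        (∀ V' Zb' Zt', S.Solves ε γ η X Y F p q V' Zb' Zt' →
          V' =ᵐ[S.area ε] V ∧ Zb' =ᵐ[S.arc (-ε)] Zb ∧ Zt' =ᵐ[S.arc S.b₁] Zt) ∧
        (∀ V', S.WeaklySolves ε γ η X Y F p q V' → V' =ᵐ[S.area ε] V) := by
  refine ⟨hS.exists_isPrincipalFrame, fun δ X₁ X₂ lam₁ lam₂ hF K => ?_⟩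
  obtain ⟨s₁, N, c, s₁pos, s₁lt, hN, cpos, hb⟩ := hF.exists_frameBounds hS
  obtain ⟨M, hM⟩ : ∃ M, M = N * (1 + |K|) := ⟨_, rfl⟩
  have hNM : N ≤ M := by rw [hM]; nlinarith [abs_nonneg K]
  have Mpos : 0 < M := by linarith
  refine ⟨2 / c * (3 / 2 * M + 49 / 4 * M ^ 2 / c + c / 4), by positivity, fun γ hγ => ?_⟩
  have γ0 : 0 ≤ γ := (by positivity : 0 ≤ 2 / c * (3 / 2 * M + 49 / 4 * M ^ 2 / c + c / 4)).trans hγ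
  have hγM : 3 / 2 * M + 49 / 4 * M ^ 2 / c + c / 4 ≤ γ * c / 2 := by
    have := mul_le_mul_of_nonneg_right hγ cpos.le
    have e : 2 / c * (3 / 2 * M + 49 / 4 * M ^ 2 / c + c / 4) * c
        = 2 * (3 / 2 * M + 49 / 4 * M ^ 2 / c + c / 4) := by field_simp
    linarith
  have Dpos : 0 < 64 * M ^ 2 * (1 + γ) := by positivity
  -- `ε₀` is chosen such that `ε^{1/3}` is smaller than `e₀`
  obtain ⟨e₀, he₀⟩ : ∃ e₀, e₀ = min 1 (c / (64 * M ^ 2 * (1 + γ))) := ⟨_, rfl⟩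
  have e₀pos : 0 < e₀ := by rw [he₀]; exact lt_min one_pos (by positivity)
  refine ⟨min (e₀ ^ 3) (s₁ / 2), lt_min (by positivity) (by positivity),
    by linarith [min_le_right (e₀ ^ 3) (s₁ / 2)], fun ε hε hε₀ σ₀ ζ η₀ _ hζ hη₀ X hX Y hY hYK => ?_⟩
  obtain ⟨h1, h2⟩ := lt_min_iff.mp hε₀
  have he : ε ^ (1 / 3 : ℝ) < e₀ := by
    have := Real.rpow_lt_rpow hε.le h1 (by norm_num : (0 : ℝ) < 1 / 3)
    rwa [← Real.rpow_natCast, ← Real.rpow_mul e₀pos.le,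
      show ((3 : ℕ) : ℝ) * (1 / 3) = 1 by norm_num, Real.rpow_one] at this
  have he1 : ε ^ (1 / 3 : ℝ) ≤ 1 := he.le.trans (he₀ ▸ min_le_left _ _)
  have heM : ε ^ (1 / 3 : ℝ) * (64 * M ^ 2 * (1 + γ)) < c :=
    (lt_div_iff₀ Dpos).mp (he.trans_le (he₀ ▸ min_le_right _ _))
  have heN : ε ^ (1 / 3 : ℝ) * N < c := by
    refine (mul_le_mul_of_nonneg_left ?_ (Real.rpow_nonneg hε.le _)).trans_lt heM
    have h3 : M ≤ M ^ 2 := by nlinarith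
    have h4 : 0 ≤ M ^ 2 * γ := by positivity
    nlinarith
  have hmul := hF.isMultiplier_fieldX (σ₀ := σ₀) hS s₁lt cpos hb hε (by linarith) heN hζ
  obtain ⟨m₀, m₀pos, hm₀⟩ := hF.exists_isAccretive hS s₁lt cpos hN hb γ0 hM hγM hε (by linarith)
    he1 heM.le hζ hη₀ hmul hY hYK
  refine ⟨m₀, m₀pos, fun m hm η hη => ?_⟩
  obtain ⟨c₀, hc₀⟩ := hm₀ m hm
  subst hX hη
  exact hmul.wellPosed (continuous_const.mul (hη₀.smooth.continuous.comp continuous_snd)) hY.1 hc₀
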